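/- **Theorem (no escape on the pair-of-pants).** *Completion.* Let $\hat W$ be the completion of a Liouville domain $W$ with boundary $(M,\alpha)=(\partial W,\lambda|_{\partial W})$: an exact symplectic manifold $(\hat W,d\lambda)$ containing $M\times\mathbb R^+$ (via the Liouville flow) as an open subset on which $\lambda=r\alpha$, with $W=\hat W\setminus (M\times(1,\infty))$ compact. Write $\xi=\ker\alpha$. Hamiltonian vector fields are defined by $d\lambda(X_H,\cdot)=dH$; an almost complex structure $J$ is $d\lambda$-compatible if $d\lambda(\cdot,J\cdot)$ is a $J$-invariant Riemannian metric. For smooth $q:M\to\mathbb R^+$ put $Q(y,r)=r\,q(y)$ and, for $v\in\xi_y$, $\zeta_Q(v)^r=v-\frac{r\,dq(v)}{q(y)}\partial_r$. $J$ is of *twisted SFT-type* on $M\times[T,\infty)$ if, there, for some such $q$ and some $d\alpha$-compatible complex structure $j_\xi$ on $\xi$, $JX_Q=r\partial_r$ and $J\zeta_Q(v)^r=\zeta_Q(j_\xi v)^r$. *Floer data* are smooth families $(H_t,J_t)_{t\in\mathbb S^1}$, $\mathbb S^1=\mathbb R/\mathbb Z$, of Hamiltonians and $d\lambda$-compatible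 almost complex structures on $\hat W$ such that, for large $r$, $H_t(y,r)=r\,h_t(y)+C$ and $J_t$ is of twisted SFT-type, and such that the slope $h_t$ is admissible: the time-one map of the Hamiltonian $r\,h_t$ on $M\times\mathbb R^+$ has no fixed points. (No transversality is needed.) *Pair-of-pants with a slit.* Let $(P,j)$ be the sphere minus three points $a_1,a_2,b$, let $S\subset P$ be a union of two intersecting curves, and let $\psi_1,\psi_2:\mathbb R\times(0,1)\to P\setminus S$ be the two components of a biholomorphism $\mathbb R\times(0,1)\sqcup\mathbb R\times(0,1)\to P\setminus S$, where $\psi_i(s,t)\to a_i$ as $s\to-\infty$ and $\psi_i(s,t)\to b$ as $s\to+\infty$. Let $\iota_{a_1},\iota_{a_2}:(-\infty,0]\times\mathbb S^1\to P$ and $\iota_b:[0,\infty)\times\mathbb S^1\to P$ be holomorphic embeddings such that, for some $s_a,s_b>0$ and all $t\in(0,1)$, $\iota_{a_i}(s,t)=\psi_i(s-s_a,t)$ for $s\le 0$, and $\iota_b(\frac s2,\frac t2)=\psi_1(s+s_b,t)$, $\iota_b(\frac s2,\frac{t+1}2)=\psi_2(s+s_b,t)$ for $s\ge0$. Fix $\delta\in(0,\frac12)$,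 put $\Omega=P\setminus\bigcup_i\psi_i(\mathbb R\times[\delta,1-\delta])$, and let $\beta$ be a smooth $1$-form on $P$ with $\psi_i^*\beta=dt$ on $\mathbb R\times[\delta,1-\delta]$, $i=1,2$. *Product data.* Let $(H^{a_1},J^{a_1}),(H^{a_2},J^{a_2}),(H^b,J^b)$ be Floer data such that $H^{a_i}_t$ is constant for $t\in[-\delta,\delta]$ and $H^b_t$ is constant for $t\in[-\frac\delta2,\frac\delta2]$ and for $t\in[\frac{1-\delta}2,\frac{1+\delta}2]$. Product data for this triple are a smooth function $H:\hat W\times P\to\mathbb R$ and a smooth $P$-family $J_p$ of $d\lambda$-compatible almost complex structures such that: 1. $H(x,\iota_{a_i}(s,t))=H^{a_i}_t(x)$ and $J_{\iota_{a_i}(s,t)}=J^{a_i}_t$ for $s\le-1$; $H(x,\iota_b(s,t))=\frac12H^b_t(x)$ and $J_{\iota_b(s,t)}=J^b_t$ for $s\ge1$ (in the coordinates $\iota_b$ one has $\beta=2\,dt$ where $\beta$ is prescribed, so there $H\beta=H^b_t\,dt$); 2. there are $T>0$ and a smooth $h:M\times P\to\mathbb R$ with $H_p(y,r)=r\,h(y,p)$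 for $r\ge T$; 3. there is $T>0$ such that every $J_p$ is of twisted SFT-type on $M\times[T,\infty)$; 4. $h(\cdot,p)=0$ for $p\in\Omega$; 5. $s\mapsto h(y,\psi_i(s,t))$ is nondecreasing for all $y\in M$, $t\in(0,1)$, $i=1,2$. *Claim.* Let $(H,J)$ be product data and let $E>0$. There is a compact set $K=K_{H,J,E}\subset\hat W$ such that $u(P)\subset K$ for every smooth $u:P\to\hat W$ with $$(du-X_H(u)\otimes\beta)^{0,1}=0\quad\text{and}\quad \tfrac12\int_P|du-X_{H_p}(u)\otimes\beta|_{J}^2\,d\mathrm{vol}_P<E,$$ where $A^{0,1}=\frac12(A+J\circ A\circ j)$ and $|v|_J^2=d\lambda(v,Jv)$. -/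

import Mathlib

open Set Filter Topology MeasureTheory Bundle
open scoped Manifold ContDiff ENNReal

noncomputable section

namespace PantsFloer

/-! ### Differential forms of degree one on a manifold without boundary -/

section Forms

variable {E : Type*} [NormedAddCommGroup E] [NormedSpace ℝ E]
  {X : Type*} [TopologicalSpace X] [ChartedSpace E X]

/-- A (not necessarily smooth) differential `1`-form on `X`. -/
abbrev OneForm (E : Type*) [NormedAddCommGroup E] [NormedSpace ℝ E]
    (X : Type*) [TopologicalSpace X] [ChartedSpace E X] :=
  ∀ x : X, TangentSpace 𝓘(ℝ, E) x →L[ℝ] ℝ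

/-- A field of endomorphisms of the tangent bundle of `X`. -/
abbrev EndField (E : Type*) [NormedAddCommGroup E] [NormedSpace ℝ E]
    (X : Type*) [TopologicalSpace X] [ChartedSpace E X] :=
  ∀ x : X, TangentSpace 𝓘(ℝ, E) x →L[ℝ] TangentSpace 𝓘(ℝ, E) x

/-- A `1`-form is smooth if it is a smooth section of the cotangent bundle. -/
def SmoothForm [IsManifold 𝓘(ℝ, E) ∞ X] (η : OneForm E X) : Prop :=
  ContMDiff 𝓘(ℝ, E) (𝓘(ℝ, E).prod 𝓘(ℝ, E →L[ℝ] ℝ)) ∞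
    (fun x ↦ TotalSpace.mk' (E →L[ℝ] ℝ) (E := fun x : X ↦ TangentSpace 𝓘(ℝ, E) x →L[ℝ] ℝ)
      x (η x))

/-- A family of endomorphism fields `J_k`, with `k` in an open subset `U` of a normed space, is
smooth if it is smooth jointly in the parameter and in the point of `X`. -/
def SmoothFamily [IsManifold 𝓘(ℝ, E) ∞ X] {K : Type*} [NormedAddCommGroup K] [NormedSpace ℝ K]
    (J : K → EndField E X) (U : Set K) : Prop :=
  ContMDiffOn (𝓘(ℝ, K).prod 𝓘(ℝ, E)) (𝓘(ℝ, E).prod 𝓘(ℝ, E →L[ℝ] E)) ∞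
    (fun z : K × X ↦ TotalSpace.mk' (E →L[ℝ] E)
      (E := fun x : X ↦ TangentSpace 𝓘(ℝ, E) x →L[ℝ] TangentSpace 𝓘(ℝ, E) x) z.2 (J z.1 z.2))
    (U ×ˢ univ)

/-- The `1`-form `η` read in the preferred chart at `x₀`. -/
def chartForm (η : OneForm E X) (x₀ : X) (e : E) : E →L[ℝ] ℝ :=
  (η ((extChartAt 𝓘(ℝ, E) x₀).symm e)).comp
    (mfderiv 𝓘(ℝ, E) 𝓘(ℝ, E) (extChartAt 𝓘(ℝ, E) x₀).symm e)

/-- The exterior derivative `dη`, computed in the preferred chart at `x`: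
`dη (v, w) = D_v η (w) - D_w η (v)`. -/
def dForm (η : OneForm E X) (x : X) (v w : TangentSpace 𝓘(ℝ, E) x) : ℝ :=
  let φ := extChartAt 𝓘(ℝ, E) x
  let D : E →L[ℝ] E →L[ℝ] ℝ := fderiv ℝ (chartForm η x) (φ x)
  let v' : E := mfderiv 𝓘(ℝ, E) 𝓘(ℝ, E) φ x v
  let w' : E := mfderiv 𝓘(ℝ, E) 𝓘(ℝ, E) φ x w
  D v' w' - D w' v'

/-- The differential of a real function, as a real-valued `1`-form. -/
def dFun (f : X → ℝ) (x : X) (v : TangentSpace 𝓘(ℝ, E) x) : ℝ :=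
  mfderiv 𝓘(ℝ, E) 𝓘(ℝ, ℝ) f x v

end Forms

/-! ### Contact forms, the symplectization, and twisted SFT-type almost complex structures -/

section Contact

variable {F : Type*} [NormedAddCommGroup F] [NormedSpace ℝ F]
  {M : Type*} [TopologicalSpace M] [ChartedSpace F M]

/-- `α` is a contact form: `dα` is nondegenerate on the hyperplane field `ξ = ker α`. -/
structure IsContactForm [IsManifold 𝓘(ℝ, F) ∞ M] (α : OneForm F M) : Prop where
  smooth : SmoothForm α
  ne_zero : ∀ y, α y ≠ 0
  nondegenerate : ∀ y (v : TangentSpace 𝓘(ℝ, F) y), α y v = 0 → v ≠ 0 →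
    ∃ w : TangentSpace 𝓘(ℝ, F) y, α y w = 0 ∧ dForm α y v w ≠ 0

/-- The symplectic form `d(rα) = dr ∧ α + r dα` of the symplectization `M × ℝ⁺` at `(y, r)`,
on tangent vectors `(v, a)` standing for `v + a ∂_r`. -/
def sympForm (α : OneForm F M) (y : M) (r : ℝ) (X Y : TangentSpace 𝓘(ℝ, F) y × ℝ) : ℝ :=
  X.2 * α y Y.1 - Y.2 * α y X.1 + r * dForm α y X.1 Y.1

/-- `X` is the value at `(y, r)` of the Hamiltonian vector field, with respect to `d(rα)`, of the
homogeneous Hamiltonian `(y, r) ↦ r · f y`; the convention is `ω(X_H, ·) = dH`. -/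
def IsLiftedHamVec (α : OneForm F M) (f : M → ℝ) (y : M) (r : ℝ)
    (X : TangentSpace 𝓘(ℝ, F) y × ℝ) : Prop :=
  ∀ Y : TangentSpace 𝓘(ℝ, F) y × ℝ, sympForm α y r X Y = Y.2 * f y + r * dFun f y Y.1

/-- A `1`-periodic contact Hamiltonian `h_t` is admissible if the Hamiltonian `r · h_t` on the
symplectization has no `1`-periodic orbit, i.e. its time-one map has no fixed point. -/
def Admissible (α : OneForm F M) (h : ℝ → M → ℝ) : Prop :=
  ¬ ∃ (y : ℝ → M) (r : ℝ → ℝ),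
    MDifferentiable 𝓘(ℝ, ℝ) 𝓘(ℝ, F) y ∧ Differentiable ℝ r ∧ (∀ t, 0 < r t) ∧
    (∀ t, y (t + 1) = y t) ∧ (∀ t, r (t + 1) = r t) ∧
    ∀ t, IsLiftedHamVec α (h t) (y t) (r t)
      (mfderiv 𝓘(ℝ, ℝ) 𝓘(ℝ, F) y t (1 : ℝ), deriv r t)

/-- `j` restricts to a `dα`-compatible complex structure on `ξ = ker α`
(its values outside `ξ` play no role). -/
structure IsCompatibleOnXi (α : OneForm F M) (j : EndField F M) : Prop where
  maps : ∀ y v, α y v = 0 → α y (j y v) = 0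
  sq : ∀ y v, α y v = 0 → j y (j y v) = -v
  pos : ∀ y v, α y v = 0 → v ≠ 0 → 0 < dForm α y v (j y v)
  inv : ∀ y v w, α y v = 0 → α y w = 0 → dForm α y (j y v) (j y w) = dForm α y v w

/-- The lift `ζ_Q(v)^r = v - (r dq(v) / q) ∂_r` of `v ∈ ξ_y`, where `Q(y, r) = r · q y`. -/
def zetaLift (q : M → ℝ) (y : M) (r : ℝ) (v : TangentSpace 𝓘(ℝ, F) y) :
    TangentSpace 𝓘(ℝ, F) y × ℝ :=
  (v, -(r * dFun q y v / q y))

/-- The almost complex structure `J` on the symplectization is of twisted SFT-type on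
`M × [T, ∞)`, for some smooth positive twist `q`. -/
def IsTwistedSFT (α : OneForm F M) (T : ℝ)
    (J : ∀ (y : M), ℝ → TangentSpace 𝓘(ℝ, F) y × ℝ → TangentSpace 𝓘(ℝ, F) y × ℝ) : Prop :=
  ∃ (q : M → ℝ) (j : EndField F M),
    ContMDiff 𝓘(ℝ, F) 𝓘(ℝ, ℝ) ∞ q ∧ (∀ y, 0 < q y) ∧ IsCompatibleOnXi α j ∧
    ∀ (y : M) (r : ℝ), T ≤ r →
      (∀ X, IsLiftedHamVec α q y r X → J y r X = (0, r)) ∧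
      (∀ v : TangentSpace 𝓘(ℝ, F) y, α y v = 0 →
        J y r (zetaLift q y r v) = zetaLift q y r (j y v))

end Contact

/-! ### Completions of Liouville domains -/

/-- The completion `X = Ŵ` of a Liouville domain `W` with contact boundary `(M, α)`: an exact
symplectic manifold `(X, dλ)` containing the symplectization `M × ℝ⁺` of the boundary as an open
subset on which `λ = rα`, such that `W`, the complement of `M × (1, ∞)`, is compact.
(The part `M × (0, 1]` is the collar of `∂W` in `W` swept out by the backward Liouville flow.) -/
structure LiouvilleCompletion
    (E : Type*) [NormedAddCommGroup E] [NormedSpace ℝ E]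
    (X : Type*) [TopologicalSpace X] [ChartedSpace E X] [IsManifold 𝓘(ℝ, E) ∞ X]
    (F : Type*) [NormedAddCommGroup F] [NormedSpace ℝ F]
    (M : Type*) [TopologicalSpace M] [ChartedSpace F M] [IsManifold 𝓘(ℝ, F) ∞ M] where
  lam : OneForm E X
  smooth_lam : SmoothForm lam
  nondegenerate : ∀ x (v : TangentSpace 𝓘(ℝ, E) x), v ≠ 0 → ∃ w, dForm lam x v w ≠ 0
  alpha : OneForm F M
  contact : IsContactForm alpha
  /-- the point `(y, r)` of the conical end, for `r > 0` -/
  cone : M × ℝ → X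
  smooth_cone : ContMDiffOn (𝓘(ℝ, F).prod 𝓘(ℝ, ℝ)) 𝓘(ℝ, E) ∞ cone (univ ×ˢ Ioi 0)
  injOn_cone : InjOn cone (univ ×ˢ Ioi 0)
  bijective_cone : ∀ (y : M) (r : ℝ), 0 < r →
    Function.Bijective (mfderiv (𝓘(ℝ, F).prod 𝓘(ℝ, ℝ)) 𝓘(ℝ, E) cone (y, r))
  isCompact_domain : IsCompact (cone '' (univ ×ˢ Ioi 1))ᶜ
  pullback : ∀ (y : M) (r : ℝ), 0 < r → ∀ (v : TangentSpace 𝓘(ℝ, F) y) (a : ℝ),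
    lam (cone (y, r)) (mfderiv (𝓘(ℝ, F).prod 𝓘(ℝ, ℝ)) 𝓘(ℝ, E) cone (y, r) (v, a))
      = r * alpha y v

section Completion

variable {E : Type*} [NormedAddCommGroup E] [NormedSpace ℝ E]
  {X : Type*} [TopologicalSpace X] [ChartedSpace E X] [IsManifold 𝓘(ℝ, E) ∞ X]
  {F : Type*} [NormedAddCommGroup F] [NormedSpace ℝ F]
  {M : Type*} [TopologicalSpace M] [ChartedSpace F M] [IsManifold 𝓘(ℝ, F) ∞ M]

namespace LiouvilleCompletion

variable (L : LiouvilleCompletion E X F M)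

/-- The symplectic form `ω = dλ`. -/
def omega (x : X) (v w : TangentSpace 𝓘(ℝ, E) x) : ℝ := dForm L.lam x v w

/-- The differential of the inclusion of the conical end. -/
def dCone (y : M) (r : ℝ) (V : TangentSpace 𝓘(ℝ, F) y × ℝ) :
    TangentSpace 𝓘(ℝ, E) (L.cone (y, r)) :=
  mfderiv (𝓘(ℝ, F).prod 𝓘(ℝ, ℝ)) 𝓘(ℝ, E) L.cone (y, r) V

/-- The Hamiltonian vector field: the vector `X_f(x)` with `ω(X_f, ·) = df` (it exists and is
unique because `ω` is nondegenerate and `X` is finite dimensional). -/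
def hamVec (f : X → ℝ) (x : X) : TangentSpace 𝓘(ℝ, E) x :=
  Classical.epsilon fun v : TangentSpace 𝓘(ℝ, E) x ↦ ∀ w, L.omega x v w = dFun f x w

/-- `J` is a `dλ`-compatible almost complex structure. -/
structure IsCompatible (J : EndField E X) : Prop where
  sq : ∀ x v, J x (J x v) = -v
  inv : ∀ x v w, L.omega x (J x v) (J x w) = L.omega x v w
  pos : ∀ x v, v ≠ 0 → 0 < L.omega x v (J x v)

/-- `J` restricts to an almost complex structure of twisted SFT-type on `M × [T, ∞)`. -/
def IsTwistedSFTAtInfinity (T : ℝ) (J : EndField E X) : Prop :=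
  ∃ J' : ∀ (y : M), ℝ → TangentSpace 𝓘(ℝ, F) y × ℝ → TangentSpace 𝓘(ℝ, F) y × ℝ,
    IsTwistedSFT L.alpha T J' ∧
    ∀ (y : M) (r : ℝ), T ≤ r → ∀ V, J (L.cone (y, r)) (L.dCone y r V) = L.dCone y r (J' y r V)

end LiouvilleCompletion

/-- Floer data `(H_t, J_t)`, `t ∈ ℝ/ℤ`: the Hamiltonian has an admissible slope `h`, and `J_t` is
compatible and of twisted SFT-type at infinity.  No transversality is required. -/
structure FloerData (L : LiouvilleCompletion E X F M) where
  H : ℝ → X → ℝ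
  J : ℝ → EndField E X
  periodic_H : ∀ t, H (t + 1) = H t
  periodic_J : ∀ t, J (t + 1) = J t
  smooth_H : ContMDiff (𝓘(ℝ, ℝ).prod 𝓘(ℝ, E)) 𝓘(ℝ, ℝ) ∞ (fun z : ℝ × X ↦ H z.1 z.2)
  smooth_J : SmoothFamily J univ
  compatible : ∀ t, L.IsCompatible (J t)
  slope : ℝ → M → ℝ
  smooth_slope : ContMDiff (𝓘(ℝ, ℝ).prod 𝓘(ℝ, F)) 𝓘(ℝ, ℝ) ∞ (fun z : ℝ × M ↦ slope z.1 z.2)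
  conical_H : ∃ T > 0, ∃ C : ℝ, ∀ t y r, T ≤ r → H t (L.cone (y, r)) = r * slope t y + C
  conical_J : ∃ T > 0, ∀ t, L.IsTwistedSFTAtInfinity T (J t)
  admissible : Admissible L.alpha slope

end Completion

/-! ### The pair-of-pants with a slit -/

/-- The pair-of-pants with a slit.  The sphere is `ℂ ∪ {∞}`, the punctures are `a₁`, `a₂` and
`b = ∞`; a point `(s, t)` of a strip or cylinder is the complex number `s + i t`, and maps on
`[0, ∞) × 𝕊¹` and `(-∞, 0] × 𝕊¹` are maps on half-planes with period `i`. -/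
structure PantsWithSlit where
  a₁ : ℂ
  a₂ : ℂ
  ne : a₁ ≠ a₂
  /-- the slit -/
  S : Set ℂ
  slit : ∃ c₁ c₂ : ℝ → ℂ, Continuous c₁ ∧ Continuous c₂ ∧
    S = range c₁ ∪ range c₂ ∧ (range c₁ ∩ range c₂).Nonempty
  slit_subset : S ⊆ {a₁, a₂}ᶜ
  ψ₁ : ℂ → ℂ
  ψ₂ : ℂ → ℂ
  holo_ψ₁ : DifferentiableOn ℂ ψ₁ {z | 0 < z.im ∧ z.im < 1}
  holo_ψ₂ : DifferentiableOn ℂ ψ₂ {z | 0 < z.im ∧ z.im < 1}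
  inj_ψ₁ : InjOn ψ₁ {z | 0 < z.im ∧ z.im < 1}
  inj_ψ₂ : InjOn ψ₂ {z | 0 < z.im ∧ z.im < 1}
  disjoint_ψ : Disjoint (ψ₁ '' {z | 0 < z.im ∧ z.im < 1}) (ψ₂ '' {z | 0 < z.im ∧ z.im < 1})
  union_ψ : ψ₁ '' {z | 0 < z.im ∧ z.im < 1} ∪ ψ₂ '' {z | 0 < z.im ∧ z.im < 1} = {a₁, a₂}ᶜ \ S
  lim_ψ₁_bot : ∀ t ∈ Ioo (0 : ℝ) 1, Tendsto (fun s : ℝ ↦ ψ₁ ⟨s, t⟩) atBot (𝓝 a₁)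
  lim_ψ₁_top : ∀ t ∈ Ioo (0 : ℝ) 1, Tendsto (fun s : ℝ ↦ ψ₁ ⟨s, t⟩) atTop (cocompact ℂ)
  lim_ψ₂_bot : ∀ t ∈ Ioo (0 : ℝ) 1, Tendsto (fun s : ℝ ↦ ψ₂ ⟨s, t⟩) atBot (𝓝 a₂)
  lim_ψ₂_top : ∀ t ∈ Ioo (0 : ℝ) 1, Tendsto (fun s : ℝ ↦ ψ₂ ⟨s, t⟩) atTop (cocompact ℂ)
  δ : ℝ
  δ_pos : 0 < δ
  δ_lt : δ < 1 / 2
  /-- the cylindrical ends -/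
  ιa₁ : ℂ → ℂ
  ιa₂ : ℂ → ℂ
  ιb : ℂ → ℂ
  periodic_ιa₁ : ∀ z, ιa₁ (z + Complex.I) = ιa₁ z
  periodic_ιa₂ : ∀ z, ιa₂ (z + Complex.I) = ιa₂ z
  periodic_ιb : ∀ z, ιb (z + Complex.I) = ιb z
  holo_ιa₁ : DifferentiableOn ℂ ιa₁ {z | z.re ≤ 0}
  holo_ιa₂ : DifferentiableOn ℂ ιa₂ {z | z.re ≤ 0}
  holo_ιb : DifferentiableOn ℂ ιb {z | 0 ≤ z.re}
  inj_ιa₁ : ∀ z w : ℂ, z.re ≤ 0 → w.re ≤ 0 → ιa₁ z = ιa₁ w → ∃ n : ℤ, z = w + n * Complex.I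
  inj_ιa₂ : ∀ z w : ℂ, z.re ≤ 0 → w.re ≤ 0 → ιa₂ z = ιa₂ w → ∃ n : ℤ, z = w + n * Complex.I
  inj_ιb : ∀ z w : ℂ, 0 ≤ z.re → 0 ≤ w.re → ιb z = ιb w → ∃ n : ℤ, z = w + n * Complex.I
  maps_ιa₁ : ∀ z : ℂ, z.re ≤ 0 → ιa₁ z ∈ ({a₁, a₂} : Set ℂ)ᶜ
  maps_ιa₂ : ∀ z : ℂ, z.re ≤ 0 → ιa₂ z ∈ ({a₁, a₂} : Set ℂ)ᶜ
  maps_ιb : ∀ z : ℂ, 0 ≤ z.re → ιb z ∈ ({a₁, a₂} : Set ℂ)ᶜ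
  sa : ℝ
  sb : ℝ
  sa_pos : 0 < sa
  sb_pos : 0 < sb
  ιa₁_eq : ∀ s t : ℝ, s ≤ 0 → t ∈ Ioo (0 : ℝ) 1 → ιa₁ ⟨s, t⟩ = ψ₁ ⟨s - sa, t⟩
  ιa₂_eq : ∀ s t : ℝ, s ≤ 0 → t ∈ Ioo (0 : ℝ) 1 → ιa₂ ⟨s, t⟩ = ψ₂ ⟨s - sa, t⟩
  ιb_eq₁ : ∀ s t : ℝ, 0 ≤ s → t ∈ Ioo (0 : ℝ) 1 → ιb ⟨s / 2, t / 2⟩ = ψ₁ ⟨s + sb, t⟩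
  ιb_eq₂ : ∀ s t : ℝ, 0 ≤ s → t ∈ Ioo (0 : ℝ) 1 → ιb ⟨s / 2, (t + 1) / 2⟩ = ψ₂ ⟨s + sb, t⟩
  /-- the `1`-form on the pair-of-pants -/
  β : ℂ → ℂ →L[ℝ] ℝ
  smooth_β : ContDiffOn ℝ ∞ β {a₁, a₂}ᶜ
  pullback_β₁ : ∀ z : ℂ, δ ≤ z.im → z.im ≤ 1 - δ → ∀ v : ℂ, β (ψ₁ z) (deriv ψ₁ z * v) = v.im
  pullback_β₂ : ∀ z : ℂ, δ ≤ z.im → z.im ≤ 1 - δ → ∀ v : ℂ, β (ψ₂ z) (deriv ψ₂ z * v) = v.im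

namespace PantsWithSlit

/-- The pair-of-pants, as an open subset of `ℂ`; its complex structure is multiplication by `i`. -/
def P (G : PantsWithSlit) : Set ℂ := {G.a₁, G.a₂}ᶜ

/-- The neighbourhood `Ω_δ` of the slit. -/
def Omega (G : PantsWithSlit) : Set ℂ :=
  (G.P \ G.ψ₁ '' {z | G.δ ≤ z.im ∧ z.im ≤ 1 - G.δ}) \ G.ψ₂ '' {z | G.δ ≤ z.im ∧ z.im ≤ 1 - G.δ}

end PantsWithSlit

/-! ### Product data and the Floer equation -/

section Product

variable {E : Type*} [NormedAddCommGroup E] [NormedSpace ℝ E]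
  {X : Type*} [TopologicalSpace X] [ChartedSpace E X] [IsManifold 𝓘(ℝ, E) ∞ X]
  {F : Type*} [NormedAddCommGroup F] [NormedSpace ℝ F]
  {M : Type*} [TopologicalSpace M] [ChartedSpace F M] [IsManifold 𝓘(ℝ, F) ∞ M]

/-- Product data `(H, J)` for a triple of Floer data. -/
structure ProductData (L : LiouvilleCompletion E X F M) (G : PantsWithSlit)
    (Da₁ Da₂ Db : FloerData L) where
  /-- `H x p` is the value at `x` of the Hamiltonian `H_p` -/
  H : X → ℂ → ℝ
  J : ℂ → EndField E X
  smooth_H : ContMDiffOn (𝓘(ℝ, E).prod 𝓘(ℝ, ℂ)) 𝓘(ℝ, ℝ) ∞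
    (fun z : X × ℂ ↦ H z.1 z.2) (univ ×ˢ G.P)
  smooth_J : SmoothFamily J G.P
  compatible : ∀ p ∈ G.P, L.IsCompatible (J p)
  /- The Floer data do not depend on time near the slit. -/
  const_a₁ : ∀ t ∈ Icc (-G.δ) G.δ, Da₁.H t = Da₁.H 0
  const_a₂ : ∀ t ∈ Icc (-G.δ) G.δ, Da₂.H t = Da₂.H 0
  const_b₀ : ∀ t ∈ Icc (-G.δ / 2) (G.δ / 2), Db.H t = Db.H 0
  const_b₁ : ∀ t ∈ Icc ((1 - G.δ) / 2) ((1 + G.δ) / 2), Db.H t = Db.H (1 / 2)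
  /- Conditions on the ends.  Since `β = 2 dt` in the coordinates of the end at `b`, the factor
  `1 / 2` makes `H β` equal to `H^b_t dt` there. -/
  H_a₁ : ∀ x s t, s ≤ -1 → H x (G.ιa₁ ⟨s, t⟩) = Da₁.H t x
  H_a₂ : ∀ x s t, s ≤ -1 → H x (G.ιa₂ ⟨s, t⟩) = Da₂.H t x
  H_b : ∀ x s t, 1 ≤ s → H x (G.ιb ⟨s, t⟩) = 1 / 2 * Db.H t x
  J_a₁ : ∀ s t, s ≤ -1 → J (G.ιa₁ ⟨s, t⟩) = Da₁.J t
  J_a₂ : ∀ s t, s ≤ -1 → J (G.ιa₂ ⟨s, t⟩) = Da₂.J t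
  J_b : ∀ s t, 1 ≤ s → J (G.ιb ⟨s, t⟩) = Db.J t
  /- The Hamiltonian on the conical end. -/
  h : M → ℂ → ℝ
  smooth_h : ContMDiffOn (𝓘(ℝ, F).prod 𝓘(ℝ, ℂ)) 𝓘(ℝ, ℝ) ∞
    (fun z : M × ℂ ↦ h z.1 z.2) (univ ×ˢ G.P)
  conical_H : ∃ T > 0, ∀ y r, T ≤ r → ∀ p ∈ G.P, H (L.cone (y, r)) p = r * h y p
  /- The almost complex structure on the conical end. -/
  conical_J : ∃ T > 0, ∀ p ∈ G.P, L.IsTwistedSFTAtInfinity T (J p)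
  /- Condition around the slit. -/
  h_slit : ∀ p ∈ G.Omega, ∀ y, h y p = 0
  /- Monotonicity. -/
  mono₁ : ∀ y, ∀ t ∈ Ioo (0 : ℝ) 1, Monotone fun s : ℝ ↦ h y (G.ψ₁ ⟨s, t⟩)
  mono₂ : ∀ y, ∀ t ∈ Ioo (0 : ℝ) 1, Monotone fun s : ℝ ↦ h y (G.ψ₂ ⟨s, t⟩)

namespace ProductData

variable {L : LiouvilleCompletion E X F M} {G : PantsWithSlit} {Da₁ Da₂ Db : FloerData L}
  (D : ProductData L G Da₁ Da₂ Db)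

/-- The `1`-form `du - X_H(u) ⊗ β` with values in `u^* TX`, at `p`. -/
def floerForm (u : ℂ → X) (p : ℂ) (v : ℂ) : TangentSpace 𝓘(ℝ, E) (u p) :=
  mfderiv 𝓘(ℝ, ℂ) 𝓘(ℝ, E) u p v - G.β p v • L.hamVec (fun x ↦ D.H x p) (u p)

/-- `u` is a (smooth) solution on the pair-of-pants of `(du - X_H(u) ⊗ β)^{0,1} = 0`, where
`A^{0,1} = (A + J ∘ A ∘ j) / 2`. -/
def IsSolution (u : ℂ → X) : Prop :=
  ContMDiffOn 𝓘(ℝ, ℂ) 𝓘(ℝ, E) ∞ u G.P ∧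
    ∀ p ∈ G.P, ∀ v : ℂ,
      (1 / 2 : ℝ) • (D.floerForm u p v + D.J p (u p) (D.floerForm u p (Complex.I * v))) = 0

/-- The energy `1/2 ∫_P |du - X_H ⊗ β|² dvol_P`, for the norm `|v|² = ω(v, J v)`.  The integrand
does not depend on the choice of a conformal metric on `P`; the Euclidean one is used. -/
def energy (u : ℂ → X) : ℝ≥0∞ :=
  ∫⁻ p in G.P, ENNReal.ofReal (1 / 2 *
    (L.omega (u p) (D.floerForm u p 1) (D.J p (u p) (D.floerForm u p 1)) +
     L.omega (u p) (D.floerForm u p Complex.I) (D.J p (u p) (D.floerForm u p Complex.I))))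

end ProductData

end Product

end PantsFloer

end

/-! Only escape through the conical end has to be excluded. In logarithmic coordinates (y, σ) with r
= e^σ, the form dλ is e^σ times a form `Om` that does not involve σ, homogeneous Hamiltonians have
Hamiltonian vector fields independent of σ, and an almost complex structure of twisted SFT-type has
a matrix K independent of σ. With X₁, X₂ the Hamiltonian vector fields of the two components of hβ
and A = w_1 - X₁, the Floer equation for a lift w reads w_I = X₂ + K A. It is invariant under
translation of σ, so compactness of M gives constants that are uniform up to infinity. The energy
density is e = r Om(A, K A).

Let q_z be the twist of J_z and ρ = r q_z(y) the height. For frozen z the twisted condition says λ ∘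
J = dρ. Hence the first derivatives of ρ are, up to terms of order zero, r α(w_I) and -r α(w_1)
(`fderiv_height_one`, `fderiv_height_I`), and two estimates follow.

(1) Δρ ≥ -C ρ. The second derivatives of w cancel, and the good term Om(A, K A) dominates the terms
linear in A (`lap_height`, `IsBound.lap_ge`). Comparison with cos(μ(s - s₀)), μ² > C, gives a
maximum principle on narrow domains (`IsControl.height_le_of_boundary`).

(2) |d log ρ| ≤ C (1 + √e) (`IsBound.abs_fderiv_le`). Along a curve of bounded energy the height
therefore grows by a bounded factor at most (`growth_le`).

Ends. If loops of bounded energy lie at heights tending to infinity, their distance from the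
Hamiltonian flow is governed by √(e / r), which tends to zero in the mean. They converge to a
1-periodic orbit of the slope, contrary to admissibility (`exists_periodic_orbit`, `exists_low`). So
every circle of bounded energy has a low point and, by (2), is low everywhere. Fubini provides such
circles in every short cylinder, and (1) bounds the height between two of them (`exists_end_bound`).
The equation on an end is independent of s, so one constant serves the whole end.

Core. The ends cover punctured neighbourhoods of the punctures, hence the rest lies in a compact set
(`PantsWithSlit.exists_compact_core`). A bound near a point c passes to any sufficiently close point
d: polar coordinates give a circle of bounded energy about d through the neighbourhood of c, (2)
bounds the height on the circle and (1) on the disc (`exists_boundedOn_of_near`). Connectedness then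
carries the bound from an end over the core (`boundedOn_of_isCompact`). -/

open Set Filter Topology MeasureTheory Bundle
open scoped Manifold ContDiff ENNReal
set_option maxSynthPendingDepth 3
set_option linter.unusedSectionVars false
noncomputable section
namespace PantsFloer

/-! ### The Floer equation in logarithmic coordinates of the conical end -/

section Local

variable {F : Type*} [NormedAddCommGroup F] [NormedSpace ℝ F]

/-- The form `σ ∧ a + da` on `F × ℝ`, where `B` is the derivative of `a`. -/
def conicalForm (a : F →L[ℝ] ℝ) (B : F →L[ℝ] F →L[ℝ] ℝ) : (F × ℝ) →L[ℝ] (F × ℝ) →L[ℝ] ℝ :=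
  (ContinuousLinearMap.snd ℝ F ℝ).smulRight (a.comp (ContinuousLinearMap.fst ℝ F ℝ))
    - (a.comp (ContinuousLinearMap.fst ℝ F ℝ)).smulRight (ContinuousLinearMap.snd ℝ F ℝ)
    + B.bilinearComp (ContinuousLinearMap.fst ℝ F ℝ) (ContinuousLinearMap.fst ℝ F ℝ)
    - (B.bilinearComp (ContinuousLinearMap.fst ℝ F ℝ) (ContinuousLinearMap.fst ℝ F ℝ)).flip

@[simp] lemma conicalForm_apply (a : F →L[ℝ] ℝ) (B : F →L[ℝ] F →L[ℝ] ℝ) (v w : F × ℝ) :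
    conicalForm a B v w = v.2 * a w.1 - w.2 * a v.1 + (B v.1 w.1 - B w.1 v.1) := by
  simp [conicalForm]; ring

lemma conicalForm_self (a : F →L[ℝ] ℝ) (B : F →L[ℝ] F →L[ℝ] ℝ) (v : F × ℝ) :
    conicalForm a B v v = 0 := by simp

lemma conicalForm_swap (a : F →L[ℝ] ℝ) (B : F →L[ℝ] F →L[ℝ] ℝ) (v w : F × ℝ) :
    conicalForm a B v w = - conicalForm a B w v := by simp; ring

lemma _root_.ContinuousAt.clm_flip {Y G₁ G₂ : Type*} [TopologicalSpace Y]
    [NormedAddCommGroup G₁] [NormedSpace ℝ G₁] [NormedAddCommGroup G₂] [NormedSpace ℝ G₂]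
    {C : Y → G₁ →L[ℝ] G₂ →L[ℝ] ℝ} {y : Y} (hC : ContinuousAt C y) :
    ContinuousAt (fun y ↦ (C y).flip) y :=
  (ContinuousLinearMap.flipₗᵢ ℝ G₁ G₂ ℝ).continuous.continuousAt.comp hC

lemma _root_.ContinuousAt.clm_smulRight {Y G₁ : Type*} [TopologicalSpace Y]
    [NormedAddCommGroup G₁] [NormedSpace ℝ G₁] (s : G₁ →L[ℝ] ℝ)
    {C : Y → G₁ →L[ℝ] ℝ} {y : Y} (hC : ContinuousAt C y) :
    ContinuousAt (fun y ↦ s.smulRight (C y)) y :=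
  (ContinuousLinearMap.smulRightL ℝ G₁ (G₁ →L[ℝ] ℝ) s).continuous.continuousAt.comp hC

lemma continuousAt_wedge_add_d {Y V : Type*} [TopologicalSpace Y] [NormedAddCommGroup V]
    [NormedSpace ℝ V] (s : V →L[ℝ] ℝ) (p : V →L[ℝ] F)
    {a : Y → F →L[ℝ] ℝ} {B : Y → F →L[ℝ] F →L[ℝ] ℝ} {y : Y} (ha : ContinuousAt a y)
    (hB : ContinuousAt B y) : ContinuousAt (fun y ↦ s.smulRight ((a y).comp p)
      - (s.smulRight ((a y).comp p)).flip + (B y).bilinearComp p p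
      - ((B y).bilinearComp p p).flip) y := by
  have h1 : ContinuousAt (fun y ↦ (B y).bilinearComp p p) y :=
    ((hB.clm_comp continuousAt_const).clm_flip.clm_comp continuousAt_const).clm_flip
  have h2 : ContinuousAt (fun y ↦ s.smulRight ((a y).comp p)) y :=
    (ha.clm_comp continuousAt_const).clm_smulRight _
  exact ((h2.sub h2.clm_flip).add h1).sub h1.clm_flip

lemma continuous_conicalForm {Y : Type*} [TopologicalSpace Y]
    {a : Y → F →L[ℝ] ℝ} {B : Y → F →L[ℝ] F →L[ℝ] ℝ} {y : Y} (ha : ContinuousAt a y)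
    (hB : ContinuousAt B y) : ContinuousAt (fun y ↦ conicalForm (a y) (B y)) y := by
  refine (continuousAt_wedge_add_d (ContinuousLinearMap.snd ℝ F ℝ) (ContinuousLinearMap.fst ℝ F ℝ)
    ha hB).congr (Eventually.of_forall fun y ↦ ?_)
  refine ContinuousLinearMap.ext fun v ↦ ContinuousLinearMap.ext fun w ↦ ?_
  simp; ring

/-- The covector `W ↦ D g (0, W.1) + g W.2`. -/
def conicalDiff (g : ℂ × F → ℝ) (p : ℂ × F) : (F × ℝ) →L[ℝ] ℝ :=
  ((fderiv ℝ g p).comp (ContinuousLinearMap.inr ℝ ℂ F)).comp (ContinuousLinearMap.fst ℝ F ℝ)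
    + g p • ContinuousLinearMap.snd ℝ F ℝ

@[simp] lemma conicalDiff_apply (g : ℂ × F → ℝ) (p : ℂ × F) (W : F × ℝ) :
    conicalDiff g p W = fderiv ℝ g p (0, W.1) + g p * W.2 := by
  simp [conicalDiff]

/-- Coordinate data for the Floer equation on the conical end: a `1`-form `α` on an open subset of
`F`, almost complex structures `K` on `F × ℝ` and the two components `g₁`, `g₂` of the
Hamiltonian `1`-form. -/
structure LocalData (F : Type*) [NormedAddCommGroup F] [NormedSpace ℝ F] where
  D : Set (ℂ × F)
  isOpen : IsOpen D
  α : F → F →L[ℝ] ℝ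
  K : ℂ × F → (F × ℝ) →L[ℝ] (F × ℝ)
  g₁ : ℂ × F → ℝ
  g₂ : ℂ × F → ℝ
  smooth_α : ∀ p ∈ D, ContDiffAt ℝ ∞ α p.2
  smooth_K : ∀ p ∈ D, ContDiffAt ℝ ∞ K p
  smooth_g₁ : ∀ p ∈ D, ContDiffAt ℝ ∞ g₁ p
  smooth_g₂ : ∀ p ∈ D, ContDiffAt ℝ ∞ g₂ p
  sq : ∀ p ∈ D, ∀ A, K p (K p A) = -A
  inv : ∀ p ∈ D, ∀ A B, conicalForm (α p.2) (fderiv ℝ α p.2) (K p A) (K p B)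
    = conicalForm (α p.2) (fderiv ℝ α p.2) A B
  pos : ∀ p ∈ D, ∀ A, A ≠ 0 → 0 < conicalForm (α p.2) (fderiv ℝ α p.2) A (K p A)
  contact : ∀ p ∈ D, ∀ A : F × ℝ, α p.2 (K p A).1
    = fderiv ℝ (fun p : ℂ × F ↦ α p.2 (K p (0, 1)).1) p (0, A.1) + α p.2 (K p (0, 1)).1 * A.2

namespace LocalData

variable (S : LocalData F)

/-- the conical symplectic form -/
def Om (p : ℂ × F) : (F × ℝ) →L[ℝ] (F × ℝ) →L[ℝ] ℝ :=
  conicalForm (S.α p.2) (fderiv ℝ S.α p.2)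

/-- the twist -/
def q (p : ℂ × F) : ℝ := S.α p.2 (S.K p (0, 1)).1

/-- the Hamiltonian vector field of `g` -/
def ham (g : ℂ × F → ℝ) (p : ℂ × F) : F × ℝ := (S.Om p).inverse (conicalDiff g p)

def A (w : ℂ → F × ℝ) (z : ℂ) : F × ℝ := fderiv ℝ w z 1 - S.ham S.g₁ (z, (w z).1)

/-- the Floer equation at `z` -/
def IsSolAt (w : ℂ → F × ℝ) (z : ℂ) : Prop :=
  fderiv ℝ w z Complex.I = S.ham S.g₂ (z, (w z).1) + S.K (z, (w z).1) (S.A w z)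

variable {S}

/-- The twist equals Om(∂_σ, K ∂_σ), so compatibility makes it positive. -/
lemma q_pos {p : ℂ × F} (hp : p ∈ S.D) : 0 < S.q p := by
  have := S.pos p hp (0, 1) (by simp)
  simpa [q] using this

lemma smooth_q {p : ℂ × F} (hp : p ∈ S.D) : ContDiffAt ℝ ∞ S.q p := by
  have h1 : ContDiffAt ℝ ∞ (fun p : ℂ × F ↦ S.α p.2) p :=
    ContDiffAt.comp p (S.smooth_α p hp) contDiffAt_snd
  have h2 : ContDiffAt ℝ ∞ (fun p : ℂ × F ↦ (S.K p (0, 1)).1) p :=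
    contDiffAt_fst.comp p ((S.smooth_K p hp).clm_apply contDiffAt_const)
  exact h1.clm_apply h2

/-- Om(A, K A) > 0 for A ≠ 0 excludes a kernel, and a finite-dimensional space has the dimension of
its dual. -/
lemma Om_bijective [FiniteDimensional ℝ F] {p : ℂ × F} (hp : p ∈ S.D) :
    ∃ e : (F × ℝ) ≃L[ℝ] ((F × ℝ) →L[ℝ] ℝ), (e : (F × ℝ) →L[ℝ] ((F × ℝ) →L[ℝ] ℝ)) = S.Om p := by
  have hinj : Function.Injective (S.Om p).toLinearMap := by
    rw [injective_iff_map_eq_zero]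
    intro A hA
    by_contra hne
    have := S.pos p hp A hne
    have h2 : S.Om p A (S.K p A) = 0 := by
      have : S.Om p A = 0 := hA
      rw [this]; rfl
    exact absurd h2 this.ne'
  have hdim : Module.finrank ℝ (F × ℝ) = Module.finrank ℝ ((F × ℝ) →L[ℝ] ℝ) := by
    rw [LinearMap.toContinuousLinearMap.symm.finrank_eq]
    exact (Subspace.dual_finrank_eq (K := ℝ) (V := F × ℝ)).symm
  refine ⟨(LinearEquiv.ofInjectiveOfFinrankEq (S.Om p).toLinearMap hinj
    hdim).toContinuousLinearEquiv, ?_⟩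
  exact ContinuousLinearMap.ext fun A ↦ rfl

lemma Om_ham [FiniteDimensional ℝ F] {p : ℂ × F} (hp : p ∈ S.D) (g : ℂ × F → ℝ) :
    S.Om p (S.ham g p) = conicalDiff g p := by
  obtain ⟨e, he⟩ := Om_bijective hp
  rw [ham, ← he, ContinuousLinearMap.inverse_equiv]
  simp

lemma eq_ham [FiniteDimensional ℝ F] {p : ℂ × F} (hp : p ∈ S.D) (g : ℂ × F → ℝ) {x : F × ℝ}
    (hx : S.Om p x = conicalDiff g p) : x = S.ham g p := by
  obtain ⟨e, he⟩ := Om_bijective hp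
  apply e.injective
  have := Om_ham hp g
  rw [← he] at this hx
  exact hx.trans this.symm

lemma continuousAt_Om [FiniteDimensional ℝ F] {p : ℂ × F} (hp : p ∈ S.D) :
    ContinuousAt S.Om p := by
  have h1 : ContinuousAt (fun p : ℂ × F ↦ S.α p.2) p :=
    ContinuousAt.comp (S.smooth_α p hp).continuousAt continuousAt_snd
  have h2 : ContinuousAt (fun p : ℂ × F ↦ fderiv ℝ S.α p.2) p :=
    ContinuousAt.comp (f := Prod.snd) (g := fderiv ℝ S.α)
      (((S.smooth_α p hp).fderiv_right (m := ∞) (by simp)).continuousAt) continuousAt_snd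
  exact continuous_conicalForm h1 h2

lemma continuousAt_conicalDiff {g : ℂ × F → ℝ} {p : ℂ × F} (hg : ContDiffAt ℝ ∞ g p) :
    ContinuousAt (conicalDiff g) p := by
  have h1 : ContinuousAt (fderiv ℝ g) p := (hg.fderiv_right (m := ∞) (by simp)).continuousAt
  have h2 := hg.continuousAt
  unfold conicalDiff
  exact ((h1.clm_comp continuousAt_const).clm_comp continuousAt_const).add
    (h2.smul continuousAt_const)

lemma continuousAt_ham [FiniteDimensional ℝ F] {g : ℂ × F → ℝ} {p : ℂ × F} (hp : p ∈ S.D)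
    (hg : ContDiffAt ℝ ∞ g p) : ContinuousAt (S.ham g) p := by
  obtain ⟨e, he⟩ := Om_bijective hp
  have h1 : ContinuousAt (fun p ↦ (S.Om p).inverse) p := by
    have : ContinuousAt ContinuousLinearMap.inverse (S.Om p) := by
      rw [← he]
      exact (contDiffAt_map_inverse (n := 0) (𝕜 := ℝ) e).continuousAt
    exact ContinuousAt.comp this (continuousAt_Om hp)
  exact h1.clm_apply (continuousAt_conicalDiff hg)

variable (S) in
/-- The zeroth order term in the derivative of the height function in the direction `1`. -/
def a (p : ℂ × F) : ℝ :=
  S.g₂ p + conicalDiff S.g₁ p (S.K p (0, 1)) + fderiv ℝ S.q p (1, 0)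

variable (S) in
/-- The zeroth order term in the derivative of the height function in the direction `I`. -/
def b (p : ℂ × F) : ℝ :=
  - S.g₁ p + conicalDiff S.g₂ p (S.K p (0, 1)) + fderiv ℝ S.q p (Complex.I, 0)

lemma smooth_conicalDiff {g : ℂ × F → ℝ} {p : ℂ × F} (hg : ContDiffAt ℝ ∞ g p) :
    ContDiffAt ℝ ∞ (conicalDiff g) p := by
  have h1 : ContDiffAt ℝ ∞ (fderiv ℝ g) p := hg.fderiv_right (m := ∞) (by simp)
  unfold conicalDiff
  exact ((h1.clm_comp contDiffAt_const).clm_comp contDiffAt_const).add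
    (hg.smul contDiffAt_const)

lemma smooth_a {p : ℂ × F} (hp : p ∈ S.D) : ContDiffAt ℝ ∞ S.a p := by
  unfold a
  have h3 : ContDiffAt ℝ ∞ (fderiv ℝ S.q) p := (smooth_q hp).fderiv_right (m := ∞) (by simp)
  exact ((S.smooth_g₂ p hp).add ((smooth_conicalDiff (S.smooth_g₁ p hp)).clm_apply
    ((S.smooth_K p hp).clm_apply contDiffAt_const))).add (h3.clm_apply contDiffAt_const)

lemma smooth_b {p : ℂ × F} (hp : p ∈ S.D) : ContDiffAt ℝ ∞ S.b p := by
  unfold b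
  have h3 : ContDiffAt ℝ ∞ (fderiv ℝ S.q) p := (smooth_q hp).fderiv_right (m := ∞) (by simp)
  exact ((S.smooth_g₁ p hp).neg.add ((smooth_conicalDiff (S.smooth_g₂ p hp)).clm_apply
    ((S.smooth_K p hp).clm_apply contDiffAt_const))).add (h3.clm_apply contDiffAt_const)

lemma contact' {p : ℂ × F} (hp : p ∈ S.D) (A : F × ℝ) :
    fderiv ℝ S.q p (0, A.1) + S.q p * A.2 = S.α p.2 (S.K p A).1 := (S.contact p hp A).symm

lemma alpha_eq_Om (p : ℂ × F) (A : F × ℝ) : S.α p.2 A.1 = S.Om p (0, 1) A := by simp [Om]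

/-- Since α = Om(∂_σ, ·), invariance of Om under K moves K from the Hamiltonian vector field onto
∂_σ. -/
lemma alpha_K_ham [FiniteDimensional ℝ F] {p : ℂ × F} (hp : p ∈ S.D) (g : ℂ × F → ℝ) :
    S.α p.2 (S.K p (S.ham g p)).1 = conicalDiff g p (S.K p (0, 1)) := by
  rw [alpha_eq_Om, ← Om_ham hp]
  have h := S.inv p hp (0, 1) (S.K p (S.ham g p))
  rw [S.sq p hp] at h
  have h2 := conicalForm_swap (S.α p.2) (fderiv ℝ S.α p.2) (S.K p (0, 1)) (S.ham g p)
  simp only [Om]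
  rw [← h, map_neg, h2, neg_neg]

lemma alpha_ham [FiniteDimensional ℝ F] {p : ℂ × F} (hp : p ∈ S.D) (g : ℂ × F → ℝ) :
    S.α p.2 (S.ham g p).1 = - g p := by
  have h := congrArg (fun l ↦ l (0, 1)) (Om_ham hp g)
  have h0 : fderiv ℝ g p (0, 0) = 0 := map_zero _
  simp [Om, h0] at h
  linarith

variable (S) in
/-- The height function `e^σ q`. -/
def height (w : ℂ → F × ℝ) (z : ℂ) : ℝ := Real.exp (w z).2 * S.q (z, (w z).1)

lemma hasFDerivAt_height {w : ℂ → F × ℝ} {z : ℂ} (hw : DifferentiableAt ℝ w z)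
    (hp : (z, (w z).1) ∈ S.D) (v : ℂ) :
    DifferentiableAt ℝ (S.height w) z ∧ fderiv ℝ (S.height w) z v = Real.exp (w z).2 *
      (fderiv ℝ S.q (z, (w z).1) (0, (fderiv ℝ w z v).1) + S.q (z, (w z).1) * (fderiv ℝ w z v).2
        + fderiv ℝ S.q (z, (w z).1) (v, 0)) := by
  have h1 := hw.hasFDerivAt
  have h2 := ((hasFDerivAt_id (𝕜 := ℝ) z).prodMk h1.fst)
  have h3 := ((smooth_q hp).differentiableAt (by simp)).hasFDerivAt
  have h4 := h1.snd.exp.mul (HasFDerivAt.comp z h3 h2)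
  refine ⟨h4.differentiableAt, ?_⟩
  have h5 : fderiv ℝ (S.height w) z = _ := h4.fderiv
  rw [h5]
  have : ((v, (fderiv ℝ w z v).1) : ℂ × F) = (0, (fderiv ℝ w z v).1) + (v, 0) := by simp
  simp [this, -Prod.mk_add_mk]
  ring

/-- By `contact'` the derivative of the height along w is α ∘ K up to the explicit z-dependence of
q, and the equation gives K w_1 = w_I - X₂ + K X₁. Only α(w_I) and terms of order zero survive. In
the direction I the same computation uses K w_I = K X₂ - w_1 + X₁. -/
lemma fderiv_height_one [FiniteDimensional ℝ F] {w : ℂ → F × ℝ} {z : ℂ}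
    (hw : DifferentiableAt ℝ w z) (hp : (z, (w z).1) ∈ S.D) (hs : S.IsSolAt w z) :
    fderiv ℝ (S.height w) z 1 = Real.exp (w z).2 *
      (S.α (w z).1 (fderiv ℝ w z Complex.I).1 + S.a (z, (w z).1)) := by
  rw [(hasFDerivAt_height hw hp 1).2]
  have h0 : fderiv ℝ w z 1 = S.ham S.g₁ (z, (w z).1) + S.A w z := by simp [A]
  rw [contact' hp, h0, hs]
  simp only [map_add, Prod.fst_add]
  have := alpha_K_ham hp S.g₁
  have h2 := alpha_ham hp S.g₂
  simp only at this h2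
  rw [this, h2, a]
  ring

lemma fderiv_height_I [FiniteDimensional ℝ F] {w : ℂ → F × ℝ} {z : ℂ}
    (hw : DifferentiableAt ℝ w z) (hp : (z, (w z).1) ∈ S.D) (hs : S.IsSolAt w z) :
    fderiv ℝ (S.height w) z Complex.I = Real.exp (w z).2 *
      (- S.α (w z).1 (fderiv ℝ w z 1).1 + S.b (z, (w z).1)) := by
  rw [(hasFDerivAt_height hw hp _).2]
  have h0 : fderiv ℝ w z 1 = S.ham S.g₁ (z, (w z).1) + S.A w z := by simp [A]
  rw [contact' hp, h0, hs]
  simp only [map_add, Prod.fst_add, S.sq _ hp]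
  have := alpha_K_ham hp S.g₂
  have h2 := alpha_ham hp S.g₁
  simp only at this h2
  rw [this, h2, b]
  simp
  ring

end LocalData
end Local

/-- The Laplacian of a function on the plane. -/
def lap (ρ : ℂ → ℝ) (z : ℂ) : ℝ :=
  fderiv ℝ (fun z ↦ fderiv ℝ ρ z 1) z 1 + fderiv ℝ (fun z ↦ fderiv ℝ ρ z Complex.I) z Complex.I

/-! ### The Laplacian inequality and the gradient estimate for the height in coordinates. -/

namespace LocalData

variable {F : Type*} [NormedAddCommGroup F] [NormedSpace ℝ F]
  {S : LocalData F}

/-- Both first derivatives of the height have this shape, with c = 1 and c = -1. -/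
lemma hasFDerivAt_height_aux {w : ℂ → F × ℝ} {z : ℂ} (hw : ContDiffAt ℝ ∞ w z)
    (hp : (z, (w z).1) ∈ S.D) (e v : ℂ) (c : ℝ) {a : ℂ × F → ℝ}
    (ha : DifferentiableAt ℝ a (z, (w z).1)) :
    fderiv ℝ (fun z ↦ Real.exp (w z).2 * (c * S.α (w z).1 (fderiv ℝ w z e).1 + a (z, (w z).1)))
      z v = Real.exp (w z).2 *
      ((fderiv ℝ w z v).2 * (c * S.α (w z).1 (fderiv ℝ w z e).1 + a (z, (w z).1))
      + c * (fderiv ℝ S.α (w z).1 (fderiv ℝ w z v).1 (fderiv ℝ w z e).1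
      + S.α (w z).1 (fderiv ℝ (fderiv ℝ w) z v e).1)
      + fderiv ℝ a (z, (w z).1) (v, (fderiv ℝ w z v).1)) := by
  have h1 : HasFDerivAt w (fderiv ℝ w z) z := (hw.differentiableAt (by simp)).hasFDerivAt
  have h2 : HasFDerivAt (fderiv ℝ w) (fderiv ℝ (fderiv ℝ w) z) z :=
    ((hw.fderiv_right (m := ∞) (by simp)).differentiableAt (by simp)).hasFDerivAt
  have h3 := (h2.clm_apply (hasFDerivAt_const e z)).fst
  have h4 : HasFDerivAt S.α (fderiv ℝ S.α (w z).1) (w z).1 :=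
    ((S.smooth_α _ hp).differentiableAt (by simp)).hasFDerivAt
  have h5 := (HasFDerivAt.comp z h4 h1.fst).clm_apply h3
  have h6 := HasFDerivAt.comp z ha.hasFDerivAt ((hasFDerivAt_id (𝕜 := ℝ) z).prodMk h1.fst)
  have h7 := h1.snd.exp.mul ((h5.const_mul c).add h6)
  have h8 := h7.fderiv
  refine (congrArg (fun l ↦ l v) h8).trans ?_
  simp
  ring

lemma eventually_mem {w : ℂ → F × ℝ} {z : ℂ} (hw : ContDiffAt ℝ ∞ w z)
    (hp : (z, (w z).1) ∈ S.D) : ∀ᶠ z' in 𝓝 z, (z', (w z').1) ∈ S.D :=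
  (continuousAt_id.prodMk hw.continuousAt.fst).preimage_mem_nhds (S.isOpen.mem_nhds hp)

lemma eventually_differentiableAt {w : ℂ → F × ℝ} {z : ℂ} (hw : ContDiffAt ℝ ∞ w z) :
    ∀ᶠ z' in 𝓝 z, DifferentiableAt ℝ w z' := by
  filter_upwards [(hw.of_le (m := 1) (by simp)).eventually (by simp)] with z' h
  exact h.differentiableAt (by simp)

/-- The mixed second derivatives of w enter as α(∂_1 ∂_I w) and -α(∂_I ∂_1 w) and cancel. The
remaining quadratic terms assemble to Om(w_1, w_I), the pullback of dλ divided by r. -/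
lemma lap_height [FiniteDimensional ℝ F] {w : ℂ → F × ℝ} {z : ℂ} (hw : ContDiffAt ℝ ∞ w z)
    (hp : (z, (w z).1) ∈ S.D) (hs : ∀ᶠ z' in 𝓝 z, S.IsSolAt w z') :
    lap (S.height w) z = Real.exp (w z).2 *
      (S.Om (z, (w z).1) (fderiv ℝ w z 1) (fderiv ℝ w z Complex.I)
        + (fderiv ℝ w z 1).2 * S.a (z, (w z).1) + (fderiv ℝ w z Complex.I).2 * S.b (z, (w z).1)
        + fderiv ℝ S.a (z, (w z).1) (1, (fderiv ℝ w z 1).1)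
        + fderiv ℝ S.b (z, (w z).1) (Complex.I, (fderiv ℝ w z Complex.I).1)) := by
  have hev : ∀ᶠ z' in 𝓝 z, DifferentiableAt ℝ w z' ∧ (z', (w z').1) ∈ S.D ∧ S.IsSolAt w z' :=
    (eventually_differentiableAt hw).and ((eventually_mem hw hp).and hs)
  have e1 : (fun z ↦ fderiv ℝ (S.height w) z 1) =ᶠ[𝓝 z] fun z ↦ Real.exp (w z).2 *
      (1 * S.α (w z).1 (fderiv ℝ w z Complex.I).1 + S.a (z, (w z).1)) := by
    filter_upwards [hev] with z' h
    rw [fderiv_height_one h.1 h.2.1 h.2.2, one_mul]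
  have e2 : (fun z ↦ fderiv ℝ (S.height w) z Complex.I) =ᶠ[𝓝 z] fun z ↦ Real.exp (w z).2 *
      (-1 * S.α (w z).1 (fderiv ℝ w z 1).1 + S.b (z, (w z).1)) := by
    filter_upwards [hev] with z' h
    rw [fderiv_height_I h.1 h.2.1 h.2.2, neg_one_mul]
  have hsymm : fderiv ℝ (fderiv ℝ w) z 1 Complex.I = fderiv ℝ (fderiv ℝ w) z Complex.I 1 :=
    (hw.isSymmSndFDerivAt (by simpa using WithTop.coe_le_coe.mpr (le_top (a := (2 : ℕ∞))))).eq 1 Complex.I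
  rw [lap, e1.fderiv_eq, e2.fderiv_eq,
    hasFDerivAt_height_aux hw hp _ _ _ ((smooth_a hp).differentiableAt (by simp)),
    hasFDerivAt_height_aux hw hp _ _ _ ((smooth_b hp).differentiableAt (by simp)), hsymm]
  simp only [Om, conicalForm_apply]
  ring

lemma _root_.ContinuousAt.exists_norm_le {Y G : Type*} [TopologicalSpace Y] [NormedAddCommGroup G]
    {f : Y → G} {y : Y} (hf : ContinuousAt f y) : ∀ᶠ y' in 𝓝 y, ‖f y'‖ ≤ ‖f y‖ + 1 := by
  filter_upwards [hf.norm.eventually (gt_mem_nhds (lt_add_one ‖f y‖))] with y' h using h.le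

/-- The constant at p₀ is the minimum of the quadratic form over the unit sphere. Continuity of the
form in p preserves half of it nearby. -/
lemma coercive [FiniteDimensional ℝ F] {p₀ : ℂ × F} (hp : p₀ ∈ S.D) :
    ∃ c > 0, ∀ᶠ p in 𝓝 p₀, ∀ A, c * ‖A‖ ^ 2 ≤ S.Om p A (S.K p A) := by
  have hB : ContinuousAt (fun p ↦ (S.Om p).flip.comp (S.K p)) p₀ :=
    (continuousAt_Om hp).clm_flip.clm_comp (S.smooth_K p₀ hp).continuousAt
  have hc : ∃ c > 0, ∀ A, c * ‖A‖ ^ 2 ≤ S.Om p₀ A (S.K p₀ A) := by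
    rcases subsingleton_or_nontrivial (F × ℝ) with h | h
    · exact ⟨1, one_pos, fun A ↦ by simp [Subsingleton.elim A 0]⟩
    have hcont : Continuous fun A ↦ S.Om p₀ A (S.K p₀ A) := by fun_prop
    obtain ⟨A₀, hA₀, hmin⟩ := (isCompact_sphere (0 : F × ℝ) 1).exists_isMinOn
      (NormedSpace.sphere_nonempty.mpr zero_le_one) hcont.continuousOn
    have hA0 : A₀ ≠ 0 := by rintro rfl; simp at hA₀
    refine ⟨_, S.pos p₀ hp A₀ hA0, fun A ↦ ?_⟩
    rcases eq_or_ne A 0 with rfl | hA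
    · simp
    have hA' : ‖A‖ ≠ 0 := norm_ne_zero_iff.mpr hA
    have := hmin (a := ‖A‖⁻¹ • A) (by simp [norm_smul, hA'])
    simp only [mem_ofPred_eq, map_smul, smul_apply, smul_eq_mul] at this
    calc _ ≤ (‖A‖⁻¹ * (‖A‖⁻¹ * S.Om p₀ A (S.K p₀ A))) * ‖A‖ ^ 2 := by gcongr; exact this
      _ = _ := by field_simp
  obtain ⟨c, hc, hcA⟩ := hc
  refine ⟨c / 2, by positivity, ?_⟩
  have := hB.eventually (Metric.ball_mem_nhds _ (by positivity : 0 < c / 2))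
  filter_upwards [this] with p hp' A
  rw [dist_eq_norm] at hp'
  have h1 := ((S.Om p).flip.comp (S.K p) - (S.Om p₀).flip.comp (S.K p₀)).le_opNorm₂ A A
  have h2 : ‖((S.Om p).flip.comp (S.K p) - (S.Om p₀).flip.comp (S.K p₀)) A A‖
      ≤ c / 2 * ‖A‖ * ‖A‖ := h1.trans (by gcongr)
  rw [Real.norm_eq_abs] at h2
  have h3 := (abs_le.mp h2).1
  have h4 := hcA A
  simp only [sub_apply, ContinuousLinearMap.comp_apply,
    ContinuousLinearMap.flip_apply] at h3
  nlinarith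

/-- `C` bounds all the coordinate data at `p`. -/
structure IsBound (S : LocalData F) (C : ℝ) (p : ℂ × F) : Prop where
  α : ‖S.α p.2‖ ≤ C
  Om : ‖S.Om p‖ ≤ C
  K : ‖S.K p‖ ≤ C
  ham₁ : ‖S.ham S.g₁ p‖ ≤ C
  ham₂ : ‖S.ham S.g₂ p‖ ≤ C
  a : ‖S.a p‖ ≤ C
  b : ‖S.b p‖ ≤ C
  da : ‖fderiv ℝ S.a p‖ ≤ C
  db : ‖fderiv ℝ S.b p‖ ≤ C
  q_le : S.q p ≤ C
  le_q : 1 ≤ C * S.q p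
  coercive : ∀ A, ‖A‖ ^ 2 ≤ C * S.Om p A (S.K p A)

lemma eventually_isBound [FiniteDimensional ℝ F] {p₀ : ℂ × F} (hp : p₀ ∈ S.D) : ∃ C ≥ 1, ∀ᶠ p in 𝓝 p₀, S.IsBound C p := by
  obtain ⟨c, hc, hco⟩ := coercive hp
  have h1 : ContinuousAt (fun p : ℂ × F ↦ S.α p.2) p₀ :=
    ContinuousAt.comp (S.smooth_α p₀ hp).continuousAt continuousAt_snd
  have hda : ContinuousAt (fderiv ℝ S.a) p₀ :=
    ((smooth_a hp).fderiv_right (m := ∞) (by simp)).continuousAt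
  have hdb : ContinuousAt (fderiv ℝ S.b) p₀ :=
    ((smooth_b hp).fderiv_right (m := ∞) (by simp)).continuousAt
  have hq := (smooth_q hp).continuousAt
  have hqi : ContinuousAt (fun p ↦ (S.q p)⁻¹) p₀ := hq.inv₀ (q_pos hp).ne'
  have key : ∀ᶠ C in atTop, ∀ᶠ p in 𝓝 p₀, S.IsBound C p := by
    filter_upwards [eventually_ge_atTop (‖S.α p₀.2‖ + 1), eventually_ge_atTop (‖S.Om p₀‖ + 1),
      eventually_ge_atTop (‖S.K p₀‖ + 1), eventually_ge_atTop (‖S.ham S.g₁ p₀‖ + 1),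
      eventually_ge_atTop (‖S.ham S.g₂ p₀‖ + 1), eventually_ge_atTop (‖S.a p₀‖ + 1),
      eventually_ge_atTop (‖S.b p₀‖ + 1), eventually_ge_atTop (‖fderiv ℝ S.a p₀‖ + 1),
      eventually_ge_atTop (‖fderiv ℝ S.b p₀‖ + 1), eventually_ge_atTop (‖S.q p₀‖ + 1),
      eventually_ge_atTop (‖(S.q p₀)⁻¹‖ + 1), eventually_ge_atTop (c⁻¹)]
      with C c1 c2 c3 c4 c5 c6 c7 c8 c9 c10 c11 c12
    filter_upwards [h1.exists_norm_le, (continuousAt_Om hp).exists_norm_le,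
      (S.smooth_K p₀ hp).continuousAt.exists_norm_le,
      (continuousAt_ham hp (S.smooth_g₁ p₀ hp)).exists_norm_le,
      (continuousAt_ham hp (S.smooth_g₂ p₀ hp)).exists_norm_le,
      (smooth_a hp).continuousAt.exists_norm_le, (smooth_b hp).continuousAt.exists_norm_le,
      hda.exists_norm_le, hdb.exists_norm_le, hq.exists_norm_le, hqi.exists_norm_le,
      hco, S.isOpen.mem_nhds hp]
      with p d1 d2 d3 d4 d5 d6 d7 d8 d9 d10 d11 d12 hpD
    refine ⟨d1.trans c1, d2.trans c2, d3.trans c3, d4.trans c4, d5.trans c5, d6.trans c6,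
      d7.trans c7, d8.trans c8, d9.trans c9, (Real.le_norm_self _).trans (d10.trans c10), ?_,
      fun A ↦ ?_⟩
    · have := (Real.le_norm_self _).trans (d11.trans c11)
      have hq0 := q_pos hpD
      calc 1 = (S.q p)⁻¹ * S.q p := (inv_mul_cancel₀ hq0.ne').symm
        _ ≤ _ := by gcongr
    · have hn : ‖A‖ ^ 2 ≤ c⁻¹ * S.Om p A (S.K p A) := by
        rw [← div_eq_inv_mul, le_div_iff₀ hc, mul_comm]; exact d12 A
      refine hn.trans ?_
      have h0 : 0 ≤ S.Om p A (S.K p A) := le_trans (by positivity) (d12 A)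
      gcongr
  obtain ⟨C, hC, h1⟩ := (key.and (eventually_ge_atTop 1)).exists
  exact ⟨C, h1, hC⟩

lemma fderiv_one_eq (w : ℂ → F × ℝ) (z : ℂ) :
    fderiv ℝ w z 1 = S.ham S.g₁ (z, (w z).1) + S.A w z := by simp [A]

lemma IsBound.norm_A_le {C : ℝ} {p : ℂ × F} (hC : 1 ≤ C) (hb : S.IsBound C p) (A : F × ℝ) :
    ‖A‖ ≤ C * √(S.Om p A (S.K p A)) := by
  have h := hb.coercive A
  have h0 : 0 ≤ S.Om p A (S.K p A) := by
    by_contra hneg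
    have : C * S.Om p A (S.K p A) < 0 := mul_neg_of_pos_of_neg (by linarith) (by linarith)
    nlinarith [sq_nonneg ‖A‖]
  refine abs_le_of_sq_le_sq' ?_ (by positivity) |>.2
  rw [mul_pow, Real.sq_sqrt h0]
  nlinarith

section

variable {C : ℝ} {w : ℂ → F × ℝ} {z : ℂ}

lemma IsBound.norm_fderiv_one (hb : S.IsBound C (z, (w z).1)) :
    ‖fderiv ℝ w z 1‖ ≤ C + ‖S.A w z‖ := by
  rw [fderiv_one_eq]
  exact (norm_add_le _ _).trans (by gcongr; exact hb.ham₁)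

lemma IsBound.norm_fderiv_I (hb : S.IsBound C (z, (w z).1)) (hs : S.IsSolAt w z) :
    ‖fderiv ℝ w z Complex.I‖ ≤ C + C * ‖S.A w z‖ := by
  rw [hs]
  refine (norm_add_le _ _).trans (add_le_add hb.ham₂ ?_)
  exact ((S.K _).le_opNorm _).trans (by gcongr; exact hb.K)

/-- Expanding Om(w_1, w_I) with w_1 = X₁ + A and w_I = X₂ + K A leaves the positive term Om(A, K A),
of size at least ‖A‖² / C, against terms at most linear in ‖A‖. Completing the square bounds the sum
below by a constant. -/
lemma IsBound.lap_ge [FiniteDimensional ℝ F] (hC : 1 ≤ C) (hw : ContDiffAt ℝ ∞ w z)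
    (hp : (z, (w z).1) ∈ S.D) (hs : ∀ᶠ z' in 𝓝 z, S.IsSolAt w z')
    (hb : S.IsBound C (z, (w z).1)) :
    - (17 * C ^ 8) * S.height w z ≤ lap (S.height w) z := by
  have hsz := hs.self_of_nhds
  rw [lap_height hw hp hs, height]
  have h1 := hb.norm_fderiv_one
  have h2 := hb.norm_fderiv_I hsz
  set p := (z, (w z).1) with hpdef
  set N := ‖S.A w z‖ with hN
  have hN0 : 0 ≤ N := norm_nonneg _
  have bil : ∀ x y : F × ℝ, ∀ a b : ℝ, ‖x‖ ≤ a → ‖y‖ ≤ b → - (C * (a * b)) ≤ S.Om p x y := by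
    intro x y a b hx hy
    have h := (S.Om p).le_opNorm₂ x y
    have h' : ‖S.Om p x y‖ ≤ C * (a * b) := by
      refine h.trans ?_
      rw [mul_assoc]
      have := hb.Om
      have := (norm_nonneg x).trans hx
      gcongr
    exact (abs_le.mp h').1
  have prod : ∀ x y a b : ℝ, |x| ≤ a → |y| ≤ b → - (a * b) ≤ x * y := by
    intro x y a b hx hy
    have : |x * y| ≤ a * b := by
      rw [abs_mul]
      have := (abs_nonneg x).trans hx
      gcongr
    exact (abs_le.mp this).1
  have lin : ∀ (l : ℂ × F →L[ℝ] ℝ) (e : ℂ) (y : F × ℝ) (a : ℝ), ‖l‖ ≤ C → ‖e‖ = 1 → ‖y‖ ≤ a →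
      - (C * (1 + a)) ≤ l (e, y.1) := by
    intro l e y a hl he hy
    have h : ‖l (e, y.1)‖ ≤ C * (1 + a) := by
      refine (l.le_opNorm _).trans ?_
      have hy1 : ‖y.1‖ ≤ a := (norm_fst_le y).trans hy
      have : ‖(e, y.1)‖ ≤ 1 + a := by
        rw [Prod.norm_def]
        exact max_le (by simp [he]; linarith [(norm_nonneg _).trans hy1])
          (by simp; linarith)
      gcongr
    exact (abs_le.mp h).1
  have hsig : ∀ y : F × ℝ, ∀ a : ℝ, ‖y‖ ≤ a → |y.2| ≤ a := fun y a hy ↦ (norm_snd_le y).trans hy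
  have hKA : ‖S.K p (S.A w z)‖ ≤ C * N := ((S.K p).le_opNorm _).trans (by gcongr; exact hb.K)
  have t1 := bil _ _ _ _ hb.ham₁ hb.ham₂
  have t2 := bil _ _ _ _ hb.ham₁ hKA
  have t3 := bil (S.A w z) _ N _ le_rfl hb.ham₂
  have t4 := prod _ _ _ _ (hsig _ _ h1) hb.a
  have t5 := prod _ _ _ _ (hsig _ _ h2) hb.b
  have t6 := lin _ 1 _ _ hb.da (by simp) h1
  have t7 := lin _ Complex.I _ _ hb.db (by simp) h2
  have hexp : S.Om p (fderiv ℝ w z 1) (fderiv ℝ w z Complex.I) = S.Om p (S.ham S.g₁ p)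
      (S.ham S.g₂ p) + S.Om p (S.ham S.g₁ p) (S.K p (S.A w z)) + S.Om p (S.A w z) (S.ham S.g₂ p)
      + S.Om p (S.A w z) (S.K p (S.A w z)) := by
    rw [fderiv_one_eq, hsz]; simp [p]; ring
  have hco := hb.coercive (S.A w z)
  have hq := hb.le_q
  have hc2 : C ^ 2 ≤ C ^ 3 := pow_le_pow_right₀ hC (by norm_num)
  have hc1 : C ≤ C ^ 3 := le_self_pow₀ hC (by norm_num)
  have hc7 : C ^ 3 ≤ C ^ 7 := pow_le_pow_right₀ hC (by norm_num)
  -- Six linear terms occur, each at most C³ N. After multiplication by C the expression plus 9 C⁷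
  -- is at least N² - 6 C⁴ N + 9 C⁸ = (N - 3 C⁴)². The constant terms add at most 7 C³, whence 17 C⁷
  -- below.
  have hquad : - (9 * C ^ 7) ≤ S.Om p (S.A w z) (S.K p (S.A w z)) - 6 * C ^ 3 * N := by
    have : 0 ≤ C * (S.Om p (S.A w z) (S.K p (S.A w z)) - 6 * C ^ 3 * N + 9 * C ^ 7) := by
      nlinarith [sq_nonneg (N - 3 * C ^ 4)]
    nlinarith [nonneg_of_mul_nonneg_right this (by linarith)]
  have hNc2 : C ^ 2 * N ≤ C ^ 3 * N := by gcongr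
  have hNc1 : C * N ≤ C ^ 3 * N := by gcongr
  have hfin : -(17 * C ^ 7) ≤ S.Om p (fderiv ℝ w z 1) (fderiv ℝ w z Complex.I)
        + (fderiv ℝ w z 1).2 * S.a p + (fderiv ℝ w z Complex.I).2 * S.b p
        + fderiv ℝ S.a p (1, (fderiv ℝ w z 1).1)
        + fderiv ℝ S.b p (Complex.I, (fderiv ℝ w z Complex.I).1) := by
    rw [hexp]
    nlinarith
  -- The inequality 1 ≤ C q turns the constant bound into a multiple of q, and thus of the height.
  have hq7 : -(17 * C ^ 8) * S.q p ≤ -(17 * C ^ 7) := by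
    have : 0 ≤ C ^ 7 := by positivity
    nlinarith
  calc _ = Real.exp (w z).2 * (-(17 * C ^ 8) * S.q p) := by ring
    _ ≤ _ := by gcongr; exact hq7.trans hfin

/-- The first derivatives are e^σ times terms of size C (1 + ‖A‖). Coercivity bounds ‖A‖ by √(Om(A,
K A)), and 1 ≤ C q turns e^σ into the height. -/
lemma IsBound.abs_fderiv_le [FiniteDimensional ℝ F] (hC : 1 ≤ C) (hw : ContDiffAt ℝ ∞ w z)
    (hp : (z, (w z).1) ∈ S.D) (hs : S.IsSolAt w z) (hb : S.IsBound C (z, (w z).1)) (v : ℂ) :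
    |fderiv ℝ (S.height w) z v| ≤ 4 * C ^ 4 * S.height w z *
      (1 + √(S.Om (z, (w z).1) (S.A w z) (S.K (z, (w z).1) (S.A w z)))) * ‖v‖ := by
  have hwd : DifferentiableAt ℝ w z := hw.differentiableAt (by simp)
  have e1 := fderiv_height_one hwd hp hs
  have e2 := fderiv_height_I hwd hp hs
  have h1 := hb.norm_fderiv_one
  have h2 := hb.norm_fderiv_I hs
  have hA := hb.norm_A_le hC (S.A w z)
  have hq := hb.le_q
  set p := (z, (w z).1) with hpdef
  set R := √(S.Om p (S.A w z) (S.K p (S.A w z)))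
  have hR : 0 ≤ R := Real.sqrt_nonneg _
  have hal : ∀ y : F × ℝ, ∀ a : ℝ, ‖y‖ ≤ a → |S.α (w z).1 y.1| ≤ C * a := fun y a hy ↦
    ((S.α (w z).1).le_opNorm _).trans
      (mul_le_mul hb.α ((norm_fst_le y).trans hy) (norm_nonneg _) (by linarith))
  have hc3 : C ^ 2 ≤ C ^ 3 := pow_le_pow_right₀ hC (by norm_num)
  have hc1 : C ≤ C ^ 3 := le_self_pow₀ hC (by norm_num)
  have hb2 : C + C * ‖S.A w z‖ ≤ C + C * (C * R) := by gcongr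
  have a1 : |S.α (w z).1 (fderiv ℝ w z Complex.I).1 + S.a p| ≤ 2 * C ^ 3 * (1 + R) := by
    refine (abs_add_le _ _).trans ((add_le_add (hal _ _ (h2.trans hb2)) hb.a).trans ?_)
    nlinarith [mul_nonneg (by positivity : 0 ≤ C ^ 3) hR]
  have a2 : |-S.α (w z).1 (fderiv ℝ w z 1).1 + S.b p| ≤ 2 * C ^ 3 * (1 + R) := by
    refine (abs_add_le _ _).trans ?_
    rw [abs_neg]
    refine (add_le_add (hal _ _ h1) hb.b).trans ?_
    have : C * ‖S.A w z‖ ≤ C * (C * R) := by gcongr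
    nlinarith [mul_nonneg (by positivity : 0 ≤ C ^ 3) hR, mul_le_mul_of_nonneg_right hc3 hR]
  have hB : Real.exp (w z).2 * (2 * C ^ 3 * (1 + R)) ≤ 2 * C ^ 4 * S.height w z * (1 + R) := by
    have : 2 * C ^ 4 * S.height w z * (1 + R)
      = Real.exp (w z).2 * (2 * C ^ 3 * (1 + R)) * (C * S.q p) := by rw [height]; ring
    rw [this]
    exact le_mul_of_one_le_right (by positivity) hq
  have d1 : |fderiv ℝ (S.height w) z 1| ≤ 2 * C ^ 4 * S.height w z * (1 + R) := by
    rw [e1, abs_mul, Real.abs_exp]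
    exact le_trans (by gcongr) hB
  have d2 : |fderiv ℝ (S.height w) z Complex.I| ≤ 2 * C ^ 4 * S.height w z * (1 + R) := by
    rw [e2, abs_mul, Real.abs_exp]
    exact le_trans (by gcongr) hB
  have hv : v = v.re • (1 : ℂ) + v.im • Complex.I := by
    rw [Complex.real_smul, Complex.real_smul, mul_one, Complex.re_add_im]
  have hP := (abs_nonneg _).trans d1
  calc |fderiv ℝ (S.height w) z v|
      = |v.re * fderiv ℝ (S.height w) z 1 + v.im * fderiv ℝ (S.height w) z Complex.I| := by
        conv_lhs => rw [hv]
        rw [map_add, map_smul, map_smul, smul_eq_mul, smul_eq_mul]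
    _ ≤ |v.re| * |fderiv ℝ (S.height w) z 1| + |v.im| * |fderiv ℝ (S.height w) z Complex.I| := by
        rw [← abs_mul, ← abs_mul]; exact abs_add_le _ _
    _ ≤ ‖v‖ * (2 * C ^ 4 * S.height w z * (1 + R)) + ‖v‖ * (2 * C ^ 4 * S.height w z * (1 + R)) := by
        gcongr
        · exact Complex.abs_re_le_norm v
        · exact Complex.abs_im_le_norm v
    _ = _ := by ring

end

end LocalData

/-! ### A maximum principle and a growth estimate along curves -/

section Scalar

/-- If the second derivative along a line were positive, the maximum would also be a local minimum
on that line. The function would be constant there, with vanishing second derivative. -/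
lemma fderiv_fderiv_nonpos_of_isLocalMax {f : ℂ → ℝ} {z : ℂ} (hf : ContDiffAt ℝ 2 f z)
    (hmax : IsLocalMax f z) (e : ℂ) :
    fderiv ℝ (fun z ↦ fderiv ℝ f z e) z e ≤ 0 := by
  by_contra! hpos
  let c : ℝ → ℂ := fun t ↦ z + t • e
  have hc : ∀ t, HasDerivAt c e t := fun t ↦ by
    have := ((hasDerivAt_id t).smul_const e).const_add z
    rwa [one_smul] at this
  have hc0 : c 0 = z := by simp [c]
  have hct : Tendsto c (𝓝 0) (𝓝 z) := by
    have := (hc 0).continuousAt.tendsto; rwa [hc0] at this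
  have hd : ∀ᶠ t in 𝓝 (0 : ℝ), deriv (f ∘ c) t = fderiv ℝ f (c t) e := by
    have h1 : ∀ᶠ z' in 𝓝 z, DifferentiableAt ℝ f z' := by
      filter_upwards [hf.eventually (by simp)] with z' h using h.differentiableAt (by simp)
    filter_upwards [hct.eventually h1] with t ht
    exact (ht.hasFDerivAt.comp_hasDerivAt t (hc t)).deriv
  have h2 : DifferentiableAt ℝ (fun z ↦ fderiv ℝ f z e) z :=
    (((hf.fderiv_right (m := 1) (by norm_num)).differentiableAt (by simp)).clm_apply
      (differentiableAt_const e))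
  have hdd : deriv (deriv (f ∘ c)) 0 = fderiv ℝ (fun z ↦ fderiv ℝ f z e) z e := by
    rw [EventuallyEq.deriv_eq hd]
    have h2' : HasFDerivAt (fun z ↦ fderiv ℝ f z e) (fderiv ℝ (fun z ↦ fderiv ℝ f z e) z) (c 0) := by
      rw [hc0]; exact h2.hasFDerivAt
    exact (h2'.comp_hasDerivAt 0 (hc 0)).deriv
  have hmax' : IsLocalMax (f ∘ c) 0 := by
    have : ∀ᶠ t in 𝓝 (0 : ℝ), f (c t) ≤ f z := hct.eventually hmax
    simpa [IsLocalMax, IsMaxFilter, hc0] using this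
  have hcont : ContinuousAt (f ∘ c) 0 := by
    refine ContinuousAt.comp ?_ (hc 0).continuousAt
    rw [hc0]; exact hf.continuousAt
  have hmin := isLocalMin_of_deriv_deriv_pos (hdd ▸ hpos) hmax'.deriv_eq_zero hcont
  have hconst : f ∘ c =ᶠ[𝓝 0] fun _ ↦ (f ∘ c) 0 := by
    filter_upwards [hmax', hmin] with t h1 h2 using le_antisymm h1 h2
  have : deriv (deriv (f ∘ c)) 0 = 0 := by
    rw [hconst.deriv.deriv_eq]; simp
  rw [hdd] at this
  exact hpos.ne' this

lemma lap_nonpos_of_isLocalMax {f : ℂ → ℝ} {z : ℂ} (hf : ContDiffAt ℝ 2 f z)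
    (hmax : IsLocalMax f z) : lap f z ≤ 0 :=
  add_nonpos (fderiv_fderiv_nonpos_of_isLocalMax hf hmax 1)
    (fderiv_fderiv_nonpos_of_isLocalMax hf hmax Complex.I)

lemma lap_sub {f g : ℂ → ℝ} {z : ℂ} (hf : ContDiffAt ℝ 2 f z) (hg : ContDiffAt ℝ 2 g z) :
    lap (fun z ↦ f z - g z) z = lap f z - lap g z := by
  have key : ∀ e : ℂ, fderiv ℝ (fun z' ↦ fderiv ℝ (fun z ↦ f z - g z) z' e) z e
      = fderiv ℝ (fun z ↦ fderiv ℝ f z e) z e - fderiv ℝ (fun z ↦ fderiv ℝ g z e) z e := by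
    intro e
    have h1 : ∀ {h : ℂ → ℝ}, ContDiffAt ℝ 2 h z → ∀ᶠ z' in 𝓝 z, DifferentiableAt ℝ h z' := by
      intro h hh
      filter_upwards [hh.eventually (by simp)] with z' h using h.differentiableAt (by simp)
    have h2 : ∀ {h : ℂ → ℝ}, ContDiffAt ℝ 2 h z →
        DifferentiableAt ℝ (fun z ↦ fderiv ℝ h z e) z := fun hh ↦
      (((hh.fderiv_right (m := 1) (by norm_num)).differentiableAt (by simp)).clm_apply
        (differentiableAt_const e))
    have h3 : (fun z' ↦ fderiv ℝ (fun z ↦ f z - g z) z' e) =ᶠ[𝓝 z]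
        fun z' ↦ fderiv ℝ f z' e - fderiv ℝ g z' e := by
      filter_upwards [h1 hf, h1 hg] with z' a b
      rw [fderiv_fun_sub a b]; rfl
    rw [h3.fderiv_eq, fderiv_fun_sub (h2 hf) (h2 hg)]; rfl
  rw [lap, key, key, lap, lap]; ring

/-- A positive eigenfunction of the Laplacian on a narrow strip. -/
def stripCos (μ s₀ : ℝ) (z : ℂ) : ℝ := Real.cos (μ * (z.re - s₀))

lemma contDiff_stripCos (μ s₀ : ℝ) {n : WithTop ℕ∞} : ContDiff ℝ n (stripCos μ s₀) := by
  have : ContDiff ℝ n (fun z : ℂ ↦ Complex.reCLM z) := Complex.reCLM.contDiff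
  exact Real.contDiff_cos.comp (contDiff_const.mul (this.sub contDiff_const))

lemma lap_stripCos (μ s₀ m : ℝ) (z : ℂ) :
    lap (fun z ↦ m * stripCos μ s₀ z) z = - μ ^ 2 * (m * stripCos μ s₀ z) := by
  have h1 : ∀ z : ℂ, HasFDerivAt (fun z : ℂ ↦ μ * (z.re - s₀)) (μ • Complex.reCLM) z := fun z ↦
    ((Complex.reCLM.hasFDerivAt (x := z)).sub_const s₀).const_mul μ
  have h2 : ∀ z e : ℂ, fderiv ℝ (fun z ↦ m * stripCos μ s₀ z) z e
      = m * (- Real.sin (μ * (z.re - s₀)) * (μ * e.re)) := by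
    intro z e
    have h := ((h1 z).cos.const_mul m).fderiv
    refine (congrArg (fun l ↦ l e) h).trans ?_
    simp
  have h3 : ∀ z e : ℂ, fderiv ℝ (fun z ↦ fderiv ℝ (fun z ↦ m * stripCos μ s₀ z) z e) z e
      = m * (- Real.cos (μ * (z.re - s₀)) * (μ * e.re) * (μ * e.re)) := by
    intro z e
    simp only [h2]
    have h := ((((h1 z).sin.neg).mul_const (μ * e.re)).const_mul m).fderiv
    refine (congrArg (fun l ↦ l e) h).trans ?_
    simp only [smul_apply, neg_apply, smul_eq_mul, Complex.reCLM_apply]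
    ring
  rw [lap, h3, h3, stripCos]
  simp
  ring

/-- With m the value of the quotient at z, the function ρ - m cos has a local maximum at z with
value 0, and the cosine is an eigenfunction with eigenvalue -μ². -/
lemma lap_le_of_isLocalMax_div {ρ : ℂ → ℝ} {z : ℂ} {μ s₀ : ℝ} (hρ : ContDiffAt ℝ 2 ρ z)
    (hpos : 0 < stripCos μ s₀ z) (hmax : IsLocalMax (fun z ↦ ρ z / stripCos μ s₀ z) z) :
    lap ρ z ≤ - μ ^ 2 * ρ z := by
  set m := ρ z / stripCos μ s₀ z with hm
  have hw : ContDiffAt ℝ 2 (fun z ↦ m * stripCos μ s₀ z) z :=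
    contDiffAt_const.mul (contDiff_stripCos μ s₀).contDiffAt
  have h1 : IsLocalMax (fun z ↦ ρ z - m * stripCos μ s₀ z) z := by
    have hc : ∀ᶠ z' in 𝓝 z, 0 < stripCos μ s₀ z' :=
      (contDiff_stripCos μ s₀ (n := 0)).continuous.continuousAt.eventually (lt_mem_nhds hpos)
    filter_upwards [hmax, hc] with z' h h'
    have hz : ρ z - m * stripCos μ s₀ z = 0 := by rw [hm]; field_simp; ring
    rw [hz, sub_nonpos, ← div_le_iff₀ h']
    exact h
  have h2 := lap_nonpos_of_isLocalMax (hρ.sub hw) h1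
  rw [lap_sub hρ hw, lap_stripCos] at h2
  have : m * stripCos μ s₀ z = ρ z := by rw [hm]; field_simp
  rw [this] at h2
  linarith

lemma norm_sub_le_of_lintegral_deriv {G : Type*} [NormedAddCommGroup G] [NormedSpace ℝ G]
    [CompleteSpace G] {f : ℝ → G} {t₀ t₁ D : ℝ} (h01 : t₀ ≤ t₁)
    (hf : ∀ t ∈ Icc t₀ t₁, ContDiffAt ℝ 1 f t) (hD : 0 ≤ D)
    (hint : ∫⁻ t in Icc t₀ t₁, ‖deriv f t‖ₑ ≤ ENNReal.ofReal D) : ‖f t₁ - f t₀‖ ≤ D := by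
  have hcont : ContinuousOn (deriv f) (Icc t₀ t₁) := by
    intro t ht
    have h1 : ContinuousAt (fderiv ℝ f) t :=
      ((hf t ht).fderiv_right (m := 0) (by norm_num)).continuousAt
    exact (h1.clm_apply continuousAt_const).continuousWithinAt
  have hFTC : ∫ t in t₀..t₁, deriv f t = f t₁ - f t₀ := by
    apply intervalIntegral.integral_deriv_eq_sub
    · intro t ht
      rw [uIcc_of_le h01] at ht
      exact (hf t ht).differentiableAt (by simp)
    · apply ContinuousOn.intervalIntegrable
      rwa [uIcc_of_le h01]
  rw [← hFTC, intervalIntegral.integral_of_le h01]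
  have h1 := enorm_integral_le_lintegral_enorm (μ := volume.restrict (Ioc t₀ t₁)) (deriv f)
  have h2 : ‖∫ t in Ioc t₀ t₁, deriv f t‖ₑ ≤ ENNReal.ofReal D :=
    h1.trans ((lintegral_mono_set Ioc_subset_Icc_self).trans hint)
  rw [← ofReal_norm] at h2
  exact (ENNReal.ofReal_le_ofReal_iff hD).mp h2

/-- A function whose logarithmic derivative is bounded by `C (1 + √e)` where it exceeds `B` grows
by a bounded factor. -/
lemma growth_le {f e : ℝ → ℝ} {t₀ t₁ B C I : ℝ} (h01 : t₀ ≤ t₁) (hB : 0 < B) (hC : 0 ≤ C)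
    (hI : 0 ≤ I) (h0 : f t₀ ≤ B)
    (hcont : ContinuousOn (fun t ↦ max (f t) B) (Icc t₀ t₁))
    (hf : ∀ t ∈ Icc t₀ t₁, B < f t → ContDiffAt ℝ 1 f t ∧ 0 ≤ e t ∧
      |deriv f t| ≤ C * f t * (1 + √(e t)))
    (hint : ∫⁻ t in Icc t₀ t₁ ∩ {t | B < f t}, ENNReal.ofReal (e t) ≤ ENNReal.ofReal I) :
    f t₁ ≤ B * Real.exp (C * (2 * (t₁ - t₀) + I)) := by
  have hE1 : 1 ≤ Real.exp (C * (2 * (t₁ - t₀) + I)) :=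
    Real.one_le_exp (mul_nonneg hC (by linarith))
  by_cases h1 : f t₁ ≤ B
  · exact h1.trans (le_mul_of_one_le_right hB.le hE1)
  push Not at h1
  -- The times at which f ≤ B. The logarithm is estimated only after the last of them, where f > B
  -- and the differential inequality is available.
  let Z : Set ℝ := {t ∈ Icc t₀ t₁ | max (f t) B ≤ B}
  have hZc : IsCompact Z := by
    have := hcont.preimage_isClosed_of_isClosed isClosed_Icc (isClosed_Iic (a := B))
    exact isCompact_Icc.of_isClosed_subset this (fun t ht ↦ ht.1)
  obtain ⟨τ, hτZ, hτ⟩ := hZc.exists_isGreatest ⟨t₀, ⟨le_rfl, h01⟩, by simp [h0]⟩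
  have hτ1 : τ < t₁ := lt_of_le_of_ne hτZ.1.2 (by
    rintro rfl; exact absurd ((le_max_left _ _).trans hτZ.2) h1.not_ge)
  have hgt : ∀ t ∈ Ioc τ t₁, B < f t := by
    intro t ht
    by_contra! hle
    exact absurd (hτ ⟨⟨hτZ.1.1.trans ht.1.le, ht.2⟩, by simp [hle]⟩) ht.1.not_ge
  have key : ∀ t ∈ Ioc τ t₁, f t₁ ≤ max (f t) B * Real.exp (C * (2 * (t₁ - t₀) + I)) := by
    intro t ht
    have hsub : Icc t t₁ ⊆ Icc t₀ t₁ ∩ {t | B < f t} := fun s hs ↦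
      ⟨⟨(hτZ.1.1.trans ht.1.le).trans hs.1, hs.2⟩, hgt s ⟨ht.1.trans_le hs.1, hs.2⟩⟩
    have hfp : ∀ s ∈ Icc t t₁, 0 < f s := fun s hs ↦ hB.trans (hsub hs).2
    have hlog : ‖Real.log (f t₁) - Real.log (f t)‖ ≤ C * (2 * (t₁ - t₀) + I) := by
      refine norm_sub_le_of_lintegral_deriv (f := fun s ↦ Real.log (f s)) ht.2
        (fun s hs ↦ ?_) (mul_nonneg hC (by linarith)) ?_
      · exact (hf s (hsub hs).1 (hsub hs).2).1.log (hfp s hs).ne'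
      · calc ∫⁻ s in Icc t t₁, ‖deriv (fun s ↦ Real.log (f s)) s‖ₑ
            ≤ ∫⁻ s in Icc t t₁, ENNReal.ofReal C * (2 + ENNReal.ofReal (e s)) := by
              refine setLIntegral_mono' measurableSet_Icc fun s hs ↦ ?_
              obtain ⟨hs1, hs2, hs3⟩ := hf s (hsub hs).1 (hsub hs).2
              have hd := (hs1.differentiableAt (by simp)).hasDerivAt.log (hfp s hs).ne'
              rw [hd.deriv, ← ofReal_norm, Real.norm_eq_abs, abs_div,
                abs_of_pos (hfp s hs), show (2 : ℝ≥0∞) = ENNReal.ofReal 2 by simp,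
                ← ENNReal.ofReal_add (by norm_num) hs2, ← ENNReal.ofReal_mul hC]
              apply ENNReal.ofReal_le_ofReal
              rw [div_le_iff₀ (hfp s hs)]
              refine hs3.trans ?_
              have h5 : √(e s) ≤ 1 + e s := by
                nlinarith [Real.sq_sqrt hs2, sq_nonneg (√(e s) - 1), Real.sqrt_nonneg (e s)]
              have h6 : C * f s * (1 + √(e s)) ≤ C * f s * (2 + e s) := by
                exact mul_le_mul_of_nonneg_left (by linarith) (mul_nonneg hC (hfp s hs).le)
              linarith
          _ ≤ ENNReal.ofReal C * (2 * ENNReal.ofReal (t₁ - t₀) + ENNReal.ofReal I) := by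
              rw [lintegral_const_mul' _ _ ENNReal.ofReal_ne_top,
                lintegral_add_left measurable_const, setLIntegral_const, Real.volume_Icc]
              have := (lintegral_mono_set hsub).trans hint
              have h7 := hτZ.1.1.trans ht.1.le
              gcongr
          _ = _ := by
              rw [ENNReal.ofReal_mul hC, ENNReal.ofReal_add (by linarith) hI,
                ENNReal.ofReal_mul (by norm_num)]
              simp
    have h8 := (Real.le_norm_self _).trans hlog
    have ht' := hfp t ⟨le_rfl, ht.2⟩
    rw [max_eq_left (hgt t ht).le, ← Real.exp_log (hfp t₁ ⟨ht.2, le_rfl⟩)]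
    conv_rhs => rw [← Real.exp_log ht', ← Real.exp_add]
    exact Real.exp_le_exp.mpr (by linarith)
  -- Only max(f, B) is assumed continuous: the height is extended by zero off the conical end and
  -- may jump. Letting t decrease to the last low time replaces max(f t, B) by B.
  have hlim : Tendsto (fun t ↦ max (f t) B * Real.exp (C * (2 * (t₁ - t₀) + I))) (𝓝[>] τ)
      (𝓝 (max (f τ) B * Real.exp (C * (2 * (t₁ - t₀) + I)))) := by
    have h9 := (hcont τ hτZ.1).tendsto
    refine Tendsto.mul_const _ (h9.mono_left ?_)
    rw [← nhdsWithin_Ioc_eq_nhdsGT hτ1]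
    exact nhdsWithin_mono _ fun s hs ↦ ⟨hτZ.1.1.trans hs.1.le, hs.2⟩
  have := ge_of_tendsto hlim (by
    rw [← nhdsWithin_Ioc_eq_nhdsGT hτ1]
    exact eventually_nhdsWithin_of_forall key)
  rwa [le_antisymm hτZ.2 (le_max_right _ _)] at this

end Scalar

/-! ### Pulling back one-forms -/

section Pull

variable {E : Type*} [NormedAddCommGroup E] [NormedSpace ℝ E]
  {X : Type*} [TopologicalSpace X] [ChartedSpace E X] [IsManifold 𝓘(ℝ, E) ∞ X]
  {V : Type*} [NormedAddCommGroup V] [NormedSpace ℝ V]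

/-- The pullback of a `1`-form by a map from a vector space. -/
def pullForm (C : V → X) (η : OneForm E X) (e : V) : V →L[ℝ] ℝ :=
  (η (C e)).comp (mfderiv 𝓘(ℝ, V) 𝓘(ℝ, E) C e)

lemma mfderiv_symm_mfderiv {x₀ x : X} (hx : x ∈ (chartAt E x₀).source)
    (v : TangentSpace 𝓘(ℝ, E) x) :
    mfderiv 𝓘(ℝ, E) 𝓘(ℝ, E) (extChartAt 𝓘(ℝ, E) x₀).symm (extChartAt 𝓘(ℝ, E) x₀ x)
      (mfderiv 𝓘(ℝ, E) 𝓘(ℝ, E) (extChartAt 𝓘(ℝ, E) x₀) x v) = v := by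
  have h := mfderivWithin_extChartAt_symm_comp_mfderiv_extChartAt' (I := 𝓘(ℝ, E)) (x := x₀)
    (y := x) (by simpa using hx)
  simp only [modelWithCornersSelf_coe, range_id, mfderivWithin_univ] at h
  exact congrArg (fun l ↦ l v) h

lemma readChart {U : Set V} (hU : IsOpen U) {C : V → X}
    (hC : ContMDiffOn 𝓘(ℝ, V) 𝓘(ℝ, E) ∞ C U) {e : V} (he : e ∈ U) {x₀ : X}
    (hx : C e ∈ (chartAt E x₀).source) :
    ContDiffAt ℝ ∞ (extChartAt 𝓘(ℝ, E) x₀ ∘ C) e ∧ ∀ v : V,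
      fderiv ℝ (extChartAt 𝓘(ℝ, E) x₀ ∘ C) e v = mfderiv 𝓘(ℝ, E) 𝓘(ℝ, E)
        (extChartAt 𝓘(ℝ, E) x₀) (C e) (mfderiv 𝓘(ℝ, V) 𝓘(ℝ, E) C e v) := by
  have h1 : ContMDiffAt 𝓘(ℝ, V) 𝓘(ℝ, E) ∞ C e := hC.contMDiffAt (hU.mem_nhds he)
  have h2 : ContMDiffAt 𝓘(ℝ, E) 𝓘(ℝ, E) ∞ (extChartAt 𝓘(ℝ, E) x₀) (C e) :=
    contMDiffAt_extChartAt' hx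
  refine ⟨(h2.comp e h1).contDiffAt, fun v ↦ ?_⟩
  have h3 := mfderiv_comp e (h2.mdifferentiableAt (by simp)) (h1.mdifferentiableAt (by simp))
  rw [mfderiv_eq_fderiv] at h3
  exact congrArg (fun l ↦ l v) h3

lemma chartForm_mfderiv (η : OneForm E X) {x₀ x : X} (hx : x ∈ (chartAt E x₀).source)
    (v : TangentSpace 𝓘(ℝ, E) x) :
    chartForm η x₀ (extChartAt 𝓘(ℝ, E) x₀ x)
      (mfderiv 𝓘(ℝ, E) 𝓘(ℝ, E) (extChartAt 𝓘(ℝ, E) x₀) x v) = η x v := by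
  have h := mfderiv_symm_mfderiv hx v
  have h' : (extChartAt 𝓘(ℝ, E) x₀).symm (extChartAt 𝓘(ℝ, E) x₀ x) = x :=
    (extChartAt 𝓘(ℝ, E) x₀).left_inv (by simpa using hx)
  have key : ∀ (y : X) (hy : y = x) (w : E), η y w = η x w := by rintro y rfl w; rfl
  exact (key _ h' _).trans (congrArg (η x) h)

/-- Trivialising the cotangent bundle at x₀ gives smoothness at the centre of the chart. The rest of
the chart domain is reached in `smooth_chartForm`, by pulling back along the inverse chart. -/
lemma smooth_chartForm_self {η : OneForm E X} (hη : SmoothForm η) (x₀ : X) :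
    ContDiffAt ℝ ∞ (chartForm η x₀) (extChartAt 𝓘(ℝ, E) x₀ x₀) := by
  have h1 := ((contMDiffAt_hom_bundle _).mp (hη x₀)).2
  have h2 : ContMDiffAt 𝓘(ℝ, E) 𝓘(ℝ, E) ∞ (extChartAt 𝓘(ℝ, E) x₀).symm
      (extChartAt 𝓘(ℝ, E) x₀ x₀) :=
    (contMDiffOn_extChartAt_symm x₀).contMDiffAt (extChartAt_target_mem_nhds x₀)
  have h3 := ContMDiffAt.comp_of_eq (f := (extChartAt 𝓘(ℝ, E) x₀).symm) h1 h2
    (extChartAt_to_inv x₀)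
  refine h3.contDiffAt.congr_of_eventuallyEq ?_
  filter_upwards [extChartAt_target_mem_nhds (I := 𝓘(ℝ, E)) x₀] with e he
  have hx : (extChartAt 𝓘(ℝ, E) x₀).symm e ∈ (chartAt E x₀).source := by
    simpa using (extChartAt 𝓘(ℝ, E) x₀).map_target he
  refine ContinuousLinearMap.ext fun v ↦ ?_
  simp only [Function.comp, ContinuousLinearMap.inCoordinates, ContinuousLinearMap.comp_apply]
  rw [TangentBundle.symmL_trivializationAt hx]
  simp only [modelWithCornersSelf_coe, range_id, mfderivWithin_univ]
  rw [(extChartAt 𝓘(ℝ, E) x₀).right_inv he]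
  simp [chartForm]
  rfl

lemma pullForm_eventuallyEq (η : OneForm E X) {U : Set V} (hU : IsOpen U) {C : V → X}
    (hC : ContMDiffOn 𝓘(ℝ, V) 𝓘(ℝ, E) ∞ C U) {e : V} (he : e ∈ U) :
    pullForm C η =ᶠ[𝓝 e] fun e' ↦ (chartForm η (C e) ((extChartAt 𝓘(ℝ, E) (C e) ∘ C) e')).comp
      (fderiv ℝ (extChartAt 𝓘(ℝ, E) (C e) ∘ C) e') := by
  have h1 : ∀ᶠ e' in 𝓝 e, C e' ∈ (chartAt E (C e)).source :=
    (hC.continuousOn.continuousAt (hU.mem_nhds he)).preimage_mem_nhds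
      ((chartAt E (C e)).open_source.mem_nhds (mem_chart_source E (C e)))
  filter_upwards [h1, hU.mem_nhds he] with e' hx he'
  refine ContinuousLinearMap.ext fun v ↦ ?_
  rw [ContinuousLinearMap.comp_apply, (readChart hU hC he' hx).2 v]
  exact (chartForm_mfderiv η hx _).symm

lemma smooth_pullForm {η : OneForm E X} (hη : SmoothForm η) {U : Set V} (hU : IsOpen U) {C : V → X}
    (hC : ContMDiffOn 𝓘(ℝ, V) 𝓘(ℝ, E) ∞ C U) {e : V} (he : e ∈ U) :
    ContDiffAt ℝ ∞ (pullForm C η) e := by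
  refine ContDiffAt.congr_of_eventuallyEq ?_ (pullForm_eventuallyEq η hU hC he)
  obtain ⟨h1, -⟩ := readChart hU hC he (mem_chart_source E (C e))
  exact ((smooth_chartForm_self hη (C e)).comp e h1).clm_comp
    (h1.fderiv_right (m := ∞) (by simp))

/-- Naturality of the exterior derivative: the term with the second derivative of the map is
symmetric and drops out on antisymmetrising. It also frees `dForm` from the chart used to define it.
-/
lemma dForm_pull {η : OneForm E X} (hη : SmoothForm η) {U : Set V} (hU : IsOpen U) {C : V → X}
    (hC : ContMDiffOn 𝓘(ℝ, V) 𝓘(ℝ, E) ∞ C U) {e : V} (he : e ∈ U) (v w : V) :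
    dForm η (C e) (mfderiv 𝓘(ℝ, V) 𝓘(ℝ, E) C e v) (mfderiv 𝓘(ℝ, V) 𝓘(ℝ, E) C e w)
      = fderiv ℝ (pullForm C η) e v w - fderiv ℝ (pullForm C η) e w v := by
  obtain ⟨h1, h2⟩ := readChart hU hC he (mem_chart_source E (C e))
  set φ := extChartAt 𝓘(ℝ, E) (C e)
  have h3 := ((smooth_chartForm_self hη (C e)).differentiableAt (by simp)).hasFDerivAt
  have h4 : HasFDerivAt (φ ∘ C) (fderiv ℝ (φ ∘ C) e) e :=
    (h1.differentiableAt (by simp)).hasFDerivAt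
  have h5 : HasFDerivAt (fderiv ℝ (φ ∘ C)) (fderiv ℝ (fderiv ℝ (φ ∘ C)) e) e :=
    ((h1.fderiv_right (m := ∞) (by simp)).differentiableAt (by simp)).hasFDerivAt
  have h6 := (HasFDerivAt.comp (f := φ ∘ C) e h3 h4).clm_comp h5
  have hsymm : fderiv ℝ (fderiv ℝ (φ ∘ C)) e v w = fderiv ℝ (fderiv ℝ (φ ∘ C)) e w v :=
    (h1.isSymmSndFDerivAt (by simpa using WithTop.coe_le_coe.mpr (le_top (a := (2 : ℕ∞))))).eq v w
  rw [(pullForm_eventuallyEq η hU hC he).fderiv_eq]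
  erw [h6.fderiv]
  simp [hsymm, dForm, h2]
  rfl

lemma contMDiffOn_symm (x₀ : X) : ContMDiffOn 𝓘(ℝ, E) 𝓘(ℝ, E) ∞ (extChartAt 𝓘(ℝ, E) x₀).symm
    (extChartAt 𝓘(ℝ, E) x₀).target := contMDiffOn_extChartAt_symm x₀

omit [IsManifold 𝓘(ℝ, E) ∞ X] in
lemma isOpen_target (x₀ : X) : IsOpen (extChartAt 𝓘(ℝ, E) x₀).target := by
  exact isOpen_extChartAt_target x₀

lemma smooth_chartForm {η : OneForm E X} (hη : SmoothForm η) {x₀ : X} {e : E}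
    (he : e ∈ (extChartAt 𝓘(ℝ, E) x₀).target) : ContDiffAt ℝ ∞ (chartForm η x₀) e :=
  smooth_pullForm hη (isOpen_target x₀) (contMDiffOn_symm x₀) he

lemma dForm_symm {η : OneForm E X} (hη : SmoothForm η) {x₀ : X} {e : E}
    (he : e ∈ (extChartAt 𝓘(ℝ, E) x₀).target) (v w : E) :
    dForm η ((extChartAt 𝓘(ℝ, E) x₀).symm e)
      (mfderiv 𝓘(ℝ, E) 𝓘(ℝ, E) (extChartAt 𝓘(ℝ, E) x₀).symm e v)
      (mfderiv 𝓘(ℝ, E) 𝓘(ℝ, E) (extChartAt 𝓘(ℝ, E) x₀).symm e w)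
      = fderiv ℝ (chartForm η x₀) e v w - fderiv ℝ (chartForm η x₀) e w v :=
  dForm_pull hη (isOpen_target x₀) (contMDiffOn_symm x₀) he v w

end Pull

/-! ### Logarithmic coordinates on the conical end -/

section Cone

variable {E : Type*} [NormedAddCommGroup E] [NormedSpace ℝ E]
  {X : Type*} [TopologicalSpace X] [ChartedSpace E X] [IsManifold 𝓘(ℝ, E) ∞ X]
  {F : Type*} [NormedAddCommGroup F] [NormedSpace ℝ F]
  {M : Type*} [TopologicalSpace M] [ChartedSpace F M] [IsManifold 𝓘(ℝ, F) ∞ M]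

/-- The coordinate vector fields of the chart at `y₀`. -/
def coordVec (y₀ : M) (f : F) : F →L[ℝ] TangentSpace 𝓘(ℝ, F) ((extChartAt 𝓘(ℝ, F) y₀).symm f) :=
  mfderiv 𝓘(ℝ, F) 𝓘(ℝ, F) (extChartAt 𝓘(ℝ, F) y₀).symm f

omit [IsManifold 𝓘(ℝ, F) ∞ M] in
lemma chartForm_apply (α : OneForm F M) (y₀ : M) (f v : F) :
    chartForm α y₀ f v = α ((extChartAt 𝓘(ℝ, F) y₀).symm f) (coordVec y₀ f v) := rfl

lemma coordVec_bijective {y₀ : M} {f : F} (hf : f ∈ (extChartAt 𝓘(ℝ, F) y₀).target) :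
    Function.Bijective (coordVec y₀ f) := by
  have h := isInvertible_mfderivWithin_extChartAt_symm (I := 𝓘(ℝ, F)) hf
  simp only [modelWithCornersSelf_coe, range_id, mfderivWithin_univ] at h
  exact h.bijective

/-- In the frame formed by the coordinate fields and r ∂_r the symplectic form is r times a form
independent of r. This homogeneity is the source of all uniformity at infinity. -/
lemma sympForm_coord {α : OneForm F M} (hα : SmoothForm α) {y₀ : M} {f : F}
    (hf : f ∈ (extChartAt 𝓘(ℝ, F) y₀).target) (r : ℝ) (V W : F × ℝ) :
    sympForm α ((extChartAt 𝓘(ℝ, F) y₀).symm f) r (coordVec y₀ f V.1, r * V.2)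
      (coordVec y₀ f W.1, r * W.2)
      = r * conicalForm (chartForm α y₀ f) (fderiv ℝ (chartForm α y₀) f) V W := by
  rw [sympForm, conicalForm_apply, chartForm_apply, chartForm_apply]
  simp only
  have h : dForm α ((extChartAt 𝓘(ℝ, F) y₀).symm f) (coordVec y₀ f V.1) (coordVec y₀ f W.1)
    = _ := dForm_symm hα hf V.1 W.1
  rw [h]
  ring

/-- A function read in the chart at `y₀`. -/
def readFun (g : M → ℝ) (y₀ : M) (f : F) : ℝ := g ((extChartAt 𝓘(ℝ, F) y₀).symm f)

lemma dFun_coord {g : M → ℝ} {y₀ : M} {f : F} (hf : f ∈ (extChartAt 𝓘(ℝ, F) y₀).target)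
    (hg : MDifferentiableAt 𝓘(ℝ, F) 𝓘(ℝ, ℝ) g ((extChartAt 𝓘(ℝ, F) y₀).symm f)) (v : F) :
    dFun g ((extChartAt 𝓘(ℝ, F) y₀).symm f) (coordVec y₀ f v) = fderiv ℝ (readFun g y₀) f v := by
  have h1 := (contMDiffOn_symm y₀).contMDiffAt ((isOpen_target y₀).mem_nhds hf)
  have h2 := mfderiv_comp f hg (h1.mdifferentiableAt (by simp))
  rw [mfderiv_eq_fderiv] at h2
  exact (congrArg (fun l ↦ l v) h2).symm

/-- The Hamiltonian vector field of a homogeneous Hamiltonian in coordinates. -/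
lemma isLiftedHamVec_coord {α : OneForm F M} (hα : SmoothForm α) {y₀ : M} {f : F}
    (hf : f ∈ (extChartAt 𝓘(ℝ, F) y₀).target) {g : M → ℝ}
    (hg : MDifferentiableAt 𝓘(ℝ, F) 𝓘(ℝ, ℝ) g ((extChartAt 𝓘(ℝ, F) y₀).symm f))
    {r : ℝ} (hr : 0 < r) (V : F × ℝ) :
    IsLiftedHamVec α g ((extChartAt 𝓘(ℝ, F) y₀).symm f) r (coordVec y₀ f V.1, r * V.2) ↔
      ∀ W : F × ℝ, conicalForm (chartForm α y₀ f) (fderiv ℝ (chartForm α y₀) f) V W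
        = fderiv ℝ (readFun g y₀) f W.1 + readFun g y₀ f * W.2 := by
  constructor
  · intro h W
    have h1 := h (coordVec y₀ f W.1, r * W.2)
    rw [sympForm_coord hα hf, dFun_coord hf hg] at h1
    have : r * conicalForm (chartForm α y₀ f) (fderiv ℝ (chartForm α y₀) f) V W
      = r * (fderiv ℝ (readFun g y₀) f W.1 + readFun g y₀ f * W.2) := by
      rw [h1, readFun]; ring
    exact mul_left_cancel₀ hr.ne' this
  · rintro h ⟨w, c⟩
    obtain ⟨w', rfl⟩ := (coordVec_bijective hf).2 w
    have h1 := sympForm_coord hα hf r V (w', c / r)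
    simp only [mul_div_cancel₀ c hr.ne'] at h1
    rw [h1, h, dFun_coord hf hg, readFun]
    simp only
    field_simp
    ring

namespace LiouvilleCompletion

variable (L : LiouvilleCompletion E X F M)

/-- Logarithmic coordinates on the conical end. -/
def param (y₀ : M) (e : F × ℝ) : X :=
  L.cone ((extChartAt 𝓘(ℝ, F) y₀).symm e.1, Real.exp e.2)

/-- The domain of `param`. -/
def paramDom (y₀ : M) : Set (F × ℝ) := (extChartAt 𝓘(ℝ, F) y₀).target ×ˢ univ

omit [NormedSpace ℝ E] [ChartedSpace E X] [IsManifold 𝓘(ℝ, E) ∞ X] [TopologicalSpace X] [NormedAddCommGroup E] [IsManifold 𝓘(ℝ, F) ∞ M] in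
lemma isOpen_paramDom (y₀ : M) : IsOpen (paramDom y₀ : Set (F × ℝ)) :=
  (isOpen_target y₀).prod isOpen_univ

omit [NormedSpace ℝ E] [ChartedSpace E X] [IsManifold 𝓘(ℝ, E) ∞ X] [TopologicalSpace X] [NormedAddCommGroup E] in
lemma smooth_preParam (y₀ : M) : ContMDiffOn 𝓘(ℝ, F × ℝ) (𝓘(ℝ, F).prod 𝓘(ℝ, ℝ)) ∞
    (fun e : F × ℝ ↦ ((extChartAt 𝓘(ℝ, F) y₀).symm e.1, Real.exp e.2)) (paramDom y₀) := by
  have h1 : ContMDiff 𝓘(ℝ, F × ℝ) 𝓘(ℝ, F) ∞ (Prod.fst : F × ℝ → F) := contDiff_fst.contMDiff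
  have h2 : ContMDiff 𝓘(ℝ, F × ℝ) 𝓘(ℝ, ℝ) ∞ (fun e : F × ℝ ↦ Real.exp e.2) :=
    (Real.contDiff_exp.comp contDiff_snd).contMDiff
  exact ((contMDiffOn_symm y₀).comp h1.contMDiffOn fun e he ↦ he.1).prodMk h2.contMDiffOn

lemma smooth_param (y₀ : M) :
    ContMDiffOn 𝓘(ℝ, F × ℝ) 𝓘(ℝ, E) ∞ (L.param y₀) (paramDom y₀) :=
  L.smooth_cone.comp (smooth_preParam y₀) fun _ _ ↦ ⟨mem_univ _, Real.exp_pos _⟩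

/-- The derivative of `param`. -/
def dParam (y₀ : M) (e : F × ℝ) : F × ℝ →L[ℝ] TangentSpace 𝓘(ℝ, E) (L.param y₀ e) :=
  mfderiv 𝓘(ℝ, F × ℝ) 𝓘(ℝ, E) (L.param y₀) e

lemma dParam_apply {y₀ : M} {e : F × ℝ} (he : e ∈ (paramDom y₀ : Set (F × ℝ))) (V : F × ℝ) :
    L.dParam y₀ e V = L.dCone ((extChartAt 𝓘(ℝ, F) y₀).symm e.1) (Real.exp e.2)
      (coordVec y₀ e.1 V.1, Real.exp e.2 * V.2) := by
  have hmem : ((extChartAt 𝓘(ℝ, F) y₀).symm e.1, Real.exp e.2) ∈ (univ ×ˢ Ioi 0 : Set (M × ℝ)) :=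
    ⟨mem_univ _, Real.exp_pos _⟩
  have h1 := (L.smooth_cone.contMDiffAt ((isOpen_univ.prod isOpen_Ioi).mem_nhds hmem)
    ).mdifferentiableAt (by simp)
  have h2 := ((smooth_preParam y₀).contMDiffAt ((isOpen_paramDom y₀).mem_nhds he)
    ).mdifferentiableAt (by simp)
  have h3 := mfderiv_comp e h1 h2
  have h4 : MDifferentiableAt 𝓘(ℝ, F × ℝ) 𝓘(ℝ, F)
      (fun e : F × ℝ ↦ (extChartAt 𝓘(ℝ, F) y₀).symm e.1) e := h2.fst
  have h5 : MDifferentiableAt 𝓘(ℝ, F × ℝ) 𝓘(ℝ, ℝ) (fun e : F × ℝ ↦ Real.exp e.2) e := h2.snd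
  have h6 := mfderiv_prodMk h4 h5
  have h7 : MDifferentiableAt 𝓘(ℝ, F) 𝓘(ℝ, F) (extChartAt 𝓘(ℝ, F) y₀).symm e.1 :=
    ((contMDiffOn_symm y₀).contMDiffAt ((isOpen_target y₀).mem_nhds he.1)).mdifferentiableAt
      (by simp)
  have h8 : MDifferentiableAt 𝓘(ℝ, F × ℝ) 𝓘(ℝ, F) (Prod.fst : F × ℝ → F) e :=
    differentiableAt_fst.mdifferentiableAt
  have h9 := mfderiv_comp e h7 h8
  have hfst : mfderiv 𝓘(ℝ, F × ℝ) 𝓘(ℝ, F) (Prod.fst : F × ℝ → F) e V = V.1 := by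
    rw [mfderiv_eq_fderiv, fderiv_fst]; rfl
  have h10 : mfderiv 𝓘(ℝ, F × ℝ) 𝓘(ℝ, ℝ) (fun e : F × ℝ ↦ Real.exp e.2) e V
      = Real.exp e.2 * V.2 := by
    rw [mfderiv_eq_fderiv, fderiv_exp differentiableAt_snd, fderiv_snd]; rfl
  have h11 : mfderiv 𝓘(ℝ, F × ℝ) 𝓘(ℝ, F)
      (fun e : F × ℝ ↦ (extChartAt 𝓘(ℝ, F) y₀).symm e.1) e V = coordVec y₀ e.1 V.1 := by
    refine (congrArg (fun l ↦ l V) h9).trans ?_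
    exact congrArg (coordVec y₀ e.1) hfst
  refine (congrArg (fun l ↦ l V) h3).trans ?_
  refine congrArg (L.dCone ((extChartAt 𝓘(ℝ, F) y₀).symm e.1) (Real.exp e.2)) ?_
  refine (congrArg (fun l ↦ l V) h6).trans ?_
  exact Prod.ext h11 h10

lemma dParam_bijective {y₀ : M} {e : F × ℝ} (he : e ∈ (paramDom y₀ : Set (F × ℝ))) :
    Function.Bijective (L.dParam y₀ e) := by
  have h0 := Real.exp_pos e.2
  have h1 : ⇑(L.dParam y₀ e) = L.dCone ((extChartAt 𝓘(ℝ, F) y₀).symm e.1) (Real.exp e.2) ∘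
      (fun V : F × ℝ ↦ ((coordVec y₀ e.1 V.1, Real.exp e.2 * V.2) :
        TangentSpace 𝓘(ℝ, F) ((extChartAt 𝓘(ℝ, F) y₀).symm e.1) × ℝ)) := by
    funext V; exact L.dParam_apply he V
  rw [h1]
  refine (L.bijective_cone _ _ h0).comp ?_
  exact (coordVec_bijective he.1).prodMap (mulLeft_bijective₀ _ h0.ne')

lemma lam_param {y₀ : M} {e : F × ℝ} (he : e ∈ (paramDom y₀ : Set (F × ℝ))) (V : F × ℝ) :
    pullForm (L.param y₀) L.lam e V = Real.exp e.2 * chartForm L.alpha y₀ e.1 V.1 := by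
  have h : pullForm (L.param y₀) L.lam e V = L.lam (L.param y₀ e) (L.dParam y₀ e V) := rfl
  rw [h, dParam_apply L he]
  exact L.pullback _ _ (Real.exp_pos _) _ _

/-- The form λ pulls back to e^σ α. Differentiating the exponential produces σ ∧ α, and the rest is
dα. -/
lemma omega_param {y₀ : M} {e : F × ℝ} (he : e ∈ (paramDom y₀ : Set (F × ℝ))) (V W : F × ℝ) :
    L.omega (L.param y₀ e) (L.dParam y₀ e V) (L.dParam y₀ e W) = Real.exp e.2 *
      conicalForm (chartForm L.alpha y₀ e.1) (fderiv ℝ (chartForm L.alpha y₀) e.1) V W := by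
  have h1 : L.omega (L.param y₀ e) (L.dParam y₀ e V) (L.dParam y₀ e W) = _ :=
    dForm_pull L.smooth_lam (isOpen_paramDom y₀) (L.smooth_param y₀) he V W
  rw [h1]
  have h2 : pullForm (L.param y₀) L.lam =ᶠ[𝓝 e] fun e ↦ Real.exp e.2 •
      (chartForm L.alpha y₀ e.1).comp (ContinuousLinearMap.fst ℝ F ℝ) := by
    filter_upwards [(isOpen_paramDom y₀).mem_nhds he] with e' he'
    refine ContinuousLinearMap.ext fun V ↦ ?_
    rw [L.lam_param he']
    simp
  have h3 : HasFDerivAt (chartForm L.alpha y₀) (fderiv ℝ (chartForm L.alpha y₀) e.1) e.1 :=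
    ((smooth_chartForm L.contact.smooth he.1).differentiableAt (by simp)).hasFDerivAt
  have h4 := HasFDerivAt.comp e h3 (hasFDerivAt_fst (𝕜 := ℝ) (p := e))
  have h5 := (hasFDerivAt_snd (𝕜 := ℝ) (p := e)).exp.smul
    (h4.clm_comp (hasFDerivAt_const (ContinuousLinearMap.fst ℝ F ℝ) e))
  rw [h2.fderiv_eq]
  erw [h5.fderiv]
  simp
  ring

end LiouvilleCompletion
end Cone

/-! ### Almost complex structures in charts, and lifts of maps into the conical end. -/

section Lift

variable {E : Type*} [NormedAddCommGroup E] [NormedSpace ℝ E]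
  {X : Type*} [TopologicalSpace X] [ChartedSpace E X] [IsManifold 𝓘(ℝ, E) ∞ X]
  {F : Type*} [NormedAddCommGroup F] [NormedSpace ℝ F]
  {M : Type*} [TopologicalSpace M] [ChartedSpace F M] [IsManifold 𝓘(ℝ, F) ∞ M]

/-- A family of endomorphism fields read in the chart at `x₀`. -/
def chartEnd {K : Type*} (J : K → EndField E X) (x₀ : X) (p : K × E) : E →L[ℝ] E :=
  (mfderiv 𝓘(ℝ, E) 𝓘(ℝ, E) (extChartAt 𝓘(ℝ, E) x₀) ((extChartAt 𝓘(ℝ, E) x₀).symm p.2)).comp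
    ((J p.1 ((extChartAt 𝓘(ℝ, E) x₀).symm p.2)).comp
      (mfderiv 𝓘(ℝ, E) 𝓘(ℝ, E) (extChartAt 𝓘(ℝ, E) x₀).symm p.2))

lemma chartEnd_mfderiv {K : Type*} (J : K → EndField E X) {x₀ x : X}
    (hx : x ∈ (chartAt E x₀).source) (z : K) (v : TangentSpace 𝓘(ℝ, E) x) :
    chartEnd J x₀ (z, extChartAt 𝓘(ℝ, E) x₀ x)
      (mfderiv 𝓘(ℝ, E) 𝓘(ℝ, E) (extChartAt 𝓘(ℝ, E) x₀) x v)
      = mfderiv 𝓘(ℝ, E) 𝓘(ℝ, E) (extChartAt 𝓘(ℝ, E) x₀) x (J z x v) := by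
  have h := mfderiv_symm_mfderiv hx v
  have h' : (extChartAt 𝓘(ℝ, E) x₀).symm (extChartAt 𝓘(ℝ, E) x₀ x) = x :=
    (extChartAt 𝓘(ℝ, E) x₀).left_inv (by simpa using hx)
  have key : ∀ (y : X) (hy : y = x) (w : E),
      (mfderiv 𝓘(ℝ, E) 𝓘(ℝ, E) (extChartAt 𝓘(ℝ, E) x₀) y (J z y w) : E)
      = mfderiv 𝓘(ℝ, E) 𝓘(ℝ, E) (extChartAt 𝓘(ℝ, E) x₀) x (J z x w) := by rintro y rfl w; rfl
  refine (key _ h' _).trans ?_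
  exact congrArg (fun w ↦ mfderiv 𝓘(ℝ, E) 𝓘(ℝ, E) (extChartAt 𝓘(ℝ, E) x₀) x (J z x w)) h

lemma smooth_chartEnd_self {K : Type*} [NormedAddCommGroup K] [NormedSpace ℝ K]
    {J : K → EndField E X} {U : Set K} (hU : IsOpen U) (hJ : SmoothFamily J U) {z₀ : K}
    (hz : z₀ ∈ U) (x₀ : X) :
    ContDiffAt ℝ ∞ (chartEnd J x₀) (z₀, extChartAt 𝓘(ℝ, E) x₀ x₀) := by
  have h0 := hJ.contMDiffAt ((hU.prod isOpen_univ).mem_nhds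
    (show (z₀, x₀) ∈ U ×ˢ (univ : Set X) from ⟨hz, mem_univ _⟩))
  have h1 := ((contMDiffAt_hom_bundle _).mp h0).2
  have h2 : ContMDiffAt 𝓘(ℝ, K × E) (𝓘(ℝ, K).prod 𝓘(ℝ, E)) ∞
      (fun p : K × E ↦ (p.1, (extChartAt 𝓘(ℝ, E) x₀).symm p.2))
      (z₀, extChartAt 𝓘(ℝ, E) x₀ x₀) := by
    have a1 : ContMDiff 𝓘(ℝ, K × E) 𝓘(ℝ, K) ∞ (Prod.fst : K × E → K) := contDiff_fst.contMDiff
    have a2 : ContMDiff 𝓘(ℝ, K × E) 𝓘(ℝ, E) ∞ (Prod.snd : K × E → E) := contDiff_snd.contMDiff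
    have a3 := (contMDiffOn_symm x₀).contMDiffAt
      (extChartAt_target_mem_nhds (I := 𝓘(ℝ, E)) x₀)
    exact a1.contMDiffAt.prodMk (ContMDiffAt.comp (z₀, extChartAt 𝓘(ℝ, E) x₀ x₀) a3 a2.contMDiffAt)
  have h3 := ContMDiffAt.comp_of_eq h1 h2 (by simp)
  refine h3.contDiffAt.congr_of_eventuallyEq ?_
  have h4 : ∀ᶠ p : K × E in 𝓝 (z₀, extChartAt 𝓘(ℝ, E) x₀ x₀),
      p.2 ∈ (extChartAt 𝓘(ℝ, E) x₀).target :=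
    continuousAt_snd.preimage_mem_nhds (extChartAt_target_mem_nhds (I := 𝓘(ℝ, E)) x₀)
  filter_upwards [h4] with p hp
  have hx : (extChartAt 𝓘(ℝ, E) x₀).symm p.2 ∈ (chartAt E x₀).source := by
    simpa using (extChartAt 𝓘(ℝ, E) x₀).map_target hp
  refine ContinuousLinearMap.ext fun v ↦ ?_
  simp only [Function.comp, ContinuousLinearMap.inCoordinates, ContinuousLinearMap.comp_apply]
  rw [TangentBundle.symmL_trivializationAt hx, TangentBundle.continuousLinearMapAt_trivializationAt hx]
  simp only [modelWithCornersSelf_coe, range_id, mfderivWithin_univ]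
  rw [(extChartAt 𝓘(ℝ, E) x₀).right_inv hp]
  rfl

namespace LiouvilleCompletion

variable (L : LiouvilleCompletion E X F M)

/-- Logarithmic coordinates followed by the chart of `X`, with invertible derivative. -/
lemma exists_equiv_readParam [FiniteDimensional ℝ F] [FiniteDimensional ℝ E] {y₀ : M} {e : F × ℝ}
    (he : e ∈ (paramDom y₀ : Set (F × ℝ))) {x₀ : X}
    (hx : L.param y₀ e ∈ (chartAt E x₀).source) :
    ∃ T : (F × ℝ) ≃L[ℝ] E, (T : (F × ℝ) →L[ℝ] E)
      = fderiv ℝ (extChartAt 𝓘(ℝ, E) x₀ ∘ L.param y₀) e := by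
  obtain ⟨-, h2⟩ := readChart (isOpen_paramDom y₀) (L.smooth_param y₀) he hx
  have h3 := (isInvertible_mfderiv_extChartAt (I := 𝓘(ℝ, E)) (x := x₀)
    (y := L.param y₀ e) (by simpa using hx)).bijective
  have hb : Function.Bijective (fderiv ℝ (extChartAt 𝓘(ℝ, E) x₀ ∘ L.param y₀) e) := by
    have : ⇑(fderiv ℝ (extChartAt 𝓘(ℝ, E) x₀ ∘ L.param y₀) e)
      = ⇑(mfderiv 𝓘(ℝ, E) 𝓘(ℝ, E) (extChartAt 𝓘(ℝ, E) x₀) (L.param y₀ e)) ∘ L.dParam y₀ e := by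
      funext v; exact h2 v
    rw [this]
    exact h3.comp (L.dParam_bijective he)
  let T := (LinearEquiv.ofBijective
    (fderiv ℝ (extChartAt 𝓘(ℝ, E) x₀ ∘ L.param y₀) e).toLinearMap hb).toContinuousLinearEquiv
  exact ⟨T, ContinuousLinearMap.ext fun v ↦ rfl⟩

/-- A smooth map into the conical end lifts to logarithmic coordinates. -/
lemma exists_lift [FiniteDimensional ℝ F] [FiniteDimensional ℝ E] {V' : Type*}
    [NormedAddCommGroup V'] [NormedSpace ℝ V'] {U : Set V'} (hU : IsOpen U) {u : V' → X}
    (hu : ContMDiffOn 𝓘(ℝ, V') 𝓘(ℝ, E) ∞ u U) {z₀ : V'} (hz : z₀ ∈ U) {y₀ y : M} {r : ℝ}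
    (hr : 0 < r) (hy : y ∈ (chartAt F y₀).source) (huz : u z₀ = L.cone (y, r)) :
    ∃ w : V' → F × ℝ, ContDiffAt ℝ ∞ w z₀ ∧ w z₀ = (extChartAt 𝓘(ℝ, F) y₀ y, Real.log r) ∧
      ∀ᶠ z in 𝓝 z₀, w z ∈ (paramDom y₀ : Set (F × ℝ)) ∧ u z = L.param y₀ (w z) := by
  set e₀ : F × ℝ := (extChartAt 𝓘(ℝ, F) y₀ y, Real.log r) with he₀
  have hy' : y ∈ (extChartAt 𝓘(ℝ, F) y₀).source := by simpa using hy
  have he : e₀ ∈ (paramDom y₀ : Set (F × ℝ)) :=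
    ⟨(extChartAt 𝓘(ℝ, F) y₀).map_source hy', mem_univ _⟩
  have hpe : L.param y₀ e₀ = u z₀ := by
    rw [huz, param, he₀, Real.exp_log hr, (extChartAt 𝓘(ℝ, F) y₀).left_inv hy']
  set x₀ := u z₀ with hx₀
  have hxs : L.param y₀ e₀ ∈ (chartAt E x₀).source := by rw [hpe]; exact mem_chart_source E x₀
  set φ := extChartAt 𝓘(ℝ, E) x₀ with hφ
  obtain ⟨h1, -⟩ := readChart (isOpen_paramDom y₀) (L.smooth_param y₀) he hxs
  obtain ⟨T, hT⟩ := L.exists_equiv_readParam he hxs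
  have hT' : HasFDerivAt (φ ∘ L.param y₀) (T : (F × ℝ) →L[ℝ] E) e₀ := by
    rw [hT]; exact (h1.differentiableAt (by simp)).hasFDerivAt
  have hstrict : HasStrictFDerivAt (φ ∘ L.param y₀) (T : (F × ℝ) →L[ℝ] E) e₀ :=
    h1.hasStrictFDerivAt' hT' (by simp)
  -- The lift is this local inverse of `param`, read in the chart of X at x₀, composed with the
  -- chart expression of u. The two maps into X then agree in the chart, and hence in X by
  -- injectivity of the chart.
  let g := hstrict.localInverse _ _ _
  have hg : ContDiffAt ℝ ∞ g ((φ ∘ L.param y₀) e₀) := h1.to_localInverse hT' (by simp)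
  have hfe : (φ ∘ L.param y₀) e₀ = φ (u z₀) := congrArg φ hpe
  obtain ⟨h2, -⟩ := readChart hU hu hz (x₀ := x₀) (mem_chart_source E x₀)
  have hgc : g (φ (u z₀)) = e₀ := by rw [← hfe]; exact hstrict.localInverse_apply_image
  rw [hfe] at hg
  have hw : ContDiffAt ℝ ∞ (g ∘ (φ ∘ u)) z₀ := ContDiffAt.comp (f := φ ∘ u) z₀ hg h2
  refine ⟨g ∘ (φ ∘ u), hw, hgc, ?_⟩
  have hw0 : (g ∘ (φ ∘ u)) z₀ = e₀ := hgc
  have e1 : ∀ᶠ z in 𝓝 z₀, (g ∘ (φ ∘ u)) z ∈ (paramDom y₀ : Set (F × ℝ)) :=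
    hw.continuousAt.preimage_mem_nhds (by rw [hw0]; exact (isOpen_paramDom y₀).mem_nhds he)
  have e2 : ∀ᶠ z in 𝓝 z₀, u z ∈ (chartAt E x₀).source :=
    (hu.continuousOn.continuousAt (hU.mem_nhds hz)).preimage_mem_nhds
      ((chartAt E x₀).open_source.mem_nhds (mem_chart_source E x₀))
  have e3 : ∀ᶠ z in 𝓝 z₀, L.param y₀ ((g ∘ (φ ∘ u)) z) ∈ (chartAt E x₀).source := by
    have hpc : ContinuousAt (L.param y₀) ((g ∘ (φ ∘ u)) z₀) := by
      rw [hw0]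
      exact (L.smooth_param y₀).continuousOn.continuousAt ((isOpen_paramDom y₀).mem_nhds he)
    have : ContinuousAt (L.param y₀ ∘ (g ∘ (φ ∘ u))) z₀ := hpc.comp hw.continuousAt
    refine this.preimage_mem_nhds ((chartAt E x₀).open_source.mem_nhds ?_)
    rw [Function.comp_apply, hw0]; exact hxs
  have e4 : ∀ᶠ z in 𝓝 z₀, (φ ∘ L.param y₀) (g ((φ ∘ u) z)) = (φ ∘ u) z := by
    have h5 := hstrict.eventually_right_inverse
    rw [hfe] at h5
    exact (h2.continuousAt.tendsto).eventually h5
  filter_upwards [e1, e2, e3, e4] with z a1 a2 a3 a4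
  refine ⟨a1, ?_⟩
  exact ((extChartAt 𝓘(ℝ, E) x₀).injOn (by simpa using a3) (by simpa using a2) a4).symm

/-- A family of endomorphism fields on the level `σ₀` of the conical end, in coordinates. -/
def coordJ (J : ℂ → EndField E X) (y₀ : M) (σ₀ : ℝ) (p : ℂ × F) : (F × ℝ) →L[ℝ] (F × ℝ) :=
  (L.dParam y₀ (p.2, σ₀)).inverse.comp
    ((J p.1 (L.param y₀ (p.2, σ₀))).comp (L.dParam y₀ (p.2, σ₀)))

lemma dParam_invertible [FiniteDimensional ℝ F] [FiniteDimensional ℝ E] {y₀ : M} {e : F × ℝ}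
    (he : e ∈ (paramDom y₀ : Set (F × ℝ))) :
    ∃ T : (F × ℝ) ≃L[ℝ] E, (T : (F × ℝ) →L[ℝ] E) = L.dParam y₀ e := by
  let l : (F × ℝ) →L[ℝ] E := L.dParam y₀ e
  let T := (LinearEquiv.ofBijective l.toLinearMap (L.dParam_bijective he)).toContinuousLinearEquiv
  exact ⟨T, ContinuousLinearMap.ext fun v ↦ rfl⟩

lemma dParam_coordJ [FiniteDimensional ℝ F] [FiniteDimensional ℝ E] (J : ℂ → EndField E X)
    {y₀ : M} {σ₀ : ℝ} {p : ℂ × F} (hp : p.2 ∈ (extChartAt 𝓘(ℝ, F) y₀).target) (V : F × ℝ) :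
    L.dParam y₀ (p.2, σ₀) (L.coordJ J y₀ σ₀ p V)
      = J p.1 (L.param y₀ (p.2, σ₀)) (L.dParam y₀ (p.2, σ₀) V) := by
  obtain ⟨T, hT⟩ := L.dParam_invertible (e := (p.2, σ₀)) ⟨hp, mem_univ _⟩
  have key : ∀ (l : (F × ℝ) →L[ℝ] E) (x : E), (T : (F × ℝ) →L[ℝ] E) = l → l (l.inverse x) = x := by
    rintro l x rfl
    simp
  exact key (L.dParam y₀ (p.2, σ₀)) _ hT

/-- The fibrewise derivative of `param` takes values in varying tangent spaces. Passing through the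
chart at x₀ rewrites the conjugation as T⁻¹ ∘ (chart expression of J) ∘ T with T a smooth family of
invertible maps between fixed spaces. -/
lemma smooth_coordJ [FiniteDimensional ℝ F] [FiniteDimensional ℝ E] {J : ℂ → EndField E X}
    {U : Set ℂ} (hU : IsOpen U) (hJ : SmoothFamily J U) {y₀ : M} (σ₀ : ℝ) {p : ℂ × F}
    (hp1 : p.1 ∈ U) (hp : p.2 ∈ (extChartAt 𝓘(ℝ, F) y₀).target) :
    ContDiffAt ℝ ∞ (L.coordJ J y₀ σ₀) p := by
  set x₀ := L.param y₀ (p.2, σ₀) with hx₀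
  have he : (p.2, σ₀) ∈ (paramDom y₀ : Set (F × ℝ)) := ⟨hp, mem_univ _⟩
  obtain ⟨h1, -⟩ := readChart (isOpen_paramDom y₀) (L.smooth_param y₀) he
    (x₀ := x₀) (mem_chart_source E x₀)
  obtain ⟨T, hT⟩ := L.exists_equiv_readParam he (x₀ := x₀) (mem_chart_source E x₀)
  set φ := extChartAt 𝓘(ℝ, E) x₀
  have hin : ContDiffAt ℝ ∞ (fun p : ℂ × F ↦ (p.2, σ₀)) p :=
    contDiffAt_snd.prodMk contDiffAt_const
  have h1' : ContDiffAt ℝ ∞ (fderiv ℝ (φ ∘ L.param y₀)) (p.2, σ₀) :=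
    h1.fderiv_right (m := ∞) (by simp)
  have hD : ContDiffAt ℝ ∞ (fun p : ℂ × F ↦ fderiv ℝ (φ ∘ L.param y₀) (p.2, σ₀)) p :=
    ContDiffAt.comp (f := fun p : ℂ × F ↦ (p.2, σ₀)) p h1' hin
  have hDi : ContDiffAt ℝ ∞ (fun p : ℂ × F ↦ (fderiv ℝ (φ ∘ L.param y₀) (p.2, σ₀)).inverse) p := by
    have hi : ContDiffAt ℝ ∞ (ContinuousLinearMap.inverse : ((F × ℝ) →L[ℝ] E) → _)
        (fderiv ℝ (φ ∘ L.param y₀) (p.2, σ₀)) := by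
      rw [← hT]
      exact contDiffAt_map_inverse (𝕜 := ℝ) T
    exact ContDiffAt.comp (f := fun p : ℂ × F ↦ fderiv ℝ (φ ∘ L.param y₀) (p.2, σ₀)) p hi hD
  have hR : ContDiffAt ℝ ∞ (fun p : ℂ × F ↦ (p.1, (φ ∘ L.param y₀) (p.2, σ₀))) p := by
    have : ContDiffAt ℝ ∞ (fun p : ℂ × F ↦ (φ ∘ L.param y₀) (p.2, σ₀)) p :=
      ContDiffAt.comp (f := fun p : ℂ × F ↦ (p.2, σ₀)) p h1 hin
    exact contDiffAt_fst.prodMk this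
  have hE : ContDiffAt ℝ ∞ (fun p : ℂ × F ↦ chartEnd J x₀ (p.1, (φ ∘ L.param y₀) (p.2, σ₀))) p :=
    ContDiffAt.comp (f := fun p : ℂ × F ↦ (p.1, (φ ∘ L.param y₀) (p.2, σ₀))) p
      (smooth_chartEnd_self hU hJ hp1 x₀) hR
  refine (hDi.clm_comp (hE.clm_comp hD)).congr_of_eventuallyEq ?_
  have e1 : ∀ᶠ p : ℂ × F in 𝓝 p, p.2 ∈ (extChartAt 𝓘(ℝ, F) y₀).target :=
    continuousAt_snd.preimage_mem_nhds ((isOpen_target y₀).mem_nhds hp)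
  have e2 : ∀ᶠ p : ℂ × F in 𝓝 p, L.param y₀ (p.2, σ₀) ∈ (chartAt E x₀).source := by
    have hc : ContinuousAt (L.param y₀) (p.2, σ₀) :=
      (L.smooth_param y₀).continuousOn.continuousAt ((isOpen_paramDom y₀).mem_nhds he)
    exact (ContinuousAt.comp (f := fun p : ℂ × F ↦ (p.2, σ₀)) hc hin.continuousAt).preimage_mem_nhds
      ((chartAt E x₀).open_source.mem_nhds (mem_chart_source E x₀))
  filter_upwards [e1, e2] with p' h3 h4
  have he' : (p'.2, σ₀) ∈ (paramDom y₀ : Set (F × ℝ)) := ⟨h3, mem_univ _⟩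
  obtain ⟨T', hT'⟩ := L.exists_equiv_readParam he' h4
  obtain ⟨-, h5⟩ := readChart (isOpen_paramDom y₀) (L.smooth_param y₀) he' h4
  refine ContinuousLinearMap.ext fun V ↦ ?_
  have h6 := L.dParam_coordJ J (σ₀ := σ₀) h3 V
  have h7 := chartEnd_mfderiv J h4 p'.1 (L.dParam y₀ (p'.2, σ₀) V)
  rw [← h6] at h7
  have h8 : chartEnd J x₀ (p'.1, (φ ∘ L.param y₀) (p'.2, σ₀))
      (fderiv ℝ (φ ∘ L.param y₀) (p'.2, σ₀) V)
      = fderiv ℝ (φ ∘ L.param y₀) (p'.2, σ₀) (L.coordJ J y₀ σ₀ p' V) := by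
    rw [h5, h5]; exact h7
  rw [ContinuousLinearMap.comp_apply, ContinuousLinearMap.comp_apply, h8, ← hT',
    ContinuousLinearMap.inverse_equiv]
  simp

end LiouvilleCompletion
end Lift

/-! ### Twisted SFT-type structures are independent of σ in logarithmic coordinates. -/

section Twisted

lemma exists_eq_of_nondegenerate {V : Type*} [NormedAddCommGroup V] [NormedSpace ℝ V]
    [FiniteDimensional ℝ V] (B : V →L[ℝ] V →L[ℝ] ℝ) (h : ∀ v, B v = 0 → v = 0) (l : V →L[ℝ] ℝ) :
    ∃ x, B x = l := by
  have hinj : Function.Injective B.toLinearMap := (injective_iff_map_eq_zero _).mpr h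
  have hdim : Module.finrank ℝ V = Module.finrank ℝ (V →L[ℝ] ℝ) := by
    rw [LinearMap.toContinuousLinearMap.symm.finrank_eq]
    exact (Subspace.dual_finrank_eq (K := ℝ) (V := V)).symm
  exact (LinearMap.injective_iff_surjective_of_finrank_eq_finrank hdim).mp hinj l

variable {E : Type*} [NormedAddCommGroup E] [NormedSpace ℝ E]
  {X : Type*} [TopologicalSpace X] [ChartedSpace E X] [IsManifold 𝓘(ℝ, E) ∞ X]
  {F : Type*} [NormedAddCommGroup F] [NormedSpace ℝ F]
  {M : Type*} [TopologicalSpace M] [ChartedSpace F M] [IsManifold 𝓘(ℝ, F) ∞ M]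

namespace LiouvilleCompletion

variable (L : LiouvilleCompletion E X F M)

/-- `J` is of twisted SFT-type on `M × [T, ∞)` with twist `q`. -/
structure IsTwistedBy (T : ℝ) (J : EndField E X) (q : M → ℝ) : Prop where
  smooth : ContMDiff 𝓘(ℝ, F) 𝓘(ℝ, ℝ) ∞ q
  pos : ∀ y, 0 < q y
  exists_xi : ∃ j : EndField F M, IsCompatibleOnXi L.alpha j ∧ ∀ (y : M) (r : ℝ), T ≤ r →
    ∀ v : TangentSpace 𝓘(ℝ, F) y, L.alpha y v = 0 →
      J (L.cone (y, r)) (L.dCone y r (zetaLift q y r v)) = L.dCone y r (zetaLift q y r (j y v))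
  ham : ∀ (y : M) (r : ℝ), T ≤ r → ∀ V, IsLiftedHamVec L.alpha q y r V →
    J (L.cone (y, r)) (L.dCone y r V) = L.dCone y r (0, r)

lemma IsTwistedSFTAtInfinity.exists_twist {L : LiouvilleCompletion E X F M} {T : ℝ}
    {J : EndField E X} (h : L.IsTwistedSFTAtInfinity T J) : ∃ q, L.IsTwistedBy T J q := by
  obtain ⟨J', ⟨q, j, hq, hpos, hj, h1⟩, h2⟩ := h
  refine ⟨q, hq, hpos, ⟨j, hj, fun y r hr v hv ↦ ?_⟩, fun y r hr V hV ↦ ?_⟩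
  · rw [h2 y r hr, (h1 y r hr).2 v hv]
  · rw [h2 y r hr, (h1 y r hr).1 V hV]

lemma IsTwistedSFTAtInfinity.mono {L : LiouvilleCompletion E X F M} {T T' : ℝ} (hT : T ≤ T')
    {J : EndField E X} (h : L.IsTwistedSFTAtInfinity T J) : L.IsTwistedSFTAtInfinity T' J := by
  obtain ⟨J', ⟨q, j, hq, hpos, hj, h1⟩, h2⟩ := h
  exact ⟨J', ⟨q, j, hq, hpos, hj, fun y r hr ↦ h1 y r (hT.trans hr)⟩,
    fun y r hr ↦ h2 y r (hT.trans hr)⟩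

variable {L}

lemma conicalForm_nondegenerate [FiniteDimensional ℝ F] [FiniteDimensional ℝ E] {y₀ : M} {f : F}
    (hf : f ∈ (extChartAt 𝓘(ℝ, F) y₀).target) (V : F × ℝ)
    (hV : conicalForm (chartForm L.alpha y₀ f) (fderiv ℝ (chartForm L.alpha y₀) f) V = 0) :
    V = 0 := by
  by_contra hne
  have he : (f, (0 : ℝ)) ∈ (paramDom y₀ : Set (F × ℝ)) := ⟨hf, mem_univ _⟩
  have hb := L.dParam_bijective he
  have hne' : L.dParam y₀ (f, 0) V ≠ 0 := fun h ↦ hne (hb.1 (h.trans (map_zero _).symm))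
  obtain ⟨w, hw⟩ := L.nondegenerate _ _ hne'
  obtain ⟨W, rfl⟩ := hb.2 w
  apply hw
  have h1 := L.omega_param he V W
  rw [omega] at h1
  rw [h1, hV]
  simp

/-- An almost complex structure of twisted SFT-type in logarithmic coordinates. -/
lemma IsTwistedBy.exists_coord [FiniteDimensional ℝ F] [FiniteDimensional ℝ E] {T : ℝ}
    {J : EndField E X} {q : M → ℝ} (h : L.IsTwistedBy T J q) (hsq : ∀ x v, J x (J x v) = -v)
    {y₀ : M} {f : F} (hf : f ∈ (extChartAt 𝓘(ℝ, F) y₀).target) :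
    ∃ K : F × ℝ → F × ℝ, (∀ σ : ℝ, T ≤ Real.exp σ → ∀ V,
      J (L.param y₀ (f, σ)) (L.dParam y₀ (f, σ) V) = L.dParam y₀ (f, σ) (K V)) ∧
      ∀ V, chartForm L.alpha y₀ f (K V).1
        = fderiv ℝ (readFun q y₀) f V.1 + readFun q y₀ f * V.2 := by
  obtain ⟨j, hj, hjJ⟩ := h.exists_xi
  set y := (extChartAt 𝓘(ℝ, F) y₀).symm f with hy
  set a := chartForm L.alpha y₀ f with ha
  set Dq := fderiv ℝ (readFun q y₀) f with hDq
  set q₀ := readFun q y₀ f with hq₀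
  have hqp : 0 < q₀ := h.pos _
  have hqd : MDifferentiableAt 𝓘(ℝ, F) 𝓘(ℝ, ℝ) q y := (h.smooth y).mdifferentiableAt (by simp)
  -- Y represents the Hamiltonian vector field of Q = r q, so that J Y = ∂_σ and J ∂_σ = -Y.
  obtain ⟨Y, hY⟩ := exists_eq_of_nondegenerate _ (conicalForm_nondegenerate (L := L) hf)
    (Dq.comp (ContinuousLinearMap.fst ℝ F ℝ) + q₀ • ContinuousLinearMap.snd ℝ F ℝ)
  have hYW : ∀ W : F × ℝ, conicalForm a (fderiv ℝ (chartForm L.alpha y₀) f) Y W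
      = Dq W.1 + q₀ * W.2 := fun W ↦ by rw [hY]; simp
  have haY : a Y.1 = - q₀ := by
    have := hYW (0, 1)
    simp at this
    linarith
  -- A Hamiltonian is constant along its own flow. This removes the unwanted multiple of α(V) in the
  -- final identity.
  have hYY : Dq Y.1 + q₀ * Y.2 = 0 := by rw [← hYW Y, conicalForm_self]
  choose j' hj' using fun v : F ↦ (coordVec_bijective hf).2 (j y (coordVec y₀ f v))
  let ξ : F × ℝ → F := fun V ↦ V.1 + (a V.1 / q₀) • Y.1
  have hξ : ∀ V, a (ξ V) = 0 := fun V ↦ by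
    simp only [ξ, map_add, map_smul, haY, smul_eq_mul]; field_simp; ring
  have hajξ : ∀ V, a (j' (ξ V)) = 0 := fun V ↦ by
    rw [ha, chartForm_apply, hj']
    exact hj.maps y _ (hξ V)
  let c : F × ℝ → ℝ := fun V ↦ V.2 + (a V.1 / q₀) * Y.2 + Dq (ξ V) / q₀
  let K : F × ℝ → F × ℝ := fun V ↦ -(a V.1 / q₀) • (0, 1) + (j' (ξ V), -(Dq (j' (ξ V)) / q₀))
    - c V • Y
  -- The splitting into ℝ Y, the lifts of vectors in ker α, and ℝ ∂_σ. The twisted condition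
  -- prescribes J on each summand by coefficients that do not involve σ, which is why a single K
  -- serves every level.
  have hdec : ∀ V : F × ℝ, V = -(a V.1 / q₀) • Y + (ξ V, -(Dq (ξ V) / q₀)) + c V • (0, 1) := by
    intro V
    refine Prod.ext ?_ ?_
    · simp [ξ]
    · simp [c]; ring
  refine ⟨K, fun σ hσ V ↦ ?_, fun V ↦ ?_⟩
  · have he : (f, σ) ∈ (paramDom y₀ : Set (F × ℝ)) := ⟨hf, mem_univ _⟩
    have hr := Real.exp_pos σ
    have h1 : J (L.param y₀ (f, σ)) (L.dParam y₀ (f, σ) Y) = L.dParam y₀ (f, σ) (0, 1) := by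
      rw [L.dParam_apply he, L.dParam_apply he]
      have := h.ham y (Real.exp σ) hσ (coordVec y₀ f Y.1, Real.exp σ * Y.2)
        ((isLiftedHamVec_coord L.contact.smooth hf hqd hr Y).mpr hYW)
      exact this.trans (congrArg (L.dCone y (Real.exp σ))
        (Prod.ext (map_zero (coordVec y₀ f)).symm (mul_one _).symm))
    have h2 : J (L.param y₀ (f, σ)) (L.dParam y₀ (f, σ) (0, 1)) = - L.dParam y₀ (f, σ) Y := by
      rw [← h1, hsq]
    have hz : ∀ v : F, L.dParam y₀ (f, σ) (v, -(Dq v / q₀))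
        = L.dCone y (Real.exp σ) (zetaLift q y (Real.exp σ) (coordVec y₀ f v)) := by
      intro v
      rw [L.dParam_apply he, zetaLift, dFun_coord hf hqd]
      have : Real.exp σ * -(Dq v / q₀) = -(Real.exp σ * Dq v / q₀) := by ring
      simp only [this]
      rfl
    have h3 : J (L.param y₀ (f, σ)) (L.dParam y₀ (f, σ) (ξ V, -(Dq (ξ V) / q₀)))
        = L.dParam y₀ (f, σ) (j' (ξ V), -(Dq (j' (ξ V)) / q₀)) := by
      rw [hz, hz, hj']
      exact hjJ y (Real.exp σ) hσ _ (hξ V)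
    conv_lhs => rw [hdec V]
    simp only [K, map_add, map_sub, map_smul, h1, h2, h3]
    module
  · simp only [K, Prod.fst_add, Prod.fst_sub, Prod.smul_fst, map_add, map_sub, map_smul, haY, hajξ,
      smul_zero, map_zero, smul_eq_mul]
    simp only [c, ξ, map_add, map_smul, smul_eq_mul]
    have : Y.2 = - Dq Y.1 / q₀ := by field_simp; linarith
    rw [this]
    field_simp
    ring

end LiouvilleCompletion
end Twisted

/-! ### The Floer equation on the conical end -/

section ConeEquation

variable {E : Type*} [NormedAddCommGroup E] [NormedSpace ℝ E]
  {X : Type*} [TopologicalSpace X] [ChartedSpace E X] [IsManifold 𝓘(ℝ, E) ∞ X]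
  {F : Type*} [NormedAddCommGroup F] [NormedSpace ℝ F]
  {M : Type*} [TopologicalSpace M] [ChartedSpace F M] [IsManifold 𝓘(ℝ, F) ∞ M]

lemma fderiv_partial {A B G : Type*} [NormedAddCommGroup A] [NormedSpace ℝ A]
    [NormedAddCommGroup B] [NormedSpace ℝ B] [NormedAddCommGroup G] [NormedSpace ℝ G]
    {h : A × B → G} {p : A × B} (hh : DifferentiableAt ℝ h p) (v : B) :
    fderiv ℝ h p (0, v) = fderiv ℝ (fun f ↦ h (p.1, f)) p.2 v := by
  have h1 : HasFDerivAt (fun f : B ↦ (p.1, f)) (ContinuousLinearMap.inr ℝ A B) p.2 :=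
    hasFDerivAt_prodMk_right p.1 p.2
  have h2 := HasFDerivAt.comp (f := fun f : B ↦ (p.1, f)) p.2 hh.hasFDerivAt h1
  have h3 : fderiv ℝ (fun f ↦ h (p.1, f)) p.2 = _ := h2.fderiv
  rw [h3]; simp

/-- The data entering the Floer equation on the conical end: an open subset of `ℂ`, a family of
almost complex structures of twisted SFT-type, and the slopes of the two components of a
Hamiltonian `1`-form. -/
structure ConeProblem (L : LiouvilleCompletion E X F M) where
  U : Set ℂ
  isOpen : IsOpen U
  J : ℂ → EndField E X
  smooth_J : SmoothFamily J U
  compatible : ∀ z ∈ U, L.IsCompatible (J z)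
  T : ℝ
  one_le : 1 ≤ T
  twisted : ∀ z ∈ U, L.IsTwistedSFTAtInfinity T (J z)
  g₁ : M → ℂ → ℝ
  g₂ : M → ℂ → ℝ
  smooth_g₁ : ContMDiffOn (𝓘(ℝ, F).prod 𝓘(ℝ, ℂ)) 𝓘(ℝ, ℝ) ∞
    (fun z : M × ℂ ↦ g₁ z.1 z.2) (univ ×ˢ U)
  smooth_g₂ : ContMDiffOn (𝓘(ℝ, F).prod 𝓘(ℝ, ℂ)) 𝓘(ℝ, ℝ) ∞
    (fun z : M × ℂ ↦ g₂ z.1 z.2) (univ ×ˢ U)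

/-- A family of functions on `M` read in the chart at `y₀`. -/
def readFam (g : M → ℂ → ℝ) (y₀ : M) (p : ℂ × F) : ℝ :=
  g ((extChartAt 𝓘(ℝ, F) y₀).symm p.2) p.1

lemma smooth_readFam {g : M → ℂ → ℝ} {U : Set ℂ} (hU : IsOpen U)
    (hg : ContMDiffOn (𝓘(ℝ, F).prod 𝓘(ℝ, ℂ)) 𝓘(ℝ, ℝ) ∞ (fun z : M × ℂ ↦ g z.1 z.2) (univ ×ˢ U))
    {y₀ : M} {p : ℂ × F} (h1 : p.1 ∈ U) (h2 : p.2 ∈ (extChartAt 𝓘(ℝ, F) y₀).target) :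
    ContDiffAt ℝ ∞ (readFam g y₀) p := by
  have a1 : ContMDiff 𝓘(ℝ, ℂ × F) 𝓘(ℝ, ℂ) ∞ (Prod.fst : ℂ × F → ℂ) := contDiff_fst.contMDiff
  have a2 : ContMDiff 𝓘(ℝ, ℂ × F) 𝓘(ℝ, F) ∞ (Prod.snd : ℂ × F → F) := contDiff_snd.contMDiff
  have a3 := (contMDiffOn_symm y₀).contMDiffAt ((isOpen_target y₀).mem_nhds h2)
  have a4 := (ContMDiffAt.comp p a3 a2.contMDiffAt).prodMk a1.contMDiffAt
  have a5 := hg.contMDiffAt ((isOpen_univ.prod hU).mem_nhds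
    (show ((extChartAt 𝓘(ℝ, F) y₀).symm p.2, p.1) ∈ (univ : Set M) ×ˢ U from ⟨mem_univ _, h1⟩))
  exact (ContMDiffAt.comp p a5 a4).contDiffAt

lemma mdifferentiableAt_slice {g : M → ℂ → ℝ} {U : Set ℂ} (hU : IsOpen U)
    (hg : ContMDiffOn (𝓘(ℝ, F).prod 𝓘(ℝ, ℂ)) 𝓘(ℝ, ℝ) ∞ (fun z : M × ℂ ↦ g z.1 z.2) (univ ×ˢ U))
    {z : ℂ} (hz : z ∈ U) (y : M) :
    MDifferentiableAt 𝓘(ℝ, F) 𝓘(ℝ, ℝ) (fun y ↦ g y z) y := by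
  have a5 := hg.contMDiffAt ((isOpen_univ.prod hU).mem_nhds
    (show (y, z) ∈ (univ : Set M) ×ˢ U from ⟨mem_univ _, hz⟩))
  have a4 : ContMDiffAt 𝓘(ℝ, F) (𝓘(ℝ, F).prod 𝓘(ℝ, ℂ)) ∞ (fun y : M ↦ (y, z)) y :=
    contMDiffAt_id.prodMk contMDiffAt_const
  exact (ContMDiffAt.comp y a5 a4).mdifferentiableAt (by simp)

namespace LiouvilleCompletion

variable (L : LiouvilleCompletion E X F M)

/-- A function of `(y, r)` as a function on `X`, extended by zero outside of the conical end. -/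
def coneLift (f : M × ℝ → ℝ) (x : X) : ℝ :=
  open Classical in
  if h : ∃ p ∈ (univ : Set M) ×ˢ Ioi (0 : ℝ), L.cone p = x then f h.choose else 0

lemma coneLift_cone (f : M × ℝ → ℝ) (y : M) {r : ℝ} (hr : 0 < r) :
    L.coneLift f (L.cone (y, r)) = f (y, r) := by
  have h : ∃ p ∈ (univ : Set M) ×ˢ Ioi (0 : ℝ), L.cone p = L.cone (y, r) :=
    ⟨(y, r), ⟨mem_univ _, hr⟩, rfl⟩
  rw [coneLift, dif_pos h]
  exact congrArg f (L.injOn_cone h.choose_spec.1 ⟨mem_univ _, hr⟩ h.choose_spec.2)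

lemma coneLift_of_notMem (f : M × ℝ → ℝ) {x : X} (hx : ∀ y r, 0 < r → x ≠ L.cone (y, r)) :
    L.coneLift f x = 0 := by
  rw [coneLift, dif_neg]
  rintro ⟨⟨y, r⟩, h1, h2⟩
  exact hx y r h1.2 h2.symm

end LiouvilleCompletion

open LiouvilleCompletion

namespace ConeProblem

variable {L : LiouvilleCompletion E X F M} (Q : ConeProblem L)

/-- the twist of `J z` -/
def q (z : ℂ) : M → ℝ :=
  open Classical in if h : ∃ q, L.IsTwistedBy Q.T (Q.J z) q then h.choose else 0

lemma isTwistedBy {z : ℂ} (hz : z ∈ Q.U) : L.IsTwistedBy Q.T (Q.J z) (Q.q z) := by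
  have h := (Q.twisted z hz).exists_twist
  rw [q, dif_pos h]
  exact h.choose_spec

lemma q_congr {z z' : ℂ} (h : Q.J z = Q.J z') : Q.q z = Q.q z' := by
  rw [q, q, h]

lemma exp_log_T : Real.exp (Real.log Q.T) = Q.T := Real.exp_log (by linarith [Q.one_le])

variable [FiniteDimensional ℝ E] [FiniteDimensional ℝ F]

/-- The coordinate matrix is read at level r = T. By `exists_coord` one matrix represents J at every
level above T, so the one at T is that matrix. -/
lemma coordJ_spec (y₀ : M) {p : ℂ × F} (hz : p.1 ∈ Q.U)
    (hf : p.2 ∈ (extChartAt 𝓘(ℝ, F) y₀).target) :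
    (∀ σ : ℝ, Q.T ≤ Real.exp σ → ∀ V,
      Q.J p.1 (L.param y₀ (p.2, σ)) (L.dParam y₀ (p.2, σ) V)
        = L.dParam y₀ (p.2, σ) (L.coordJ Q.J y₀ (Real.log Q.T) p V)) ∧
      ∀ V, chartForm L.alpha y₀ p.2 (L.coordJ Q.J y₀ (Real.log Q.T) p V).1
        = fderiv ℝ (readFun (Q.q p.1) y₀) p.2 V.1 + readFun (Q.q p.1) y₀ p.2 * V.2 := by
  obtain ⟨K, h1, h2⟩ := (Q.isTwistedBy hz).exists_coord (Q.compatible _ hz).sq hf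
  have hK : ∀ V, L.coordJ Q.J y₀ (Real.log Q.T) p V = K V := by
    intro V
    apply (L.dParam_bijective (e := (p.2, Real.log Q.T)) ⟨hf, mem_univ _⟩).1
    rw [L.dParam_coordJ Q.J hf, h1 _ (by rw [Q.exp_log_T])]
  simp only [hK]
  exact ⟨h1, h2⟩

/-- The twist is chosen separately for each z. Writing it as α(K ∂_σ) determines it at every point
and shows its smoothness jointly in z and y. -/
lemma readFun_q (y₀ : M) {p : ℂ × F} (hz : p.1 ∈ Q.U)
    (hf : p.2 ∈ (extChartAt 𝓘(ℝ, F) y₀).target) :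
    chartForm L.alpha y₀ p.2 (L.coordJ Q.J y₀ (Real.log Q.T) p (0, 1)).1
      = readFun (Q.q p.1) y₀ p.2 := by
  rw [(Q.coordJ_spec y₀ hz hf).2]
  have : fderiv ℝ (readFun (Q.q p.1) y₀) p.2 0 = 0 := map_zero _
  simp [this]

/-- The Floer equation in logarithmic coordinates over the chart at `y₀`. -/
def localData (y₀ : M) : LocalData F where
  D := Q.U ×ˢ (extChartAt 𝓘(ℝ, F) y₀).target
  isOpen := Q.isOpen.prod (isOpen_target y₀)
  α := chartForm L.alpha y₀
  K := L.coordJ Q.J y₀ (Real.log Q.T)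
  g₁ := readFam Q.g₁ y₀
  g₂ := readFam Q.g₂ y₀
  smooth_α p hp := smooth_chartForm L.contact.smooth hp.2
  smooth_K p hp := L.smooth_coordJ Q.isOpen Q.smooth_J _ hp.1 hp.2
  smooth_g₁ p hp := smooth_readFam Q.isOpen Q.smooth_g₁ hp.1 hp.2
  smooth_g₂ p hp := smooth_readFam Q.isOpen Q.smooth_g₂ hp.1 hp.2
  sq p hp A := by
    have he : (p.2, Real.log Q.T) ∈ (paramDom y₀ : Set (F × ℝ)) := ⟨hp.2, mem_univ _⟩
    apply (L.dParam_bijective he).1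
    rw [L.dParam_coordJ Q.J hp.2, L.dParam_coordJ Q.J hp.2, (Q.compatible _ hp.1).sq, map_neg]
  inv p hp A B := by
    have he : (p.2, Real.log Q.T) ∈ (paramDom y₀ : Set (F × ℝ)) := ⟨hp.2, mem_univ _⟩
    have h := (Q.compatible _ hp.1).inv (L.param y₀ (p.2, Real.log Q.T)) (L.dParam y₀ _ A)
      (L.dParam y₀ _ B)
    rw [← L.dParam_coordJ Q.J hp.2, ← L.dParam_coordJ Q.J hp.2, L.omega_param he,
      L.omega_param he] at h
    exact mul_left_cancel₀ (Real.exp_pos _).ne' h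
  pos p hp A hA := by
    have he : (p.2, Real.log Q.T) ∈ (paramDom y₀ : Set (F × ℝ)) := ⟨hp.2, mem_univ _⟩
    have hne : L.dParam y₀ (p.2, Real.log Q.T) A ≠ 0 := fun h ↦ hA
      ((L.dParam_bijective he).1 (h.trans (map_zero _).symm))
    have h := (Q.compatible _ hp.1).pos (L.param y₀ (p.2, Real.log Q.T)) _ hne
    rw [← L.dParam_coordJ Q.J hp.2, L.omega_param he] at h
    exact pos_of_mul_pos_right h (Real.exp_pos _).le
  contact p hp A := by
    have hK := L.smooth_coordJ Q.isOpen Q.smooth_J (Real.log Q.T) hp.1 hp.2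
    have h1 : ContDiffAt ℝ ∞ (fun p : ℂ × F ↦ chartForm L.alpha y₀ p.2) p :=
      ContDiffAt.comp p (smooth_chartForm L.contact.smooth hp.2) contDiffAt_snd
    have h2 : ContDiffAt ℝ ∞ (fun p : ℂ × F ↦
        chartForm L.alpha y₀ p.2 (L.coordJ Q.J y₀ (Real.log Q.T) p (0, 1)).1) p :=
      h1.clm_apply (contDiffAt_fst.comp p (hK.clm_apply contDiffAt_const))
    rw [fderiv_partial (h2.differentiableAt (by simp)), (Q.coordJ_spec y₀ hp.1 hp.2).2,
      Q.readFun_q y₀ hp.1 hp.2]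
    -- The identity with the twist holds on a neighbourhood of p.2 with z frozen, so the derivatives
    -- in the F-direction agree as well.
    have h3 : (fun f ↦ chartForm L.alpha y₀ f
        (L.coordJ Q.J y₀ (Real.log Q.T) (p.1, f) (0, 1)).1) =ᶠ[𝓝 p.2]
        readFun (Q.q p.1) y₀ := by
      filter_upwards [(isOpen_target y₀).mem_nhds hp.2] with f hf
      exact Q.readFun_q y₀ (p := (p.1, f)) hp.1 hf
    rw [h3.fderiv_eq]

lemma localData_q {y₀ : M} {p : ℂ × F} (hp : p ∈ (Q.localData y₀).D) :
    (Q.localData y₀).q p = Q.q p.1 ((extChartAt 𝓘(ℝ, F) y₀).symm p.2) :=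
  Q.readFun_q y₀ hp.1 hp.2

lemma q_pos {z : ℂ} (hz : z ∈ Q.U) (y : M) : 0 < Q.q z y := (Q.isTwistedBy hz).pos y

/-- `X` is a solution of the Floer equation on the conical end, with energy density `e`. -/
structure IsSol (u : ℂ → X) (e : ℂ → ℝ) : Prop where
  smooth : ContMDiffOn 𝓘(ℝ, ℂ) 𝓘(ℝ, E) ∞ u Q.U
  eqn : ∀ z ∈ Q.U, ∀ (y : M) (r : ℝ), Q.T < r → (hu : u z = L.cone (y, r)) →
    ∃ A₁ A₂ X₁ X₂ : TangentSpace 𝓘(ℝ, F) y × ℝ,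
      IsLiftedHamVec L.alpha (fun y ↦ Q.g₁ y z) y r X₁ ∧
      IsLiftedHamVec L.alpha (fun y ↦ Q.g₂ y z) y r X₂ ∧
      (mfderiv 𝓘(ℝ, ℂ) 𝓘(ℝ, E) u z (1 : ℂ) : E) = L.dCone y r (X₁ + A₁) ∧
      (mfderiv 𝓘(ℝ, ℂ) 𝓘(ℝ, E) u z Complex.I : E) = L.dCone y r (X₂ + A₂) ∧
      L.dCone y r A₂ = Q.J z (L.cone (y, r)) (L.dCone y r A₁) ∧
      e z = sympForm L.alpha y r A₁ A₂

variable {Q}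

lemma conicalDiff_readFam {g : M → ℂ → ℝ} 
    (hg : ContMDiffOn (𝓘(ℝ, F).prod 𝓘(ℝ, ℂ)) 𝓘(ℝ, ℝ) ∞ (fun z : M × ℂ ↦ g z.1 z.2)
      (univ ×ˢ Q.U)) {y₀ : M} {p : ℂ × F} (hp : p ∈ (Q.localData y₀).D) (W : F × ℝ) :
    conicalDiff (readFam g y₀) p W
      = fderiv ℝ (readFun (fun y ↦ g y p.1) y₀) p.2 W.1 + readFun (fun y ↦ g y p.1) y₀ p.2 * W.2 := by
  rw [conicalDiff_apply, fderiv_partial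
    ((smooth_readFam Q.isOpen hg hp.1 hp.2).differentiableAt (by simp))]
  rfl

lemma eq_ham_of_isLiftedHamVec {g : M → ℂ → ℝ}
    (hg : ContMDiffOn (𝓘(ℝ, F).prod 𝓘(ℝ, ℂ)) 𝓘(ℝ, ℝ) ∞ (fun z : M × ℂ ↦ g z.1 z.2)
      (univ ×ˢ Q.U)) {y₀ : M} {p : ℂ × F} (hp : p ∈ (Q.localData y₀).D) {r : ℝ} (hr : 0 < r)
    (V : F × ℝ) : IsLiftedHamVec L.alpha (fun y ↦ g y p.1) ((extChartAt 𝓘(ℝ, F) y₀).symm p.2) r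
      (coordVec y₀ p.2 V.1, r * V.2) ↔ V = (Q.localData y₀).ham (readFam g y₀) p := by
  rw [isLiftedHamVec_coord L.contact.smooth hp.2 (mdifferentiableAt_slice Q.isOpen hg hp.1 _) hr]
  constructor
  · intro h
    refine LocalData.eq_ham hp _ (ContinuousLinearMap.ext fun W ↦ ?_)
    rw [conicalDiff_readFam hg hp]
    exact h W
  · rintro rfl W
    rw [← conicalDiff_readFam hg hp W, ← LocalData.Om_ham hp (readFam g y₀)]
    rfl

/-- The equation is needed on a neighbourhood of z, because the Laplacian differentiates the
first-order identities for the height. -/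
lemma IsSol.exists_local {u : ℂ → X} {e : ℂ → ℝ} (h : Q.IsSol u e) {z : ℂ} (hz : z ∈ Q.U)
    {y₀ y : M} {r : ℝ} (hr : Q.T < r) (hy : y ∈ (chartAt F y₀).source)
    (huz : u z = L.cone (y, r)) :
    ∃ w : ℂ → F × ℝ, ContDiffAt ℝ ∞ w z ∧ w z = (extChartAt 𝓘(ℝ, F) y₀ y, Real.log r) ∧
      ∀ᶠ z' in 𝓝 z, (z', (w z').1) ∈ (Q.localData y₀).D ∧ u z' = L.param y₀ (w z') ∧
        Q.T < Real.exp (w z').2 ∧ (Q.localData y₀).IsSolAt w z' ∧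
        e z' = Real.exp (w z').2 * (Q.localData y₀).Om (z', (w z').1)
          ((Q.localData y₀).A w z') ((Q.localData y₀).K (z', (w z').1)
            ((Q.localData y₀).A w z')) := by
  have hT0 : 0 < Q.T := by linarith [Q.one_le]
  have hr0 : 0 < r := by linarith
  obtain ⟨w, hw, hwz, hev⟩ := L.exists_lift Q.isOpen h.smooth hz hr0 hy huz
  refine ⟨w, hw, hwz, ?_⟩
  have e1 : ∀ᶠ z' in 𝓝 z, Q.T < Real.exp (w z').2 := by
    have : ContinuousAt (fun z ↦ Real.exp (w z).2) z := hw.continuousAt.snd.rexp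
    refine this.eventually_const_lt ?_
    simpa [hwz, Real.exp_log hr0] using hr
  filter_upwards [Q.isOpen.mem_nhds hz, e1, hev.eventually_nhds,
    LocalData.eventually_differentiableAt hw] with z' hz' hT hev' hdw
  obtain ⟨hdom, hu'⟩ := hev'.self_of_nhds
  have hp : (z', (w z').1) ∈ (Q.localData y₀).D := ⟨hz', hdom.1⟩
  refine ⟨hp, hu', hT, ?_⟩
  set f := (w z').1 with hf
  set y' := (extChartAt 𝓘(ℝ, F) y₀).symm f with hy'
  set r' := Real.exp (w z').2 with hr'
  have hr'0 : 0 < r' := Real.exp_pos _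
  obtain ⟨A₁, A₂, X₁, X₂, hX₁, hX₂, hd1, hdI, hA, he⟩ := h.eqn z' hz' y' r' hT hu'
  have hderiv : ∀ v : ℂ, (mfderiv 𝓘(ℝ, ℂ) 𝓘(ℝ, E) u z' v : E)
      = L.dCone y' r' (coordVec y₀ f (fderiv ℝ w z' v).1, r' * (fderiv ℝ w z' v).2) := by
    intro v
    have a1 : u =ᶠ[𝓝 z'] L.param y₀ ∘ w := hev'.mono fun _ hx ↦ hx.2
    have a2 : MDifferentiableAt 𝓘(ℝ, F × ℝ) 𝓘(ℝ, E) (L.param y₀) (w z') :=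
      ((L.smooth_param y₀).contMDiffAt ((isOpen_paramDom y₀).mem_nhds hdom)).mdifferentiableAt
        (by simp)
    have a3 := (HasMFDerivAt.comp z' a2.hasMFDerivAt hdw.mdifferentiableAt.hasMFDerivAt)
    have a4 := (a3.congr_of_eventuallyEq a1).mfderiv
    refine (congrArg (fun l ↦ l v) a4).trans ?_
    rw [mfderiv_eq_fderiv]
    exact L.dParam_apply hdom _
  have hlift : ∀ Y : TangentSpace 𝓘(ℝ, F) y' × ℝ, ∃ V : F × ℝ,
      Y = (coordVec y₀ f V.1, r' * V.2) := by
    intro Y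
    obtain ⟨V, hV⟩ := ((coordVec_bijective hdom.1).prodMap (mulLeft_bijective₀ _ hr'0.ne')).2 Y
    exact ⟨V, hV.symm⟩
  have hinj := (L.bijective_cone y' r' hr'0).1
  obtain ⟨V₁, rfl⟩ := hlift X₁
  obtain ⟨V₂, rfl⟩ := hlift X₂
  obtain ⟨B₁, rfl⟩ := hlift A₁
  obtain ⟨B₂, rfl⟩ := hlift A₂
  have hadd : ∀ V B : F × ℝ, ((coordVec y₀ f V.1, r' * V.2) + (coordVec y₀ f B.1, r' * B.2) :
      TangentSpace 𝓘(ℝ, F) y' × ℝ) = (coordVec y₀ f (V + B).1, r' * (V + B).2) := by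
    intro V B
    refine Prod.ext (map_add _ _ _).symm ?_
    simp only [Prod.snd_add]; ring
  have hinj' : ∀ V B : F × ℝ, L.dCone y' r' (coordVec y₀ f V.1, r' * V.2)
      = L.dCone y' r' (coordVec y₀ f B.1, r' * B.2) → V = B := by
    intro V B hVB
    exact ((coordVec_bijective hdom.1).prodMap (mulLeft_bijective₀ _ hr'0.ne')).1 (hinj hVB)
  have hV₁ := (eq_ham_of_isLiftedHamVec Q.smooth_g₁ hp hr'0 V₁).mp hX₁
  have hV₂ := (eq_ham_of_isLiftedHamVec Q.smooth_g₂ hp hr'0 V₂).mp hX₂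
  have h1 : fderiv ℝ w z' 1 = V₁ + B₁ := by
    apply hinj'
    rw [← hadd]
    exact (hderiv 1).symm.trans hd1
  have h2 : fderiv ℝ w z' Complex.I = V₂ + B₂ := by
    apply hinj'
    rw [← hadd]
    exact (hderiv _).symm.trans hdI
  have hB₁ : (Q.localData y₀).A w z' = B₁ := by
    rw [LocalData.A, h1]
    rw [hV₁]
    exact add_sub_cancel_left _ _
  have hB₂ : B₂ = (Q.localData y₀).K (z', f) B₁ := by
    apply hinj'
    refine hA.trans ?_
    have a1 := (Q.coordJ_spec y₀ (p := (z', f)) hz' hdom.1).1 (w z').2 hT.le B₁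
    have a2 := L.dParam_apply (y₀ := y₀) (e := w z') hdom
    have a3 := (congrArg (Q.J z' (L.param y₀ (w z'))) (a2 B₁)).symm.trans a1
    exact a3.trans (a2 _)
  refine ⟨?_, ?_⟩
  · rw [LocalData.IsSolAt, hB₁, h2, hB₂, hV₂]
    rfl
  · rw [he, hB₁, ← hB₂]
    exact sympForm_coord L.contact.smooth hdom.1 r' B₁ B₂

end ConeProblem
end ConeEquation

/-! ### Estimates which are uniform over all solutions -/

section Estimates

variable {E : Type*} [NormedAddCommGroup E] [NormedSpace ℝ E] [FiniteDimensional ℝ E]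
  {X : Type*} [TopologicalSpace X] [ChartedSpace E X] [IsManifold 𝓘(ℝ, E) ∞ X]
  {F : Type*} [NormedAddCommGroup F] [NormedSpace ℝ F] [FiniteDimensional ℝ F]
  {M : Type*} [TopologicalSpace M] [ChartedSpace F M] [IsManifold 𝓘(ℝ, F) ∞ M]

/-- Monotonicity in the constant lets finitely many local constants be replaced by their maximum
over the compact product. -/
lemma _root_.IsCompact.exists_uniform {A B : Type*} [TopologicalSpace A] [TopologicalSpace B]
    [CompactSpace B] {Z : Set A} (hZ : IsCompact Z) (R : ℝ → A → B → Prop)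
    (mono : ∀ C C' z y, C ≤ C' → R C z y → R C' z y)
    (h : ∀ z ∈ Z, ∀ y, ∃ C, ∀ᶠ p in 𝓝 (z, y), R C p.1 p.2) : ∃ C, ∀ z ∈ Z, ∀ y, R C z y := by
  have key : ∃ C, ∀ p ∈ Z ×ˢ (univ : Set B), R C p.1 p.2 := by
    refine (hZ.prod isCompact_univ).induction_on (p := fun s ↦ ∃ C, ∀ p ∈ s, R C p.1 p.2)
      ⟨0, by simp⟩ (fun s t hst ⟨C, hC⟩ ↦ ⟨C, fun p hp ↦ hC p (hst hp)⟩) ?_ ?_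
    · rintro s t ⟨C, hC⟩ ⟨C', hC'⟩
      refine ⟨max C C', fun p hp ↦ ?_⟩
      rcases hp with hp | hp
      · exact mono _ _ _ _ (le_max_left _ _) (hC p hp)
      · exact mono _ _ _ _ (le_max_right _ _) (hC' p hp)
    · rintro ⟨z, y⟩ hp
      obtain ⟨C, hC⟩ := h z hp.1 y
      exact ⟨{p | R C p.1 p.2}, mem_nhdsWithin_of_mem_nhds hC, C, fun p hp ↦ hp⟩
  obtain ⟨C, hC⟩ := key
  exact ⟨C, fun z hz y ↦ hC (z, y) ⟨hz, mem_univ _⟩⟩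

namespace ConeProblem

variable {L : LiouvilleCompletion E X F M} (Q : ConeProblem L)

lemma tendsto_chart (z : ℂ) (y₀ : M) :
    Tendsto (fun p : ℂ × M ↦ (p.1, extChartAt 𝓘(ℝ, F) y₀ p.2)) (𝓝 (z, y₀))
      (𝓝 (z, extChartAt 𝓘(ℝ, F) y₀ y₀)) := by
  have h : ContinuousAt (extChartAt 𝓘(ℝ, F) y₀) (z, y₀).2 := continuousAt_extChartAt y₀
  exact (continuousAt_fst.prodMk (ContinuousAt.comp (f := Prod.snd) (x := (z, y₀)) h
    continuousAt_snd)).tendsto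

lemma eventually_mem_source (z : ℂ) (y₀ : M) :
    ∀ᶠ p : ℂ × M in 𝓝 (z, y₀), p.2 ∈ (chartAt F y₀).source :=
  continuousAt_snd.preimage_mem_nhds ((chartAt F y₀).open_source.mem_nhds (mem_chart_source F y₀))

lemma mem_localData_D {z : ℂ} (hz : z ∈ Q.U) {y₀ y : M} (hy : y ∈ (chartAt F y₀).source) :
    (z, extChartAt 𝓘(ℝ, F) y₀ y) ∈ (Q.localData y₀).D :=
  ⟨hz, (extChartAt 𝓘(ℝ, F) y₀).map_source (by simpa using hy)⟩

/-- The local constant C' is kept apart from C, which makes the relation evidently monotone in C, as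
`IsCompact.exists_uniform` demands. -/
lemma exists_isBound [CompactSpace M] {φ : M → ℝ} (hφ : ContMDiff 𝓘(ℝ, F) 𝓘(ℝ, ℝ) ∞ φ) {Z : Set ℂ}
    (hZ : IsCompact Z) (hZU : Z ⊆ Q.U) :
    ∃ C ≥ (1 : ℝ), ∀ z ∈ Z, ∀ y : M, ∃ C' ∈ Icc 1 C, ∃ y₀ : M, y ∈ (chartAt F y₀).source ∧
      (Q.localData y₀).IsBound C' (z, extChartAt 𝓘(ℝ, F) y₀ y) ∧
      ‖fderiv ℝ (readFun φ y₀) (extChartAt 𝓘(ℝ, F) y₀ y)‖ ≤ C := by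
  suffices h : ∃ C, ∀ z ∈ Z, ∀ y : M, ∃ C' ∈ Icc 1 C, ∃ y₀ : M, y ∈ (chartAt F y₀).source ∧
      (Q.localData y₀).IsBound C' (z, extChartAt 𝓘(ℝ, F) y₀ y) ∧
      ‖fderiv ℝ (readFun φ y₀) (extChartAt 𝓘(ℝ, F) y₀ y)‖ ≤ C by
    obtain ⟨C, hC⟩ := h
    refine ⟨max 1 C, le_max_left _ _, fun z hz y ↦ ?_⟩
    obtain ⟨C', hC', y₀, h1, h2, h3⟩ := hC z hz y
    exact ⟨C', ⟨hC'.1, hC'.2.trans (le_max_right _ _)⟩, y₀, h1, h2, h3.trans (le_max_right _ _)⟩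
  refine hZ.exists_uniform _ ?_ ?_
  · rintro C C' z y hCC ⟨C₁, hC₁, y₀, h1, h2, h3⟩
    exact ⟨C₁, ⟨hC₁.1, hC₁.2.trans hCC⟩, y₀, h1, h2, h3.trans hCC⟩
  · intro z hz y₀
    obtain ⟨C, hC1, hC⟩ := LocalData.eventually_isBound
      (Q.mem_localData_D (hZU hz) (mem_chart_source F y₀))
    have hr : ContDiffAt ℝ ∞ (readFun φ y₀) (extChartAt 𝓘(ℝ, F) y₀ y₀) :=
      (ContMDiffAt.comp _ (hφ _) ((contMDiffOn_symm y₀).contMDiffAt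
        (extChartAt_target_mem_nhds (I := 𝓘(ℝ, F)) y₀))).contDiffAt
    have hb := ((hr.fderiv_right (m := ∞) (by simp)).continuousAt).exists_norm_le
    have hb' := ((tendsto_chart (F := F) z y₀).snd_nhds).eventually hb
    refine ⟨max C (‖fderiv ℝ (readFun φ y₀) (extChartAt 𝓘(ℝ, F) y₀ y₀)‖ + 1), ?_⟩
    filter_upwards [(tendsto_chart (F := F) z y₀).eventually hC, eventually_mem_source (F := F) z y₀, hb']
      with p h1 h2 h3
    exact ⟨C, ⟨hC1, le_max_left _ _⟩, y₀, h2, h1, h3.trans (le_max_right _ _)⟩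

/-- The height function `r q` along a map to `X`. -/
def height (u : ℂ → X) (z : ℂ) : ℝ := L.coneLift (fun p ↦ p.2 * Q.q z p.1) (u z)

variable {Q}

lemma height_eq {u : ℂ → X} {z : ℂ} {y : M} {r : ℝ} (hr : 0 < r) (hu : u z = L.cone (y, r)) :
    Q.height u z = r * Q.q z y := by rw [height, hu, L.coneLift_cone _ _ hr]

lemma height_eq_local {u : ℂ → X} {y₀ : M} {w : ℂ → F × ℝ} {z : ℂ}
    (hp : (z, (w z).1) ∈ (Q.localData y₀).D) (hu : u z = L.param y₀ (w z)) :
    Q.height u z = (Q.localData y₀).height w z := by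
  rw [height_eq (Real.exp_pos _) hu, LocalData.height, Q.localData_q hp]

lemma continuousAt_energy {u : ℂ → X} {e : ℂ → ℝ} (h : Q.IsSol u e) {z : ℂ} (hz : z ∈ Q.U)
    {y : M} {r : ℝ} (hr : Q.T < r) (hu : u z = L.cone (y, r)) : ContinuousAt e z := by
  obtain ⟨w, hw, hwz, hev⟩ := h.exists_local hz hr (mem_chart_source F y) hu
  have hp := hev.self_of_nhds.1
  have hin : ContinuousAt (fun z ↦ (z, (w z).1)) z := continuousAt_id.prodMk hw.continuousAt.fst
  have hA : ContinuousAt ((Q.localData y).A w) z := by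
    have h1 : ContinuousAt (fderiv ℝ w) z := (hw.fderiv_right (m := ∞) (by simp)).continuousAt
    have h2 : ContinuousAt ((Q.localData y).ham (Q.localData y).g₁) (z, (w z).1) :=
      LocalData.continuousAt_ham hp ((Q.localData y).smooth_g₁ _ hp)
    exact (h1.clm_apply continuousAt_const).sub
      (ContinuousAt.comp (f := fun z ↦ (z, (w z).1)) h2 hin)
  have hO : ContinuousAt (fun z ↦ (Q.localData y).Om (z, (w z).1)) z :=
    ContinuousAt.comp (f := fun z ↦ (z, (w z).1)) (LocalData.continuousAt_Om hp) hin
  have hK : ContinuousAt (fun z ↦ (Q.localData y).K (z, (w z).1)) z :=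
    ContinuousAt.comp (f := fun z ↦ (z, (w z).1))
      ((Q.localData y).smooth_K _ hp).continuousAt hin
  refine ContinuousAt.congr ?_ (hev.mono fun z' hz' ↦ hz'.2.2.2.2.symm)
  exact hw.continuousAt.snd.rexp.mul ((hO.clm_apply hA).clm_apply (hK.clm_apply hA))

lemma lap_congr {f g : ℂ → ℝ} {z : ℂ} (h : f =ᶠ[𝓝 z] g) : lap f z = lap g z := by
  have h1 : ∀ v : ℂ, (fun z ↦ fderiv ℝ f z v) =ᶠ[𝓝 z] fun z ↦ fderiv ℝ g z v := fun v ↦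
    (h.fderiv (𝕜 := ℝ)).mono fun z hz ↦ by simp only [hz]
  simp only [lap, (h1 _).fderiv_eq]

lemma contDiffAt_height {S : LocalData F} {w : ℂ → F × ℝ} {z : ℂ} (hw : ContDiffAt ℝ ∞ w z)
    (hp : (z, (w z).1) ∈ S.D) : ContDiffAt ℝ ∞ (S.height w) z := by
  have h1 : ContDiffAt ℝ ∞ (fun z ↦ S.q (z, (w z).1)) z :=
    ContDiffAt.comp (f := fun z ↦ (z, (w z).1)) z (LocalData.smooth_q hp)
      (contDiffAt_id.prodMk hw.fst)
  exact (Real.contDiff_exp.contDiffAt.comp z hw.snd).mul h1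

variable (Q)

lemma exists_q_bound [CompactSpace M] {Z : Set ℂ} (hZ : IsCompact Z) (hZU : Z ⊆ Q.U) :
    ∃ C ≥ (1 : ℝ), ∀ z ∈ Z, ∀ y : M, Q.q z y ≤ C ∧ 1 ≤ C * Q.q z y := by
  obtain ⟨C, hC1, hC⟩ := Q.exists_isBound (φ := fun _ ↦ 0) contMDiff_const hZ hZU
  refine ⟨C, hC1, fun z hz y ↦ ?_⟩
  obtain ⟨C', hC', y₀, hy, hb, -⟩ := hC z hz y
  have hq := Q.localData_q (Q.mem_localData_D (hZU hz) hy)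
  simp only [(extChartAt 𝓘(ℝ, F) y₀).left_inv (show y ∈ (extChartAt 𝓘(ℝ, F) y₀).source by
    simpa using hy)] at hq
  rw [← hq]
  refine ⟨hb.q_le.trans hC'.2, hb.le_q.trans (mul_le_mul_of_nonneg_right hC'.2 ?_)⟩
  rw [hq]; exact (Q.q_pos (hZU hz) y).le

/-- Besides the two height estimates, this bounds the derivative of φ(y) + κ log r. The case κ = 0
with a bump function φ confines y to charts, and κ = 1 with φ = 0 controls the oscillation of log r.
-/
lemma exists_estimates [CompactSpace M] {φ : M → ℝ} (hφ : ContMDiff 𝓘(ℝ, F) 𝓘(ℝ, ℝ) ∞ φ)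
    {κ : ℝ} (hκ : |κ| ≤ 1)
    {Z : Set ℂ} (hZ : IsCompact Z) (hZU : Z ⊆ Q.U) :
    ∃ C ≥ (1 : ℝ), ∀ (u : ℂ → X) (e : ℂ → ℝ), Q.IsSol u e → ∀ z ∈ Z, ∀ (y : M) (r : ℝ),
      Q.T < r → u z = L.cone (y, r) →
      ContDiffAt ℝ ∞ (Q.height u) z ∧ -C * Q.height u z ≤ lap (Q.height u) z ∧ 0 ≤ e z ∧
      (∀ v, |fderiv ℝ (Q.height u) z v| ≤ C * Q.height u z * (1 + √(e z)) * ‖v‖) ∧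
      ContDiffAt ℝ ∞ (fun z ↦ L.coneLift (fun p ↦ φ p.1 + κ * Real.log p.2) (u z)) z ∧
      ∀ v, |fderiv ℝ (fun z ↦ L.coneLift (fun p ↦ φ p.1 + κ * Real.log p.2) (u z)) z v|
        ≤ C * (1 + √(e z)) * ‖v‖ := by
  obtain ⟨C, hC1, hC⟩ := Q.exists_isBound hφ hZ hZU
  refine ⟨17 * C ^ 8, by nlinarith [one_le_pow₀ (n := 8) hC1], fun u e h z hz y r hr hu ↦ ?_⟩
  obtain ⟨C', ⟨hC'1, hC'C⟩, y₀, hy, hb, hbφ⟩ := hC z hz y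
  obtain ⟨w, hw, hwz, hev⟩ := h.exists_local (hZU hz) hr hy hu
  obtain ⟨hp, hu', hT, hs, he⟩ := hev.self_of_nhds
  have hT0 : 0 < Q.T := by linarith [Q.one_le]
  have hheq : Q.height u =ᶠ[𝓝 z] (Q.localData y₀).height w :=
    hev.mono fun z' hz' ↦ height_eq_local hz'.1 hz'.2.1
  have hh0 : 0 < Q.height u z := by
    rw [height_eq (hT0.trans hr) hu]; exact mul_pos (hT0.trans hr) (Q.q_pos (hZU hz) y)
  rw [show extChartAt 𝓘(ℝ, F) y₀ y = (w z).1 by rw [hwz]] at hb hbφ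
  set S := Q.localData y₀ with hS
  have hOm : 0 ≤ S.Om (z, (w z).1) (S.A w z) (S.K (z, (w z).1) (S.A w z)) := by
    by_contra hneg
    have := hb.coercive (S.A w z)
    nlinarith [sq_nonneg ‖S.A w z‖]
  -- Since r > T ≥ 1, the density e = r Om(A, K A) dominates Om(A, K A).
  have h1e : 1 ≤ Real.exp (w z).2 := Q.one_le.trans hT.le
  have hOe : S.Om (z, (w z).1) (S.A w z) (S.K (z, (w z).1) (S.A w z)) ≤ e z := by
    rw [he]; nlinarith
  have hsq := Real.sqrt_le_sqrt hOe
  have hpow : ∀ n ≤ 8, C' ^ n ≤ C ^ 8 := fun n hn ↦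
    (pow_le_pow_left₀ (by linarith) hC'C n).trans (pow_le_pow_right₀ hC1 hn)
  have hs0 := Real.sqrt_nonneg (e z)
  refine ⟨(contDiffAt_height hw hp).congr_of_eventuallyEq hheq, ?_, by rw [he]; positivity,
    fun v ↦ ?_, ?_, fun v ↦ ?_⟩
  · rw [lap_congr hheq, hheq.self_of_nhds]
    have := hb.lap_ge hC'1 hw hp (hev.mono fun z' hz' ↦ hz'.2.2.2.1)
    rw [hheq.self_of_nhds] at hh0
    have h8 := hpow 8 le_rfl
    nlinarith
  · rw [hheq.fderiv_eq, hheq.self_of_nhds]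
    rw [hheq.self_of_nhds] at hh0
    refine (hb.abs_fderiv_le hC'1 hw hp hs v).trans ?_
    have h4 := hpow 4 (by norm_num)
    have hC8 : 0 < C ^ 8 := by positivity
    gcongr
    · linarith
  · have hφr : ContDiffAt ℝ ∞ (readFun φ y₀) (w z).1 :=
      (ContMDiffAt.comp _ (hφ _) ((contMDiffOn_symm y₀).contMDiffAt
        ((isOpen_target y₀).mem_nhds hp.2))).contDiffAt
    refine ((ContDiffAt.comp (f := fun z ↦ (w z).1) z hφr hw.fst).add
      ((contDiffAt_const (c := κ)).mul hw.snd)).congr_of_eventuallyEq (f₁ := fun z ↦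
        L.coneLift (fun p ↦ φ p.1 + κ * Real.log p.2) (u z)) ?_
    filter_upwards [hev] with z' hz'
    rw [hz'.2.1, LiouvilleCompletion.param, L.coneLift_cone _ _ (Real.exp_pos _), Real.log_exp]
    rfl
  · have hφr : ContDiffAt ℝ ∞ (readFun φ y₀) (w z).1 :=
      (ContMDiffAt.comp _ (hφ _) ((contMDiffOn_symm y₀).contMDiffAt
        ((isOpen_target y₀).mem_nhds hp.2))).contDiffAt
    have heq : (fun z ↦ L.coneLift (fun p ↦ φ p.1 + κ * Real.log p.2) (u z)) =ᶠ[𝓝 z]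
        fun z ↦ readFun φ y₀ (w z).1 + κ * (w z).2 := by
      filter_upwards [hev] with z' hz'
      rw [hz'.2.1, LiouvilleCompletion.param, L.coneLift_cone _ _ (Real.exp_pos _), Real.log_exp]
      rfl
    have hwd := (hw.differentiableAt (by simp)).hasFDerivAt
    have hd : HasFDerivAt (fun z ↦ readFun φ y₀ (w z).1 + κ * (w z).2) _ z :=
      (HasFDerivAt.comp (f := fun z ↦ (w z).1) z
        (hφr.differentiableAt (by simp)).hasFDerivAt hwd.fst).add (hwd.snd.const_mul κ)
    have hd' : fderiv ℝ (fun z ↦ readFun φ y₀ (w z).1 + κ * (w z).2) z v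
        = fderiv ℝ (readFun φ y₀) (w z).1 (fderiv ℝ w z v).1 + κ * (fderiv ℝ w z v).2 := by
      rw [hd.fderiv]; rfl
    rw [heq.fderiv_eq, hd']
    have hA := hb.norm_A_le hC'1 (S.A w z)
    have hA2 : ‖S.A w z‖ ≤ C' * √(e z) := hA.trans (by gcongr)
    have hn1 := hb.norm_fderiv_one
    have hnI := hb.norm_fderiv_I hs
    have hb1 : ‖fderiv ℝ w z 1‖ ≤ C ^ 2 * (1 + √(e z)) := by
      have h1 : C' + C' * √(e z) ≤ C * (1 + √(e z)) := by nlinarith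
      have h2 : C * (1 + √(e z)) ≤ C ^ 2 * (1 + √(e z)) := by gcongr; nlinarith
      linarith
    have hbI : ‖fderiv ℝ w z Complex.I‖ ≤ C ^ 2 * (1 + √(e z)) := by
      have : C' * ‖S.A w z‖ ≤ C' * (C' * √(e z)) := by gcongr
      have h2 : C' * C' ≤ C ^ 2 := by nlinarith
      nlinarith
    have hv : fderiv ℝ w z v = v.re • fderiv ℝ w z 1 + v.im • fderiv ℝ w z Complex.I := by
      rw [← map_smul, ← map_smul, ← map_add]
      congr 1
      simp
    have hvn : ‖fderiv ℝ w z v‖ ≤ 2 * (C ^ 2 * (1 + √(e z))) * ‖v‖ := by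
      rw [hv]
      have hr1 := Complex.abs_re_le_norm v
      have hi1 := Complex.abs_im_le_norm v
      have ha := norm_smul v.re (fderiv ℝ w z 1)
      have hb := norm_smul v.im (fderiv ℝ w z Complex.I)
      rw [Real.norm_eq_abs] at ha hb
      have h1 := mul_le_mul hr1 hb1 (norm_nonneg _) (norm_nonneg _)
      have h2 := mul_le_mul hi1 hbI (norm_nonneg _) (norm_nonneg _)
      have := norm_add_le (v.re • fderiv ℝ w z 1) (v.im • fderiv ℝ w z Complex.I)
      linarith
    have h3 : ‖(fderiv ℝ w z v).1‖ ≤ 2 * (C ^ 2 * (1 + √(e z))) * ‖v‖ := (norm_fst_le _).trans hvn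
    have h4 := (ContinuousLinearMap.le_opNorm (fderiv ℝ (readFun φ y₀) (w z).1)
      (fderiv ℝ w z v).1).trans (mul_le_mul hbφ h3 (norm_nonneg _) (by linarith))
    have h3' : |κ * (fderiv ℝ w z v).2| ≤ 2 * (C ^ 2 * (1 + √(e z))) * ‖v‖ := by
      rw [abs_mul]
      have := (norm_snd_le _).trans hvn
      rw [Real.norm_eq_abs] at this
      nlinarith [abs_nonneg (fderiv ℝ w z v).2]
    rw [Real.norm_eq_abs] at h4
    refine (abs_add_le _ _).trans ((add_le_add h4 h3').trans ?_)
    have h38 : C ^ 3 ≤ C ^ 8 := pow_le_pow_right₀ hC1 (by norm_num)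
    have h28 : C ^ 2 ≤ C ^ 8 := pow_le_pow_right₀ hC1 (by norm_num)
    have : C * (2 * (C ^ 2 * (1 + √(e z))) * ‖v‖) + 2 * (C ^ 2 * (1 + √(e z))) * ‖v‖
      = (2 * C ^ 3 + 2 * C ^ 2) * ((1 + √(e z)) * ‖v‖) := by ring
    have h5 : 0 ≤ (1 + √(e z)) * ‖v‖ := by positivity
    have h6 : (0 : ℝ) < C ^ 8 := by positivity
    have h7 := mul_le_mul_of_nonneg_right (show 2 * C ^ 3 + 2 * C ^ 2 ≤ 17 * C ^ 8 by linarith) h5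
    rw [this]
    linarith

end ConeProblem
end Estimates

/-! ### Topology of the conical end -/

section ConeTopology

variable {E : Type*} [NormedAddCommGroup E] [NormedSpace ℝ E]
  {X : Type*} [TopologicalSpace X] [T2Space X] [ChartedSpace E X] [IsManifold 𝓘(ℝ, E) ∞ X]
  {F : Type*} [NormedAddCommGroup F] [NormedSpace ℝ F]
  {M : Type*} [TopologicalSpace M] [CompactSpace M] [ChartedSpace F M] [IsManifold 𝓘(ℝ, F) ∞ M]

namespace LiouvilleCompletion

variable (L : LiouvilleCompletion E X F M)

lemma isCompact_cone_Icc {a : ℝ} (ha : 0 < a) (b : ℝ) :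
    IsCompact (L.cone '' (univ ×ˢ Icc a b)) :=
  (isCompact_univ.prod isCompact_Icc).image_of_continuousOn
    (L.smooth_cone.continuousOn.mono (prod_mono le_rfl fun _ h ↦ ha.trans_le h.1))

lemma cone_inj {y y' : M} {r r' : ℝ} (hr : 0 < r) (hr' : 0 < r')
    (h : L.cone (y, r) = L.cone (y', r')) : y = y' ∧ r = r' :=
  Prod.ext_iff.mp (L.injOn_cone (show (y, r) ∈ _ from ⟨mem_univ _, hr⟩)
    (show (y', r') ∈ _ from ⟨mem_univ _, hr'⟩) h)

lemma isCompact_compl_end {R : ℝ} (hR : 1 ≤ R) : IsCompact (L.cone '' (univ ×ˢ Ioi R))ᶜ := by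
  have h : (L.cone '' (univ ×ˢ Ioi R))ᶜ ⊆
      (L.cone '' (univ ×ˢ Ioi 1))ᶜ ∪ L.cone '' (univ ×ˢ Icc 1 R) := by
    intro x hx
    by_cases h1 : x ∈ L.cone '' (univ ×ˢ Ioi 1)
    · right
      obtain ⟨⟨y, r⟩, hr, rfl⟩ := h1
      refine ⟨(y, r), ⟨mem_univ _, hr.2.le, ?_⟩, rfl⟩
      by_contra hlt
      exact hx ⟨(y, r), ⟨mem_univ _, not_le.mp hlt⟩, rfl⟩
    · exact Or.inl h1
  have heq : (L.cone '' (univ ×ˢ Ioi R))ᶜ =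
      (L.cone '' (univ ×ˢ Ioi 1))ᶜ ∪ L.cone '' (univ ×ˢ Icc 1 R) := by
    refine h.antisymm ?_
    rintro x (hx | ⟨⟨y, r⟩, hr, rfl⟩) ⟨⟨y', r'⟩, hr', h'⟩
    · exact hx ⟨(y', r'), ⟨mem_univ _, lt_of_le_of_lt hR hr'.2⟩, h'⟩
    · have h3 : R < r' := hr'.2
      have h4 : 1 ≤ r ∧ r ≤ R := hr.2
      have h2 := (L.cone_inj (by linarith) (by linarith [h4.1]) h').2
      linarith [h4.2]
  rw [heq]
  exact L.isCompact_domain.union (L.isCompact_cone_Icc one_pos R)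

lemma isOpen_end {R : ℝ} (hR : 1 ≤ R) : IsOpen (L.cone '' (univ ×ˢ Ioi R)) := by
  rw [← isClosed_compl_iff]
  exact (L.isCompact_compl_end hR).isClosed

end LiouvilleCompletion

open LiouvilleCompletion

variable [FiniteDimensional ℝ E] [FiniteDimensional ℝ F]

/-- The metric ω(·, J·) is bounded above in charts of X. Against the lower bound on the conical end,
this prevents a point of X from being a limit of points with r tending to infinity. -/
lemma exists_omega_le (L : LiouvilleCompletion E X F M) {J : ℂ → EndField E X} {U : Set ℂ}
    (hU : IsOpen U) (hJ : SmoothFamily J U) {z : ℂ} (hz : z ∈ U) (x : X) :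
    ∃ B ≥ (0 : ℝ), ∃ η > 0, Metric.ball (extChartAt 𝓘(ℝ, E) x x) η ⊆ (extChartAt 𝓘(ℝ, E) x).target ∧
      ∀ e ∈ Metric.ball (extChartAt 𝓘(ℝ, E) x x) η, ∀ V : E,
        L.omega ((extChartAt 𝓘(ℝ, E) x).symm e) (coordVec x e V)
          (J z ((extChartAt 𝓘(ℝ, E) x).symm e) (coordVec x e V)) ≤ (B * ‖V‖) ^ 2 := by
  set φ := extChartAt 𝓘(ℝ, E) x
  have h1 : ContinuousAt (fderiv ℝ (chartForm L.lam x)) (φ x) :=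
    ((smooth_chartForm_self L.smooth_lam x).fderiv_right (m := ∞) (by simp)).continuousAt
  have h2 : ContinuousAt (fun e ↦ chartEnd J x (z, e)) (φ x) :=
    ContinuousAt.comp (f := fun e : E ↦ (z, e)) (smooth_chartEnd_self hU hJ hz x).continuousAt
      (by fun_prop)
  obtain ⟨η, hη, hball⟩ := Metric.eventually_nhds_iff_ball.mp
    ((h1.exists_norm_le.and h2.exists_norm_le).and (extChartAt_target_mem_nhds (I := 𝓘(ℝ, E)) x))
  set a := ‖fderiv ℝ (chartForm L.lam x) (φ x)‖ + 1
  set b := ‖chartEnd J x (z, φ x)‖ + 1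
  have ha : 1 ≤ a := by simp [a]
  have hb : 1 ≤ b := by simp [b]
  refine ⟨2 * a * b, by positivity, η, hη, fun e he ↦ (hball e he).2, fun e he V ↦ ?_⟩
  obtain ⟨⟨hD, hN⟩, ht⟩ := hball e he
  have hJV : J z (φ.symm e) (coordVec x e V) = coordVec x e (chartEnd J x (z, e) V) :=
    by
    have h := mfderiv_symm_mfderiv (x₀ := x) (x := φ.symm e)
      (by simpa [φ] using φ.map_target ht) (J z (φ.symm e) (coordVec x e V))
    rw [φ.right_inv ht] at h
    exact h.symm
  rw [hJV]
  have h3 : L.omega (φ.symm e) (coordVec x e V) (coordVec x e (chartEnd J x (z, e) V)) = _ :=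
    dForm_symm L.smooth_lam ht V (chartEnd J x (z, e) V)
  rw [h3]
  have h4 : ‖chartEnd J x (z, e) V‖ ≤ b * ‖V‖ :=
    (ContinuousLinearMap.le_opNorm _ _).trans (mul_le_mul_of_nonneg_right hN (norm_nonneg _))
  have h5 : ∀ v w : E, |fderiv ℝ (chartForm L.lam x) e v w| ≤ a * ‖v‖ * ‖w‖ := fun v w ↦
    
    (ContinuousLinearMap.le_opNorm₂ (fderiv ℝ (chartForm L.lam x) e) v w).trans (by gcongr)
  have h6 := h5 V (chartEnd J x (z, e) V)
  have h7 := h5 (chartEnd J x (z, e) V) V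
  have h8 : a * ‖V‖ * ‖chartEnd J x (z, e) V‖ ≤ a * ‖V‖ * (b * ‖V‖) := by gcongr
  have h9 := abs_sub (fderiv ℝ (chartForm L.lam x) e V (chartEnd J x (z, e) V))
    (fderiv ℝ (chartForm L.lam x) e (chartEnd J x (z, e) V) V)
  have h10 := le_abs_self (fderiv ℝ (chartForm L.lam x) e V (chartEnd J x (z, e) V) -
    fderiv ℝ (chartForm L.lam x) e (chartEnd J x (z, e) V) V)
  have h11 : (2 * a * b * ‖V‖) ^ 2 = 2 * (a * b) * (2 * (a * b) * ‖V‖ ^ 2) := by ring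
  -- Since 2ab ≥ 1, the bound may be written as a square, the form used for comparing lengths.
  have h12 : 2 * (a * b) * ‖V‖ ^ 2 ≤ (2 * a * b * ‖V‖) ^ 2 := by
    rw [h11]
    have : 1 ≤ a * b := one_le_mul_of_one_le_of_one_le ha hb
    exact le_mul_of_one_le_left (by positivity) (by linarith)
  nlinarith

namespace ConeProblem

variable {L : LiouvilleCompletion E X F M} (Q : ConeProblem L)

/-- The logarithm of `r` is uniformly Lipschitz for the metrics `ω(·, J·)`. -/
lemma exists_speed_le {z : ℂ} (hz : z ∈ Q.U) : ∃ C ≥ (0 : ℝ), ∀ (y : M) (r : ℝ), Q.T < r → ∃ y₀ : M,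
    y ∈ (chartAt F y₀).source ∧ ∀ (e : F × ℝ), e = (extChartAt 𝓘(ℝ, F) y₀ y, Real.log r) →
      ∀ W : F × ℝ, ∀ K : ℝ, 0 ≤ K → L.omega (L.param y₀ e) (L.dParam y₀ e W)
        (Q.J z (L.param y₀ e) (L.dParam y₀ e W)) ≤ K ^ 2 → ‖W‖ ≤ C * K := by
  obtain ⟨C, hC1, hC⟩ := Q.exists_isBound (φ := fun _ ↦ 0) contMDiff_const
    (isCompact_singleton (x := z)) (by simpa using hz)
  refine ⟨C, by linarith, fun y r hr ↦ ?_⟩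
  obtain ⟨C', hC', y₀, hy, hb, -⟩ := hC z rfl y
  refine ⟨y₀, hy, fun e he W K hK hW ↦ ?_⟩
  have hp := Q.mem_localData_D hz hy
  have hT0 : 0 < Q.T := by linarith [Q.one_le]
  have hr' : Real.exp (Real.log r) = r := Real.exp_log (hT0.trans hr)
  subst he
  have hdom : (extChartAt 𝓘(ℝ, F) y₀ y, Real.log r) ∈ (paramDom y₀ : Set (F × ℝ)) :=
    ⟨hp.2, mem_univ _⟩
  rw [(Q.coordJ_spec y₀ (p := (z, extChartAt 𝓘(ℝ, F) y₀ y)) hz hp.2).1 _ (by rw [hr']; exact hr.le),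
    L.omega_param hdom, hr'] at hW
  have h1 := hb.norm_A_le hC'.1 W
  set o := (Q.localData y₀).Om (z, extChartAt 𝓘(ℝ, F) y₀ y) W
    ((Q.localData y₀).K (z, extChartAt 𝓘(ℝ, F) y₀ y) W) with ho
  have h2 : r * o ≤ K ^ 2 := hW
  -- From r o ≤ K² and r > T ≥ 1.
  have h3 : √o ≤ K := by
    rw [Real.sqrt_le_left hK]
    by_contra hlt
    have := Q.one_le
    nlinarith [sq_nonneg K]
  calc ‖W‖ ≤ C' * √o := h1
    _ ≤ C * K := by
      have := hC'.1
      exact mul_le_mul hC'.2 h3 (Real.sqrt_nonneg _) (by linarith)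

/-- Along a short segment in a chart of `X` the logarithm of `r` varies little. -/
lemma exists_cone_of_segment {z : ℂ} (hz : z ∈ Q.U) (x : X) : ∃ C ≥ (0 : ℝ), ∃ η > 0,
    Metric.ball (extChartAt 𝓘(ℝ, E) x x) η ⊆ (extChartAt 𝓘(ℝ, E) x).target ∧
    ∀ e ∈ Metric.ball (extChartAt 𝓘(ℝ, E) x x) η, ∀ (y : M) (σ l : ℝ),
      (extChartAt 𝓘(ℝ, E) x).symm e = L.cone (y, Real.exp σ) →
      C * ‖extChartAt 𝓘(ℝ, E) x x - e‖ < l → Q.T < Real.exp (σ - l) →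
      ∃ (y' : M) (σ' : ℝ), |σ' - σ| ≤ l ∧ x = L.cone (y', Real.exp σ') := by
  obtain ⟨B, hB0, η, hη, hball, hB⟩ := exists_omega_le L Q.isOpen Q.smooth_J hz x
  obtain ⟨C, hC0, hC⟩ := Q.exists_speed_le hz
  refine ⟨C * B, by positivity, η, hη, hball, fun e he y σ l hcone hl hT ↦ ?_⟩
  set φ := extChartAt 𝓘(ℝ, E) x
  set v := φ x - e with hv
  let seg : ℝ → E := fun τ ↦ e + τ • v
  have hseg : ContDiff ℝ ∞ seg := by fun_prop
  let c : ℝ → X := fun τ ↦ φ.symm (seg τ)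
  let U : Set ℝ := seg ⁻¹' Metric.ball (φ x) η
  have hU : IsOpen U := Metric.isOpen_ball.preimage hseg.continuous
  have hIU : Icc (0 : ℝ) 1 ⊆ U := by
    intro τ hτ
    have : seg τ ∈ segment ℝ e (φ x) := by
      rw [segment_eq_image']
      exact ⟨τ, hτ, rfl⟩
    exact (convex_ball _ _).segment_subset he (Metric.mem_ball_self hη) this
  have hc : ContMDiffOn 𝓘(ℝ, ℝ) 𝓘(ℝ, E) ∞ c U := by
    have h1 : ContMDiff 𝓘(ℝ, ℝ) 𝓘(ℝ, E) ∞ seg := hseg.contMDiff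
    exact (contMDiffOn_symm x).comp h1.contMDiffOn fun τ hτ ↦ hball hτ
  have hl0 : 0 ≤ l := by
    have : 0 ≤ C * B * ‖v‖ := by positivity
    linarith
  -- Continuity method along the segment: the set of times at which the curve is still on the
  -- conical end with log r moved by at most l τ is closed, as the projection of a compact set, and
  -- extends to the right of each of its points.
  let s : Set ℝ := {τ | ∃ (y' : M) (σ' : ℝ), |σ' - σ| ≤ l * τ ∧ c τ = L.cone (y', Real.exp σ')}
  have hclosed : IsClosed (s ∩ Icc 0 1) := by
    let Kc : Set (ℝ × (M × ℝ)) := Icc 0 1 ×ˢ (univ ×ˢ Icc (σ - l) (σ + l))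
    have hKc : IsCompact Kc := isCompact_Icc.prod (isCompact_univ.prod isCompact_Icc)
    have h1 : ContinuousOn (fun p : ℝ × (M × ℝ) ↦ (c p.1, L.cone (p.2.1, Real.exp p.2.2))) Kc := by
      refine ContinuousOn.prodMk ?_ ?_
      · exact hc.continuousOn.comp continuousOn_fst fun p hp ↦ hIU hp.1
      · exact L.smooth_cone.continuousOn.comp (by fun_prop)
          fun p hp ↦ ⟨mem_univ _, Real.exp_pos _⟩
    have h2 : IsClosed {q : X × X | q.1 = q.2} := isClosed_diagonal
    have hKcl : IsClosed Kc := isClosed_Icc.prod (isClosed_univ.prod isClosed_Icc)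
    have h3 : IsCompact (Kc ∩ ((fun p : ℝ × (M × ℝ) ↦
        (c p.1, L.cone (p.2.1, Real.exp p.2.2))) ⁻¹' {q : X × X | q.1 = q.2})
          ∩ {p | |p.2.2 - σ| ≤ l * p.1}) :=
      hKc.of_isClosed_subset ((h1.preimage_isClosed_of_isClosed hKcl h2).inter
        (isClosed_le (by fun_prop) (by fun_prop))) fun p hp ↦ hp.1.1
    have h4 : s ∩ Icc 0 1 = Prod.fst '' (Kc ∩ ((fun p : ℝ × (M × ℝ) ↦
        (c p.1, L.cone (p.2.1, Real.exp p.2.2))) ⁻¹' {q : X × X | q.1 = q.2})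
          ∩ {p | |p.2.2 - σ| ≤ l * p.1}) := by
      ext τ
      constructor
      · rintro ⟨⟨y', σ', h5, h6⟩, hτ⟩
        refine ⟨(τ, y', σ'), ⟨⟨⟨hτ, mem_univ _, ?_⟩, h6⟩, h5⟩, rfl⟩
        have := abs_le.mp h5
        constructor <;> nlinarith [hτ.1, hτ.2]
      · rintro ⟨⟨τ', y', σ'⟩, ⟨⟨h7, h6⟩, h5⟩, rfl⟩
        exact ⟨⟨y', σ', h5, h6⟩, h7.1⟩
    rw [h4]
    exact (h3.image continuous_fst).isClosed
  have h0 : (0 : ℝ) ∈ s := ⟨y, σ, by simp, by simp [c, seg, hcone]⟩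
  have hstep : ∀ τ ∈ s ∩ Ico 0 1, s ∈ 𝓝[>] τ := by
    rintro τ ⟨⟨y', σ', hσ', hcτ⟩, hτ⟩
    have hτU : τ ∈ U := hIU ⟨hτ.1, hτ.2.le⟩
    have hTσ : Q.T < Real.exp σ' := by
      refine hT.trans_le (Real.exp_le_exp.mpr ?_)
      have := abs_le.mp hσ'
      nlinarith [hτ.1, hτ.2]
    obtain ⟨y₀, hy₀, hsp⟩ := hC y' (Real.exp σ') hTσ
    obtain ⟨w, hw, hwτ, hev⟩ := L.exists_lift hU hc hτU (Real.exp_pos σ') hy₀ hcτ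
    have hdom := hev.self_of_nhds.1
    have hcw : c τ = L.param y₀ (w τ) := hev.self_of_nhds.2
    have hd1 : (mfderiv 𝓘(ℝ, ℝ) 𝓘(ℝ, E) c τ (1 : ℝ) : E) = coordVec x (seg τ) v := by
      have a1 : MDifferentiableAt 𝓘(ℝ, E) 𝓘(ℝ, E) φ.symm (seg τ) :=
        ((contMDiffOn_symm x).contMDiffAt ((isOpen_target x).mem_nhds (hball hτU))).mdifferentiableAt
          (by simp)
      have a2 : HasDerivAt seg v τ := by
        simpa [seg] using ((hasDerivAt_id τ).smul_const v).const_add e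
      have a3 := (HasMFDerivAt.comp τ a1.hasMFDerivAt a2.hasFDerivAt.hasMFDerivAt).mfderiv
      refine (congrArg (fun l ↦ l (1 : ℝ)) a3).trans ?_
      have : (ContinuousLinearMap.toSpanSingleton ℝ v) (1 : ℝ) = v := by simp
      exact congrArg (coordVec x (seg τ)) this
    have hd2 : (mfderiv 𝓘(ℝ, ℝ) 𝓘(ℝ, E) c τ (1 : ℝ) : E)
        = L.dParam y₀ (w τ) (fderiv ℝ w τ 1) := by
      have a1 : c =ᶠ[𝓝 τ] L.param y₀ ∘ w := hev.mono fun _ hx ↦ hx.2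
      have a2 : MDifferentiableAt 𝓘(ℝ, F × ℝ) 𝓘(ℝ, E) (L.param y₀) (w τ) :=
        ((L.smooth_param y₀).contMDiffAt ((isOpen_paramDom y₀).mem_nhds hdom)).mdifferentiableAt
          (by simp)
      have a3 := HasMFDerivAt.comp τ a2.hasMFDerivAt
        (hw.differentiableAt (by simp)).mdifferentiableAt.hasMFDerivAt
      have a4 := (a3.congr_of_eventuallyEq a1).mfderiv
      refine (congrArg (fun l ↦ l (1 : ℝ)) a4).trans ?_
      rw [mfderiv_eq_fderiv]
      rfl
    have hom := hB (seg τ) hτU v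
    have key : ∀ (x' x'' : X) (V V' : E), x' = x'' → V = V' →
        L.omega x' V (Q.J z x' V) = L.omega x'' V' (Q.J z x'' V') := by
      rintro x' _ V _ rfl rfl; rfl
    have hom' := (key _ _ _ _ hcw (hd1.symm.trans hd2)).symm.le.trans hom
    have hW := hsp (w τ) hwτ (fderiv ℝ w τ 1) (B * ‖v‖) (by positivity) hom'
    -- The speed of log r is strictly below l. The margin l - speed absorbs the first-order error
    -- just after time τ.
    have hWl : ‖(fderiv ℝ w τ 1).2‖ < l := (norm_snd_le _).trans_lt (by
      refine hW.trans_lt ?_; rw [← mul_assoc]; exact hl)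
    have hD : HasDerivAt (fun τ ↦ (w τ).2) (fderiv ℝ w τ 1).2 τ := by
      have := (hw.differentiableAt (by simp)).hasFDerivAt.snd.hasDerivAt
      exact this
    have hO := hD.isLittleO.def (sub_pos.mpr hWl)
    have hwσ : (w τ).2 = σ' := by rw [hwτ]; simp
    filter_upwards [mem_nhdsWithin_of_mem_nhds hev, mem_nhdsWithin_of_mem_nhds hO,
      self_mem_nhdsWithin] with τ' h1 h2 h3
    refine ⟨(extChartAt 𝓘(ℝ, F) y₀).symm (w τ').1, (w τ').2, ?_, h1.2⟩
    have h3' : 0 < τ' - τ := sub_pos.mpr h3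
    simp only [Real.norm_eq_abs, smul_eq_mul, hwσ] at h2 hWl
    rw [abs_of_pos h3'] at h2
    have h4 : |(w τ').2 - σ'| ≤ l * (τ' - τ) := by
      have := abs_sub_abs_le_abs_sub ((w τ').2 - σ' ) ((τ' - τ) * (fderiv ℝ w τ 1).2)
      rw [abs_mul, abs_of_pos h3'] at this
      nlinarith
    have := abs_sub_le (w τ').2 σ' σ
    nlinarith
  obtain ⟨y', σ', h1, h2⟩ := hclosed.Icc_subset_of_forall_mem_nhdsWithin h0 hstep
    (right_mem_Icc.mpr zero_le_one)
  refine ⟨y', σ', by simpa using h1, ?_⟩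
  rw [← h2]
  simp only [c, seg, one_smul, hv, add_sub_cancel]
  exact ((extChartAt 𝓘(ℝ, E) x).left_inv (mem_extChartAt_source x)).symm

/-- A limit x of points with r ≥ t might a priori be approached through r → ∞ and lie off the end.
The logarithm of r is locally Lipschitz in charts of X, with a constant independent of r, so x lies
on the end with log r ≥ log t - l for all small l > 0. Injectivity of the cone makes this one value
of r. -/
lemma isClosed_end {z : ℂ} (hz : z ∈ Q.U) {t : ℝ} (ht : Q.T < t) :
    IsClosed (L.cone '' (univ ×ˢ Ici t)) := by
  have hT0 : 0 < Q.T := by linarith [Q.one_le]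
  have ht0 : 0 < t := hT0.trans ht
  rw [← closure_subset_iff_isClosed]
  intro x hx
  obtain ⟨C, hC0, η, hη, hball, hC⟩ := Q.exists_cone_of_segment hz x
  have main : ∀ l > 0, Q.T < Real.exp (Real.log t - l) → ∃ (y : M) (σ : ℝ),
      Real.log t - l ≤ σ ∧ x = L.cone (y, Real.exp σ) := by
    intro l hl hTl
    have e1 : ∀ᶠ x' in 𝓝 x, extChartAt 𝓘(ℝ, E) x x' ∈ Metric.ball (extChartAt 𝓘(ℝ, E) x x) η ∧
        C * ‖extChartAt 𝓘(ℝ, E) x x - extChartAt 𝓘(ℝ, E) x x'‖ < l ∧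
        x' ∈ (extChartAt 𝓘(ℝ, E) x).source := by
      have hcont : ContinuousAt (extChartAt 𝓘(ℝ, E) x) x := continuousAt_extChartAt x
      refine Eventually.and (hcont.preimage_mem_nhds (Metric.ball_mem_nhds _ hη))
        (Eventually.and ?_ (extChartAt_source_mem_nhds x))
      have : ContinuousAt (fun x' ↦ C * ‖extChartAt 𝓘(ℝ, E) x x - extChartAt 𝓘(ℝ, E) x x'‖) x :=
        continuousAt_const.mul (continuousAt_const.sub hcont).norm
      exact this.eventually_lt_const (by simpa using hl)
    obtain ⟨x', ⟨h1, h2, h3⟩, ⟨⟨y, r⟩, hr, rfl⟩⟩ := mem_closure_iff_nhds.mp hx _ e1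
    have hr0 : t ≤ r := hr.2
    have hlog : Real.log t ≤ Real.log r := Real.log_le_log ht0 hr0
    obtain ⟨y', σ', h4, h5⟩ := hC _ h1 y (Real.log r) l
      (by rw [(extChartAt 𝓘(ℝ, E) x).left_inv h3, Real.exp_log (ht0.trans_le hr0)]) h2
      (hTl.trans_le (Real.exp_le_exp.mpr (by linarith)))
    have := (abs_le.mp h4).1
    exact ⟨y', σ', by linarith, h5⟩
  have hlt : Real.log Q.T < Real.log t := Real.log_lt_log hT0 ht
  have hTl : ∀ l < Real.log t - Real.log Q.T, Q.T < Real.exp (Real.log t - l) := by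
    intro l hl
    rw [← Real.log_lt_iff_lt_exp hT0]
    linarith
  obtain ⟨y, σ, h1, rfl⟩ := main ((Real.log t - Real.log Q.T) / 2) (by linarith)
    (hTl _ (by linarith))
  refine ⟨(y, Real.exp σ), ⟨mem_univ _, ?_⟩, rfl⟩
  show t ≤ Real.exp σ
  rw [← Real.log_le_iff_le_exp ht0]
  by_contra hlt'
  set l := min ((Real.log t - σ) / 2) ((Real.log t - Real.log Q.T) / 2)
  obtain ⟨y', σ', h2, h3⟩ := main l (lt_min (by linarith) (by linarith))
    (hTl _ ((min_le_right _ _).trans_lt (by linarith)))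
  have h5 : σ = σ' := Real.exp_injective (L.cone_inj (Real.exp_pos _) (Real.exp_pos _) h3).2
  have := min_le_left ((Real.log t - σ) / 2) ((Real.log t - Real.log Q.T) / 2)
  linarith

end ConeProblem
end ConeTopology

/-! ### Solutions along a line -/

section Lines

variable {E : Type*} [NormedAddCommGroup E] [NormedSpace ℝ E] [FiniteDimensional ℝ E]
  {X : Type*} [TopologicalSpace X] [T2Space X] [ChartedSpace E X] [IsManifold 𝓘(ℝ, E) ∞ X]
  {F : Type*} [NormedAddCommGroup F] [NormedSpace ℝ F] [FiniteDimensional ℝ F]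
  {M : Type*} [TopologicalSpace M] [T2Space M] [CompactSpace M] [ChartedSpace F M]
  [IsManifold 𝓘(ℝ, F) ∞ M]

lemma mk_eq_vline (s : ℝ) : (fun t : ℝ ↦ (⟨s, t⟩ : ℂ)) = fun t : ℝ ↦ (s : ℂ) + t • Complex.I := by
  funext t; apply Complex.ext <;> simp

lemma contDiff_vline (s : ℝ) {n : WithTop ℕ∞} : ContDiff ℝ n (fun t : ℝ ↦ (⟨s, t⟩ : ℂ)) := by
  rw [mk_eq_vline]; fun_prop

lemma hasDerivAt_vline (s t : ℝ) : HasDerivAt (fun t : ℝ ↦ (⟨s, t⟩ : ℂ)) Complex.I t := by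
  rw [mk_eq_vline]
  simpa using ((hasDerivAt_id t).smul_const Complex.I).const_add (s : ℂ)

/-- The inequality of the means with a free parameter. A small fixed κ gives equicontinuity, and κ =
√n gives convergence to the flow. -/
lemma sqrt_le_add_mul {x κ : ℝ} (hx : 0 ≤ x) (hκ : 0 < κ) : √x ≤ κ⁻¹ + κ * x := by
  have h1 := Real.sq_sqrt hx
  have h2 : 0 ≤ κ * (√x - κ⁻¹) ^ 2 := by positivity
  have h3 : κ * (√x - κ⁻¹) ^ 2 = κ * x - 2 * √x + κ⁻¹ := by
    have : κ * κ⁻¹ = 1 := mul_inv_cancel₀ hκ.ne'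
    calc κ * (√x - κ⁻¹) ^ 2 = κ * √x ^ 2 - 2 * (κ * κ⁻¹) * √x + (κ * κ⁻¹) * κ⁻¹ := by ring
      _ = _ := by rw [h1, this]; ring
  have h4 := Real.sqrt_nonneg x
  linarith

lemma lintegral_Icc_periodic {f : ℝ → ℝ≥0∞} (hf : ∀ t, f (t + 1) = f t) (a : ℝ) :
    ∫⁻ t in Icc a (a + 1), f t = ∫⁻ t in Icc (0 : ℝ) 1, f t := by
  have hp : Function.Periodic f 1 := hf
  rw [← restrict_Ioc_eq_restrict_Icc, ← restrict_Ioc_eq_restrict_Icc]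
  have := (isAddFundamentalDomain_Ioc (T := (1 : ℝ)) one_pos a).setLIntegral_eq
    (isAddFundamentalDomain_Ioc (T := (1 : ℝ)) one_pos 0) f ?_
  · simpa using this
  · rintro ⟨g, hg⟩ x
    obtain ⟨n, rfl⟩ := AddSubgroup.mem_zmultiples_iff.mp hg
    simpa [AddSubgroup.vadd_def, add_comm] using hp.zsmul n x

/-- Control of a curve by the energy. -/
lemma norm_sub_le_of_energy {G : Type*} [NormedAddCommGroup G] [NormedSpace ℝ G] [CompleteSpace G]
    {f : ℝ → G} {e : ℝ → ℝ} {t₀ t₁ a b I : ℝ} (h01 : t₀ ≤ t₁) (ha : 0 ≤ a) (hb : 0 ≤ b) (hI : 0 ≤ I)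
    (hf : ∀ t ∈ Icc t₀ t₁, ContDiffAt ℝ 1 f t ∧ 0 ≤ e t ∧ ‖deriv f t‖ ≤ a + b * e t)
    (hint : ∫⁻ t in Icc t₀ t₁, ENNReal.ofReal (e t) ≤ ENNReal.ofReal I) :
    ‖f t₁ - f t₀‖ ≤ a * (t₁ - t₀) + b * I := by
  have hD : 0 ≤ a * (t₁ - t₀) + b * I :=
    add_nonneg (mul_nonneg ha (by linarith)) (mul_nonneg hb hI)
  refine norm_sub_le_of_lintegral_deriv h01 (fun t ht ↦ (hf t ht).1) hD ?_
  calc ∫⁻ t in Icc t₀ t₁, ‖deriv f t‖ₑ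
      ≤ ∫⁻ t in Icc t₀ t₁, (ENNReal.ofReal a + ENNReal.ofReal b * ENNReal.ofReal (e t)) := by
        refine setLIntegral_mono' measurableSet_Icc fun t ht ↦ ?_
        rw [← ofReal_norm, ← ENNReal.ofReal_mul hb, ← ENNReal.ofReal_add ha
          (mul_nonneg hb (hf t ht).2.1)]
        exact ENNReal.ofReal_le_ofReal (hf t ht).2.2
    _ ≤ ENNReal.ofReal (a * (t₁ - t₀) + b * I) := by
        rw [lintegral_add_left measurable_const, lintegral_const_mul' _ _ ENNReal.ofReal_ne_top,
          ENNReal.ofReal_add (mul_nonneg ha (by linarith)) (mul_nonneg hb hI),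
          ENNReal.ofReal_mul ha, ENNReal.ofReal_mul hb]
        simp only [lintegral_const, MeasurableSet.univ, Measure.restrict_apply, univ_inter,
          Real.volume_Icc]
        gcongr

namespace ConeProblem

variable {L : LiouvilleCompletion E X F M} {Q : ConeProblem L} {u : ℂ → X} {e : ℂ → ℝ} {s : ℝ}
  {y : ℝ → M} {r : ℝ → ℝ}

/-- On a vertical line only the I-component of the equation matters: the velocity is the Hamiltonian
vector field of g₂ plus K A. Injectivity of the cone identifies the given curve with the local lift.
-/
lemma IsSol.line (h : Q.IsSol u e) (hs : ∀ t : ℝ, (⟨s, t⟩ : ℂ) ∈ Q.U)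
    (hc : ∀ t : ℝ, Q.T < r t ∧ u ⟨s, t⟩ = L.cone (y t, r t)) {y₀ : M} {t : ℝ}
    (hy : y t ∈ (chartAt F y₀).source) :
    ContDiffAt ℝ ∞ (fun t ↦ (extChartAt 𝓘(ℝ, F) y₀ (y t), Real.log (r t))) t ∧
    ∃ A, deriv (fun t ↦ (extChartAt 𝓘(ℝ, F) y₀ (y t), Real.log (r t))) t
        = (Q.localData y₀).ham (readFam Q.g₂ y₀) (⟨s, t⟩, extChartAt 𝓘(ℝ, F) y₀ (y t))
          + (Q.localData y₀).K (⟨s, t⟩, extChartAt 𝓘(ℝ, F) y₀ (y t)) A ∧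
      e ⟨s, t⟩ = r t * (Q.localData y₀).Om (⟨s, t⟩, extChartAt 𝓘(ℝ, F) y₀ (y t)) A
        ((Q.localData y₀).K (⟨s, t⟩, extChartAt 𝓘(ℝ, F) y₀ (y t)) A) := by
  have hT0 : 0 < Q.T := by linarith [Q.one_le]
  obtain ⟨w, hw, hwz, hev⟩ := h.exists_local (hs t) (hc t).1 hy (hc t).2
  have hev' := ((contDiff_vline s (n := 0)).continuous.continuousAt (x := t)).eventually hev
  have heq : (fun t ↦ (extChartAt 𝓘(ℝ, F) y₀ (y t), Real.log (r t))) =ᶠ[𝓝 t]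
      fun t ↦ w ⟨s, t⟩ := by
    filter_upwards [hev'] with t' ht'
    have hinj := L.cone_inj (hT0.trans (hc t').1) (Real.exp_pos _) ((hc t').2.symm.trans ht'.2.1)
    rw [hinj.1, hinj.2, Real.log_exp, (extChartAt 𝓘(ℝ, F) y₀).right_inv ht'.1.2]
  refine ⟨?_, (Q.localData y₀).A w ⟨s, t⟩, ?_, ?_⟩
  · exact (ContDiffAt.comp (f := fun t : ℝ ↦ (⟨s, t⟩ : ℂ)) t hw
      (contDiff_vline s).contDiffAt).congr_of_eventuallyEq heq
  · rw [heq.deriv_eq]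
    have hd := (hw.differentiableAt (by simp)).hasFDerivAt.comp_hasDerivAt t (hasDerivAt_vline s t)
    have hs' := hev.self_of_nhds.2.2.2.1
    rw [LocalData.IsSolAt, hwz] at hs'
    exact hd.deriv.trans hs'
  · have he := hev.self_of_nhds.2.2.2.2
    rw [hwz, Real.exp_log (hT0.trans (hc t).1)] at he
    exact he

/-- Near a point of `M` the coordinates of a solution along a line almost follow the Hamiltonian
flow. -/
lemma exists_flow_estimate (Q : ConeProblem L) {z₀ : ℂ} (hz₀ : z₀ ∈ Q.U) (y₀ : M) {ε : ℝ}
    (hε : 0 < ε) :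
    ∃ C ≥ (1 : ℝ), ∃ N ∈ 𝓝 z₀, ∃ V ∈ 𝓝 y₀, V ⊆ (chartAt F y₀).source ∧ IsClosed V ∧
      ∀ (u : ℂ → X) (e : ℂ → ℝ) (s : ℝ) (y : ℝ → M) (r : ℝ → ℝ) (t : ℝ), Q.IsSol u e →
      (∀ t : ℝ, (⟨s, t⟩ : ℂ) ∈ Q.U) → (∀ t : ℝ, Q.T < r t ∧ u ⟨s, t⟩ = L.cone (y t, r t)) →
      (⟨s, t⟩ : ℂ) ∈ N → y t ∈ V → 0 ≤ e ⟨s, t⟩ ∧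
        ‖deriv (fun t ↦ (extChartAt 𝓘(ℝ, F) y₀ (y t), Real.log (r t))) t
          - (Q.localData y₀).ham (readFam Q.g₂ y₀) (z₀, extChartAt 𝓘(ℝ, F) y₀ y₀)‖
          ≤ ε + C * √(e ⟨s, t⟩ / r t) := by
  have hT0 : 0 < Q.T := by linarith [Q.one_le]
  set S := Q.localData y₀
  have hp := Q.mem_localData_D hz₀ (mem_chart_source F y₀)
  obtain ⟨C, hC1, hC⟩ := LocalData.eventually_isBound hp
  have hcont : ContinuousAt (S.ham (readFam Q.g₂ y₀)) (z₀, extChartAt 𝓘(ℝ, F) y₀ y₀) :=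
    LocalData.continuousAt_ham hp (S.smooth_g₂ _ hp)
  have h1 := (Metric.tendsto_nhds.mp hcont.tendsto ε hε)
  have h2 := (tendsto_chart (F := F) z₀ y₀).eventually (hC.and h1)
  obtain ⟨N, hN, V, hV, hNV⟩ := mem_nhds_prod_iff.mp h2
  obtain ⟨V', hV', hVcl, hV'V⟩ := exists_mem_nhds_isClosed_subset
    (inter_mem hV ((chartAt F y₀).open_source.mem_nhds (mem_chart_source F y₀)))
  refine ⟨C ^ 2, one_le_pow₀ hC1, N, hN, V', hV', hV'V.trans inter_subset_right, hVcl, ?_⟩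
  intro u e s y r t h hs hc hzN hyV
  obtain ⟨hb, hdist⟩ := hNV (mk_mem_prod hzN (hV'V hyV).1)
  obtain ⟨-, A, hA, he⟩ := h.line hs hc (y₀ := y₀) (t := t) (hV'V hyV).2
  have hr0 : 0 < r t := hT0.trans (hc t).1
  set o := S.Om (⟨s, t⟩, extChartAt 𝓘(ℝ, F) y₀ (y t)) A
    (S.K (⟨s, t⟩, extChartAt 𝓘(ℝ, F) y₀ (y t)) A) with ho
  have ho0 : 0 ≤ o := by
    by_contra hneg
    have := hb.coercive A
    have h3 : C * o < 0 := mul_neg_of_pos_of_neg (by linarith) (not_le.mp hneg)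
    nlinarith [sq_nonneg ‖A‖]
  refine ⟨by rw [he]; positivity, ?_⟩
  have hn := hb.norm_A_le hC1 A
  -- Dividing the energy density by r gives Om(A, K A). The deviation from the flow is thus of order
  -- √(e / r), small at large height.
  have heo : e ⟨s, t⟩ / r t = o := by rw [he]; field_simp
  rw [heo, hA]
  have hK : ‖S.K (⟨s, t⟩, extChartAt 𝓘(ℝ, F) y₀ (y t)) A‖ ≤ C ^ 2 * √o := by
    refine (ContinuousLinearMap.le_opNorm _ _).trans ?_
    refine (mul_le_mul hb.K hn (norm_nonneg _) (by linarith)).trans_eq ?_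
    rw [ho]; ring
  rw [add_sub_right_comm]
  refine (norm_add_le _ _).trans (add_le_add ?_ hK)
  rw [← dist_eq_norm]
  exact hdist.le

end ConeProblem
end Lines

/-! ### Limits of solutions along lines are periodic orbits -/

section Limits

variable {E : Type*} [NormedAddCommGroup E] [NormedSpace ℝ E] [FiniteDimensional ℝ E]
  {X : Type*} [TopologicalSpace X] [T2Space X] [ChartedSpace E X] [IsManifold 𝓘(ℝ, E) ∞ X]
  {F : Type*} [NormedAddCommGroup F] [NormedSpace ℝ F] [FiniteDimensional ℝ F]
  {M : Type*} [TopologicalSpace M] [T2Space M] [CompactSpace M] [ChartedSpace F M]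
  [IsManifold 𝓘(ℝ, F) ∞ M]

namespace ConeProblem

variable {L : LiouvilleCompletion E X F M}

/-- A substitute for equicontinuity under an energy bound: ε is chosen first to make C ε I small,
and then the time interval to make the other term small. -/
lemma exists_variation_le (Q : ConeProblem L) {φ : M → ℝ} (hφ : ContMDiff 𝓘(ℝ, F) 𝓘(ℝ, ℝ) ∞ φ)
    {κ : ℝ} (hκ : |κ| ≤ 1) {Z : Set ℂ} (hZ : IsCompact Z) (hZU : Z ⊆ Q.U) :
    ∃ C ≥ (1 : ℝ), ∀ (u : ℂ → X) (e : ℂ → ℝ) (s : ℝ) (y : ℝ → M) (r : ℝ → ℝ) (t t' I ε : ℝ),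
      Q.IsSol u e → (∀ t : ℝ, Q.T < r t ∧ u ⟨s, t⟩ = L.cone (y t, r t)) → t ≤ t' →
      (∀ τ ∈ Icc t t', (⟨s, τ⟩ : ℂ) ∈ Z) → 0 ≤ I → 0 < ε →
      ∫⁻ τ in Icc t t', ENNReal.ofReal (e ⟨s, τ⟩) ≤ ENNReal.ofReal I →
      |(φ (y t') + κ * Real.log (r t')) - (φ (y t) + κ * Real.log (r t))|
        ≤ C * (1 + ε⁻¹) * (t' - t) + C * ε * I := by
  have hT0 : 0 < Q.T := by linarith [Q.one_le]
  obtain ⟨C, hC1, hC⟩ := Q.exists_estimates hφ hκ hZ hZU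
  refine ⟨C, hC1, fun u e s y r t t' I ε h hc htt hZt hI hε hint ↦ ?_⟩
  let g : ℂ → ℝ := fun z ↦ L.coneLift (fun p ↦ φ p.1 + κ * Real.log p.2) (u z)
  have hg : ∀ τ, g ⟨s, τ⟩ = φ (y τ) + κ * Real.log (r τ) := fun τ ↦ by
    simp only [g]
    rw [(hc τ).2, L.coneLift_cone _ _ (hT0.trans (hc τ).1)]
  rw [← hg, ← hg]
  refine norm_sub_le_of_energy (f := fun τ ↦ g ⟨s, τ⟩) (e := fun τ ↦ e ⟨s, τ⟩) htt
    (by positivity) (by positivity) hI (fun τ hτ ↦ ?_) hint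
  obtain ⟨-, -, he0, -, hd, hbd⟩ := hC u e h _ (hZt τ hτ) _ _ (hc τ).1 (hc τ).2
  have hd' : HasDerivAt (fun τ ↦ g ⟨s, τ⟩) (fderiv ℝ g ⟨s, τ⟩ Complex.I) τ :=
    (hd.differentiableAt (by simp)).hasFDerivAt.comp_hasDerivAt τ (hasDerivAt_vline s τ)
  refine ⟨?_, he0, ?_⟩
  · exact (ContDiffAt.comp (f := fun t : ℝ ↦ (⟨s, t⟩ : ℂ)) τ hd
      (contDiff_vline s).contDiffAt).of_le (by simp)
  · rw [hd'.deriv]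
    refine (hbd Complex.I).trans ?_
    rw [Complex.norm_I, mul_one]
    have := sqrt_le_add_mul he0 hε
    nlinarith

/-! ### Limits of loops escaping to infinity. -/

section Sequence

variable {Q : ConeProblem L} (hU : ∀ z : ℂ, |z.re| < 1 → z ∈ Q.U)
  {u : ℕ → ℂ → X} {e : ℕ → ℂ → ℝ} {s : ℕ → ℝ} {y : ℕ → ℝ → M} {r : ℕ → ℝ → ℝ} {I : ℝ}
  (hsol : ∀ n, Q.IsSol (u n) (e n)) (hs : ∀ n, |s n| ≤ 1 / 2)
  (hc : ∀ n t, Q.T < r n t ∧ u n ⟨s n, t⟩ = L.cone (y n t, r n t))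
  (hr : ∀ (n : ℕ) (t : ℝ), (n : ℝ) ≤ r n t)
  (hI : 0 ≤ I)
  (hint : ∀ n a, ∫⁻ t in Icc a (a + 1), ENNReal.ofReal (e n ⟨s n, t⟩) ≤ ENNReal.ofReal I)

include hU hsol hs hc hI hint

lemma variation_le {φ : M → ℝ} (hφ : ContMDiff 𝓘(ℝ, F) 𝓘(ℝ, ℝ) ∞ φ)
    {κ : ℝ} (hκ : |κ| ≤ 1) (a : ℝ) : ∃ C ≥ (1 : ℝ), ∀ n, ∀ t ∈ Icc a (a + 1), ∀ t' ∈ Icc a (a + 1),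
      ∀ ε > 0, |(φ (y n t') + κ * Real.log (r n t')) - (φ (y n t) + κ * Real.log (r n t))|
        ≤ C * (1 + ε⁻¹) * |t' - t| + C * ε * I := by
  have hZ : IsCompact (Icc (-(1 / 2) : ℝ) (1 / 2) ×ℂ Icc a (a + 1)) :=
    isCompact_Icc.reProdIm isCompact_Icc
  have hZU : Icc (-(1 / 2) : ℝ) (1 / 2) ×ℂ Icc a (a + 1) ⊆ Q.U := fun z hz ↦
    hU z (abs_lt.mpr ⟨by linarith [hz.1.1], by linarith [hz.1.2]⟩)
  obtain ⟨C, hC1, hC⟩ := Q.exists_variation_le hφ hκ hZ hZU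
  have key : ∀ n, ∀ t ∈ Icc a (a + 1), ∀ t' ∈ Icc a (a + 1), t ≤ t' → ∀ ε > 0,
      |(φ (y n t') + κ * Real.log (r n t')) - (φ (y n t) + κ * Real.log (r n t))|
        ≤ C * (1 + ε⁻¹) * (t' - t) + C * ε * I := by
    intro n t ht t' ht' htt ε hε
    refine hC (u n) (e n) (s n) (y n) (r n) t t' I ε (hsol n) (hc n) htt (fun τ hτ ↦ ?_) hI hε ?_
    · exact ⟨abs_le.mp (hs n), ht.1.trans hτ.1, hτ.2.trans ht'.2⟩
    · exact (lintegral_mono_set (Icc_subset_Icc ht.1 ht'.2)).trans (hint n a)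
  refine ⟨C, hC1, fun n t ht t' ht' ε hε ↦ ?_⟩
  rcases le_total t t' with h | h
  · rw [abs_of_nonneg (sub_nonneg.mpr h)]
    exact key n t ht t' ht' h ε hε
  · rw [abs_sub_comm, abs_sub_comm t', abs_of_nonneg (sub_nonneg.mpr h)]
    exact key n t' ht' t ht h ε hε

/-- A bump function at y₀ is close to 1 at time t₀ and varies by at most 1/2 over a short time,
uniformly in n. It stays positive, so y stays in V. -/
lemma eventually_confined {𝓤 : Filter ℕ} {y₀ : M} {t₀ : ℝ}
    (hy₀ : Tendsto (fun n ↦ y n t₀) 𝓤 (𝓝 y₀)) {V : Set M} (hV : V ∈ 𝓝 y₀) :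
    ∃ τ > 0, τ ≤ 1 / 2 ∧ ∀ᶠ n in 𝓤, ∀ t, |t - t₀| ≤ τ → y n t ∈ V := by
  obtain ⟨φ, -, hφV⟩ := (SmoothBumpFunction.nhds_basis_tsupport (I := 𝓘(ℝ, F)) y₀).mem_iff.mp hV
  have hφ : ContMDiff 𝓘(ℝ, F) 𝓘(ℝ, ℝ) ∞ φ := φ.contMDiff
  obtain ⟨C, hC1, hC⟩ := variation_le hU hsol hs hc hI hint hφ (κ := 0) (by simp) (t₀ - 1 / 2)
  -- With these choices C ε I ≤ 1/4 and C (1 + ε⁻¹) τ ≤ 1/4, against an initial value above 3/4.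
  set ε : ℝ := (4 * C * (I + 1))⁻¹ with hε
  have hε0 : 0 < ε := by positivity
  set τ : ℝ := min (1 / 2) (4 * C * (1 + ε⁻¹))⁻¹ with hτ
  have hτ0 : 0 < τ := by positivity
  refine ⟨τ, hτ0, min_le_left _ _, ?_⟩
  have h1 : Tendsto (fun n ↦ φ (y n t₀)) 𝓤 (𝓝 (φ y₀)) := (hφ.continuous.tendsto y₀).comp hy₀
  rw [φ.eq_one] at h1
  filter_upwards [h1.eventually_const_lt (show (3 / 4 : ℝ) < 1 by norm_num)] with n hn t ht
  have htb := abs_le.mp (ht.trans (min_le_left _ _))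
  have h2 := hC n t₀ ⟨by linarith, by linarith⟩ t ⟨by linarith, by linarith⟩ ε hε0
  simp only [zero_mul, add_zero] at h2
  have h3 : C * (1 + ε⁻¹) * |t - t₀| ≤ 1 / 4 := by
    have : |t - t₀| ≤ (4 * C * (1 + ε⁻¹))⁻¹ := ht.trans (min_le_right _ _)
    calc C * (1 + ε⁻¹) * |t - t₀| ≤ C * (1 + ε⁻¹) * (4 * C * (1 + ε⁻¹))⁻¹ := by gcongr
      _ = 1 / 4 := by field_simp
  have h4 : C * ε * I ≤ 1 / 4 := by
    calc C * ε * I ≤ C * ε * (I + 1) := by gcongr; linarith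
      _ = 1 / 4 := by rw [hε]; field_simp
  have h5 := (abs_le.mp h2).1
  have h6 : 0 < φ (y n t) := by linarith
  exact hφV (subset_tsupport _ (Function.mem_support.mpr h6.ne'))

-- Integrating the flow estimate for the n-th loop leaves an error (C / √n) (|t - t₀| + I) beyond ε
-- |t - t₀|. In the limit the increment is linear up to ε, so the limit curve is differentiable with
-- the Hamiltonian vector field as derivative.
include hr in
lemma limit_estimate {𝓤 : Filter ℕ} [𝓤.NeBot] (h𝓤 : 𝓤 ≤ atTop) {s' : ℝ}
    (hs' : Tendsto s 𝓤 (𝓝 s')) {y' : ℝ → M} (hy' : ∀ t, Tendsto (fun n ↦ y n t) 𝓤 (𝓝 (y' t)))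
    {σ : ℝ → ℝ} (hσ : ∀ t, Tendsto (fun n ↦ Real.log (r n t) - Real.log (r n 0)) 𝓤 (𝓝 (σ t)))
    (t₀ : ℝ) {ε : ℝ} (hε : 0 < ε) :
    ∀ᶠ t in 𝓝 t₀, y' t ∈ (chartAt F (y' t₀)).source ∧
      ‖(extChartAt 𝓘(ℝ, F) (y' t₀) (y' t), σ t) - (extChartAt 𝓘(ℝ, F) (y' t₀) (y' t₀), σ t₀)
        - (t - t₀) • (Q.localData (y' t₀)).ham (readFam Q.g₂ (y' t₀))
          (⟨s', t₀⟩, extChartAt 𝓘(ℝ, F) (y' t₀) (y' t₀))‖ ≤ ε * ‖t - t₀‖ := by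
  have hsn : ∀ n (t : ℝ), (⟨s n, t⟩ : ℂ) ∈ Q.U := fun n t ↦
    hU _ ((hs n).trans_lt (by norm_num))
  have hs'1 : |s'| ≤ 1 / 2 := le_of_tendsto hs'.abs (Eventually.of_forall hs)
  have hz₀ : (⟨s', t₀⟩ : ℂ) ∈ Q.U := hU _ (hs'1.trans_lt (by norm_num))
  obtain ⟨C, hC1, N, hN, V, hV, hVs, hVcl, hCN⟩ := Q.exists_flow_estimate hz₀ (y' t₀) hε
  set X₀ := (Q.localData (y' t₀)).ham (readFam Q.g₂ (y' t₀))
    (⟨s', t₀⟩, extChartAt 𝓘(ℝ, F) (y' t₀) (y' t₀)) with hX₀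
  obtain ⟨τ, hτ0, hτ1, hconf⟩ := eventually_confined hU hsol hs hc hI hint (hy' t₀) hV
  have hcontc : Continuous fun p : ℝ × ℝ ↦ (⟨p.1, p.2⟩ : ℂ) :=
    Complex.equivRealProdCLM.symm.continuous
  obtain ⟨A, hA, B, hB, hAB⟩ := mem_nhds_prod_iff.mp
    (hcontc.continuousAt.preimage_mem_nhds (x := (s', t₀)) hN)
  obtain ⟨τ', hτ'0, hτ'B⟩ := Metric.mem_nhds_iff.mp hB
  filter_upwards [Metric.ball_mem_nhds t₀ (lt_min hτ0 hτ'0)] with t ht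
  have htt : |t - t₀| < min τ τ' := ht
  have hconf' : ∀ᶠ n in 𝓤, ∀ t₁ ∈ uIcc t₀ t, y n t₁ ∈ V ∧ (⟨s n, t₁⟩ : ℂ) ∈ N := by
    filter_upwards [hconf, hs'.eventually hA] with n h1 h2 t₁ ht₁
    have h3 : |t₁ - t₀| ≤ |t - t₀| := abs_sub_left_of_mem_uIcc ht₁
    refine ⟨h1 t₁ (h3.trans (htt.le.trans (min_le_left _ _))), hAB (mk_mem_prod h2 (hτ'B ?_))⟩
    exact lt_of_le_of_lt h3 (htt.trans_le (min_le_right _ _))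
  have hyV : y' t ∈ V := hVcl.mem_of_tendsto (hy' t) (hconf'.mono fun n hn ↦ (hn t right_mem_uIcc).1)
  refine ⟨hVs hyV, ?_⟩
  set χ := extChartAt 𝓘(ℝ, F) (y' t₀) with hχ
  have hχc : ∀ t, y' t ∈ V → Tendsto (fun n ↦ χ (y n t)) 𝓤 (𝓝 (χ (y' t))) := fun t hV ↦
    ((continuousAt_extChartAt' (by simpa using hVs hV)).tendsto).comp (hy' t)
  have hlim : Tendsto (fun n ↦ ‖(χ (y n t), Real.log (r n t)) - (χ (y n t₀), Real.log (r n t₀))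
      - (t - t₀) • X₀‖) 𝓤 (𝓝 ‖(χ (y' t), σ t) - (χ (y' t₀), σ t₀) - (t - t₀) • X₀‖) := by
    have h1 := ((hχc t hyV).prodMk_nhds (hσ t)).sub
      ((hχc t₀ (mem_of_mem_nhds hV)).prodMk_nhds (hσ t₀))
    refine ((h1.sub_const ((t - t₀) • X₀)).norm).congr fun n ↦ ?_
    simp
  have hlim2 : Tendsto (fun n : ℕ ↦ (ε + C * (√n)⁻¹) * |t - t₀| + C * (√n)⁻¹ * I) 𝓤
      (𝓝 ((ε + C * 0) * |t - t₀| + C * 0 * I)) := by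
    have h1 : Tendsto (fun n : ℕ ↦ (√(n : ℝ))⁻¹) 𝓤 (𝓝 0) :=
      (tendsto_inv_atTop_zero.comp (Real.tendsto_sqrt_atTop.comp tendsto_natCast_atTop_atTop)).mono_left
        h𝓤
    exact (((h1.const_mul C).const_add ε).mul_const _).add ((h1.const_mul C).mul_const I)
  have hle : ∀ᶠ n in 𝓤, ‖(χ (y n t), Real.log (r n t)) - (χ (y n t₀), Real.log (r n t₀))
      - (t - t₀) • X₀‖ ≤ (ε + C * (√n)⁻¹) * |t - t₀| + C * (√n)⁻¹ * I := by
    filter_upwards [hconf', h𝓤 (eventually_ge_atTop 1)] with n hn hn1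
    have hn0 : (1 : ℝ) ≤ n := by exact_mod_cast hn1
    have hsq : 0 < √(n : ℝ) := Real.sqrt_pos.mpr (by linarith)
    set f : ℝ → F × ℝ := fun t ↦ (χ (y n t), Real.log (r n t)) with hf
    have hfd : ∀ t₁ ∈ uIcc t₀ t, ContDiffAt ℝ 1 (fun t ↦ f t - t • X₀) t₁ ∧ 0 ≤ e n ⟨s n, t₁⟩ ∧
        ‖deriv (fun t ↦ f t - t • X₀) t₁‖ ≤ (ε + C * (√n)⁻¹) + C * (√n)⁻¹ * e n ⟨s n, t₁⟩ := by
      intro t₁ ht₁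
      have h1 := ((hsol n).line (hsn n) (hc n) (y₀ := y' t₀) (t := t₁) (hVs (hn t₁ ht₁).1)).1
      obtain ⟨h2, h3⟩ := hCN (u n) (e n) (s n) (y n) (r n) t₁ (hsol n) (hsn n) (hc n)
        (hn t₁ ht₁).2 (hn t₁ ht₁).1
      have h4 : HasDerivAt (fun t ↦ f t - t • X₀) (deriv f t₁ - X₀) t₁ := by
        have := (h1.differentiableAt (by simp)).hasDerivAt.sub ((hasDerivAt_id t₁).smul_const X₀)
        rw [one_smul] at this
        exact this
      refine ⟨(h1.of_le (by simp)).sub (by fun_prop), h2, ?_⟩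
      rw [h4.deriv]
      refine h3.trans ?_
      have hr0 : (n : ℝ) ≤ r n t₁ := hr n t₁
      -- With κ = √n and r ≥ n one gets √(e / r) ≤ 1/√n + √n e / r ≤ (1 + e) / √n, whose integral
      -- tends to zero under a uniform energy bound.
      have h5 := sqrt_le_add_mul (x := e n ⟨s n, t₁⟩ / r n t₁)
        (div_nonneg h2 (by linarith)) hsq
      have h6 : √(n : ℝ) * (e n ⟨s n, t₁⟩ / r n t₁) ≤ (√(n : ℝ))⁻¹ * e n ⟨s n, t₁⟩ := by
        have h7 : e n ⟨s n, t₁⟩ / r n t₁ ≤ e n ⟨s n, t₁⟩ / n := by gcongr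
        have h8 : √(n : ℝ) * (e n ⟨s n, t₁⟩ / n) = (√(n : ℝ))⁻¹ * e n ⟨s n, t₁⟩ := by
          have : (n : ℝ) = √n * √n := (Real.mul_self_sqrt (by linarith)).symm
          rw [div_eq_inv_mul, ← mul_assoc]
          congr 1
          nth_rewrite 2 [this]
          field_simp
        rw [← h8]
        gcongr
      have h9 : C * √(e n ⟨s n, t₁⟩ / r n t₁) ≤ C * ((√(n : ℝ))⁻¹ + (√(n : ℝ))⁻¹ * e n ⟨s n, t₁⟩) := by
        gcongr; linarith
      linarith
    have hfin : ‖(f t - t • X₀) - (f t₀ - t₀ • X₀)‖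
        ≤ (ε + C * (√n)⁻¹) * |t - t₀| + C * (√n)⁻¹ * I := by
      have hu : |t - t₀| ≤ 1 / 2 := htt.le.trans ((min_le_left _ _).trans hτ1)
      rcases le_total t₀ t with h | h
      · rw [abs_of_nonneg (sub_nonneg.mpr h)] at hu ⊢
        rw [uIcc_of_le h] at hfd
        refine norm_sub_le_of_energy (f := fun t ↦ f t - t • X₀) h (by positivity) (by positivity)
          hI hfd ((lintegral_mono_set (Icc_subset_Icc le_rfl ?_)).trans (hint n t₀))
        linarith
      · rw [abs_of_nonpos (sub_nonpos.mpr h)] at hu ⊢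
        rw [uIcc_of_ge h] at hfd
        rw [norm_sub_rev, neg_sub]
        refine norm_sub_le_of_energy (f := fun t ↦ f t - t • X₀) h (by positivity) (by positivity)
          hI hfd ((lintegral_mono_set (Icc_subset_Icc le_rfl ?_)).trans (hint n t))
        linarith
    refine le_of_eq_of_le (congrArg _ ?_) hfin
    simp only [hf, sub_smul]
    abel
  have := le_of_tendsto_of_tendsto hlim hlim2 hle
  simpa using this

-- Convergence along an ultrafilter replaces the extraction of subsequences: compactness of M gives
-- a limit of y at every time at once, and log r has a limit once normalised by its value at 0,
-- since its oscillation is bounded. `limit_estimate` then identifies the limit as an orbit.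
include hr in
lemma exists_periodic_orbit (hper : ∀ n t, y n (t + 1) = y n t ∧ r n (t + 1) = r n t) :
    ∃ (s' : ℝ) (y' : ℝ → M) (r' : ℝ → ℝ), |s'| ≤ 1 / 2 ∧
      MDifferentiable 𝓘(ℝ, ℝ) 𝓘(ℝ, F) y' ∧ Differentiable ℝ r' ∧ (∀ t, 0 < r' t) ∧
      (∀ t, y' (t + 1) = y' t) ∧ (∀ t, r' (t + 1) = r' t) ∧
      ∀ t, IsLiftedHamVec L.alpha (fun y ↦ Q.g₂ y ⟨s', t⟩) (y' t) (r' t)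
        (mfderiv 𝓘(ℝ, ℝ) 𝓘(ℝ, F) y' t (1 : ℝ), deriv r' t) := by
  set 𝓤 : Ultrafilter ℕ := hyperfilter ℕ
  have h𝓤 : (𝓤 : Filter ℕ) ≤ atTop := Nat.hyperfilter_le_atTop
  have hex : ∀ t, ∃ y' : M, Tendsto (fun n ↦ y n t) 𝓤 (𝓝 y') := fun t ↦
    ⟨_, (𝓤.map fun n ↦ y n t).le_nhds_lim⟩
  choose y' hy' using hex
  obtain ⟨C, hC1, hC⟩ := variation_le hU hsol hs hc hI hint (φ := fun _ ↦ 0) contMDiff_const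
    (κ := 1) (by simp) 0
  have hbd : ∀ n t, Real.log (r n t) - Real.log (r n 0) ∈ Icc (-(C * 2 + C * I)) (C * 2 + C * I) := by
    intro n t
    have hp : Function.Periodic (r n) 1 := fun t ↦ (hper n t).2
    -- By periodicity the oscillation need only be bounded over one unit interval, where the energy
    -- bound applies with ε = 1.
    have h1 : r n t = r n (Int.fract t) := by
      have := hp.sub_int_mul_eq (x := t) ⌊t⌋
      rw [mul_one] at this
      exact this.symm
    have h2 := Int.fract_nonneg t
    have h3 := (Int.fract_lt_one t).le
    have h4 := hC n 0 ⟨le_rfl, by norm_num⟩ (Int.fract t) ⟨h2, by simpa using h3⟩ 1 one_pos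
    simp only [zero_add, one_mul, sub_zero, inv_one, mul_one, abs_of_nonneg h2] at h4
    rw [h1]
    refine abs_le.mp (h4.trans ?_)
    nlinarith
  have hexσ : ∀ t, ∃ σ : ℝ,
      Tendsto (fun n ↦ Real.log (r n t) - Real.log (r n 0)) 𝓤 (𝓝 σ) := by
    intro t
    obtain ⟨σ, -, hσ⟩ := isCompact_Icc.ultrafilter_le_nhds
      (𝓤.map fun n ↦ Real.log (r n t) - Real.log (r n 0)) (by
        rw [le_principal_iff]; exact Filter.mem_map.mpr (univ_mem' fun n : ℕ ↦ hbd n t))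
    exact ⟨σ, hσ⟩
  choose σ hσ using hexσ
  obtain ⟨s', hs'1, hs'⟩ := isCompact_Icc.ultrafilter_le_nhds (𝓤.map s) (by
    rw [le_principal_iff]; exact Filter.mem_map.mpr (univ_mem' fun n : ℕ ↦ abs_le.mp (hs n)))
  have hest := fun t₀ ε (hε : 0 < ε) ↦ limit_estimate hU hsol hs hc hr hI hint h𝓤
    (show Tendsto s 𝓤 (𝓝 s') from hs') hy' hσ t₀ hε
  have hsz : ∀ t : ℝ, (⟨s', t⟩ : ℂ) ∈ Q.U := fun t ↦
    hU _ ((abs_le.mpr hs'1).trans_lt (by norm_num))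
  have hder : ∀ t₀, HasDerivAt (fun t ↦ (extChartAt 𝓘(ℝ, F) (y' t₀) (y' t), σ t))
      ((Q.localData (y' t₀)).ham (readFam Q.g₂ (y' t₀))
          (⟨s', t₀⟩, extChartAt 𝓘(ℝ, F) (y' t₀) (y' t₀))) t₀ := by
    intro t₀
    rw [hasDerivAt_iff_isLittleO, Asymptotics.isLittleO_iff]
    intro ε hε
    exact (hest t₀ ε hε).mono fun t ht ↦ ht.2
  have hsrc : ∀ t₀, ∀ᶠ t in 𝓝 t₀, y' t ∈ (chartAt F (y' t₀)).source := fun t₀ ↦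
    (hest t₀ 1 one_pos).mono fun t ht ↦ ht.1
  have hmf : ∀ t₀, HasMFDerivAt 𝓘(ℝ, ℝ) 𝓘(ℝ, F) y' t₀
      ((coordVec (y' t₀) (extChartAt 𝓘(ℝ, F) (y' t₀) (y' t₀))).comp
        (ContinuousLinearMap.toSpanSingleton ℝ ((Q.localData (y' t₀)).ham (readFam Q.g₂ (y' t₀))
          (⟨s', t₀⟩, extChartAt 𝓘(ℝ, F) (y' t₀) (y' t₀))).1) : ℝ →L[ℝ] F) := by
    intro t₀
    have h1 : HasDerivAt (fun t ↦ extChartAt 𝓘(ℝ, F) (y' t₀) (y' t)) _ t₀ :=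
      (hasFDerivAt_fst (𝕜 := ℝ) (E := F) (F := ℝ)).comp_hasDerivAt t₀ (hder t₀)
    have h2 : MDifferentiableAt 𝓘(ℝ, F) 𝓘(ℝ, F) (extChartAt 𝓘(ℝ, F) (y' t₀)).symm
        (extChartAt 𝓘(ℝ, F) (y' t₀) (y' t₀)) :=
      ((contMDiffOn_symm (y' t₀)).contMDiffAt
        (extChartAt_target_mem_nhds (I := 𝓘(ℝ, F)) _)).mdifferentiableAt (by simp)
    have h3 := HasMFDerivAt.comp t₀ h2.hasMFDerivAt h1.hasFDerivAt.hasMFDerivAt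
    refine h3.congr_of_eventuallyEq ?_
    filter_upwards [hsrc t₀] with t ht
    exact ((extChartAt 𝓘(ℝ, F) (y' t₀)).left_inv (by simpa using ht)).symm
  have hrd : ∀ t₀, HasDerivAt (fun t ↦ Real.exp (σ t)) (Real.exp (σ t₀) *
      ((Q.localData (y' t₀)).ham (readFam Q.g₂ (y' t₀))
          (⟨s', t₀⟩, extChartAt 𝓘(ℝ, F) (y' t₀) (y' t₀))).2) t₀ := fun t₀ ↦
    HasDerivAt.exp ((hasFDerivAt_snd (𝕜 := ℝ) (E := F) (F := ℝ)).comp_hasDerivAt t₀ (hder t₀))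
  refine ⟨s', y', fun t ↦ Real.exp (σ t), abs_le.mpr hs'1, fun t ↦ (hmf t).mdifferentiableAt,
    fun t ↦ (hrd t).differentiableAt, fun t ↦ Real.exp_pos _, fun t ↦ ?_, fun t ↦ ?_, fun t₀ ↦ ?_⟩
  · exact tendsto_nhds_unique ((hy' (t + 1)).congr fun n ↦ (hper n t).1) (hy' t)
  · exact congrArg Real.exp (tendsto_nhds_unique
      ((hσ (t + 1)).congr fun n ↦ by rw [(hper n t).2]) (hσ t))
  · have hp := Q.mem_localData_D (hsz t₀) (mem_chart_source F (y' t₀))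
    have h1 := (eq_ham_of_isLiftedHamVec Q.smooth_g₂ hp (Real.exp_pos (σ t₀)) _).mpr rfl
    have key : ∀ (y₁ y₂ : M) (v v' : F) (a a' : ℝ), y₁ = y₂ → v = v' → a = a' →
        IsLiftedHamVec L.alpha (fun y ↦ Q.g₂ y ⟨s', t₀⟩) y₁ (Real.exp (σ t₀)) (v, a) →
        IsLiftedHamVec L.alpha (fun y ↦ Q.g₂ y ⟨s', t₀⟩) y₂ (Real.exp (σ t₀)) (v', a') := by
      rintro y₁ _ v _ a _ rfl rfl rfl h
      exact h
    refine key _ _ _ _ _ _ ((extChartAt 𝓘(ℝ, F) (y' t₀)).left_inv (mem_extChartAt_source _)) ?_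
      (hrd t₀).deriv.symm h1
    have h2 := congrArg (fun l ↦ l (1 : ℝ)) (hmf t₀).mfderiv
    refine Eq.trans ?_ h2.symm
    refine congrArg (coordVec (y' t₀) (extChartAt 𝓘(ℝ, F) (y' t₀) (y' t₀))) ?_
    exact (one_smul ℝ _).symm

end Sequence
end ConeProblem
end Limits

/-! ### Growth of the height along curves and the maximum principle -/

section Growth

variable {E : Type*} [NormedAddCommGroup E] [NormedSpace ℝ E] [FiniteDimensional ℝ E]
  {X : Type*} [TopologicalSpace X] [T2Space X] [ChartedSpace E X] [IsManifold 𝓘(ℝ, E) ∞ X]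
  {F : Type*} [NormedAddCommGroup F] [NormedSpace ℝ F] [FiniteDimensional ℝ F]
  {M : Type*} [TopologicalSpace M] [CompactSpace M] [ChartedSpace F M]
  [IsManifold 𝓘(ℝ, F) ∞ M]

open LiouvilleCompletion

namespace ConeProblem

variable {L : LiouvilleCompletion E X F M}

/-- The estimates for solutions hold on `Z` with constant `C`. -/
structure IsControl (Q : ConeProblem L) (Z : Set ℂ) (C : ℝ) : Prop where
  isOpen : IsOpen Z
  subset : Z ⊆ Q.U
  one_le : 1 ≤ C
  q_le : ∀ z ∈ Z, ∀ y, Q.q z y ≤ C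
  le_q : ∀ z ∈ Z, ∀ y, 1 ≤ C * Q.q z y
  est : ∀ (u : ℂ → X) (e : ℂ → ℝ), Q.IsSol u e → ∀ z ∈ Z, ∀ (y : M) (r : ℝ),
      Q.T < r → u z = L.cone (y, r) →
      ContDiffAt ℝ ∞ (Q.height u) z ∧ -C * Q.height u z ≤ lap (Q.height u) z ∧ 0 ≤ e z ∧
      ∀ v, |fderiv ℝ (Q.height u) z v| ≤ C * Q.height u z * (1 + √(e z)) * ‖v‖

lemma exists_isControl (Q : ConeProblem L) {Z : Set ℂ} (hZ : IsCompact Z) (hZU : Z ⊆ Q.U) :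
    ∃ Z' C, Z ⊆ Z' ∧ Q.IsControl Z' C := by
  obtain ⟨K, hK, hZK, hKU⟩ := exists_compact_between hZ Q.isOpen hZU
  obtain ⟨C₁, h1, hC₁⟩ := Q.exists_q_bound hK hKU
  obtain ⟨C₂, h2, hC₂⟩ := Q.exists_estimates (φ := fun _ ↦ 0) contMDiff_const (κ := 0) (by simp)
    hK hKU
  have hm1 := le_max_left C₁ C₂
  have hm2 := le_max_right C₁ C₂
  refine ⟨interior K, max C₁ C₂, hZK, isOpen_interior, interior_subset.trans hKU, h1.trans hm1,
    fun z hz y ↦ (hC₁ z (interior_subset hz) y).1.trans hm1, fun z hz y ↦ ?_,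
    fun u e h z hz y r hr hu ↦ ?_⟩
  · refine (hC₁ z (interior_subset hz) y).2.trans (mul_le_mul_of_nonneg_right hm1 ?_)
    exact (Q.q_pos (hKU (interior_subset hz)) y).le
  · obtain ⟨a1, a2, a3, a4, -⟩ := hC₂ u e h z (interior_subset hz) y r hr hu
    have h0 : 0 ≤ Q.height u z := by
      rw [height_eq (by linarith [Q.one_le]) hu]
      exact mul_nonneg (by linarith [Q.one_le]) (Q.q_pos (hKU (interior_subset hz)) y).le
    refine ⟨a1, ?_, a3, fun v ↦ (a4 v).trans ?_⟩
    · nlinarith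
    · gcongr

variable {Q : ConeProblem L} {Z : Set ℂ} {C B : ℝ} {u : ℂ → X} {e : ℂ → ℝ}

namespace IsControl

lemma height_le (hC : Q.IsControl Z C) {z : ℂ} (hz : z ∈ Z) {y : M} {r : ℝ} (hr : 0 < r)
    (hu : u z = L.cone (y, r)) : Q.height u z ≤ C * r := by
  rw [height_eq hr hu, mul_comm]
  exact mul_le_mul_of_nonneg_right (hC.q_le z hz y) hr.le

lemma le_height (hC : Q.IsControl Z C) {z : ℂ} (hz : z ∈ Z) {y : M} {r : ℝ} (hr : 0 < r)
    (hu : u z = L.cone (y, r)) : r ≤ C * Q.height u z := by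
  rw [height_eq hr hu]
  nlinarith [hC.le_q z hz y]

lemma exists_of_lt_height (hC : Q.IsControl Z C) (hB : C * Q.T ≤ B) {z : ℂ} (hz : z ∈ Z)
    (h : B < Q.height u z) : ∃ y r, Q.T < r ∧ u z = L.cone (y, r) := by
  have hT0 : 0 < Q.T := by linarith [Q.one_le]
  have hC0 : 0 < C := by linarith [hC.one_le]
  have hB0 : 0 < B := lt_of_lt_of_le (by positivity) hB
  by_cases hx : ∃ y r, 0 < r ∧ u z = L.cone (y, r)
  · obtain ⟨y, r, hr, hu⟩ := hx
    refine ⟨y, r, ?_, hu⟩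
    have := hC.height_le hz hr hu
    by_contra hle
    nlinarith
  · push Not at hx
    rw [height, L.coneLift_of_notMem _ hx] at h
    linarith

/-- Where u lies on the part r > T the height is smooth. Elsewhere closedness of M × [B / C, ∞),
with B / C > T, keeps nearby points below that level, so the height stays at most B there. -/
lemma continuousAt_max (hC : Q.IsControl Z C) (hB : C * Q.T < B) (h : Q.IsSol u e)
    {z : ℂ} (hz : z ∈ Z) : ContinuousAt (fun z ↦ max (Q.height u z) B) z := by
  have hT0 : 0 < Q.T := by linarith [Q.one_le]
  have hC0 : 0 < C := by linarith [hC.one_le]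
  have hB0 : 0 < B := lt_trans (by positivity) hB
  have hcont : ContinuousAt u z :=
    h.smooth.continuousOn.continuousAt (Q.isOpen.mem_nhds (hC.subset hz))
  by_cases hx : u z ∈ L.cone '' (univ ×ˢ Ioi Q.T)
  · obtain ⟨⟨y, r⟩, hr, hu⟩ := hx
    exact ((hC.est u e h z hz y r hr.2 hu.symm).1.continuousAt).max continuousAt_const
  · have ht : Q.T < B / C := by rw [lt_div_iff₀ hC0]; linarith
    have hcl := Q.isClosed_end (hC.subset hz) ht
    have hxc : u z ∉ L.cone '' (univ ×ˢ Ici (B / C)) := by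
      rintro ⟨⟨y, r⟩, hr, hu⟩
      exact hx ⟨(y, r), ⟨mem_univ _, ht.trans_le hr.2⟩, hu⟩
    have hev : ∀ᶠ z' in 𝓝 z, max (Q.height u z') B = B := by
      filter_upwards [hcont.preimage_mem_nhds (hcl.isOpen_compl.mem_nhds hxc),
        hC.isOpen.mem_nhds hz] with z' h1 h2
      apply max_eq_right
      by_contra hlt
      obtain ⟨y, r, hr, hu⟩ := hC.exists_of_lt_height hB.le h2 (not_le.mp hlt)
      refine h1 ⟨(y, r), ⟨mem_univ _, ?_⟩, hu.symm⟩
      have := hC.height_le h2 (hT0.trans hr) hu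
      show B / C ≤ r
      rw [div_le_iff₀ hC0]
      linarith [not_le.mp hlt]
    exact ContinuousAt.congr continuousAt_const (hev.mono fun z' hz' ↦ hz'.symm)

lemma growth (hC : Q.IsControl Z C) (hB : C * Q.T < B) (h : Q.IsSol u e) {γ : ℝ → ℂ}
    (hγ : ContDiff ℝ ∞ γ) {N : ℝ} (hN : ∀ t, ‖deriv γ t‖ ≤ N) {t₀ t₁ I : ℝ} (h01 : t₀ ≤ t₁)
    (hI : 0 ≤ I) (hZ : ∀ t ∈ Icc t₀ t₁, γ t ∈ Z) (h0 : Q.height u (γ t₀) ≤ B)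
    (hint : ∫⁻ t in Icc t₀ t₁, ENNReal.ofReal (e (γ t)) ≤ ENNReal.ofReal I) :
    Q.height u (γ t₁) ≤ B * Real.exp (C * N * (2 * (t₁ - t₀) + I)) := by
  have hT0 : 0 < Q.T := by linarith [Q.one_le]
  have hC0 : 0 < C := by linarith [hC.one_le]
  have hN0 : 0 ≤ N := (norm_nonneg _).trans (hN 0)
  have hB0 : 0 < B := lt_trans (by positivity) hB
  refine growth_le (f := fun t ↦ Q.height u (γ t)) (e := fun t ↦ e (γ t)) h01 hB0 (by positivity)
    hI h0 (fun t ht ↦ ?_) (fun t ht hlt ↦ ?_) ((lintegral_mono_set inter_subset_left).trans hint)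
  · exact ((hC.continuousAt_max hB h (hZ t ht)).comp (f := γ)
      hγ.continuous.continuousAt).continuousWithinAt
  · obtain ⟨y, r, hr, hu⟩ := hC.exists_of_lt_height hB.le (hZ t ht) hlt
    obtain ⟨a1, -, a3, a4⟩ := hC.est u e h _ (hZ t ht) y r hr hu
    have hd : HasDerivAt (fun t ↦ Q.height u (γ t)) (fderiv ℝ (Q.height u) (γ t) (deriv γ t)) t :=
      (a1.differentiableAt (by simp)).hasFDerivAt.comp_hasDerivAt t
        ((hγ.differentiable (by simp)).differentiableAt.hasDerivAt)
    refine ⟨(ContDiffAt.comp (f := γ) t a1 hγ.contDiffAt).of_le (by simp), a3, ?_⟩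
    rw [hd.deriv]
    have h1 := a4 (deriv γ t)
    have h2 : 0 ≤ C * Q.height u (γ t) * (1 + √(e (γ t))) := by
      have := hB0.trans hlt
      positivity
    calc _ ≤ _ := h1
      _ ≤ C * Q.height u (γ t) * (1 + √(e (γ t))) * N := by gcongr; exact hN t
      _ = _ := by ring

/-- A maximum principle on narrow domains. -/
lemma height_le_of_boundary (hC : Q.IsControl Z C) (hB : C * Q.T < B) (h : Q.IsSol u e) {μ s₀ c : ℝ}
    (hμ : C < μ ^ 2) (hc : 0 < c) {K : Set ℂ} (hK : IsCompact K) (hKZ : K ⊆ Z)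
    (hcos : ∀ z ∈ K, c ≤ stripCos μ s₀ z)
    (hloc : ∀ z ∈ K, B < Q.height u z → ∀ᶠ z' in 𝓝 z, ∃ z'' ∈ K,
      Q.height u z'' = Q.height u z' ∧ z''.re = z'.re) {z : ℂ} (hz : z ∈ K) :
    Q.height u z ≤ B / c := by
  have hT0 : 0 < Q.T := by linarith [Q.one_le]
  have hC0 : 0 < C := by linarith [hC.one_le]
  have hB0 : 0 < B := lt_trans (by positivity) hB
  have hcosp : ∀ z ∈ K, 0 < stripCos μ s₀ z := fun z hz ↦ hc.trans_le (hcos z hz)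
  -- The maximum of max(ρ, B) / cos over K. If ρ > B there, then ρ / cos has a local maximum, so Δρ
  -- ≤ -μ² ρ, contradicting Δρ ≥ -C ρ with C < μ². Otherwise the value at m is at most B / c.
  obtain ⟨m, hmK, hm⟩ := hK.exists_isMaxOn ⟨z, hz⟩
    (f := fun z ↦ max (Q.height u z) B / stripCos μ s₀ z) (fun z hz ↦ by
      refine ((hC.continuousAt_max hB h (hKZ hz)).div ?_ (hcosp z hz).ne').continuousWithinAt
      exact (contDiff_stripCos μ s₀ (n := 0)).continuous.continuousAt)
  have hcos1 : stripCos μ s₀ z ≤ 1 := Real.cos_le_one _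
  by_cases hmB : B < Q.height u m
  · exfalso
    obtain ⟨y, r, hr, hu⟩ := hC.exists_of_lt_height hB.le (hKZ hmK) hmB
    obtain ⟨a1, a2, -⟩ := hC.est u e h _ (hKZ hmK) y r hr hu
    -- A point near m need not lie in K. It suffices that K contains a point with the same height
    -- and real part, since the cosine depends on the real part alone. On a cylinder that point is a
    -- vertical translate.
    have hloc' : IsLocalMax (fun z ↦ Q.height u z / stripCos μ s₀ z) m := by
      filter_upwards [hloc m hmK hmB] with z' hz'
      obtain ⟨z'', hz''K, hh, hre⟩ := hz'
      have h1 := hm hz''K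
      have h2 : stripCos μ s₀ z'' = stripCos μ s₀ z' := by simp only [stripCos, hre]
      simp only [mem_ofPred_eq] at h1
      rw [max_eq_left hmB.le] at h1
      rw [← hh, ← h2]
      refine le_trans ?_ h1
      have := hcosp z'' hz''K
      gcongr
      exact le_max_left _ _
    have h2 : (2 : WithTop ℕ∞) ≤ ((⊤ : ℕ∞) : WithTop ℕ∞) := by
      simpa using WithTop.coe_le_coe.mpr (le_top (a := (2 : ℕ∞)))
    have := lap_le_of_isLocalMax_div (a1.of_le h2) (hcosp m hmK) hloc'
    have hpos : 0 < Q.height u m := hB0.trans hmB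
    nlinarith
  · have h1 : max (Q.height u z) B / stripCos μ s₀ z ≤ max (Q.height u m) B / stripCos μ s₀ m :=
      hm hz
    rw [max_eq_right (not_lt.mp hmB)] at h1
    have h2 : B / stripCos μ s₀ m ≤ B / c := by
      have := hcos m hmK
      gcongr
    have h3 := h1.trans h2
    rw [div_le_iff₀ (hcosp z hz)] at h3
    refine (le_max_left _ B).trans (h3.trans ?_)
    have : 0 ≤ B / c := by positivity
    nlinarith

end IsControl

/-- the part of the domain which is mapped to the conical end -/
def region (Q : ConeProblem L) (u : ℂ → X) : Set ℂ := Q.U ∩ u ⁻¹' (L.cone '' (univ ×ˢ Ioi Q.T))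

lemma isOpen_region (h : Q.IsSol u e) : IsOpen (Q.region u) :=
  h.smooth.continuousOn.isOpen_inter_preimage Q.isOpen (L.isOpen_end Q.one_le)

/-- The density is constrained only where u is on the conical end with r > T. Cutting it off
elsewhere keeps the equation and makes it measurable, as Fubini and polar coordinates require. -/
lemma IsSol.indicator (h : Q.IsSol u e) : Q.IsSol u ((Q.region u).indicator e) := by
  refine ⟨h.smooth, fun z hz y r hr hu ↦ ?_⟩
  have hmem : z ∈ Q.region u := ⟨hz, ⟨(y, r), ⟨mem_univ _, hr⟩, hu.symm⟩⟩
  rw [indicator_of_mem hmem]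
  exact h.eqn z hz y r hr hu

lemma measurable_indicator_region (h : Q.IsSol u e) : Measurable ((Q.region u).indicator e) := by
  classical
  rw [← piecewise_eq_indicator]
  refine ContinuousOn.measurable_piecewise (fun z hz ↦ ?_) continuousOn_const
    (isOpen_region h).measurableSet
  obtain ⟨hzU, ⟨y, r⟩, hr, hu⟩ := hz
  exact (continuousAt_energy h hzU hr.2 hu.symm).continuousWithinAt

lemma ofReal_indicator_le (Q : ConeProblem L) (u : ℂ → X) (e : ℂ → ℝ) (z : ℂ) :
    ENNReal.ofReal ((Q.region u).indicator e z) ≤ ENNReal.ofReal (e z) := by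
  by_cases hz : z ∈ Q.region u
  · rw [indicator_of_mem hz]
  · rw [indicator_of_notMem hz]; simp

end ConeProblem
end Growth

/-! ### Selecting lines of small energy. -/

section Integration

/-- A mean value argument. The summand 1 makes the comparison strict, also for I = 0. -/
lemma exists_le_of_lintegral_Ioo {a b I : ℝ} (hab : a < b) {g : ℝ → ℝ≥0∞} (hI : 0 ≤ I)
    (h : ∫⁻ s in Ioo a b, g s ≤ ENNReal.ofReal I) :
    ∃ s ∈ Ioo a b, g s ≤ ENNReal.ofReal ((I + 1) / (b - a)) := by
  by_contra! hcon
  have h1 : ∫⁻ s in Ioo a b, ENNReal.ofReal ((I + 1) / (b - a)) ≤ ∫⁻ s in Ioo a b, g s :=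
    setLIntegral_mono' measurableSet_Ioo fun s hs ↦ (hcon s hs).le
  have hba : 0 < b - a := sub_pos.mpr hab
  rw [setLIntegral_const, Real.volume_Ioo, ← ENNReal.ofReal_mul (by positivity),
    div_mul_cancel₀ _ hba.ne'] at h1
  have h2 := (ENNReal.ofReal_le_ofReal_iff hI).mp (h1.trans h)
  linarith

lemma lintegral_reProdIm {s t : Set ℝ} {f : ℂ → ℝ≥0∞} (hf : Measurable f) :
    ∫⁻ z in s ×ℂ t, f z = ∫⁻ x in s, ∫⁻ y in t, f ⟨x, y⟩ := by
  have h1 := Complex.volume_preserving_equiv_real_prod.symm.setLIntegral_comp_preimage_emb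
    Complex.measurableEquivRealProd.symm.measurableEmbedding f (s ×ℂ t)
  rw [← h1]
  have h2 : Complex.measurableEquivRealProd.symm ⁻¹' (s ×ℂ t) = s ×ˢ t := by
    ext p; rfl
  rw [h2, Measure.volume_eq_prod, setLIntegral_prod
    (fun a ↦ f (Complex.measurableEquivRealProd.symm a))
    (hf.comp Complex.measurableEquivRealProd.symm.measurable).aemeasurable]
  rfl

lemma _root_.Function.Periodic.map_fract_one {α : Type*} {f : ℝ → α} (hf : Function.Periodic f 1)
    (t : ℝ) : f (Int.fract t) = f t := by
  have := hf.sub_int_mul_eq (x := t) ⌊t⌋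
  rw [mul_one] at this
  exact this

end Integration

/-! ### Cylindrical ends -/

section Ends

variable {E : Type*} [NormedAddCommGroup E] [NormedSpace ℝ E] [FiniteDimensional ℝ E]
  {X : Type*} [TopologicalSpace X] [T2Space X] [ChartedSpace E X] [IsManifold 𝓘(ℝ, E) ∞ X]
  {F : Type*} [NormedAddCommGroup F] [NormedSpace ℝ F] [FiniteDimensional ℝ F]
  {M : Type*} [TopologicalSpace M] [T2Space M] [CompactSpace M] [ChartedSpace F M]
  [IsManifold 𝓘(ℝ, F) ∞ M]

namespace ConeProblem

variable {L : LiouvilleCompletion E X F M} {Q : ConeProblem L}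

lemma periodic_vline {α : Type*} {f : ℂ → α} (hf : ∀ z, f (z + Complex.I) = f z) (s : ℝ) :
    Function.Periodic (fun t : ℝ ↦ f ⟨s, t⟩) 1 := fun t ↦ by
  refine Eq.trans (congrArg f ?_) (hf ⟨s, t⟩)
  apply Complex.ext <;> simp

/-- By admissibility, a line with bounded energy meets a fixed compact set. -/
lemma exists_low (hU : ∀ z : ℂ, |z.re| < 1 → z ∈ Q.U) {slope : ℝ → M → ℝ}
    (hslope : ∀ s t : ℝ, |s| < 1 → ∀ y, Q.g₂ y ⟨s, t⟩ = slope t y)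
    (hadm : Admissible L.alpha slope) {I : ℝ} (hI : 0 ≤ I) :
    ∃ R₀ ≥ (0 : ℝ), ∀ (u : ℂ → X) (e : ℂ → ℝ) (s : ℝ), Q.IsSol u e →
      (∀ z, u (z + Complex.I) = u z) → (∀ z, e (z + Complex.I) = e z) → |s| ≤ 1 / 2 →
      ∫⁻ t in Icc (0 : ℝ) 1, ENNReal.ofReal (e ⟨s, t⟩) ≤ ENNReal.ofReal I →
      ∃ t ∈ Icc (0 : ℝ) 1, ∀ y r, Q.T < r → u ⟨s, t⟩ = L.cone (y, r) → r ≤ R₀ := by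
  -- Failure for every R₀ = n gives solutions and lines on which r > n at every point. Fractional
  -- parts extend these curves to 1-periodic ones, and their limit would be an orbit forbidden by
  -- admissibility.
  by_contra! hcon
  choose u e s hsol hu he hs hint hr using fun n : ℕ ↦ hcon n n.cast_nonneg
  have hfr : ∀ t : ℝ, Int.fract t ∈ Icc (0 : ℝ) 1 := fun t ↦
    ⟨Int.fract_nonneg t, (Int.fract_lt_one t).le⟩
  choose y r hT hc hn using fun n t ↦ hr n (Int.fract t) (hfr t)
  have hper : ∀ n t, y n (t + 1) = y n t ∧ r n (t + 1) = r n t := by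
    intro n t
    have h1 := hc n (t + 1)
    rw [Int.fract_add_one] at h1
    exact L.cone_inj (by linarith [hT n (t + 1), Q.one_le]) (by linarith [hT n t, Q.one_le])
      (h1.symm.trans (hc n t))
  have hc' : ∀ n t, Q.T < r n t ∧ u n ⟨s n, t⟩ = L.cone (y n t, r n t) := by
    refine fun n t ↦ ⟨hT n t, ?_⟩
    rw [← hc n t]
    exact ((periodic_vline (hu n) (s n)).map_fract_one t).symm
  have hint' : ∀ n a, ∫⁻ t in Icc a (a + 1), ENNReal.ofReal (e n ⟨s n, t⟩) ≤ ENNReal.ofReal I := by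
    intro n a
    rw [lintegral_Icc_periodic (f := fun t ↦ ENNReal.ofReal (e n ⟨s n, t⟩))]
    · exact hint n
    · exact fun t ↦ congrArg ENNReal.ofReal (periodic_vline (he n) (s n) t)
  obtain ⟨s', y', r', hs', h1, h2, h3, h4, h5, h6⟩ :=
    exists_periodic_orbit hU hsol hs hc' (fun n t ↦ (hn n t).le) hI hint' hper
  refine hadm ⟨y', r', h1, h2, h3, h4, h5, fun t ↦ ?_⟩
  have h7 := h6 t
  have h8 : (fun y ↦ Q.g₂ y ⟨s', t⟩) = slope t := funext fun y ↦
    hslope s' t (hs'.trans_lt (by norm_num)) y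
  rwa [h8] at h7

/-- Solutions of bounded energy on a cylinder are bounded on the central circle. -/
theorem exists_end_bound (hU : ∀ z : ℂ, z ∈ Q.U ↔ |z.re| < 1)
    (hJ : ∀ z, Q.J (z + Complex.I) = Q.J z) {slope : ℝ → M → ℝ}
    (hslope : ∀ s t : ℝ, |s| < 1 → ∀ y, Q.g₂ y ⟨s, t⟩ = slope t y)
    (hadm : Admissible L.alpha slope) {I : ℝ} (hI : 0 ≤ I) :
    ∃ R : ℝ, ∀ (u : ℂ → X) (e : ℂ → ℝ), Q.IsSol u e →
      (∀ z, u (z + Complex.I) = u z) → (∀ z, e (z + Complex.I) = e z) →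
      ∫⁻ z in Ioo (-1 : ℝ) 1 ×ℂ Ioo (0 : ℝ) 1, ENNReal.ofReal (e z) ≤ ENNReal.ofReal I →
      ∀ t y r, Q.T < r → u ⟨0, t⟩ = L.cone (y, r) → r ≤ R := by
  have hT0 : 0 < Q.T := by linarith [Q.one_le]
  -- The height 2 leaves room to follow a circle once around, starting from any t₀ in [0, 1].
  have hrect : IsCompact (Icc (-(1 / 2) : ℝ) (1 / 2) ×ℂ Icc (0 : ℝ) 2) :=
    isCompact_Icc.reProdIm isCompact_Icc
  obtain ⟨Z, C, hrZ, hC⟩ := Q.exists_isControl hrect fun z hz ↦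
    (hU z).mpr (abs_lt.mpr ⟨by linarith [hz.1.1], by linarith [hz.1.2]⟩)
  have hC1 := hC.one_le
  have hC0 : 0 < C := by linarith
  -- Then μ² > C, and |Re z| ≤ d = 1 / (2μ) keeps the argument of the cosine within 1/2, so that the
  -- cosine is at least 1 - 1/8 ≥ 1/2.
  set μ := C + 1 with hμ
  set d := 1 / (2 * μ) with hd
  have hμ0 : 0 < μ := by linarith
  have hd0 : 0 < d := by positivity
  have hd1 : d ≤ 1 / 2 := by
    rw [hd, div_le_div_iff₀ (by positivity) (by norm_num)]
    linarith
  set I' := (I + 1) / d with hI'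
  have hI'0 : 0 ≤ I' := by positivity
  obtain ⟨R₀, hR₀, hlow⟩ := exists_low (fun z ↦ (hU z).mpr) hslope hadm hI'0
  set B₀ := max (C * R₀) (C * Q.T + 1) with hB₀
  have hB₀T : C * Q.T < B₀ := lt_of_lt_of_le (by linarith) (le_max_right _ _)
  have hB₀0 : 0 < B₀ := lt_trans (by positivity) hB₀T
  set B₁ := B₀ * Real.exp (C * 1 * (2 * 1 + I')) with hB₁
  have hB₀₁ : B₀ ≤ B₁ := le_mul_of_one_le_right hB₀0.le (Real.one_le_exp (by positivity))
  refine ⟨C * (B₁ / (1 / 2)), ?_⟩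
  intro u e₀ h₀ hu he₀ hint₀ t y r hr hut
  set e := (Q.region u).indicator e₀ with he_def
  have h : Q.IsSol u e := h₀.indicator
  have hmeas : Measurable e := measurable_indicator_region h₀
  have hreg : ∀ z, z + Complex.I ∈ Q.region u ↔ z ∈ Q.region u := fun z ↦ by
    simp only [region, mem_inter_iff, mem_preimage, hu, hU]
    simp
  have he : ∀ z, e (z + Complex.I) = e z := fun z ↦ by
    by_cases hz : z ∈ Q.region u
    · rw [he_def, indicator_of_mem hz, indicator_of_mem ((hreg z).mpr hz), he₀]
    · rw [he_def, indicator_of_notMem hz, indicator_of_notMem (mt (hreg z).mp hz)]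
  have hint : ∫⁻ x in Ioo (-1 : ℝ) 1, ∫⁻ y in Ioo (0 : ℝ) 1, ENNReal.ofReal (e ⟨x, y⟩)
      ≤ ENNReal.ofReal I := by
    rw [← lintegral_reProdIm (f := fun z ↦ ENNReal.ofReal (e z)) hmeas.ennreal_ofReal]
    exact (lintegral_mono fun z ↦ ofReal_indicator_le Q u e₀ z).trans hint₀
  have hper : ∀ z, Q.height u (z + Complex.I) = Q.height u z := fun z ↦ by
    rw [height, height, hu, Q.q_congr (hJ z)]
  have hgood : ∀ a b : ℝ, -1 ≤ a → b ≤ 1 → b - a = d → ∃ s ∈ Ioo a b,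
      ∫⁻ t in Icc (0 : ℝ) 1, ENNReal.ofReal (e ⟨s, t⟩) ≤ ENNReal.ofReal I' := by
    intro a b ha hb hab
    obtain ⟨s, hs, hle⟩ := exists_le_of_lintegral_Ioo (by linarith) hI
      ((lintegral_mono_set (Ioo_subset_Ioo ha hb)).trans hint)
    rw [hab, setLIntegral_congr Ioo_ae_eq_Icc] at hle
    exact ⟨s, hs, hle⟩
  have hline : ∀ s : ℝ, |s| ≤ 1 / 2 →
      ∫⁻ t in Icc (0 : ℝ) 1, ENNReal.ofReal (e ⟨s, t⟩) ≤ ENNReal.ofReal I' →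
      ∀ t ∈ Icc (0 : ℝ) 1, Q.height u ⟨s, t⟩ ≤ B₁ := by
    intro s hs hsI
    obtain ⟨t₀, ht₀, hlow₀⟩ := hlow u e s h hu he hs hsI
    have hZ : ∀ τ : ℝ, 0 ≤ τ → τ ≤ 2 → (⟨s, τ⟩ : ℂ) ∈ Z := fun τ h0 h2 ↦
      hrZ ⟨abs_le.mp hs, h0, h2⟩
    have h0 : Q.height u ⟨s, t₀⟩ ≤ B₀ := by
      by_contra hlt
      have hz := hZ t₀ ht₀.1 (by linarith [ht₀.2])
      obtain ⟨y, r, hr, hu'⟩ := hC.exists_of_lt_height hB₀T.le hz (not_le.mp hlt)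
      have h1 := hlow₀ y r hr hu'
      have h2 := hC.height_le hz (hT0.trans hr) hu'
      have h3 : C * r ≤ C * R₀ := by gcongr
      exact hlt (h2.trans (h3.trans (le_max_left _ _)))
    have hstep : ∀ t' ∈ Icc t₀ (t₀ + 1), Q.height u ⟨s, t'⟩ ≤ B₁ := by
      intro t' ht'
      have h1 := hC.growth hB₀T h (contDiff_vline s) (N := 1)
        (fun t ↦ by rw [(hasDerivAt_vline s t).deriv]; simp) ht'.1 hI'0
        (fun τ hτ ↦ hZ τ (ht₀.1.trans hτ.1) (by linarith [ht₀.2, ht'.2, hτ.2])) h0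
        ((lintegral_mono_set (Icc_subset_Icc le_rfl ht'.2)).trans ((lintegral_Icc_periodic (f := fun t ↦ ENNReal.ofReal (e ⟨s, t⟩))
          (fun t ↦ congrArg ENNReal.ofReal (periodic_vline he s t)) t₀).le.trans hsI))
      refine h1.trans ?_
      rw [hB₁]
      have := ht'.2
      gcongr
      linarith
    intro t ht
    rcases le_total t₀ t with hle | hle
    · exact hstep t ⟨hle, by linarith [ht.2, ht₀.1]⟩
    · have h1 := hstep (t + 1) ⟨by linarith [ht.1, ht₀.2], by linarith⟩
      exact (periodic_vline hper s t).symm.trans_le h1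
  -- One circle of bounded energy on each side of the central one. The cylinder between them is
  -- narrow enough for the maximum principle.
  obtain ⟨s₁, hs₁, hI₁⟩ := hgood (-d) 0 (by linarith) (by norm_num) (by ring)
  obtain ⟨s₂, hs₂, hI₂⟩ := hgood 0 d (by norm_num) (by linarith) (by ring)
  have hl₁ := hline s₁ (abs_le.mpr ⟨by linarith [hs₁.1], by linarith [hs₁.2]⟩) hI₁
  have hl₂ := hline s₂ (abs_le.mpr ⟨by linarith [hs₂.1], by linarith [hs₂.2]⟩) hI₂
  have hbd := hC.height_le_of_boundary (hB₀T.trans_le hB₀₁) h (μ := μ) (s₀ := 0) (c := 1 / 2)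
    (by rw [hμ]; nlinarith) (by norm_num) (K := Icc s₁ s₂ ×ℂ Icc (0 : ℝ) 1)
    (isCompact_Icc.reProdIm isCompact_Icc)
    (fun z hz ↦ hrZ ⟨⟨by linarith [hz.1.1, hs₁.1], by linarith [hz.1.2, hs₂.2]⟩,
      hz.2.1, by linarith [hz.2.2]⟩)
    (fun z hz ↦ by
      have h1 : |z.re| ≤ d := abs_le.mpr ⟨by linarith [hz.1.1, hs₁.1], by linarith [hz.1.2, hs₂.2]⟩
      have h2 : |μ * (z.re - 0)| ≤ 1 / 2 := by
        rw [sub_zero, abs_mul, abs_of_pos hμ0]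
        calc μ * |z.re| ≤ μ * d := by gcongr
          _ = 1 / 2 := by rw [hd]; field_simp
      refine le_trans ?_ Real.one_sub_sq_div_two_le_cos
      have h3 : (μ * (z.re - 0)) ^ 2 ≤ (1 / 2) ^ 2 := sq_le_sq' (by linarith [abs_le.mp h2])
        (abs_le.mp h2).2
      linarith)
    -- A point above the bound is off the two bounding circles, so nearby points have real part in
    -- the open interval. Reducing the imaginary part modulo 1 returns them to the rectangle.
    (fun z hz hlt ↦ by
      have h1 : s₁ < z.re := lt_of_le_of_ne hz.1.1 fun heq ↦ by
        have := hl₁ z.im hz.2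
        rw [heq] at this
        exact absurd hlt (not_lt.mpr this)
      have h2 : z.re < s₂ := lt_of_le_of_ne hz.1.2 fun heq ↦ by
        have := hl₂ z.im hz.2
        rw [← heq] at this
        exact absurd hlt (not_lt.mpr this)
      have h3 := Complex.continuous_re.continuousAt.preimage_mem_nhds (Ioo_mem_nhds h1 h2)
      filter_upwards [h3] with z' hz'
      exact ⟨⟨z'.re, Int.fract z'.im⟩, ⟨⟨hz'.1.le, hz'.2.le⟩, Int.fract_nonneg _,
        (Int.fract_lt_one _).le⟩, (periodic_vline hper z'.re).map_fract_one z'.im, rfl⟩)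
    (z := ⟨0, Int.fract t⟩) ⟨⟨hs₁.2.le, hs₂.1.le⟩, Int.fract_nonneg _, (Int.fract_lt_one _).le⟩
  have hu' : u ⟨0, Int.fract t⟩ = L.cone (y, r) :=
    ((periodic_vline hu 0).map_fract_one t).trans hut
  refine (hC.le_height (hrZ ⟨⟨by norm_num, by norm_num⟩, Int.fract_nonneg _, ?_⟩)
    (hT0.trans hr) hu').trans (mul_le_mul_of_nonneg_left hbd hC0.le)
  linarith [Int.fract_lt_one t]

end ConeProblem
end Ends

/-! ### Propagation of bounds over the domain -/

section Integration

lemma lintegral_polar (f : ℂ → ℝ≥0∞) (hf : Measurable f) (d w : ℂ) (hw : ‖w‖ = 1) :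
    ∫⁻ s in Ioi (0 : ℝ), ∫⁻ θ in Ioo (-Real.pi) Real.pi,
      ENNReal.ofReal s * f (d + w * (s * Complex.exp (θ * Complex.I))) = ∫⁻ z, f z := by
  have h1 : ∫⁻ z, f z = ∫⁻ z, f (d + w * z) := by
    have h2 := lintegral_add_left_eq_self (μ := volume) f d
    have h3 := (rotation ⟨w, by
      simpa [Submonoid.unitSphere, mem_sphere_iff_norm] using hw⟩).measurePreserving
    rw [← h2, ← h3.lintegral_comp (f := fun z ↦ f (d + z))
      (hf.comp (measurable_const_add d))]
    rfl
  have hm : Measurable fun p : ℝ × ℝ ↦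
      ENNReal.ofReal p.1 * f (d + w * (p.1 * Complex.exp (p.2 * Complex.I))) := by
    refine (ENNReal.measurable_ofReal.comp measurable_fst).mul (hf.comp ?_)
    fun_prop
  rw [h1, ← Complex.lintegral_comp_polarCoord_symm, polarCoord_target, Measure.volume_eq_prod,
    setLIntegral_prod]
  · refine lintegral_congr fun s ↦ lintegral_congr fun θ ↦ ?_
    simp only [Complex.polarCoord_symm_apply, smul_eq_mul, Complex.exp_mul_I, Complex.ofReal_cos,
      Complex.ofReal_sin]
  · refine Measurable.aemeasurable ?_
    convert hm using 4
    simp only [Complex.polarCoord_symm_apply, smul_eq_mul, Complex.exp_mul_I, Complex.ofReal_cos,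
      Complex.ofReal_sin]

/-- Radii in (a, b) carry weight at least a in polar coordinates, so the angular integrals have
total at most I / a over an interval of length b - a. -/
lemma exists_circle_le {f : ℂ → ℝ≥0∞} (hf : Measurable f) (d : ℂ) {w : ℂ} (hw : ‖w‖ = 1)
    {I a b : ℝ} (hI : 0 ≤ I) (ha : 0 < a) (hab : a < b)
    (hint : ∫⁻ z, f z ≤ ENNReal.ofReal I) :
    ∃ s ∈ Ioo a b, ∫⁻ θ in Icc (-Real.pi) Real.pi, f (d + w * (s * Complex.exp (θ * Complex.I)))
      ≤ ENNReal.ofReal ((I / a + 1) / (b - a)) := by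
  simp only [← setLIntegral_congr (Ioo_ae_eq_Icc (a := -Real.pi) (b := Real.pi))]
  refine exists_le_of_lintegral_Ioo hab (by positivity) ?_
  have ha' : ENNReal.ofReal a ≠ 0 := by simpa using ha
  rw [ENNReal.ofReal_div_of_pos ha, ENNReal.le_div_iff_mul_le (Or.inl ha') (by simp), mul_comm,
    ← lintegral_const_mul' _ _ ENNReal.ofReal_ne_top]
  refine le_trans ?_ ((lintegral_polar f hf d w hw).trans_le hint)
  refine le_trans ?_ (lintegral_mono_set (s := Ioo a b) fun s hs ↦ ha.trans hs.1)
  refine setLIntegral_mono' measurableSet_Ioo fun s hs ↦ ?_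
  rw [← lintegral_const_mul' _ _ ENNReal.ofReal_ne_top]
  gcongr
  exact hs.1.le

end Integration

/-! ### Bounds spread from a point to nearby points. -/

section Propagation

variable {E : Type*} [NormedAddCommGroup E] [NormedSpace ℝ E] [FiniteDimensional ℝ E]
  {X : Type*} [TopologicalSpace X] [T2Space X] [ChartedSpace E X] [IsManifold 𝓘(ℝ, E) ∞ X]
  {F : Type*} [NormedAddCommGroup F] [NormedSpace ℝ F] [FiniteDimensional ℝ F]
  {M : Type*} [TopologicalSpace M] [T2Space M] [CompactSpace M] [ChartedSpace F M]
  [IsManifold 𝓘(ℝ, F) ∞ M]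

namespace ConeProblem

variable {L : LiouvilleCompletion E X F M}

/-- On `N`, the solutions of energy at most `I` are uniformly bounded. -/
def BoundedOn (Q : ConeProblem L) (I : ℝ) (N : Set ℂ) : Prop :=
  ∃ R : ℝ, ∀ (u : ℂ → X) (e : ℂ → ℝ), Q.IsSol u e →
    ∫⁻ z in Q.U, ENNReal.ofReal (e z) ≤ ENNReal.ofReal I →
    ∀ z ∈ N, ∀ y r, Q.T < r → u z = L.cone (y, r) → r ≤ R

variable {Q : ConeProblem L} {I : ℝ}

lemma BoundedOn.mono {N N' : Set ℂ} (h : Q.BoundedOn I N) (hN : N' ⊆ N) : Q.BoundedOn I N' := by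
  obtain ⟨R, hR⟩ := h
  exact ⟨R, fun u e hu he z hz ↦ hR u e hu he z (hN hz)⟩

lemma BoundedOn.union {N N' : Set ℂ} (h : Q.BoundedOn I N) (h' : Q.BoundedOn I N') :
    Q.BoundedOn I (N ∪ N') := by
  obtain ⟨R, hR⟩ := h
  obtain ⟨R', hR'⟩ := h'
  refine ⟨max R R', fun u e hu he z hz y r hr hc ↦ ?_⟩
  rcases hz with hz | hz
  · exact (hR u e hu he z hz y r hr hc).trans (le_max_left _ _)
  · exact (hR' u e hu he z hz y r hr hc).trans (le_max_right _ _)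

/-- The admissible distance depends on d only, not on c or on its neighbourhood. This makes the set
of points with a bounded neighbourhood relatively closed. The resulting bound may degenerate as c
approaches d, which does no harm. -/
lemma exists_boundedOn_of_near (hI : 0 ≤ I) {d : ℂ} (hd : d ∈ Q.U) :
    ∃ ε > 0, ∀ c, dist c d < ε → (∃ N ∈ 𝓝 c, Q.BoundedOn I N) → ∃ N ∈ 𝓝 d, Q.BoundedOn I N := by
  have hT0 : 0 < Q.T := by linarith [Q.one_le]
  obtain ⟨η₀, hη₀, hη₀U⟩ := Metric.nhds_basis_closedBall.mem_iff.mp (Q.isOpen.mem_nhds hd)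
  obtain ⟨Z, C, hZ, hC⟩ := Q.exists_isControl (isCompact_closedBall d η₀) hη₀U
  have hC1 := hC.one_le
  have hC0 : 0 < C := by linarith
  set μ := C + 1 with hμ
  have hμ0 : 0 < μ := by linarith
  set η := min η₀ (1 / (2 * μ)) with hη
  have hη0 : 0 < η := lt_min hη₀ (by positivity)
  have hηZ : Metric.closedBall d η ⊆ Z :=
    (Metric.closedBall_subset_closedBall (min_le_left _ _)).trans hZ
  refine ⟨η, hη0, fun c hc ⟨N, hN, R₀, hR₀⟩ ↦ ?_⟩
  rcases eq_or_ne c d with rfl | hcd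
  · exact ⟨N, hN, R₀, hR₀⟩
  set ρ := ‖c - d‖ with hρ
  have hρ0 : 0 < ρ := norm_pos_iff.mpr (sub_ne_zero.mpr hcd)
  have hρη : ρ < η := by rwa [hρ, ← dist_eq_norm]
  obtain ⟨κ₀, hκ₀, hκN⟩ := Metric.mem_nhds_iff.mp hN
  -- Radii between ρ and b give circles that meet the ball of radius κ₀ about c and stay where the
  -- cosine is at least 1/2.
  set b := min (ρ + κ₀) η with hb
  have hρb : ρ < b := lt_min (by linarith) hρη
  -- Rotates the circle so that θ = -π, where growth starts, lies on the ray from d through c, at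
  -- distance s - ρ < κ₀ from c.
  set w : ℂ := -((c - d) / ρ) with hw
  have hρc : (ρ : ℂ) ≠ 0 := by exact_mod_cast hρ0.ne'
  have hw1 : ‖w‖ = 1 := by
    rw [hw, norm_neg, norm_div, Complex.norm_real, Real.norm_of_nonneg hρ0.le, ← hρ,
      div_self hρ0.ne']
  set I' := (I / ρ + 1) / (b - ρ) with hI'
  have hI'0 : 0 ≤ I' := div_nonneg (by positivity) (by linarith)
  set B₀ := max (C * R₀) (C * Q.T + 1) with hB₀
  have hB₀T : C * Q.T < B₀ := lt_of_lt_of_le (by linarith) (le_max_right _ _)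
  have hB₀0 : 0 < B₀ := lt_trans (by positivity) hB₀T
  set B₁ := B₀ * Real.exp (C * η * (2 * (2 * Real.pi) + I')) with hB₁
  have hB₀₁ : B₀ ≤ B₁ := by
    have := Real.pi_pos
    exact le_mul_of_one_le_right hB₀0.le (Real.one_le_exp (by positivity))
  refine ⟨Metric.ball d ρ, Metric.ball_mem_nhds d hρ0, C * (B₁ / (1 / 2)), ?_⟩
  intro u e₀ h₀ hint₀ z hz y r hr hu
  set e := (Q.region u).indicator e₀ with he_def
  have h : Q.IsSol u e := h₀.indicator
  have hmeas : Measurable e := measurable_indicator_region h₀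
  have hint : ∫⁻ z, ENNReal.ofReal (e z) ≤ ENNReal.ofReal I := by
    refine le_trans ?_ hint₀
    rw [← lintegral_indicator Q.isOpen.measurableSet]
    refine lintegral_mono fun z ↦ ?_
    by_cases hzU : z ∈ Q.U
    · rw [indicator_of_mem hzU]
      exact ofReal_indicator_le Q u e₀ z
    · rw [he_def, indicator_of_notMem (fun hz ↦ hzU hz.1)]
      simp
  obtain ⟨s, hs, hcirc⟩ := exists_circle_le hmeas.ennreal_ofReal d hw1 hI hρ0 hρb hint
  have hs0 : 0 < s := hρ0.trans hs.1
  have hsη : s < η := hs.2.trans_le (min_le_right _ _)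
  set γ : ℝ → ℂ := fun θ ↦ d + w * (s * Complex.exp (θ * Complex.I)) with hγ
  have hγd : ∀ θ : ℝ, HasDerivAt γ (w * (s * (Complex.exp (θ * Complex.I) * Complex.I))) θ := by
    intro θ
    have h1 : HasDerivAt (fun θ : ℝ ↦ (θ : ℂ) * Complex.I) Complex.I θ := by
      simpa using (Complex.ofRealCLM.hasDerivAt (x := θ)).mul_const Complex.I
    exact ((h1.cexp.const_mul (s : ℂ)).const_mul w).const_add d
  have hγs : ∀ θ, dist (γ θ) d = s := fun θ ↦ by
    rw [dist_eq_norm, hγ]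
    simp only [add_sub_cancel_left, norm_mul, hw1, Complex.norm_exp_ofReal_mul_I, one_mul, mul_one,
      Complex.norm_real, Real.norm_of_nonneg hs0.le]
  have hγsm : ContDiff ℝ ∞ γ := by
    have h1 : ContDiff ℝ ∞ (fun θ : ℝ ↦ (θ : ℂ) * Complex.I) :=
      Complex.ofRealCLM.contDiff.mul contDiff_const
    exact contDiff_const.add (contDiff_const.mul (contDiff_const.mul h1.cexp))
  have hstart : Q.height u (γ (-Real.pi)) ≤ B₀ := by
    have hmem : γ (-Real.pi) ∈ N := by
      apply hκN
      have : γ (-Real.pi) - c = ((s - ρ : ℝ) : ℂ) * ((c - d) / ρ) := by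
        have : Complex.exp (((-Real.pi : ℝ) : ℂ) * Complex.I) = -1 := by
          push_cast
          rw [neg_mul, Complex.exp_neg, Complex.exp_pi_mul_I]
          norm_num
        simp only [hγ, this, hw]
        push_cast
        field_simp
        ring
      rw [Metric.mem_ball, dist_eq_norm, this, norm_mul, ← norm_neg (_ / _), ← hw, hw1, mul_one,
        Complex.norm_real, Real.norm_of_nonneg (by linarith [hs.1])]
      linarith [hs.2, min_le_left (ρ + κ₀) η]
    have hZ' : γ (-Real.pi) ∈ Z := hηZ (Metric.mem_closedBall.mpr ((hγs _).trans_le hsη.le))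
    by_contra hlt
    obtain ⟨y, r, hr, hu'⟩ := hC.exists_of_lt_height hB₀T.le hZ' (not_le.mp hlt)
    have h1 := hR₀ u e₀ h₀ hint₀ _ hmem y r hr hu'
    have h2 := hC.height_le hZ' (hT0.trans hr) hu'
    have h3 : C * r ≤ C * R₀ := by gcongr
    exact hlt (h2.trans (h3.trans (le_max_left _ _)))
  have hcircle : ∀ θ ∈ Icc (-Real.pi) Real.pi, Q.height u (γ θ) ≤ B₁ := by
    intro θ hθ
    have h1 := hC.growth hB₀T h hγsm (N := η) (fun t ↦ by
        rw [(hγd t).deriv]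
        simp only [norm_mul, hw1, Complex.norm_exp_ofReal_mul_I, one_mul, mul_one,
          Complex.norm_real, Real.norm_of_nonneg hs0.le, Complex.norm_I]
        exact hsη.le) hθ.1 hI'0
      (fun τ _ ↦ hηZ (Metric.mem_closedBall.mpr ((hγs _).trans_le hsη.le))) hstart
      ((lintegral_mono_set (Icc_subset_Icc le_rfl hθ.2)).trans hcirc)
    refine h1.trans ?_
    rw [hB₁]
    have := hθ.2
    gcongr
    linarith
  have hbdry : ∀ z, dist z d = s → Q.height u z ≤ B₁ := by
    intro z hz
    have hw0 : w ≠ 0 := norm_ne_zero_iff.mp (by rw [hw1]; exact one_ne_zero)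
    have hn : ‖(z - d) / w‖ = s := by rw [norm_div, hw1, div_one, ← dist_eq_norm, hz]
    have h1 : γ (Complex.arg ((z - d) / w)) = z := by
      simp only [hγ]
      rw [← hn, Complex.norm_mul_exp_arg_mul_I, mul_div_cancel₀ _ hw0]
      ring
    rw [← h1]
    exact hcircle _ ⟨(Complex.neg_pi_lt_arg _).le, Complex.arg_le_pi _⟩
  have hzK : z ∈ Metric.closedBall d s :=
    Metric.mem_closedBall.mpr ((Metric.mem_ball.mp hz).le.trans hs.1.le)
  have hKZ : Metric.closedBall d s ⊆ Z :=
    (Metric.closedBall_subset_closedBall hsη.le).trans hηZ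
  have hbd := hC.height_le_of_boundary (hB₀T.trans_le hB₀₁) h (μ := μ) (s₀ := d.re) (c := 1 / 2)
    (by rw [hμ]; nlinarith) (by norm_num) (K := Metric.closedBall d s)
    (isCompact_closedBall d s) hKZ
    (fun z hz ↦ by
      have h1 : |z.re - d.re| ≤ 1 / (2 * μ) := by
        rw [← Complex.sub_re]
        refine (Complex.abs_re_le_norm _).trans ?_
        rw [← dist_eq_norm]
        exact (Metric.mem_closedBall.mp hz).trans (hsη.le.trans (min_le_right _ _))
      have h2 : |μ * (z.re - d.re)| ≤ 1 / 2 := by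
        rw [abs_mul, abs_of_pos hμ0]
        calc μ * |z.re - d.re| ≤ μ * (1 / (2 * μ)) := by gcongr
          _ = 1 / 2 := by field_simp
      refine le_trans ?_ Real.one_sub_sq_div_two_le_cos
      have h3 : (μ * (z.re - d.re)) ^ 2 ≤ (1 / 2) ^ 2 := sq_le_sq' (by linarith [abs_le.mp h2])
        (abs_le.mp h2).2
      linarith)
    (fun z hz hlt ↦ by
      have h1 : dist z d < s := lt_of_le_of_ne (Metric.mem_closedBall.mp hz) fun heq ↦
        absurd hlt (not_lt.mpr (hbdry z heq))
      filter_upwards [Metric.isOpen_ball.mem_nhds (Metric.mem_ball.mpr h1)] with z' hz'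
      exact ⟨z', Metric.ball_subset_closedBall hz', rfl, rfl⟩)
    hzK
  exact (hC.le_height (hKZ hzK) (hT0.trans hr) hu).trans (mul_le_mul_of_nonneg_left hbd hC0.le)

/-- Bounds propagate from one point to compact subsets of a connected domain. -/
lemma boundedOn_of_isCompact (hI : 0 ≤ I) (hU : IsPreconnected Q.U) {c : ℂ} (hc : c ∈ Q.U)
    (hcN : ∃ N ∈ 𝓝 c, Q.BoundedOn I N) {K : Set ℂ} (hK : IsCompact K) (hKU : K ⊆ Q.U) :
    Q.BoundedOn I K := by
  have hopen : IsOpen {d | ∃ N ∈ 𝓝 d, Q.BoundedOn I N} := by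
    rw [isOpen_iff_mem_nhds]
    rintro d ⟨N, hN, hb⟩
    filter_upwards [eventually_mem_nhds_iff.mpr hN] with d' hd'
    exact ⟨N, hd', hb⟩
  have hall : Q.U ⊆ {d | ∃ N ∈ 𝓝 d, Q.BoundedOn I N} := by
    refine hU.subset_of_closure_inter_subset hopen ⟨c, hc, hcN⟩ ?_
    rintro d ⟨hd, hdU⟩
    obtain ⟨ε, hε, h⟩ := exists_boundedOn_of_near hI hdU
    obtain ⟨c', hc', hdist⟩ := Metric.mem_closure_iff.mp hd ε hε
    exact h c' (by rwa [dist_comm]) hc'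
  refine hK.induction_on (p := Q.BoundedOn I) ⟨0, by simp⟩ (fun _ _ h h' ↦ h'.mono h)
    (fun _ _ h h' ↦ h.union h') fun d hd ↦ ?_
  obtain ⟨N, hN, hb⟩ := hall (hKU hd)
  exact ⟨N, mem_nhdsWithin_of_mem_nhds hN, hb⟩

end ConeProblem
end Propagation

/-! ### Cylindrical ends of planar domains -/

section Punctures

/-- A bounded holomorphic injection of a half-cylinder covers a punctured neighbourhood of its
limit. -/
lemma image_mem_nhdsNE {f : ℂ → ℂ} (hper : ∀ z, f (z + Complex.I) = f z) {κ₀ B : ℝ}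
    (hf : DifferentiableOn ℂ f {z | z.re < κ₀}) (hb : ∀ z : ℂ, z.re < κ₀ → ‖f z‖ ≤ B)
    (hinj : ∀ z w : ℂ, z.re < κ₀ → w.re < κ₀ → f z = f w → ∃ n : ℤ, z = w + n * Complex.I)
    {ℓ : ℂ} {t : ℝ} (hlim : Tendsto (fun s : ℝ ↦ f ⟨s, t⟩) atBot (𝓝 ℓ)) (κ : ℝ) :
    f '' {z | z.re < κ} ∈ 𝓝[≠] ℓ := by
  -- Multiplication by I turns the left half-cylinder into the upper end of a cylinder with period
  -- 1. There the exponential coordinate q turns f into a bounded holomorphic function on a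
  -- punctured disc, which extends across q = 0.
  set f' : ℂ → ℂ := fun w ↦ f (Complex.I * w) with hf'
  have hre : ∀ w : ℂ, (Complex.I * w).re = -w.im := fun w ↦ by simp
  have hper' : Function.Periodic f' ((1 : ℝ) : ℂ) := fun w ↦ by
    simp only [hf', mul_add, Complex.ofReal_one, mul_one, hper]
  have hev : ∀ A : ℝ, ∀ᶠ w in comap Complex.im atTop, A < w.im := fun A ↦
    (tendsto_comap (f := Complex.im) (x := atTop)).eventually (eventually_gt_atTop A)
  have hopen : IsOpen {z : ℂ | z.re < κ₀} := isOpen_lt Complex.continuous_re continuous_const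
  have hhol : ∀ᶠ w in comap Complex.im atTop, DifferentiableAt ℂ f' w := by
    filter_upwards [hev (-κ₀)] with w hw
    have h1 : DifferentiableAt ℂ f (Complex.I * w) :=
      hf.differentiableAt (hopen.mem_nhds (by simp only [mem_ofPred_eq, hre]; linarith))
    exact DifferentiableAt.comp (f := fun w ↦ Complex.I * w) w h1
      (differentiableAt_id.const_mul _)
  have hbd : BoundedAtFilter (comap Complex.im atTop) f' := by
    refine Asymptotics.IsBigO.of_bound B ?_
    filter_upwards [hev (-κ₀)] with w hw
    simpa using hb (Complex.I * w) (by rw [hre]; linarith)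
  set G := Function.Periodic.cuspFunction 1 f' with hG
  have hd0 : DifferentiableAt ℂ G 0 :=
    hper'.differentiableAt_cuspFunction_zero one_pos hhol hbd
  have hlim0 : Tendsto f' (comap Complex.im atTop) (𝓝 (G 0)) :=
    hper'.tendsto_at_I_inf one_pos hhol hbd
  have hℓ : G 0 = ℓ := by
    refine tendsto_nhds_unique (f := fun s : ℝ ↦ f' ⟨t, -s⟩) (l := atBot) (hlim0.comp ?_) ?_
    · exact tendsto_comap_iff.mpr tendsto_neg_atBot_atTop
    · convert hlim using 2 with s
      simp only [hf']
      congr 1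
      apply Complex.ext <;> simp
  have han : AnalyticAt ℂ G 0 := by
    rw [Complex.analyticAt_iff_eventually_differentiableAt]
    have h1 := hper'.eventually_differentiableAt_cuspFunction_nhds_ne_zero one_pos hhol
    rw [eventually_nhdsWithin_iff] at h1
    filter_upwards [h1] with q hq
    rcases eq_or_ne q 0 with rfl | hq0
    · exact hd0
    · exact hq hq0
  -- The extension is open at 0 unless it is constant nearby. Constancy would identify two points of
  -- the cylinder half a period apart, contrary to injectivity.
  rcases han.eventually_constant_or_nhds_le_map_nhds with hconst | hle
  · exfalso
    have h1 := ((Function.Periodic.qParam_tendsto (h := 1) one_pos).mono_right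
      nhdsWithin_le_nhds).eventually hconst
    simp only [hG, Function.Periodic.eq_cuspFunction one_ne_zero hper'] at h1
    obtain ⟨s, hs, hsub⟩ := mem_comap.mp h1
    obtain ⟨A, hA⟩ := mem_atTop_sets.mp hs
    have h2 : ∀ x : ℝ, f' ⟨x, max A (1 - κ₀)⟩ = G 0 := fun x ↦
      hsub (hA _ (le_max_left A (1 - κ₀)))
    have h3 : ∀ x : ℝ, (Complex.I * (⟨x, max A (1 - κ₀)⟩ : ℂ)).re < κ₀ := fun x ↦ by
      rw [hre]
      have := le_max_right A (1 - κ₀)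
      show -max A (1 - κ₀) < κ₀
      linarith
    obtain ⟨n, hn⟩ := hinj _ _ (h3 0) (h3 (1 / 2)) ((h2 0).trans (h2 (1 / 2)).symm)
    have h4 := congrArg Complex.im hn
    simp only [Complex.mul_im, Complex.I_re, Complex.I_im, Complex.add_im, zero_mul, one_mul,
      zero_add, Complex.intCast_re, Complex.intCast_im, mul_one, mul_zero] at h4
    have h5 : (2 * n + 1 : ℤ) = 0 := by
      have : ((2 * n + 1 : ℤ) : ℝ) = 0 := by push_cast; linarith
      exact_mod_cast this
    omega
  · have h1 := (Function.Periodic.invQParam_tendsto (h := 1) one_pos).eventually (hev (-κ))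
    rw [eventually_nhdsWithin_iff] at h1
    have h2 : G '' {q | q ∈ ({0}ᶜ : Set ℂ) → -κ < (Function.Periodic.invQParam 1 q).im} ∈ 𝓝 (G 0) :=
      hle (image_mem_map h1)
    rw [← hℓ]
    filter_upwards [nhdsWithin_le_nhds h2, self_mem_nhdsWithin] with p hp hp0
    obtain ⟨q, hq, rfl⟩ := hp
    have hq0 : q ≠ 0 := fun h ↦ hp0 (by rw [h]; rfl)
    refine ⟨Complex.I * Function.Periodic.invQParam 1 q, ?_, ?_⟩
    · simp only [mem_ofPred_eq, hre]
      linarith [hq hq0]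
    · exact (Function.Periodic.cuspFunction_eq_of_nonzero 1 f' hq0).symm

/-- A holomorphic embedding of a half-cylinder covers a neighbourhood of its end. -/
lemma image_mem_of_tendsto {g : ℂ → ℂ} (hper : ∀ z, g (z + Complex.I) = g z)
    (hg : DifferentiableOn ℂ g {z | z.re ≤ 0})
    (hinj : ∀ z w : ℂ, z.re ≤ 0 → w.re ≤ 0 → g z = g w → ∃ n : ℤ, z = w + n * Complex.I)
    {l : Filter ℂ} {ℓ : ℂ} (hl : Tendsto (fun p ↦ (p - g (-1 / 2))⁻¹) l (𝓝[≠] ℓ)) {t : ℝ}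
    (hlim : Tendsto (fun s : ℝ ↦ (g ⟨s, t⟩ - g (-1 / 2))⁻¹) atBot (𝓝 ℓ)) (κ : ℝ) :
    g '' {z | z.re < κ} ∈ l := by
  -- The inversion p ↦ (p - c)⁻¹ treats finite punctures and infinity alike. It is bounded on Re z <
  -- -1, because the open image of the band -1 < Re z < 0 already covers a ball about c and g is
  -- injective modulo the period.
  set c := g (-1 / 2) with hc
  have hopen : IsOpen {z : ℂ | z.re < 0} := isOpen_lt Complex.continuous_re continuous_const
  have hsub : {z : ℂ | z.re < 0} ⊆ {z | z.re ≤ 0} := fun z (hz : z.re < 0) ↦ hz.le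
  have hmem : (-1 / 2 : ℂ) ∈ {z : ℂ | z.re < 0} := by
    show (-1 / 2 : ℂ).re < 0
    norm_num
  have hre : (-1 / 2 : ℂ).re = -1 / 2 := by norm_num
  have han : AnalyticAt ℂ g (-1 / 2) :=
    (hg.mono hsub).analyticAt (hopen.mem_nhds hmem)
  obtain ⟨ε, hε, hfar⟩ : ∃ ε > 0, ∀ z : ℂ, z.re < -1 → ε ≤ ‖g z - c‖ := by
    rcases han.eventually_constant_or_nhds_le_map_nhds with hconst | hle
    · exfalso
      obtain ⟨η, hη, hball⟩ := Metric.eventually_nhds_iff.mp hconst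
      have h1 : g (-1 / 2 + ((-(η / 2) : ℝ) : ℂ)) = g (-1 / 2) := hball (by
        rw [dist_eq_norm, add_sub_cancel_left, Complex.norm_real, norm_neg,
          Real.norm_of_nonneg (by positivity)]
        linarith)
      obtain ⟨n, hn⟩ := hinj _ _ (by rw [Complex.add_re, hre, Complex.ofReal_re]; linarith)
        (hsub hmem) h1
      have h2 := congrArg Complex.re hn
      rw [Complex.add_re, Complex.add_re, Complex.ofReal_re] at h2
      simp at h2
      linarith
    · have h1 : {z : ℂ | -1 < z.re ∧ z.re < 0} ∈ 𝓝 (-1 / 2 : ℂ) :=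
        Complex.continuous_re.continuousAt.preimage_mem_nhds
          (Ioo_mem_nhds (by rw [hre]; norm_num) (by rw [hre]; norm_num))
      obtain ⟨ε, hε, hball⟩ := Metric.mem_nhds_iff.mp (hle (image_mem_map h1))
      refine ⟨ε, hε, fun z hz ↦ ?_⟩
      by_contra hlt
      obtain ⟨w, hw, hwz⟩ := hball (show g z ∈ Metric.ball (g (-1 / 2)) ε by
        rw [Metric.mem_ball, dist_eq_norm]
        exact not_le.mp hlt)
      obtain ⟨n, hn⟩ := hinj w z hw.2.le (by linarith) hwz
      have h2 := congrArg Complex.re hn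
      simp at h2
      linarith [hw.1]
  have hne : ∀ z : ℂ, z.re < -1 → g z - c ≠ 0 := fun z hz h ↦ by
    have := hfar z hz
    rw [h, norm_zero] at this
    linarith
  have key := image_mem_nhdsNE (f := fun z ↦ (g z - c)⁻¹) (κ₀ := -1) (B := ε⁻¹)
    (fun z ↦ by rw [hper]) (fun z hz ↦ ?_) (fun z hz ↦ ?_) (fun z w hz hw h ↦ ?_) hlim κ
  · filter_upwards [hl key] with p hp
    obtain ⟨z, hz, hzp⟩ := hp
    exact ⟨z, hz, sub_left_injective (inv_injective hzp)⟩
  · have hz' : z.re < 0 := by linarith [show z.re < -1 from hz]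
    exact ((((hg.mono hsub).differentiableAt (hopen.mem_nhds hz')).sub_const c).inv
      (hne z hz)).differentiableWithinAt
  · rw [norm_inv]
    exact inv_anti₀ hε (hfar z hz)
  · exact hinj z w (by linarith) (by linarith) (sub_left_injective (inv_injective h))

lemma tendsto_inv_sub_nhdsNE {a c : ℂ} (h : a ≠ c) :
    Tendsto (fun p ↦ (p - c)⁻¹) (𝓝[≠] a) (𝓝[≠] (a - c)⁻¹) := by
  refine tendsto_nhdsWithin_of_tendsto_nhds_of_eventually_within _ ?_ ?_
  · exact (((continuous_id.sub continuous_const).tendsto a).inv₀ (sub_ne_zero.mpr h)).mono_left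
      nhdsWithin_le_nhds
  · filter_upwards [self_mem_nhdsWithin] with p hp h'
    exact hp (sub_left_injective (inv_injective h'))

lemma tendsto_sub_cocompact (c : ℂ) : Tendsto (fun p ↦ p - c) (cocompact ℂ) (cocompact ℂ) :=
  (Homeomorph.subRight c).isClosedEmbedding.tendsto_cocompact

lemma tendsto_inv_cocompact : Tendsto (fun p : ℂ ↦ p⁻¹) (cocompact ℂ) (𝓝 0) := by
  rw [← Metric.cobounded_eq_cocompact]
  exact tendsto_inv₀_cobounded

lemma tendsto_inv_sub_cocompact (c : ℂ) :
    Tendsto (fun p ↦ (p - c)⁻¹) (cocompact ℂ) (𝓝[≠] 0) := by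
  refine tendsto_nhdsWithin_of_tendsto_nhds_of_eventually_within _
    (tendsto_inv_cocompact.comp (tendsto_sub_cocompact c)) ?_
  filter_upwards [(isCompact_singleton (x := c)).compl_mem_cocompact] with p hp h'
  exact hp (sub_eq_zero.mp (inv_eq_zero.mp h'))

namespace PantsWithSlit

variable (G : PantsWithSlit)

lemma tendsto_shift_atBot (c : ℝ) : Tendsto (fun s : ℝ ↦ s - c) atBot atBot :=
  tendsto_atBot_add_const_right _ (-c) tendsto_id

lemma image_ιa₁_mem (κ : ℝ) : G.ιa₁ '' {z | z.re < κ} ∈ 𝓝[≠] G.a₁ := by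
  have hc : G.a₁ ≠ G.ιa₁ (-1 / 2) := fun h ↦
    G.maps_ιa₁ (-1 / 2) (by norm_num) (by rw [← h]; exact mem_insert _ _)
  refine image_mem_of_tendsto G.periodic_ιa₁ G.holo_ιa₁ G.inj_ιa₁ (tendsto_inv_sub_nhdsNE hc)
    (t := 1 / 2) (Tendsto.inv₀ (Tendsto.sub_const ?_ _) (sub_ne_zero.mpr hc)) κ
  refine ((G.lim_ψ₁_bot (1 / 2) (by norm_num)).comp (tendsto_shift_atBot G.sa)).congr' ?_
  filter_upwards [eventually_le_atBot 0] with s hs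
  exact (G.ιa₁_eq s (1 / 2) hs (by norm_num)).symm

lemma image_ιa₂_mem (κ : ℝ) : G.ιa₂ '' {z | z.re < κ} ∈ 𝓝[≠] G.a₂ := by
  have hc : G.a₂ ≠ G.ιa₂ (-1 / 2) := fun h ↦
    G.maps_ιa₂ (-1 / 2) (by norm_num) (by rw [← h]; exact mem_insert_of_mem _ rfl)
  refine image_mem_of_tendsto G.periodic_ιa₂ G.holo_ιa₂ G.inj_ιa₂ (tendsto_inv_sub_nhdsNE hc)
    (t := 1 / 2) (Tendsto.inv₀ (Tendsto.sub_const ?_ _) (sub_ne_zero.mpr hc)) κ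
  refine ((G.lim_ψ₂_bot (1 / 2) (by norm_num)).comp (tendsto_shift_atBot G.sa)).congr' ?_
  filter_upwards [eventually_le_atBot 0] with s hs
  exact (G.ιa₂_eq s (1 / 2) hs (by norm_num)).symm

lemma image_ιb_mem (κ : ℝ) : G.ιb '' {z | κ < z.re} ∈ cocompact ℂ := by
  have hper : ∀ z, G.ιb (-(z + Complex.I)) = G.ιb (-z) := fun z ↦ by
    rw [← G.periodic_ιb (-(z + Complex.I))]
    congr 1
    ring
  have key := image_mem_of_tendsto (g := fun z ↦ G.ιb (-z)) hper
    (DifferentiableOn.comp (f := fun z : ℂ ↦ -z) G.holo_ιb differentiable_neg.differentiableOn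
      fun z (hz : z.re ≤ 0) ↦ by simpa using hz)
    (fun z w hz hw h ↦ by
      obtain ⟨n, hn⟩ := G.inj_ιb (-z) (-w) (by simpa using hz) (by simpa using hw) h
      refine ⟨-n, ?_⟩
      push_cast
      linear_combination -hn)
    -- Along Im z = -1/4 the point -z lies on the line of height 1/4 of the end at b, which is the
    -- middle line of the first strip.
    (tendsto_inv_sub_cocompact _) (t := -1 / 4)
    ((tendsto_inv_cocompact.comp (tendsto_sub_cocompact _)).comp ?_) (-κ)
  · filter_upwards [key] with p hp
    obtain ⟨z, hz, rfl⟩ := hp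
    refine ⟨-z, ?_, rfl⟩
    have hz' : z.re < -κ := hz
    show κ < (-z).re
    rw [Complex.neg_re]
    linarith
  · have h1 : Tendsto (fun s : ℝ ↦ -2 * s + G.sb) atBot atTop :=
      tendsto_atTop_add_const_right _ _ (tendsto_id.const_mul_atBot_of_neg (by norm_num))
    refine ((G.lim_ψ₁_top (1 / 2) (by norm_num)).comp h1).congr' ?_
    filter_upwards [eventually_le_atBot 0] with s hs
    refine (G.ιb_eq₁ (-2 * s) (1 / 2) (by linarith) (by norm_num)).symm.trans (congrArg G.ιb ?_)
    apply Complex.ext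
    · simp
      ring
    · simp
      norm_num

lemma isOpen_P : IsOpen G.P := (Set.toFinite {G.a₁, G.a₂}).isClosed.isOpen_compl

lemma isPreconnected_P : IsPreconnected G.P :=
  ((Set.toFinite {G.a₁, G.a₂}).countable.isConnected_compl_of_one_lt_rank (by
    rw [Complex.rank_real_complex]; norm_num)).isPreconnected

/-- The complement of the ends is contained in a compact subset. -/
lemma exists_compact_core (κ : ℝ) : ∃ K : Set ℂ, IsCompact K ∧ K ⊆ G.P ∧ ∀ p ∈ G.P,
    p ∈ K ∨ (∃ z : ℂ, z.re < -κ ∧ G.ιa₁ z = p) ∨ (∃ z : ℂ, z.re < -κ ∧ G.ιa₂ z = p) ∨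
      ∃ z : ℂ, κ < z.re ∧ G.ιb z = p := by
  obtain ⟨V₁, hV₁, ho₁, hm₁⟩ := mem_nhds_iff.mp (mem_nhdsWithin_iff_eventually.mp
    (G.image_ιa₁_mem (-κ)))
  obtain ⟨V₂, hV₂, ho₂, hm₂⟩ := mem_nhds_iff.mp (mem_nhdsWithin_iff_eventually.mp
    (G.image_ιa₂_mem (-κ)))
  obtain ⟨B, hB, hBs⟩ := mem_cocompact.mp (G.image_ιb_mem κ)
  refine ⟨B \ (V₁ ∪ V₂), hB.diff (ho₁.union ho₂), ?_, ?_⟩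
  · rintro p ⟨-, hp⟩ hp'
    rcases hp' with rfl | rfl
    · exact hp (Or.inl hm₁)
    · exact hp (Or.inr hm₂)
  · intro p hp
    by_cases hpB : p ∈ B
    · by_cases hp1 : p ∈ V₁
      · obtain ⟨z, hz, hzp⟩ := hV₁ hp1 (fun h ↦ hp (by rw [h]; exact mem_insert _ _))
        exact Or.inr (Or.inl ⟨z, hz, hzp⟩)
      · by_cases hp2 : p ∈ V₂
        · obtain ⟨z, hz, hzp⟩ := hV₂ hp2 (fun h ↦ hp (by rw [h]; exact mem_insert_of_mem _ rfl))
          exact Or.inr (Or.inr (Or.inl ⟨z, hz, hzp⟩))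
        · exact Or.inl ⟨hpB, fun h ↦ h.elim hp1 hp2⟩
    · obtain ⟨z, hz, hzp⟩ := hBs hpB
      exact Or.inr (Or.inr (Or.inr ⟨z, hz, hzp⟩))

end PantsWithSlit
end Punctures

/-! ### Holomorphic changes of the domain -/

section Pullback

variable {E : Type*} [NormedAddCommGroup E] [NormedSpace ℝ E]
  {X : Type*} [TopologicalSpace X] [ChartedSpace E X] [IsManifold 𝓘(ℝ, E) ∞ X]
  {F : Type*} [NormedAddCommGroup F] [NormedSpace ℝ F]
  {M : Type*} [TopologicalSpace M] [ChartedSpace F M] [IsManifold 𝓘(ℝ, F) ∞ M]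

lemma dForm_add_left (η : OneForm E X) (x : X) (v v' w : TangentSpace 𝓘(ℝ, E) x) :
    dForm η x (v + v') w = dForm η x v w + dForm η x v' w := by
  have key : ∀ (D : E →L[ℝ] E →L[ℝ] ℝ) (a b c : E),
      D (a + b) c - D c (a + b) = D a c - D c a + (D b c - D c b) := fun D a b c ↦ by
    simp only [map_add, add_apply]
    ring
  simp only [dForm, map_add]
  exact key _ _ _ _

lemma dForm_smul_left (η : OneForm E X) (x : X) (a : ℝ) (v w : TangentSpace 𝓘(ℝ, E) x) :
    dForm η x (a • v) w = a * dForm η x v w := by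
  have key : ∀ (D : E →L[ℝ] E →L[ℝ] ℝ) (b c : E),
      D (a • b) c - D c (a • b) = a * (D b c - D c b) := fun D b c ↦ by
    simp only [map_smul, smul_apply, smul_eq_mul]
    ring
  simp only [dForm, map_smul]
  exact key _ _ _

lemma dForm_swap (η : OneForm E X) (x : X) (v w : TangentSpace 𝓘(ℝ, E) x) :
    dForm η x v w = -dForm η x w v := by
  simp only [dForm]
  ring

lemma sympForm_comb_left (α : OneForm F M) (y : M) (r a b : ℝ)
    (V V' W : TangentSpace 𝓘(ℝ, F) y × ℝ) :
    sympForm α y r (a • V + b • V') W = a * sympForm α y r V W + b * sympForm α y r V' W := by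
  simp only [sympForm, Prod.fst_add, Prod.snd_add, Prod.smul_fst, Prod.smul_snd, dForm_add_left,
    dForm_smul_left, map_add, map_smul, smul_eq_mul]
  ring

lemma sympForm_swap (α : OneForm F M) (y : M) (r : ℝ) (V W : TangentSpace 𝓘(ℝ, F) y × ℝ) :
    sympForm α y r V W = -sympForm α y r W V := by
  rw [sympForm, sympForm, dForm_swap]
  ring

lemma sympForm_rotate (α : OneForm F M) (y : M) (r a b : ℝ) (V W : TangentSpace 𝓘(ℝ, F) y × ℝ) :
    sympForm α y r (a • V + b • W) ((-b) • V + a • W) = (a ^ 2 + b ^ 2) * sympForm α y r V W := by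
  have h : ∀ V : TangentSpace 𝓘(ℝ, F) y × ℝ, sympForm α y r V V = 0 := fun V ↦ by
    linarith [sympForm_swap α y r V V]
  rw [sympForm_comb_left, sympForm_swap α y r V, sympForm_swap α y r W, sympForm_comb_left,
    sympForm_comb_left, h, h, sympForm_swap α y r W V]
  ring

lemma IsLiftedHamVec.comb {α : OneForm F M} {f g : M → ℝ} {y : M} {r : ℝ}
    {V W : TangentSpace 𝓘(ℝ, F) y × ℝ} (hf : MDifferentiableAt 𝓘(ℝ, F) 𝓘(ℝ, ℝ) f y)
    (hg : MDifferentiableAt 𝓘(ℝ, F) 𝓘(ℝ, ℝ) g y) (hV : IsLiftedHamVec α f y r V)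
    (hW : IsLiftedHamVec α g y r W) (a b : ℝ) :
    IsLiftedHamVec α (fun y ↦ a * f y + b * g y) y r (a • V + b • W) := by
  intro Y
  have h1 : dFun (fun y ↦ a * f y + b * g y) y Y.1 = a * dFun f y Y.1 + b * dFun g y Y.1 := by
    have h2 := ((hf.hasMFDerivAt.const_smul a).add (hg.hasMFDerivAt.const_smul b)).mfderiv
    exact congrArg (fun l ↦ l Y.1) h2
  rw [sympForm_comb_left, hV, hW, h1]
  ring

namespace ConeProblem

variable {L : LiouvilleCompletion E X F M}

/-- With φ' = a + b i, the pairs (A₁, A₂) and (X₁, X₂) transform by the matrix with rows (a, b) and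
(-b, a), which commutes with A₂ = J A₁. The form g₁ ds + g₂ dt is pulled back, and the density
scales by |φ'|², the Jacobian. -/
lemma IsSol.comp {Q Q' : ConeProblem L} {u : ℂ → X} {e : ℂ → ℝ} (h : Q.IsSol u e) {φ : ℂ → ℂ}
    (hφ : DifferentiableOn ℂ φ Q'.U) (hmaps : MapsTo φ Q'.U Q.U) (hT : Q'.T = Q.T)
    (hJ : ∀ z ∈ Q'.U, Q'.J z = Q.J (φ z))
    (h₁ : ∀ z ∈ Q'.U, ∀ y, Q'.g₁ y z
      = (deriv φ z).re * Q.g₁ y (φ z) + (deriv φ z).im * Q.g₂ y (φ z))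
    (h₂ : ∀ z ∈ Q'.U, ∀ y, Q'.g₂ y z
      = -(deriv φ z).im * Q.g₁ y (φ z) + (deriv φ z).re * Q.g₂ y (φ z)) :
    Q'.IsSol (u ∘ φ) (fun z ↦ Complex.normSq (deriv φ z) * e (φ z)) := by
  have hφs : ContDiffOn ℝ ∞ φ Q'.U :=
    ((hφ.analyticOn Q'.isOpen).contDiffOn Q'.isOpen.uniqueDiffOn).restrict_scalars ℝ
  refine ⟨h.smooth.comp hφs.contMDiffOn hmaps, fun z hz y r hr hu ↦ ?_⟩
  have hφz := hmaps hz
  obtain ⟨A₁, A₂, X₁, X₂, hX₁, hX₂, hd1, hdI, hA, he⟩ := h.eqn (φ z) hφz y r (hT ▸ hr) hu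
  set a := (deriv φ z).re with ha
  set b := (deriv φ z).im with hb
  have hd : DifferentiableAt ℂ φ z := hφ.differentiableAt (Q'.isOpen.mem_nhds hz)
  have hud : MDifferentiableAt 𝓘(ℝ, ℂ) 𝓘(ℝ, E) u (φ z) :=
    (h.smooth.contMDiffAt (Q.isOpen.mem_nhds hφz)).mdifferentiableAt (by simp)
  have hcomp : ∀ v : ℂ, (mfderiv 𝓘(ℝ, ℂ) 𝓘(ℝ, E) (u ∘ φ) z v : E)
      = mfderiv 𝓘(ℝ, ℂ) 𝓘(ℝ, E) u (φ z) (deriv φ z * v : ℂ) := by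
    intro v
    have a1 := (hd.hasDerivAt.hasFDerivAt.restrictScalars ℝ).hasMFDerivAt
    have a3 := (HasMFDerivAt.comp z hud.hasMFDerivAt a1).mfderiv
    refine (congrArg (fun l ↦ l v) a3).trans ?_
    show (mfderiv 𝓘(ℝ, ℂ) 𝓘(ℝ, E) u (φ z) (v * deriv φ z : ℂ) : E) = _
    rw [mul_comm]
  have hlin : ∀ s t : ℝ, (mfderiv 𝓘(ℝ, ℂ) 𝓘(ℝ, E) u (φ z) (s • (1 : ℂ) + t • Complex.I : ℂ) : E)
      = L.dCone y r ((s • X₁ + t • X₂) + (s • A₁ + t • A₂)) := by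
    intro s t
    have a1 : (mfderiv 𝓘(ℝ, ℂ) 𝓘(ℝ, E) u (φ z) (s • (1 : ℂ) + t • Complex.I : ℂ) : E)
        = s • (mfderiv 𝓘(ℝ, ℂ) 𝓘(ℝ, E) u (φ z) (1 : ℂ) : E)
          + t • (mfderiv 𝓘(ℝ, ℂ) 𝓘(ℝ, E) u (φ z) Complex.I : E) := by
      refine (map_add (mfderiv 𝓘(ℝ, ℂ) 𝓘(ℝ, E) u (φ z)) _ _).trans ?_
      exact congrArg₂ (· + ·) (map_smul (mfderiv 𝓘(ℝ, ℂ) 𝓘(ℝ, E) u (φ z)) _ _)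
        (map_smul (mfderiv 𝓘(ℝ, ℂ) 𝓘(ℝ, E) u (φ z)) _ _)
    rw [a1, hd1, hdI]
    have a2 : (s • X₁ + t • X₂) + (s • A₁ + t • A₂) = s • (X₁ + A₁) + t • (X₂ + A₂) := by
      simp only [smul_add]
      abel
    rw [a2]
    have a3 := map_add (mfderiv (𝓘(ℝ, F).prod 𝓘(ℝ, ℝ)) 𝓘(ℝ, E) L.cone (y, r))
      (s • (X₁ + A₁)) (t • (X₂ + A₂))
    refine Eq.trans ?_ a3.symm
    exact congrArg₂ (· + ·) (map_smul (mfderiv (𝓘(ℝ, F).prod 𝓘(ℝ, ℝ)) 𝓘(ℝ, E) L.cone (y, r)) s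
      (X₁ + A₁)).symm (map_smul (mfderiv (𝓘(ℝ, F).prod 𝓘(ℝ, ℝ)) 𝓘(ℝ, E) L.cone (y, r)) t
      (X₂ + A₂)).symm
  have hcone : ∀ (s t : ℝ) (V W : TangentSpace 𝓘(ℝ, F) y × ℝ),
      L.dCone y r (s • V + t • W) = s • L.dCone y r V + t • L.dCone y r W := by
    intro s t V W
    refine (map_add (mfderiv (𝓘(ℝ, F).prod 𝓘(ℝ, ℝ)) 𝓘(ℝ, E) L.cone (y, r)) _ _).trans ?_
    exact congrArg₂ (· + ·) (map_smul (mfderiv (𝓘(ℝ, F).prod 𝓘(ℝ, ℝ)) 𝓘(ℝ, E) L.cone (y, r)) s V)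
      (map_smul (mfderiv (𝓘(ℝ, F).prod 𝓘(ℝ, ℝ)) 𝓘(ℝ, E) L.cone (y, r)) t W)
  have hs₁ := mdifferentiableAt_slice Q.isOpen Q.smooth_g₁ hφz y
  have hs₂ := mdifferentiableAt_slice Q.isOpen Q.smooth_g₂ hφz y
  refine ⟨a • A₁ + b • A₂, (-b) • A₁ + a • A₂, a • X₁ + b • X₂, (-b) • X₁ + a • X₂,
    ?_, ?_, ?_, ?_, ?_, ?_⟩
  · rw [funext (h₁ z hz)]
    exact hX₁.comb hs₁ hs₂ hX₂ a b
  · rw [funext (h₂ z hz)]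
    exact hX₁.comb hs₁ hs₂ hX₂ (-b) a
  · rw [hcomp, ← hlin]
    congr 1
    apply Complex.ext <;> simp [ha, hb]
  · rw [hcomp, ← hlin]
    congr 1
    apply Complex.ext <;> simp [ha, hb]
  · have hsq := (Q.compatible _ hφz).sq (L.cone (y, r)) (L.dCone y r A₁)
    rw [← hA] at hsq
    rw [hJ z hz, hcone, hcone, map_add, map_smul, map_smul, hsq, ← hA, smul_neg, neg_smul, add_comm]
  · rw [sympForm_rotate, he, Complex.normSq_apply]
    ring

end ConeProblem

lemma det_restrictScalars_smulRight (c : ℂ) :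
    (((ContinuousLinearMap.smulRight (1 : ℂ →L[ℂ] ℂ) c).restrictScalars ℝ) : ℂ →L[ℝ] ℂ).det
      = Complex.normSq c := by
  rw [← Algebra.norm_complex_apply, Algebra.norm_apply, ContinuousLinearMap.det]
  congr 1
  ext
  all_goals simp [mul_comm]

/-- The energy is invariant under holomorphic changes of the domain. -/
lemma lintegral_normSq_deriv_mul_le {φ : ℂ → ℂ} {S U : Set ℂ} (hS : MeasurableSet S)
    (hφ : ∀ z ∈ S, DifferentiableAt ℂ φ z) (hinj : InjOn φ S) (hmaps : MapsTo φ S U) (e : ℂ → ℝ) :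
    ∫⁻ z in S, ENNReal.ofReal (Complex.normSq (deriv φ z) * e (φ z))
      ≤ ∫⁻ z in U, ENNReal.ofReal (e z) := by
  have h := lintegral_image_eq_lintegral_abs_det_fderiv_mul volume hS
    (fun z hz ↦ ((hφ z hz).hasDerivAt.hasFDerivAt.restrictScalars ℝ).hasFDerivWithinAt) hinj
    (fun z ↦ ENNReal.ofReal (e z))
  refine le_trans (le_of_eq ?_) (h.symm.le.trans (lintegral_mono_set hmaps.image_subset))
  refine lintegral_congr fun z ↦ ?_
  rw [ENNReal.ofReal_mul (Complex.normSq_nonneg _)]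
  congr 2
  refine Eq.trans ?_ (congrArg abs (det_restrictScalars_smulRight (deriv φ z))).symm
  exact (abs_of_nonneg (Complex.normSq_nonneg _)).symm

end Pullback

/-! ### Solutions on the pair-of-pants as solutions of a cone problem -/

section Solutions

variable {E : Type*} [NormedAddCommGroup E] [NormedSpace ℝ E] [FiniteDimensional ℝ E]
  {X : Type*} [TopologicalSpace X] [ChartedSpace E X] [IsManifold 𝓘(ℝ, E) ∞ X]
  {F : Type*} [NormedAddCommGroup F] [NormedSpace ℝ F]
  {M : Type*} [TopologicalSpace M] [ChartedSpace F M] [IsManifold 𝓘(ℝ, F) ∞ M]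

namespace LiouvilleCompletion

variable (L : LiouvilleCompletion E X F M)

lemma omega_cone (y : M) {r : ℝ} (hr : 0 < r) (V W : TangentSpace 𝓘(ℝ, F) y × ℝ) :
    L.omega (L.cone (y, r)) (L.dCone y r V) (L.dCone y r W) = sympForm L.alpha y r V W := by
  obtain ⟨y₀, f, hf, rfl⟩ : ∃ y₀ : M, ∃ f ∈ (extChartAt 𝓘(ℝ, F) y₀).target,
      (extChartAt 𝓘(ℝ, F) y₀).symm f = y :=
    ⟨y, extChartAt 𝓘(ℝ, F) y y, mem_extChartAt_target y, extChartAt_to_inv y⟩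
  obtain ⟨σ, rfl⟩ : ∃ σ, Real.exp σ = r := ⟨Real.log r, Real.exp_log hr⟩
  have hlift := ((coordVec_bijective hf).prodMap (mulLeft_bijective₀ _ hr.ne')).2
  obtain ⟨V', rfl⟩ := hlift V
  obtain ⟨W', rfl⟩ := hlift W
  have he : (f, σ) ∈ (paramDom y₀ : Set (F × ℝ)) := ⟨hf, mem_univ _⟩
  have h1 := L.omega_param he V' W'
  rw [L.dParam_apply he, L.dParam_apply he] at h1
  exact h1.trans (sympForm_coord L.contact.smooth hf _ V' W').symm

/-- Nondegeneracy in finite dimension provides a vector with the defining property, so the choice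
made in `hamVec` satisfies it. -/
lemma omega_hamVec (f : X → ℝ) (x : X) (w : TangentSpace 𝓘(ℝ, E) x) :
    L.omega x (L.hamVec f x) w = dFun f x w := by
  have hex : ∃ v : TangentSpace 𝓘(ℝ, E) x, ∀ w, L.omega x v w = dFun f x w := by
    set d : E →L[ℝ] E := mfderiv 𝓘(ℝ, E) 𝓘(ℝ, E) (extChartAt 𝓘(ℝ, E) x) x with hd
    set D : E →L[ℝ] E →L[ℝ] ℝ := (fderiv ℝ (chartForm L.lam x) (extChartAt 𝓘(ℝ, E) x x)) with hD
    have hB : ∀ v w : E, (D.bilinearComp d d - (D.bilinearComp d d).flip) v w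
        = dForm L.lam x v w := fun v w ↦ rfl
    obtain ⟨v, hv⟩ := exists_eq_of_nondegenerate (D.bilinearComp d d - (D.bilinearComp d d).flip)
      (fun v hv ↦ by
        by_contra hne
        obtain ⟨w, hw⟩ := L.nondegenerate x v hne
        exact hw ((hB v w).symm.trans (congrArg (fun l : E →L[ℝ] ℝ ↦ l w) hv))) (mfderiv 𝓘(ℝ, E) 𝓘(ℝ, ℝ) f x : E →L[ℝ] ℝ)
    exact ⟨v, fun w ↦ (hB v w).symm.trans (congrArg (fun l ↦ l w) hv)⟩
  exact Classical.epsilon_spec hex w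

/-- The Hamiltonian vector field of a Hamiltonian which is homogeneous on the conical end. -/
lemma isLiftedHamVec_of_conical {f : X → ℝ} {g : M → ℝ} {T : ℝ} (hT : 0 < T)
    (hfg : ∀ y r, T ≤ r → f (L.cone (y, r)) = r * g y) {y : M} {r : ℝ} (hr : T < r)
    (hf : MDifferentiableAt 𝓘(ℝ, E) 𝓘(ℝ, ℝ) f (L.cone (y, r)))
    (hg : MDifferentiableAt 𝓘(ℝ, F) 𝓘(ℝ, ℝ) g y) {V : TangentSpace 𝓘(ℝ, F) y × ℝ}
    (hV : L.dCone y r V = L.hamVec f (L.cone (y, r))) : IsLiftedHamVec L.alpha g y r V := by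
  intro Y
  have hr0 : 0 < r := hT.trans hr
  have hmem : (y, r) ∈ (univ ×ˢ Ioi 0 : Set (M × ℝ)) := ⟨mem_univ _, hr0⟩
  rw [← L.omega_cone y hr0, hV, L.omega_hamVec]
  have hc := (L.smooth_cone.contMDiffAt ((isOpen_univ.prod isOpen_Ioi).mem_nhds hmem)
    ).mdifferentiableAt (by simp)
  have h1 := (HasMFDerivAt.comp (y, r) hf.hasMFDerivAt hc.hasMFDerivAt).mfderiv
  have h2 : (f ∘ L.cone) =ᶠ[𝓝 (y, r)] (Prod.snd : M × ℝ → ℝ) * (g ∘ Prod.fst) := by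
    filter_upwards [(isOpen_univ.prod isOpen_Ioi).mem_nhds
      (show (y, r) ∈ (univ : Set M) ×ˢ Ioi T from ⟨mem_univ _, hr⟩)] with p hp
    exact hfg p.1 p.2 (le_of_lt hp.2)
  have h3 := HasMFDerivAt.comp (f := (Prod.fst : M × ℝ → M)) (y, r) hg.hasMFDerivAt
    (hasMFDerivAt_fst (I := 𝓘(ℝ, F)) (I' := 𝓘(ℝ, ℝ)) (y, r))
  have h4 := ((hasMFDerivAt_snd (I := 𝓘(ℝ, F)) (I' := 𝓘(ℝ, ℝ)) (y, r)).mul h3).congr_of_eventuallyEq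
    h2
  have h5 := congrArg (fun l ↦ l Y) (h1.symm.trans h4.mfderiv)
  refine Eq.trans h5 ?_
  show r * dFun g y Y.1 + g y * Y.2 = _
  ring

end LiouvilleCompletion
end Solutions

section Problems

variable {E : Type*} [NormedAddCommGroup E] [NormedSpace ℝ E]
  {X : Type*} [TopologicalSpace X] [ChartedSpace E X] [IsManifold 𝓘(ℝ, E) ∞ X]
  {F : Type*} [NormedAddCommGroup F] [NormedSpace ℝ F]
  {M : Type*} [TopologicalSpace M] [ChartedSpace F M] [IsManifold 𝓘(ℝ, F) ∞ M]
  {L : LiouvilleCompletion E X F M}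

/-- The cone problem on a cylindrical end, in the coordinates of the end. -/
def FloerData.problem (D : FloerData L) {T : ℝ} (hT : 1 ≤ T)
    (hJ : ∀ t, L.IsTwistedSFTAtInfinity T (D.J t)) : ConeProblem L where
  U := {z | |z.re| < 1}
  isOpen := isOpen_lt Complex.continuous_re.abs continuous_const
  J z := D.J z.im
  smooth_J := by
    have h1 : ContMDiff (𝓘(ℝ, ℂ).prod 𝓘(ℝ, E)) 𝓘(ℝ, ℝ) ∞ fun z : ℂ × X ↦ z.1.im :=
      Complex.imCLM.contDiff.contMDiff.comp contMDiff_fst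
    exact D.smooth_J.comp (h1.prodMk contMDiff_snd).contMDiffOn fun _ _ ↦ ⟨mem_univ _, mem_univ _⟩
  compatible z _ := D.compatible z.im
  T := T
  one_le := hT
  twisted z _ := hJ z.im
  g₁ _ _ := 0
  g₂ y z := D.slope z.im y
  smooth_g₁ := contMDiffOn_const
  smooth_g₂ := by
    have h1 : ContMDiff (𝓘(ℝ, F).prod 𝓘(ℝ, ℂ)) 𝓘(ℝ, ℝ) ∞ fun z : M × ℂ ↦ z.2.im :=
      Complex.imCLM.contDiff.contMDiff.comp contMDiff_snd
    exact (D.smooth_slope.comp (h1.prodMk contMDiff_fst)).contMDiffOn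

namespace ProductData

variable {G : PantsWithSlit} {Da₁ Da₂ Db : FloerData L} (D : ProductData L G Da₁ Da₂ Db)

lemma smooth_h_mul_β (v : ℂ) : ContMDiffOn (𝓘(ℝ, F).prod 𝓘(ℝ, ℂ)) 𝓘(ℝ, ℝ) ∞
    (fun z : M × ℂ ↦ D.h z.1 z.2 * G.β z.2 v) (univ ×ˢ G.P) := by
  have h1 : ContMDiffOn 𝓘(ℝ, ℂ) 𝓘(ℝ, ℝ) ∞ (fun z ↦ G.β z v) G.P :=
    (G.smooth_β.clm_apply contDiffOn_const).contMDiffOn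
  have h2 : ContMDiffOn (𝓘(ℝ, F).prod 𝓘(ℝ, ℂ)) 𝓘(ℝ, ℝ) ∞ (fun z : M × ℂ ↦ G.β z.2 v)
      (univ ×ˢ G.P) := h1.comp contMDiff_snd.contMDiffOn fun z hz ↦ hz.2
  exact D.smooth_h.mul h2

/-- The cone problem on the pair-of-pants. -/
def problem {T : ℝ} (hT : 1 ≤ T) (hJ : ∀ p ∈ G.P, L.IsTwistedSFTAtInfinity T (D.J p)) :
    ConeProblem L where
  U := G.P
  isOpen := G.isOpen_P
  J := D.J
  smooth_J := D.smooth_J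
  compatible := D.compatible
  T := T
  one_le := hT
  twisted := hJ
  g₁ y p := D.h y p * G.β p 1
  g₂ y p := D.h y p * G.β p Complex.I
  smooth_g₁ := D.smooth_h_mul_β 1
  smooth_g₂ := D.smooth_h_mul_β Complex.I

/-- The energy density. -/
def density (u : ℂ → X) (p : ℂ) : ℝ :=
  L.omega (u p) (D.floerForm u p 1) (D.J p (u p) (D.floerForm u p 1))

variable {D} {u : ℂ → X}

lemma IsSolution.apply_I (hu : D.IsSolution u) {p : ℂ} (hp : p ∈ G.P) :
    D.J p (u p) (D.floerForm u p 1) = D.floerForm u p Complex.I := by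
  have h1 := hu.2 p hp 1
  rw [mul_one, smul_eq_zero_iff_right (by norm_num), add_eq_zero_iff_eq_neg] at h1
  rw [h1, map_neg, (D.compatible p hp).sq, neg_neg]

/-- The value on I is J applied to the value on 1, and J preserves ω. The two terms of the integrand
are equal, which cancels the factor 1/2. -/
lemma IsSolution.energy_eq (hu : D.IsSolution u) :
    D.energy u = ∫⁻ p in G.P, ENNReal.ofReal (D.density u p) := by
  refine setLIntegral_congr_fun G.isOpen_P.measurableSet fun p hp ↦ ?_
  have h1 : L.omega (u p) (D.floerForm u p Complex.I) (D.J p (u p) (D.floerForm u p Complex.I))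
      = D.density u p := by
    rw [← hu.apply_I hp, (D.compatible p hp).inv, density]
  simp only [h1]
  rw [← density]
  congr 1
  ring

variable [FiniteDimensional ℝ E]

/-- Above level T the Hamiltonian is r h, so its Hamiltonian vector field is the lifted one.
Multiplying it by the values of β on 1 and I gives the fields belonging to the two components of h
β. -/
lemma IsSolution.isSol (hu : D.IsSolution u) {T : ℝ} (hT : 1 ≤ T)
    (hJ : ∀ p ∈ G.P, L.IsTwistedSFTAtInfinity T (D.J p))
    (hH : ∀ y r, T ≤ r → ∀ p ∈ G.P, D.H (L.cone (y, r)) p = r * D.h y p) :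
    (D.problem hT hJ).IsSol u (D.density u) := by
  refine ⟨hu.1, fun p (hp : p ∈ G.P) y r (hr : T < r) hup ↦ ?_⟩
  have hr0 : 0 < r := by linarith
  have hsurj : ∀ V : E, ∃ Y : TangentSpace 𝓘(ℝ, F) y × ℝ, (L.dCone y r Y : E) = V :=
    (L.bijective_cone y r hr0).2
  obtain ⟨A₁, hA₁⟩ := hsurj (D.floerForm u p 1)
  obtain ⟨A₂, hA₂⟩ := hsurj (D.floerForm u p Complex.I)
  obtain ⟨V, hV⟩ := hsurj (L.hamVec (fun x ↦ D.H x p) (L.cone (y, r)))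
  have hadd : ∀ (b : ℝ) (A : TangentSpace 𝓘(ℝ, F) y × ℝ), (L.dCone y r (b • V + A) : E)
      = b • (L.dCone y r V : E) + (L.dCone y r A : E) := by
    intro b A
    refine (map_add (mfderiv (𝓘(ℝ, F).prod 𝓘(ℝ, ℝ)) 𝓘(ℝ, E) L.cone (y, r)) _ _).trans ?_
    exact congrArg₂ (· + ·)
      (map_smul (mfderiv (𝓘(ℝ, F).prod 𝓘(ℝ, ℝ)) 𝓘(ℝ, E) L.cone (y, r)) b V) rfl
  have hham : (L.hamVec (fun x ↦ D.H x p) (L.cone (y, r)) : E)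
      = L.hamVec (fun x ↦ D.H x p) (u p) := by rw [hup]
  have hder : ∀ (v : ℂ) (A : TangentSpace 𝓘(ℝ, F) y × ℝ),
      (L.dCone y r A : E) = (D.floerForm u p v : E) →
      (mfderiv 𝓘(ℝ, ℂ) 𝓘(ℝ, E) u p v : E) = L.dCone y r (G.β p v • V + A) := by
    intro v A hA
    rw [hadd, hA, hV, hham, floerForm]
    exact (add_sub_cancel _ _).symm
  have hs : MDifferentiableAt 𝓘(ℝ, F) 𝓘(ℝ, ℝ) (fun y ↦ D.h y p) y :=
    mdifferentiableAt_slice G.isOpen_P D.smooth_h hp y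
  have hX : IsLiftedHamVec L.alpha (fun y ↦ D.h y p) y r V := by
    refine L.isLiftedHamVec_of_conical (T := T) (by linarith) (fun y r hr ↦ hH y r hr p hp) hr ?_
      hs hV
    have a1 := D.smooth_H.contMDiffAt ((isOpen_univ.prod G.isOpen_P).mem_nhds
      (show (L.cone (y, r), p) ∈ (univ : Set X) ×ˢ G.P from ⟨mem_univ _, hp⟩))
    have a2 : ContMDiffAt 𝓘(ℝ, E) (𝓘(ℝ, E).prod 𝓘(ℝ, ℂ)) ∞ (fun x : X ↦ (x, p))
      (L.cone (y, r)) := contMDiffAt_id.prodMk contMDiffAt_const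
    exact (ContMDiffAt.comp (L.cone (y, r)) a1 a2).mdifferentiableAt (by simp)
  have hXv : ∀ v : ℂ, IsLiftedHamVec L.alpha (fun y ↦ D.h y p * G.β p v) y r (G.β p v • V) := by
    intro v
    have := hX.comb hs hs hX (G.β p v) 0
    simpa only [zero_mul, add_zero, zero_smul, mul_comm] using this
  have hrot : L.dCone y r A₂ = D.J p (L.cone (y, r)) (L.dCone y r A₁) := by
    have a1 := hu.apply_I hp
    have a2 : (D.J p (L.cone (y, r)) (L.dCone y r A₁) : E)
        = D.J p (u p) (D.floerForm u p 1) := by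
      rw [hup]
      exact congrArg (D.J p (L.cone (y, r))) hA₁
    exact hA₂.trans (a1.symm.trans a2.symm)
  refine ⟨A₁, A₂, _, _, hXv 1, hXv Complex.I, hder _ _ hA₁, hder _ _ hA₂, hrot, ?_⟩
  rw [← L.omega_cone y hr0, hrot, density]
  have a3 : ∀ {x x' : X} (h : x = x') (W : TangentSpace 𝓘(ℝ, E) x)
      (W' : TangentSpace 𝓘(ℝ, E) x'), (W : E) = (W' : E) →
      L.omega x W (D.J p x W) = L.omega x' W' (D.J p x' W') := by
    rintro x _ rfl W W' h
    exact congrArg (fun W : TangentSpace 𝓘(ℝ, E) x ↦ L.omega x W (D.J p x W)) h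
  exact a3 hup _ _ hA₁.symm

end ProductData
end Problems

/-! ### The Hamiltonian one-form on the cylindrical ends -/

section EndForms

variable {E : Type*} [NormedAddCommGroup E] [NormedSpace ℝ E]
  {X : Type*} [TopologicalSpace X] [ChartedSpace E X] [IsManifold 𝓘(ℝ, E) ∞ X]
  {F : Type*} [NormedAddCommGroup F] [NormedSpace ℝ F]
  {M : Type*} [TopologicalSpace M] [ChartedSpace F M] [IsManifold 𝓘(ℝ, F) ∞ M]

namespace PantsWithSlit

variable (G : PantsWithSlit)

lemma ψ₁_mem_Omega {z : ℂ} (hz : 0 < z.im ∧ z.im < 1) (hδ : ¬(G.δ ≤ z.im ∧ z.im ≤ 1 - G.δ)) :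
    G.ψ₁ z ∈ G.Omega := by
  have hsub : ∀ w : ℂ, G.δ ≤ w.im ∧ w.im ≤ 1 - G.δ → 0 < w.im ∧ w.im < 1 := fun w hw ↦
    ⟨G.δ_pos.trans_le hw.1, by linarith [hw.2, G.δ_pos]⟩
  refine ⟨⟨?_, ?_⟩, ?_⟩
  · exact (G.union_ψ.subset (Or.inl (mem_image_of_mem _ hz))).1
  · rintro ⟨w, hw, hwz⟩
    exact hδ (G.inj_ψ₁ (hsub w hw) hz hwz ▸ hw)
  · rintro ⟨w, hw, hwz⟩
    exact G.disjoint_ψ.ne_of_mem (mem_image_of_mem _ hz) (mem_image_of_mem _ (hsub w hw)) hwz.symm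

lemma ψ₂_mem_Omega {z : ℂ} (hz : 0 < z.im ∧ z.im < 1) (hδ : ¬(G.δ ≤ z.im ∧ z.im ≤ 1 - G.δ)) :
    G.ψ₂ z ∈ G.Omega := by
  have hsub : ∀ w : ℂ, G.δ ≤ w.im ∧ w.im ≤ 1 - G.δ → 0 < w.im ∧ w.im < 1 := fun w hw ↦
    ⟨G.δ_pos.trans_le hw.1, by linarith [hw.2, G.δ_pos]⟩
  refine ⟨⟨?_, ?_⟩, ?_⟩
  · exact (G.union_ψ.subset (Or.inr (mem_image_of_mem _ hz))).1
  · rintro ⟨w, hw, hwz⟩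
    exact G.disjoint_ψ.ne_of_mem (mem_image_of_mem _ (hsub w hw)) (mem_image_of_mem _ hz) hwz
  · rintro ⟨w, hw, hwz⟩
    exact hδ (G.inj_ψ₂ (hsub w hw) hz hwz ▸ hw)

end PantsWithSlit

lemma isOpen_strip : IsOpen {z : ℂ | 0 < z.im ∧ z.im < 1} :=
  (isOpen_lt continuous_const Complex.continuous_im).inter
    (isOpen_lt Complex.continuous_im continuous_const)

lemma eq_of_forall_mul_eq {a b C R : ℝ} (hR : 0 < R) (h : ∀ r, R ≤ r → r * a = r * b + C) :
    a = b := by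
  have h1 := h R le_rfl
  have h2 := h (2 * R) (by linarith)
  have h3 : R * a = R * b := by linarith
  exact mul_left_cancel₀ hR.ne' h3

namespace ProductData

variable {L : LiouvilleCompletion E X F M} {G : PantsWithSlit} {Da₁ Da₂ Db : FloerData L}
  (D : ProductData L G Da₁ Da₂ Db)

/-- At `z`, the pull-back of `h β` under `ι` is `m h dt`. -/
def FormAt (ι : ℂ → ℂ) (m : ℝ) (z : ℂ) : Prop :=
  ∀ y (v : ℂ), D.h y (ι z) * G.β (ι z) (deriv ι z * v) = m * v.im * D.h y (ι z)

variable {D}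

/-- Inside the middle of a strip β is dt. In the remaining part of the strip h vanishes, so that β
is irrelevant. -/
lemma FormAt.of_strip {ψ ι : ℂ → ℂ} (hd : DifferentiableOn ℂ ψ {z | 0 < z.im ∧ z.im < 1})
    (hpull : ∀ z : ℂ, G.δ ≤ z.im → z.im ≤ 1 - G.δ → ∀ v : ℂ, G.β (ψ z) (deriv ψ z * v) = v.im)
    (hΩ : ∀ z : ℂ, (0 < z.im ∧ z.im < 1) → ¬(G.δ ≤ z.im ∧ z.im ≤ 1 - G.δ) → ψ z ∈ G.Omega)
    {m : ℝ} {c z : ℂ} (hι : ι =ᶠ[𝓝 z] fun w ↦ ψ (m * w + c))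
    (hz : 0 < (m * z + c).im ∧ (m * z + c).im < 1) : D.FormAt ι m z := by
  intro y v
  rw [hι.self_of_nhds]
  by_cases hδ : G.δ ≤ (m * z + c).im ∧ (m * z + c).im ≤ 1 - G.δ
  · have h1 : HasDerivAt (fun w : ℂ ↦ m * w + c) m z := by
      simpa using ((hasDerivAt_id z).const_mul (m : ℂ)).add_const c
    have h2 : HasDerivAt ψ (deriv ψ (m * z + c)) (m * z + c) :=
      (hd.differentiableAt (isOpen_strip.mem_nhds hz)).hasDerivAt
    have h3 := (HasDerivAt.comp z h2 h1).congr_of_eventuallyEq hι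
    rw [h3.deriv, mul_assoc, hpull _ hδ.1 hδ.2, Complex.im_ofReal_mul]
    ring
  · rw [D.h_slit _ (hΩ _ hz hδ)]
    ring

/-- The lines joining the strips are not covered by ψ₁ and ψ₂. There h vanishes by continuity, as a
limit of its values on Ω. -/
lemma FormAt.of_limit {ι : ℂ → ℂ} {m : ℝ} {z : ℂ} (hι : ContinuousAt ι z) (hz : ι z ∈ G.P) {ε : ℝ}
    (hε : 0 < ε) (h : ∀ τ ∈ Ioo 0 ε, ι ⟨z.re, z.im + τ⟩ ∈ G.Omega) : D.FormAt ι m z := by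
  have h0 : ∀ y, D.h y (ι z) = 0 := by
    intro y
    have a1 : ContinuousAt (fun p ↦ D.h y p) (ι z) := by
      have b1 := (D.smooth_h.continuousOn).continuousAt
        ((isOpen_univ.prod G.isOpen_P).mem_nhds
          (show (y, ι z) ∈ (univ : Set M) ×ˢ G.P from ⟨mem_univ _, hz⟩))
      exact ContinuousAt.comp (f := fun p ↦ (y, p)) b1 (by fun_prop)
    have a2 : ContinuousAt (fun τ : ℝ ↦ (⟨z.re, z.im + τ⟩ : ℂ)) 0 := by
      have : (fun τ : ℝ ↦ (⟨z.re, z.im + τ⟩ : ℂ)) = fun τ : ℝ ↦ z + τ * Complex.I := by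
        funext τ
        apply Complex.ext <;> simp
      rw [this]
      fun_prop
    have hz0 : (⟨z.re, z.im + 0⟩ : ℂ) = z := by simp
    have a3 : ContinuousAt (fun τ : ℝ ↦ D.h y (ι ⟨z.re, z.im + τ⟩)) 0 :=
      ContinuousAt.comp (f := fun τ : ℝ ↦ ι ⟨z.re, z.im + τ⟩) (g := fun p ↦ D.h y p)
        (by rwa [hz0]) (ContinuousAt.comp (f := fun τ : ℝ ↦ (⟨z.re, z.im + τ⟩ : ℂ))
          (by rwa [hz0]) a2)
    have a4 : Tendsto (fun τ : ℝ ↦ D.h y (ι ⟨z.re, z.im + τ⟩)) (𝓝[>] 0) (𝓝 (D.h y (ι z))) := by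
      have := a3.tendsto.mono_left (nhdsWithin_le_nhds (s := Ioi 0))
      rwa [hz0] at this
    refine tendsto_nhds_unique a4 (tendsto_const_nhds.congr' ?_)
    filter_upwards [Ioo_mem_nhdsGT hε] with τ hτ
    exact (D.h_slit _ (h τ hτ) y).symm
  intro y v
  rw [h0]
  ring

lemma FormAt.of_fract {ι : ℂ → ℂ} (hper : ∀ z, ι (z + Complex.I) = ι z) {m : ℝ} {z : ℂ}
    (h : D.FormAt ι m ⟨z.re, Int.fract z.im⟩) : D.FormAt ι m z := by
  have h1 : ι ⟨z.re, Int.fract z.im⟩ = ι z :=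
    (ConeProblem.periodic_vline hper z.re).map_fract_one z.im
  have hper' : ∀ z, deriv ι (z + Complex.I) = deriv ι z := fun z ↦ by
    rw [← deriv_comp_add_const]
    simp only [hper]
  have h2 : deriv ι ⟨z.re, Int.fract z.im⟩ = deriv ι z :=
    (ConeProblem.periodic_vline hper' z.re).map_fract_one z.im
  rw [FormAt, h1, h2] at h
  exact h

lemma formAt_a {ψ ι : ℂ → ℂ} (hd : DifferentiableOn ℂ ψ {z | 0 < z.im ∧ z.im < 1})
    (hpull : ∀ z : ℂ, G.δ ≤ z.im → z.im ≤ 1 - G.δ → ∀ v : ℂ, G.β (ψ z) (deriv ψ z * v) = v.im)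
    (hΩ : ∀ z : ℂ, (0 < z.im ∧ z.im < 1) → ¬(G.δ ≤ z.im ∧ z.im ≤ 1 - G.δ) → ψ z ∈ G.Omega)
    (hper : ∀ z, ι (z + Complex.I) = ι z) (hι : DifferentiableOn ℂ ι {z | z.re ≤ 0})
    (hmaps : ∀ z : ℂ, z.re ≤ 0 → ι z ∈ G.P) {c : ℝ}
    (heq : ∀ s t : ℝ, s ≤ 0 → t ∈ Ioo (0 : ℝ) 1 → ι ⟨s, t⟩ = ψ ⟨s - c, t⟩) {z : ℂ}
    (hz : z.re < 0) : D.FormAt ι 1 z := by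
  refine .of_fract hper ?_
  have hre : {w : ℂ | w.re < 0} ∈ 𝓝 (⟨z.re, Int.fract z.im⟩ : ℂ) :=
    (isOpen_lt Complex.continuous_re continuous_const).mem_nhds hz
  rcases (Int.fract_nonneg z.im).eq_or_lt with h0 | h0
  · refine .of_limit ((hι.differentiableAt (mem_of_superset hre fun w hw ↦
      le_of_lt (show w.re < 0 from hw))).continuousAt) (hmaps _ hz.le) G.δ_pos fun τ hτ ↦ ?_
    have hτ1 : 0 < τ ∧ τ < 1 := ⟨hτ.1, by linarith [hτ.2, G.δ_lt]⟩
    simp only [← h0, zero_add]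
    rw [heq _ _ hz.le hτ1]
    exact hΩ _ hτ1 fun h ↦ absurd h.1 (not_le.mpr hτ.2)
  · have h1 := Int.fract_lt_one z.im
    refine .of_strip hd hpull hΩ (c := -(c : ℂ)) ?_ (by simpa using ⟨h0, h1⟩)
    filter_upwards [hre, isOpen_strip.mem_nhds
      (show (⟨z.re, Int.fract z.im⟩ : ℂ) ∈ {z : ℂ | 0 < z.im ∧ z.im < 1} from ⟨h0, h1⟩)]
      with w hw hw'
    refine (heq w.re w.im (le_of_lt hw) hw').trans (congrArg ψ ?_)
    apply Complex.ext <;> simp [sub_eq_add_neg]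

lemma formAt_a₁ {z : ℂ} (hz : z.re < 0) : D.FormAt G.ιa₁ 1 z :=
  formAt_a G.holo_ψ₁ G.pullback_β₁ (fun _ ↦ G.ψ₁_mem_Omega) G.periodic_ιa₁ G.holo_ιa₁ G.maps_ιa₁
    G.ιa₁_eq hz

lemma formAt_a₂ {z : ℂ} (hz : z.re < 0) : D.FormAt G.ιa₂ 1 z :=
  formAt_a G.holo_ψ₂ G.pullback_β₂ (fun _ ↦ G.ψ₂_mem_Omega) G.periodic_ιa₂ G.holo_ιa₂ G.maps_ιa₂
    G.ιa₂_eq hz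

lemma ιb_eq_ψ₁ {w : ℂ} (h : 0 ≤ w.re) (h0 : 0 < w.im) (h1 : w.im < 1 / 2) :
    G.ιb w = G.ψ₁ ((2 : ℝ) * w + G.sb) := by
  have := G.ιb_eq₁ (2 * w.re) (2 * w.im) (by linarith) ⟨by linarith, by linarith⟩
  rw [mul_div_cancel_left₀ _ two_ne_zero, mul_div_cancel_left₀ _ two_ne_zero] at this
  refine this.trans (congrArg G.ψ₁ ?_)
  apply Complex.ext <;> simp

lemma ιb_eq_ψ₂ {w : ℂ} (h : 0 ≤ w.re) (h0 : 1 / 2 < w.im) (h1 : w.im < 1) :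
    G.ιb w = G.ψ₂ ((2 : ℝ) * w + (G.sb - Complex.I)) := by
  have := G.ιb_eq₂ (2 * w.re) (2 * w.im - 1) (by linarith) ⟨by linarith, by linarith⟩
  rw [mul_div_cancel_left₀ _ two_ne_zero, sub_add_cancel,
    mul_div_cancel_left₀ _ two_ne_zero] at this
  refine this.trans (congrArg G.ψ₂ ?_)
  apply Complex.ext <;> simp [sub_eq_add_neg]

/-- The circle at b has two strips of length 1/2, covering 0 < t < 1/2 and 1/2 < t < 1, and two
joining lines t = 0 and t = 1/2. The dilation by 2 in the coordinates makes m = 2. -/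
lemma formAt_b {z : ℂ} (hz : 0 < z.re) : D.FormAt G.ιb 2 z := by
  refine .of_fract G.periodic_ιb ?_
  have hδ := G.δ_pos
  have hδ' := G.δ_lt
  have h0' := Int.fract_nonneg z.im
  have h1 := Int.fract_lt_one z.im
  generalize Int.fract z.im = t at *
  have hre : {w : ℂ | 0 < w.re} ∈ 𝓝 (⟨z.re, t⟩ : ℂ) :=
    (isOpen_lt continuous_const Complex.continuous_re).mem_nhds hz
  have hcont : ContinuousAt G.ιb ⟨z.re, t⟩ :=
    (G.holo_ιb.differentiableAt (mem_of_superset hre fun w hw ↦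
      le_of_lt (show 0 < w.re from hw))).continuousAt
  have him : ∀ a b : ℝ, a < t → t < b → {w : ℂ | a < w.im ∧ w.im < b} ∈ 𝓝 (⟨z.re, t⟩ : ℂ) :=
    fun a b ha hb ↦ ((isOpen_lt continuous_const Complex.continuous_im).inter
      (isOpen_lt Complex.continuous_im continuous_const)).mem_nhds ⟨ha, hb⟩
  rcases h0'.eq_or_lt with h0 | h0
  · refine .of_limit hcont (G.maps_ιb _ hz.le) (ε := G.δ / 2) (by positivity) fun τ hτ ↦ ?_
    have hτ2 := hτ.2
    have hτ1 := hτ.1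
    simp only [← h0, zero_add]
    rw [ιb_eq_ψ₁ (w := ⟨z.re, τ⟩) hz.le hτ1 (show τ < 1 / 2 by linarith)]
    refine G.ψ₁_mem_Omega ?_ ?_
    · simp; constructor <;> linarith
    · simp; intro h; linarith
  rcases lt_trichotomy t (1 / 2) with ht | ht | ht
  · refine .of_strip G.holo_ψ₁ G.pullback_β₁ (fun _ ↦ G.ψ₁_mem_Omega) (c := G.sb) ?_ ?_
    · filter_upwards [hre, him 0 (1 / 2) h0 ht] with w hw hw'
      exact ιb_eq_ψ₁ (le_of_lt hw) hw'.1 hw'.2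
    · simp; constructor <;> linarith
  · refine .of_limit hcont (G.maps_ιb _ hz.le) (ε := G.δ / 2) (by positivity) fun τ hτ ↦ ?_
    have hτ2 := hτ.2
    have hτ1 := hτ.1
    rw [ιb_eq_ψ₂ (w := ⟨z.re, t + τ⟩) hz.le (show 1 / 2 < t + τ by linarith) (show t + τ < 1 by linarith)]
    refine G.ψ₂_mem_Omega ?_ ?_
    · simp; constructor <;> linarith
    · simp; intro h; linarith
  · refine .of_strip G.holo_ψ₂ G.pullback_β₂ (fun _ ↦ G.ψ₂_mem_Omega)
      (c := G.sb - Complex.I) ?_ ?_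
    · filter_upwards [hre, him (1 / 2) 1 ht h1] with w hw hw'
      exact ιb_eq_ψ₂ (le_of_lt hw) hw'.1 hw'.2
    · simp; constructor <;> linarith

/-- Both Hamiltonians are affine in r for large r, and the coefficients of r are compared. The
additive constant of the Floer data disappears. -/
lemma h_eq_slope {Da : FloerData L} {p : ℂ} (hp : p ∈ G.P) {k t : ℝ}
    (hH : ∀ x, D.H x p = k * Da.H t x) (y : M) : D.h y p = k * Da.slope t y := by
  obtain ⟨T₁, hT₁, h₁⟩ := D.conical_H
  obtain ⟨T₂, hT₂, C, h₂⟩ := Da.conical_H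
  refine eq_of_forall_mul_eq (C := k * C) (R := max T₁ T₂) (lt_max_of_lt_left hT₁) fun r hr ↦ ?_
  rw [← h₁ y r ((le_max_left _ _).trans hr) p hp, hH, h₂ t y r ((le_max_right _ _).trans hr)]
  ring

end ProductData
end EndForms

/-! ### Bounds on the ends and on the core -/

section Assembly

variable {E : Type*} [NormedAddCommGroup E] [NormedSpace ℝ E] [FiniteDimensional ℝ E]
  {X : Type*} [TopologicalSpace X] [T2Space X] [ChartedSpace E X] [IsManifold 𝓘(ℝ, E) ∞ X]
  {F : Type*} [NormedAddCommGroup F] [NormedSpace ℝ F] [FiniteDimensional ℝ F]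
  {M : Type*} [TopologicalSpace M] [T2Space M] [CompactSpace M] [ChartedSpace F M]
  [IsManifold 𝓘(ℝ, F) ∞ M]

namespace ProductData

variable {L : LiouvilleCompletion E X F M} {G : PantsWithSlit} {Da₁ Da₂ Db : FloerData L}
  {D : ProductData L G Da₁ Da₂ Db}

/-- Solutions of bounded energy are bounded on an end, uniformly over the end. -/
lemma exists_bound_on_end {T : ℝ} (hT : 1 ≤ T)
    (hJ : ∀ p ∈ G.P, L.IsTwistedSFTAtInfinity T (D.J p)) {Da : FloerData L}
    (hJa : ∀ t, L.IsTwistedSFTAtInfinity T (Da.J t)) {I : ℝ} (hI : 0 ≤ I) {ι : ℂ → ℂ} {m k : ℝ}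
    (hmk : m * k = 1) (hper : ∀ z, ι (z + Complex.I) = ι z) {dom : Set ℂ}
    (hdiff : ∀ z ∈ dom, DifferentiableAt ℂ ι z) (hmaps : ∀ z ∈ dom, ι z ∈ G.P)
    (hinj : ∀ z ∈ dom, ∀ w ∈ dom, ι z = ι w → ∃ n : ℤ, z = w + n * Complex.I)
    (hform : ∀ z ∈ dom, D.FormAt ι m z)
    (hHι : ∀ z ∈ dom, ∀ x, D.H x (ι z) = k * Da.H z.im x)
    (hJι : ∀ z ∈ dom, D.J (ι z) = Da.J z.im) :
    ∃ R : ℝ, ∀ c : ℝ, (∀ z : ℂ, |z.re| < 1 → z + c ∈ dom) → ∀ (u : ℂ → X) (e : ℂ → ℝ),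
      (D.problem hT hJ).IsSol u e →
      ∫⁻ p in G.P, ENNReal.ofReal (e p) ≤ ENNReal.ofReal I →
      ∀ t y r, T < r → u (ι ⟨c, t⟩) = L.cone (y, r) → r ≤ R := by
  -- The bound is taken once, for the problem on |Re z| < 1. In the coordinates of the end the
  -- equation does not depend on s, so every translate by c is a solution of this same problem.
  obtain ⟨R, hR⟩ := ConeProblem.exists_end_bound (Q := Da.problem hT hJa) (fun z ↦ Iff.rfl)
    (fun z ↦ by
      show Da.J (z + Complex.I).im = Da.J z.im
      rw [Complex.add_im, Complex.I_im, Da.periodic_J])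
    (slope := Da.slope) (fun s t _ y ↦ rfl) Da.admissible hI
  refine ⟨R, fun c hc u e hu hint t y r hr hut ↦ ?_⟩
  set φ : ℂ → ℂ := fun z ↦ ι (z + c) with hφ
  have hd : ∀ z, deriv φ z = deriv ι (z + c) := fun z ↦ deriv_comp_add_const ι (c : ℂ) z
  have hlin : ∀ p v : ℂ, G.β p v = v.re * G.β p 1 + v.im * G.β p Complex.I := by
    intro p v
    have h1 : v = v.re • (1 : ℂ) + v.im • Complex.I := by apply Complex.ext <;> simp
    conv_lhs => rw [h1]
    rw [map_add, map_smul, map_smul, smul_eq_mul, smul_eq_mul]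
  have hφd : ∀ z : ℂ, |z.re| < 1 → DifferentiableAt ℂ φ z := fun z hz ↦
    DifferentiableAt.comp (f := fun z : ℂ ↦ z + c) z (hdiff _ (hc z hz))
      (differentiableAt_id.add_const _)
  have hsol := hu.comp (Q' := Da.problem hT hJa) (φ := φ)
    (fun z hz ↦ (hφd z hz).differentiableWithinAt)
    (fun z hz ↦ hmaps _ (hc z hz)) rfl
    (fun z hz ↦ by
      show Da.J z.im = D.J (ι (z + c))
      rw [hJι _ (hc z hz), Complex.add_im, Complex.ofReal_im, add_zero])
    (fun z hz y ↦ by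
      show 0 = (deriv φ z).re * (D.h y (φ z) * G.β (φ z) 1)
        + (deriv φ z).im * (D.h y (φ z) * G.β (φ z) Complex.I)
      have h1 := hform _ (hc z hz) y 1
      rw [mul_one, Complex.one_im, mul_zero, zero_mul, ← hd, hlin] at h1
      linarith)
    (fun z hz y ↦ by
      show Da.slope z.im y = -(deriv φ z).im * (D.h y (φ z) * G.β (φ z) 1)
        + (deriv φ z).re * (D.h y (φ z) * G.β (φ z) Complex.I)
      have h1 := hform _ (hc z hz) y Complex.I
      have h2 := D.h_eq_slope (hmaps _ (hc z hz)) (hHι _ (hc z hz)) y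
      rw [← hd, hlin, h2, Complex.add_im, Complex.ofReal_im, add_zero] at h1
      simp only [Complex.mul_re, Complex.mul_im, Complex.I_re, Complex.I_im, mul_zero, mul_one,
        zero_sub, add_zero] at h1
      have h3 : D.h y (φ z) = k * Da.slope z.im y := by
        rw [hφ, h2, Complex.add_im, Complex.ofReal_im, add_zero]
      rw [h3]
      -- The factor m from the pull-back of β and the factor k from the Hamiltonian cancel: 1 · 1 at
      -- the inputs, 2 · 1/2 at the output.
      linear_combination -h1 - Da.slope z.im y * hmk)
  refine hR (u ∘ φ) _ hsol (fun z ↦ ?_) (fun z ↦ ?_) ?_ t y r hr ?_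
  · simp only [Function.comp_apply, hφ, add_right_comm z Complex.I, hper]
  · have hper' : ∀ z, deriv ι (z + Complex.I) = deriv ι z := fun z ↦ by
      rw [← deriv_comp_add_const]
      simp only [hper]
    show Complex.normSq (deriv φ (z + Complex.I)) * e (ι (z + Complex.I + c))
      = Complex.normSq (deriv φ z) * e (ι (z + c))
    rw [hd, hd, add_right_comm z Complex.I, hper, hper']
  · refine (lintegral_normSq_deriv_mul_le (U := G.P) ?_ (fun z hz ↦ hφd z (abs_lt.mpr hz.1)) ?_
      (fun z hz ↦ hmaps _ (hc z (abs_lt.mpr hz.1))) e).trans hint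
    · exact (isOpen_Ioo.reProdIm isOpen_Ioo).measurableSet
    · intro z hz w hw hzw
      obtain ⟨n, hn⟩ := hinj _ (hc z (abs_lt.mpr hz.1)) _ (hc w (abs_lt.mpr hw.1)) hzw
      have h1 := congrArg Complex.im hn
      simp at h1
      have h2 : (-1 : ℝ) < n := by linarith [hz.2.1, hw.2.2]
      have h3 : (n : ℝ) < 1 := by linarith [hz.2.2, hw.2.1]
      have h4 : n = 0 := by
        have h5 : -1 < n := by exact_mod_cast h2
        have h6 : n < 1 := by exact_mod_cast h3
        omega
      rw [h4, Int.cast_zero, zero_mul, add_zero] at hn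
      exact add_right_cancel hn
  · refine Eq.trans (congrArg u (congrArg ι ?_)) hut
    apply Complex.ext <;> simp

theorem exists_isCompact_image_subset (D : ProductData L G Da₁ Da₂ Db) {I : ℝ} (hI : 0 < I) :
    ∃ K : Set X, IsCompact K ∧
      ∀ u : ℂ → X, D.IsSolution u → D.energy u < ENNReal.ofReal I → u '' G.P ⊆ K := by
  obtain ⟨T₁, -, hH⟩ := D.conical_H
  obtain ⟨T₂, -, hJ⟩ := D.conical_J
  obtain ⟨T₃, -, hJ₁⟩ := Da₁.conical_J
  obtain ⟨T₄, -, hJ₂⟩ := Da₂.conical_J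
  obtain ⟨T₅, -, hJb⟩ := Db.conical_J
  -- One level beyond which all the data are conical, and at least 1 so that the energy density
  -- dominates `Om`.
  obtain ⟨T, h1, hT₁, hT₂, hT₃, hT₄, hT₅⟩ :
      ∃ T : ℝ, 1 ≤ T ∧ T₁ ≤ T ∧ T₂ ≤ T ∧ T₃ ≤ T ∧ T₄ ≤ T ∧ T₅ ≤ T := by
    refine ⟨max 1 (max T₁ (max T₂ (max T₃ (max T₄ T₅)))), ?_⟩
    simp
  replace hJ : ∀ p ∈ G.P, L.IsTwistedSFTAtInfinity T (D.J p) := fun p hp ↦ (hJ p hp).mono hT₂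
  have hopen : ∀ {z : ℂ}, z.re < 0 → {w : ℂ | w.re ≤ 0} ∈ 𝓝 z := fun {z} hz ↦
    mem_of_superset ((isOpen_lt Complex.continuous_re continuous_const).mem_nhds hz)
      fun w hw ↦ le_of_lt (show w.re < 0 from hw)
  have hopen' : ∀ {z : ℂ}, 0 < z.re → {w : ℂ | 0 ≤ w.re} ∈ 𝓝 z := fun {z} hz ↦
    mem_of_superset ((isOpen_lt continuous_const Complex.continuous_re).mem_nhds hz)
      fun w hw ↦ le_of_lt (show 0 < w.re from hw)
  obtain ⟨R₁, hR₁⟩ := exists_bound_on_end (D := D) h1 hJ (fun t ↦ (hJ₁ t).mono hT₃) hI.le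
    (mul_one 1) G.periodic_ιa₁ (dom := {z | z.re < -1})
    (fun z (hz : z.re < -1) ↦ G.holo_ιa₁.differentiableAt (hopen (by linarith)))
    (fun z (hz : z.re < -1) ↦ G.maps_ιa₁ z (by linarith))
    (fun z (hz : z.re < -1) w (hw : w.re < -1) ↦ G.inj_ιa₁ z w (by linarith) (by linarith))
    (fun z (hz : z.re < -1) ↦ formAt_a₁ (by linarith))
    (fun z (hz : z.re < -1) x ↦ by rw [one_mul]; exact D.H_a₁ x z.re z.im hz.le)
    (fun z (hz : z.re < -1) ↦ D.J_a₁ z.re z.im hz.le)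
  obtain ⟨R₂, hR₂⟩ := exists_bound_on_end (D := D) h1 hJ (fun t ↦ (hJ₂ t).mono hT₄) hI.le
    (mul_one 1) G.periodic_ιa₂ (dom := {z | z.re < -1})
    (fun z (hz : z.re < -1) ↦ G.holo_ιa₂.differentiableAt (hopen (by linarith)))
    (fun z (hz : z.re < -1) ↦ G.maps_ιa₂ z (by linarith))
    (fun z (hz : z.re < -1) w (hw : w.re < -1) ↦ G.inj_ιa₂ z w (by linarith) (by linarith))
    (fun z (hz : z.re < -1) ↦ formAt_a₂ (by linarith))
    (fun z (hz : z.re < -1) x ↦ by rw [one_mul]; exact D.H_a₂ x z.re z.im hz.le)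
    (fun z (hz : z.re < -1) ↦ D.J_a₂ z.re z.im hz.le)
  obtain ⟨R₃, hR₃⟩ := exists_bound_on_end (D := D) h1 hJ (fun t ↦ (hJb t).mono hT₅) hI.le
    (show (2 : ℝ) * (1 / 2) = 1 by norm_num) G.periodic_ιb (dom := {z | 1 < z.re})
    (fun z (hz : 1 < z.re) ↦ G.holo_ιb.differentiableAt (hopen' (by linarith)))
    (fun z (hz : 1 < z.re) ↦ G.maps_ιb z (by linarith))
    (fun z (hz : 1 < z.re) w (hw : 1 < w.re) ↦ G.inj_ιb z w (by linarith) (by linarith))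
    (fun z (hz : 1 < z.re) ↦ formAt_b (by linarith))
    (fun z (hz : 1 < z.re) x ↦ D.H_b x z.re z.im hz.le)
    (fun z (hz : 1 < z.re) ↦ D.J_b z.re z.im hz.le)
  have hleft : ∀ c : ℝ, c < -2 → ∀ z : ℂ, |z.re| < 1 → z + c ∈ {z : ℂ | z.re < -1} :=
    fun c hc z hz ↦ by
      show (z + c).re < -1
      rw [Complex.add_re, Complex.ofReal_re]
      linarith [(abs_lt.mp hz).2]
  have hright : ∀ c : ℝ, 2 < c → ∀ z : ℂ, |z.re| < 1 → z + c ∈ {z : ℂ | 1 < z.re} :=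
    fun c hc z hz ↦ by
      show 1 < (z + c).re
      rw [Complex.add_re, Complex.ofReal_re]
      linarith [(abs_lt.mp hz).1]
  set Q := D.problem h1 hJ with hQ
  obtain ⟨K, hK, hKP, hcover⟩ := G.exists_compact_core 2
  -- Propagation starts from a point near a₁: a whole neighbourhood of it lies in the end at a₁,
  -- where R₁ already bounds r.
  obtain ⟨R₀, hR₀⟩ : Q.BoundedOn I K := by
    obtain ⟨V, hV, hVo, hVa⟩ := mem_nhds_iff.mp (mem_nhdsWithin_iff_eventually.mp
      (G.image_ιa₁_mem (-2)))
    have hne : ({G.a₂}ᶜ : Set ℂ) ∈ 𝓝[≠] G.a₁ :=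
      mem_nhdsWithin_of_mem_nhds (isOpen_compl_singleton.mem_nhds G.ne)
    obtain ⟨p, ⟨hpV, hp2⟩, hp1⟩ := Filter.nonempty_of_mem
      (Filter.inter_mem (Filter.inter_mem (mem_nhdsWithin_of_mem_nhds (hVo.mem_nhds hVa)) hne)
        (self_mem_nhdsWithin (a := G.a₁)))
    have hpP : p ∈ G.P := by
      rintro (h | h)
      · exact hp1 h
      · exact hp2 h
    refine ConeProblem.boundedOn_of_isCompact hI.le G.isPreconnected_P hpP
      ⟨V ∩ G.P, (hVo.inter G.isOpen_P).mem_nhds ⟨hpV, hpP⟩, R₁, ?_⟩ hK hKP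
    rintro u e hu hint z ⟨hzV, hzP⟩ y r hr huz
    obtain ⟨w, hw, rfl⟩ := hV hzV (fun h ↦ hzP (by rw [h]; exact mem_insert _ _))
    exact hR₁ w.re (hleft _ hw) u e hu hint w.im y r hr huz
  set R := max 1 (max T (max R₀ (max R₁ (max R₂ R₃)))) with hR
  refine ⟨_, L.isCompact_compl_end (R := R) (le_max_left _ _), ?_⟩
  rintro u hu henergy _ ⟨p, hp, rfl⟩ ⟨⟨y, r⟩, ⟨-, hr : R < r⟩, hup⟩
  have hsol := hu.isSol h1 hJ fun y r hr ↦ hH y r (hT₁.trans hr)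
  have hint : ∫⁻ p in G.P, ENNReal.ofReal (D.density u p) ≤ ENNReal.ofReal I :=
    (hu.energy_eq.symm.trans_lt henergy).le
  simp only [hR, max_lt_iff] at hr
  obtain ⟨-, hrT, hr₀, hr₁, hr₂, hr₃⟩ := hr
  rcases hcover p hp with hpK | ⟨z, hz, rfl⟩ | ⟨z, hz, rfl⟩ | ⟨z, hz, rfl⟩
  · exact absurd (hR₀ u _ hsol hint p hpK y r hrT hup.symm) (not_le.mpr hr₀)
  · exact absurd (hR₁ z.re (hleft _ hz) u _ hsol hint z.im y r hrT hup.symm) (not_le.mpr hr₁)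
  · exact absurd (hR₂ z.re (hleft _ hz) u _ hsol hint z.im y r hrT hup.symm) (not_le.mpr hr₂)
  · exact absurd (hR₃ z.re (hright _ hz) u _ hsol hint z.im y r hrT hup.symm) (not_le.mpr hr₃)

end ProductData
end Assembly

end PantsFloer

end

theorem mainTheorem11
    {E : Type*} [NormedAddCommGroup E] [NormedSpace ℝ E] [FiniteDimensional ℝ E]
    {X : Type*} [TopologicalSpace X] [T2Space X] [ChartedSpace E X] [IsManifold 𝓘(ℝ, E) ∞ X]
    {F : Type*} [NormedAddCommGroup F] [NormedSpace ℝ F] [FiniteDimensional ℝ F]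
    {M : Type*} [TopologicalSpace M] [T2Space M] [CompactSpace M] [ChartedSpace F M]
    [IsManifold 𝓘(ℝ, F) ∞ M]
    (L : PantsFloer.LiouvilleCompletion E X F M) (G : PantsFloer.PantsWithSlit)
    (Da₁ Da₂ Db : PantsFloer.FloerData L) (D : PantsFloer.ProductData L G Da₁ Da₂ Db)
    (bound : ℝ) (hbound : 0 < bound) :
    ∃ K : Set X, IsCompact K ∧
      ∀ u : ℂ → X, D.IsSolution u → D.energy u < ENNReal.ofReal bound → u '' G.P ⊆ K := by
  exact D.exists_isCompact_image_subset hbound
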